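/- **Elimination of the constraint and the reduced conformal Ricci flow equation.** Let $M$ be a smooth closed (compact, without boundary) connected $n$-manifold, $n\ge 3$. Let $\mathcal F=C^\infty(M,\mathbb R)$, let $\mathcal M$ be the space of smooth Riemannian metrics on $M$, and let $\mathcal M_{-1}=\{g\in\mathcal M : R(g)=-1\}$, where $R(g)$ is the scalar curvature. Let $\mathrm{Ric}(g)$ be the Ricci tensor, $|\mathrm{Ric}(g)|_g^2=g^{ik}g^{jl}R_{ij}R_{kl}$, let $\Delta_g\varphi=-g^{ij}\nabla_i\nabla_j\varphi$ be the (positive) Laplacian, and let $L_g=(n-1)\Delta_g+1$. Let $0<T\le\infty$ and let $g:[0,T)\to\mathcal M$ be a smooth curve (one-sidedly at $0$) with $g(0)=g_0\in\mathcal M_{-1}$. Then: 1. For every $t\in[0,T)$ the operator $L_{g(t)}$ is elliptic and is a bijection $\mathcal F\to\mathcal F$, with inverse $L_{g(t)}^{-1}:\mathcal F\to\mathcal F$. 2. The curve $g$ is a solution on $[0,T)$ of the reduced conformal Ricci flow equation $$\frac{\partial g}{\partial t}+2\,\mathrm{Ric}(g)=-2\big(L_g^{-1}(|\mathrm{Ric}(g)|_g^2)\big)\,g$$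 if and only if $g$ is a solution on $[0,T)$ of the conformal Ricci flow equations $$\frac{\partial g}{\partial t}+2\Big(\mathrm{Ric}(g)+\tfrac1n g\Big)=-p\,g,\qquad R(g)=-1,$$ with conformal pressure $p=2L_g^{-1}(|\mathrm{Ric}(g)|_g^2)-\tfrac2n$, which is in particular required to be a smooth curve $p:[0,T)\to\mathcal F$. -/

import Mathlib

open scoped Manifold ContDiff Bundle

noncomputable section

namespace ConformalRicci

/-! ### Local coordinate formulas

`G : ℝⁿ → Matrix` is the matrix `(g_ij)` of a metric in a coordinate chart, as a function of the
coordinates. -/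

section Coordinates

variable {n : ℕ}

/-- The `k`-th partial derivative of a real function on `ℝⁿ`. -/
def pd (k : Fin n) (f : EuclideanSpace ℝ (Fin n) → ℝ) (z : EuclideanSpace ℝ (Fin n)) : ℝ :=
  fderiv ℝ f z (EuclideanSpace.single k 1)

/-- Christoffel symbols
`Γ^k_ij = 1/2 g^{kl} (∂_i g_jl + ∂_j g_il - ∂_l g_ij)`. -/
def christoffel (G : EuclideanSpace ℝ (Fin n) → Matrix (Fin n) (Fin n) ℝ) (k i j : Fin n)
    (z : EuclideanSpace ℝ (Fin n)) : ℝ :=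
  (1 / 2 : ℝ) * ∑ l, (G z)⁻¹ k l *
    (pd i (fun y => G y j l) z + pd j (fun y => G y i l) z - pd l (fun y => G y i j) z)

/-- Riemann curvature `R^a_{bcd}`, the `∂_a`-component of
`∇_c ∇_d ∂_b - ∇_d ∇_c ∂_b`. -/
def riemannCoord (G : EuclideanSpace ℝ (Fin n) → Matrix (Fin n) (Fin n) ℝ) (a b c d : Fin n)
    (z : EuclideanSpace ℝ (Fin n)) : ℝ :=
  pd c (christoffel G a d b) z - pd d (christoffel G a c b) z
    + ∑ e, (christoffel G a c e z * christoffel G e d b z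
        - christoffel G a d e z * christoffel G e c b z)

/-- Ricci curvature `R_ij = R^a_{iaj}`. -/
def ricciCoord (G : EuclideanSpace ℝ (Fin n) → Matrix (Fin n) (Fin n) ℝ) (i j : Fin n)
    (z : EuclideanSpace ℝ (Fin n)) : ℝ :=
  ∑ a, riemannCoord G a i a j z

/-- Scalar curvature `g^{ij} R_ij`. -/
def scalarCoord (G : EuclideanSpace ℝ (Fin n) → Matrix (Fin n) (Fin n) ℝ)
    (z : EuclideanSpace ℝ (Fin n)) : ℝ :=
  ∑ i, ∑ j, (G z)⁻¹ i j * ricciCoord G i j z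

/-- Squared norm of the Ricci tensor, `g^{ik} g^{jl} R_ij R_kl`. -/
def ricciNormSqCoord (G : EuclideanSpace ℝ (Fin n) → Matrix (Fin n) (Fin n) ℝ)
    (z : EuclideanSpace ℝ (Fin n)) : ℝ :=
  ∑ i, ∑ j, ∑ k, ∑ l,
    (G z)⁻¹ i k * (G z)⁻¹ j l * ricciCoord G i j z * ricciCoord G k l z

/-- The positive Laplacian `-g^{ij} (∂_i ∂_j f - Γ^k_ij ∂_k f)`. -/
def laplacianCoord (G : EuclideanSpace ℝ (Fin n) → Matrix (Fin n) (Fin n) ℝ)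
    (f : EuclideanSpace ℝ (Fin n) → ℝ) (z : EuclideanSpace ℝ (Fin n)) : ℝ :=
  -∑ i, ∑ j, (G z)⁻¹ i j * (pd i (pd j f) z - ∑ k, christoffel G k i j z * pd k f z)

end Coordinates

/-! ### Geometry of a Riemannian metric -/

section Manifold

variable (n : ℕ) (M : Type*) [TopologicalSpace M] [ChartedSpace (EuclideanSpace ℝ (Fin n)) M]
  [IsManifold (𝓡 n) ∞ M]

/-- The space of smooth Riemannian metrics on the `n`-manifold `M`. -/
abbrev Metric : Type _ :=
  Bundle.ContMDiffRiemannianMetric (𝓡 n) ∞ (EuclideanSpace ℝ (Fin n))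
    (fun x : M => TangentSpace (𝓡 n) x)

/-- The space of smooth real-valued functions on `M`. -/
def smoothFunctions : Set (M → ℝ) :=
  {f | ContMDiff (𝓡 n) 𝓘(ℝ, ℝ) ∞ f}

variable {n M}

/-- The coefficient matrix `g_ij` of `g` in the preferred chart at `c`, i.e. the matrix of the
pullback of `g` under the inverse of that chart. -/
def metricCoord (g : Metric n M) (c : M) (z : EuclideanSpace ℝ (Fin n)) :
    Matrix (Fin n) (Fin n) ℝ :=
  fun i j => g.inner ((extChartAt (𝓡 n) c).symm z)
    (mfderiv 𝓘(ℝ, EuclideanSpace ℝ (Fin n)) (𝓡 n) (extChartAt (𝓡 n) c).symm z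
      (EuclideanSpace.single i (1 : ℝ)))
    (mfderiv 𝓘(ℝ, EuclideanSpace ℝ (Fin n)) (𝓡 n) (extChartAt (𝓡 n) c).symm z
      (EuclideanSpace.single j (1 : ℝ)))

/-- Components at `x` of the tangent vector `v`, in the coordinate basis of the preferred chart
at `x`. In Mathlib `TangentSpace (𝓡 n) x` is the model space `ℝⁿ`, a vector of which stands
for the tangent vector with these components in the preferred chart at `x`. -/
def tangentCoord {x : M} (v : TangentSpace (𝓡 n) x) (i : Fin n) : ℝ :=
  (show EuclideanSpace ℝ (Fin n) from v) i

/-- The Ricci tensor of `g` at `x`, a bilinear form on the tangent space at `x`. -/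
def ricci (g : Metric n M) (x : M) (v w : TangentSpace (𝓡 n) x) : ℝ :=
  ∑ i, ∑ j, ricciCoord (metricCoord g x) i j (extChartAt (𝓡 n) x x)
    * tangentCoord v i * tangentCoord w j

/-- The scalar curvature `R(g)`. -/
def scalarCurvature (g : Metric n M) (x : M) : ℝ :=
  scalarCoord (metricCoord g x) (extChartAt (𝓡 n) x x)

/-- The function `|Ric(g)|²_g`. -/
def ricciNormSq (g : Metric n M) (x : M) : ℝ :=
  ricciNormSqCoord (metricCoord g x) (extChartAt (𝓡 n) x x)

/-- The Laplacian `Δ_g` on functions, with the sign that makes it a positive operator. -/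
def laplacian (g : Metric n M) (f : M → ℝ) (x : M) : ℝ :=
  laplacianCoord (metricCoord g x) (f ∘ (extChartAt (𝓡 n) x).symm) (extChartAt (𝓡 n) x x)

/-- The operator `L_g = (n - 1) Δ_g + 1`. -/
def conformalOp (g : Metric n M) (f : M → ℝ) (x : M) : ℝ :=
  ((n : ℝ) - 1) * laplacian g f x + f x

/-- The inverse `L_g⁻¹` of `L_g` on the space of smooth functions. -/
def conformalOpInv (g : Metric n M) : (M → ℝ) → (M → ℝ) :=
  Function.invFunOn (conformalOp g) (smoothFunctions n M)

variable (n) in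
/-- Ellipticity of a scalar linear differential operator `P` of order two: its principal symbol
does not vanish on non-zero covectors. The symbol at the covector `dψ(x)` is, up to a universal
sign, the value at `x` of `P` applied to `(ψ - ψ(x))² / 2`. -/
def IsEllipticOrderTwo (P : (M → ℝ) → (M → ℝ)) : Prop :=
  ∀ (x : M) (ψ : M → ℝ), ψ ∈ smoothFunctions n M → mfderiv (𝓡 n) 𝓘(ℝ, ℝ) ψ x ≠ 0 →
    P (fun y => (ψ y - ψ x) ^ 2 / 2) x ≠ 0

/-- The space of Riemannian metrics with constant scalar curvature `-1`. -/
def metricsNegOne (n : ℕ) (M : Type*) [TopologicalSpace M]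
    [ChartedSpace (EuclideanSpace ℝ (Fin n)) M] [IsManifold (𝓡 n) ∞ M] : Set (Metric n M) :=
  {g | ∀ x, scalarCurvature g x = -1}

/-! ### Flows -/

/-- The interval `[0, T)`, where `T ≤ ∞`. -/
def timeInterval (T : EReal) : Set ℝ := {t | 0 ≤ t ∧ (t : EReal) < T}

/-- `g` is smooth on `[0, T)` (one-sidedly at `0`) as a curve of Riemannian metrics, i.e. `g` is
smooth in `(t, x)` on `[0, T) × M`. The values of `g` outside `[0, T)` play no role. -/
def IsSmoothMetricCurve (T : EReal) (g : ℝ → Metric n M) : Prop :=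
  ContMDiffOn (𝓘(ℝ, ℝ).prod (𝓡 n))
    ((𝓡 n).prod 𝓘(ℝ, EuclideanSpace ℝ (Fin n) →L[ℝ] EuclideanSpace ℝ (Fin n) →L[ℝ] ℝ)) ∞
    (fun q : ℝ × M => Bundle.TotalSpace.mk'
      (EuclideanSpace ℝ (Fin n) →L[ℝ] EuclideanSpace ℝ (Fin n) →L[ℝ] ℝ)
      (E := fun x : M => TangentSpace (𝓡 n) x →L[ℝ] TangentSpace (𝓡 n) x →L[ℝ] ℝ)
      q.2 ((g q.1).inner q.2))
    (timeInterval T ×ˢ Set.univ)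

variable (n) in
/-- `p` is smooth on `[0, T)` as a curve of smooth functions. -/
def IsSmoothFunctionCurve (T : EReal) (p : ℝ → M → ℝ) : Prop :=
  ContMDiffOn (𝓘(ℝ, ℝ).prod (𝓡 n)) 𝓘(ℝ, ℝ) ∞ (fun q : ℝ × M => p q.1 q.2)
    (timeInterval T ×ˢ Set.univ)

/-- `∂g/∂t = h` on `[0, T)`, for a curve `h` of bilinear forms on the tangent spaces; at `t = 0`
the derivative is one-sided. -/
def HasTimeDeriv (T : EReal) (g : ℝ → Metric n M)
    (h : ℝ → ∀ x : M, TangentSpace (𝓡 n) x → TangentSpace (𝓡 n) x → ℝ) : Prop :=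
  ∀ t ∈ timeInterval T, ∀ (x : M) (v w : TangentSpace (𝓡 n) x),
    HasDerivWithinAt (fun s => (g s).inner x v w) (h t x v w) (timeInterval T) t

/-- The reduced conformal Ricci flow equation
`∂g/∂t + 2 Ric(g) = -2 (L_g⁻¹ |Ric(g)|²) g` on `[0, T)`. -/
def SolvesReducedFlow (T : EReal) (g : ℝ → Metric n M) : Prop :=
  HasTimeDeriv T g fun t x v w =>
    -2 * ricci (g t) x v w
      - 2 * conformalOpInv (g t) (ricciNormSq (g t)) x * (g t).inner x v w

/-- The conformal Ricci flow equations on `[0, T)` for the curve of metrics `g` with conformal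
pressure `p`. -/
structure SolvesConformalRicciFlow (T : EReal) (g : ℝ → Metric n M) (p : ℝ → M → ℝ) :
    Prop where
  /-- The conformal pressure is a smooth curve of smooth functions. -/
  pressure_smooth : IsSmoothFunctionCurve n T p
  /-- `∂g/∂t + 2 (Ric(g) + (1/n) g) = -p g`. -/
  evolution : HasTimeDeriv T g fun t x v w =>
    -2 * (ricci (g t) x v w + 1 / (n : ℝ) * (g t).inner x v w) - p t x * (g t).inner x v w
  /-- `R(g) = -1`. -/
  constraint : ∀ t ∈ timeInterval T, g t ∈ metricsNegOne n M

/-- The function `2 L_g⁻¹(|Ric(g)|²) - 2/n`. -/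
def conformalPressure (g : Metric n M) (x : M) : ℝ :=
  2 * conformalOpInv g (ricciNormSq g) x - 2 / (n : ℝ)

end Manifold

end ConformalRicci

end

/-!
There are two ingredients: the solvability of `L_g u = f` for the operator `L_g = (n - 1) Δ_g + 1`
on a closed manifold, and the preservation of `R = -1` along the reduced flow.

*Bijectivity of `L_g`.* Injectivity is the maximum principle (`conformalOp_injOn`). Surjectivity is
proved without function spaces other than `C^k`. In charts the inverse metric is a sum of squares of
smooth vector fields (`MetricNear.exists_frame`). Each field `Y` of such a frame, cut off in a
chart, generates a family of maps `x ↦ x + s Y + s² Z` of the manifold, where `Z` is the second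
order term of the geodesics, and a positive multiple of `Δ_g` is minus one half of the sum of the
second derivatives in `s` along these families (`exists_generator_eq_laplacian`). The rest of the
argument is carried out for such a `generator`.

* If the generator `A` is replaced by symmetric difference quotients, then `μ u + A u = f` is solved
  by a contraction for large `μ`, since the averages of a function along a deformation increase its
  `C^k` norm at most by a factor `1 + O(s²)` (`Deformation.exists_avg_le`). This yields solutions of
  the equation up to a small error (`exists_approx_of_large`).
* The maximum principle for a weighted sum of squares of derivatives gives the Bernstein estimate
  `(μ - 1 / 8) N u ≤ N (μ u + A u)` for a norm `N` equivalent to the `C^k` norm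
  (`exists_bernstein`). With its help approximate solutions for a large `μ` are turned into
  approximate solutions for `μ = 1` (`exists_approx_one`), and the latter form a Cauchy sequence in
  every `C^k` norm.
* The smooth functions are complete for these norms (`ChartCover.IsCauchy.exists_ckNorm_limit`), so
  that a solution exists (`exists_solution`).

*The flow.* For `p = 2 L_g⁻¹ |Ric|² - 2 / n` the two evolution equations are the same, so that only
the constraint and the smoothness of `p` along a solution of the reduced equation are at issue.
Write `φ = L_g⁻¹ |Ric|²`. For `∂g/∂t = -2 Ric - 2 φ g` the scalar curvature evolves by `∂R/∂t = -Δ R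
- 2 (n - 1) Δ φ + 2 |Ric|² + 2 φ R`. This is `MetricCurveNear.evolution`, which is computed in
normal coordinates and uses the contracted Bianchi identity (`MetricNear.bianchi`) and the
transformation laws under changes of coordinates (`PullbackNear`). By the choice of `φ` it becomes
`∂(R + 1)/∂t = -Δ (R + 1) + 2 φ (R + 1)`, and the parabolic maximum principle
(`nonpos_of_deriv_le_at_max`) gives `R = -1`. Since the metric is positive, `φ` can be read off from
a diagonal component of the evolution equation, all other terms of which are smooth in time and
space up to the initial time; this shows that the pressure is smooth without differentiating `L_g⁻¹`
in `g`.
-/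

noncomputable section

namespace ConformalRicci

section

open Filter Topology Matrix

/-! ### Partial derivatives and matrix-valued functions -/

section Calculus

variable {n : ℕ}

/-- `f` is smooth at all points near `z`. -/
def SmoothNear {E F : Type*} [NormedAddCommGroup E] [NormedSpace ℝ E] [NormedAddCommGroup F]
    [NormedSpace ℝ F] (f : E → F) (z : E) : Prop :=
  ∀ᶠ y in 𝓝 z, ContDiffAt ℝ ∞ f y

section SmoothNear

variable {E F : Type*} [NormedAddCommGroup E] [NormedSpace ℝ E] [NormedAddCommGroup F]
    [NormedSpace ℝ F] {f g : E → F} {z : E}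

theorem SmoothNear.contDiffAt (h : SmoothNear f z) : ContDiffAt ℝ ∞ f z := h.self_of_nhds

theorem SmoothNear.differentiableAt (h : SmoothNear f z) : DifferentiableAt ℝ f z :=
  h.contDiffAt.differentiableAt (by simp)

theorem SmoothNear.continuousAt (h : SmoothNear f z) : ContinuousAt f z :=
  h.contDiffAt.continuousAt

theorem SmoothNear.eventually (h : SmoothNear f z) : ∀ᶠ y in 𝓝 z, SmoothNear f y :=
  h.eventually_nhds

theorem SmoothNear.congr (h : SmoothNear f z) (e : g =ᶠ[𝓝 z] f) : SmoothNear g z := by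
  filter_upwards [h, e.eventually_nhds] with y hy hy' using hy.congr_of_eventuallyEq hy'

theorem smoothNear_const (c : F) : SmoothNear (fun _ : E => c) z :=
  Eventually.of_forall fun _ => contDiffAt_const

theorem SmoothNear.add (hf : SmoothNear f z) (hg : SmoothNear g z) :
    SmoothNear (fun y => f y + g y) z := by
  filter_upwards [hf, hg] with y h1 h2 using h1.add h2

theorem SmoothNear.sub (hf : SmoothNear f z) (hg : SmoothNear g z) :
    SmoothNear (fun y => f y - g y) z := by
  filter_upwards [hf, hg] with y h1 h2 using h1.sub h2

theorem SmoothNear.neg (hf : SmoothNear f z) : SmoothNear (fun y => -f y) z := by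
  filter_upwards [hf] with y h1 using h1.neg

theorem SmoothNear.mul {f g : E → ℝ} (hf : SmoothNear f z) (hg : SmoothNear g z) :
    SmoothNear (fun y => f y * g y) z := by
  filter_upwards [hf, hg] with y h1 h2 using h1.mul h2

theorem SmoothNear.sum {ι : Type*} {s : Finset ι} {f : ι → E → F}
    (h : ∀ i ∈ s, SmoothNear (f i) z) : SmoothNear (fun y => ∑ i ∈ s, f i y) z := by
  have := (Filter.eventually_all_finset s).2 h
  filter_upwards [this] with y hy using ContDiffAt.sum hy

theorem SmoothNear.prod {ι : Type*} {s : Finset ι} {f : ι → E → ℝ}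
    (h : ∀ i ∈ s, SmoothNear (f i) z) : SmoothNear (fun y => ∏ i ∈ s, f i y) z := by
  have := (Filter.eventually_all_finset s).2 h
  filter_upwards [this] with y hy using contDiffAt_prod hy

theorem SmoothNear.inv {f : E → ℝ} (hf : SmoothNear f z) (h0 : f z ≠ 0) :
    SmoothNear (fun y => (f y)⁻¹) z := by
  filter_upwards [hf, hf.continuousAt.eventually_ne h0] with y h1 h2 using h1.inv h2

theorem SmoothNear.comp {E' : Type*} [NormedAddCommGroup E'] [NormedSpace ℝ E'] {ψ : E' → E}
    {y : E'} (hf : SmoothNear f (ψ y)) (hψ : SmoothNear ψ y) :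
    SmoothNear (fun w => f (ψ w)) y := by
  filter_upwards [hψ, hψ.continuousAt.eventually hf] with w h1 h2 using h2.comp w h1

theorem SmoothNear.apply {ψ : E → EuclideanSpace ℝ (Fin n)} (h : SmoothNear ψ z) (i : Fin n) :
    SmoothNear (fun y => ψ y i) z := by
  filter_upwards [h] with y hy using (contDiffAt_piLp_apply (p := 2)).comp y hy

end SmoothNear

variable {f g : EuclideanSpace ℝ (Fin n) → ℝ} {z : EuclideanSpace ℝ (Fin n)} {k : Fin n}

theorem SmoothNear.pd (h : SmoothNear f z) (k : Fin n) : SmoothNear (pd k f) z := by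
  filter_upwards [h] with y hy
  exact (hy.fderiv_right (m := ∞) (by simp)).clm_apply contDiffAt_const

theorem pd_congr (h : f =ᶠ[𝓝 z] g) : pd k f z = pd k g z := by
  simp only [pd, h.fderiv_eq]

theorem pd_eventuallyEq (h : f =ᶠ[𝓝 z] g) : pd k f =ᶠ[𝓝 z] pd k g := by
  filter_upwards [h.eventually_nhds] with y hy using pd_congr hy

@[simp] theorem pd_const (c : ℝ) : pd k (fun _ => c) z = 0 := by simp [pd]

theorem pd_add (hf : DifferentiableAt ℝ f z) (hg : DifferentiableAt ℝ g z) :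
    pd k (fun y => f y + g y) z = pd k f z + pd k g z := by
  simp [pd, fderiv_fun_add hf hg]

theorem pd_sub (hf : DifferentiableAt ℝ f z) (hg : DifferentiableAt ℝ g z) :
    pd k (fun y => f y - g y) z = pd k f z - pd k g z := by
  simp [pd, fderiv_fun_sub hf hg]

theorem pd_mul (hf : DifferentiableAt ℝ f z) (hg : DifferentiableAt ℝ g z) :
    pd k (fun y => f y * g y) z = pd k f z * g z + f z * pd k g z := by
  simp [pd, fderiv_fun_mul hf hg]; ring

theorem pd_const_mul (c : ℝ) : pd k (fun y => c * f y) z = c * pd k f z := by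
  have : (fun y => c * f y) = c • f := rfl
  simp [pd, this, fderiv_const_smul_field]

theorem pd_sum {ι : Type*} {s : Finset ι} {f : ι → EuclideanSpace ℝ (Fin n) → ℝ}
    (h : ∀ i ∈ s, DifferentiableAt ℝ (f i) z) :
    pd k (fun y => ∑ i ∈ s, f i y) z = ∑ i ∈ s, pd k (f i) z := by
  simp [pd, fderiv_fun_sum h]

theorem pd_comm (h : ContDiffAt ℝ ∞ f z) (i j : Fin n) :
    pd i (pd j f) z = pd j (pd i f) z := by
  have hd : DifferentiableAt ℝ (fderiv ℝ f) z :=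
    (h.fderiv_right (m := ∞) (by simp)).differentiableAt (by simp)
  have key : ∀ i j : Fin n, pd i (pd j f) z =
      fderiv ℝ (fderiv ℝ f) z (EuclideanSpace.single i 1) (EuclideanSpace.single j 1) := by
    intro i j
    have := fderiv_clm_apply hd (differentiableAt_const (EuclideanSpace.single j (1 : ℝ)))
    unfold pd
    rw [this]; simp
  rw [key, key]
  exact (h.isSymmSndFDerivAt
    (by simp only [minSmoothness_of_isRCLikeNormedField]; exact WithTop.coe_le_coe.2 le_top)).eq _ _

theorem fderiv_eq_sum_pd (v : EuclideanSpace ℝ (Fin n)) :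
    fderiv ℝ f z v = ∑ c, v c * pd c f z := by
  conv_lhs => rw [← (EuclideanSpace.basisFun (Fin n) ℝ).sum_repr v]
  simp [pd]

/-- The Jacobian matrix `∂_b ψ^a`. -/
def jacobian (ψ : EuclideanSpace ℝ (Fin n) → EuclideanSpace ℝ (Fin n))
    (y : EuclideanSpace ℝ (Fin n)) : Matrix (Fin n) (Fin n) ℝ :=
  Matrix.of fun a b => pd b (fun w => ψ w a) y

theorem fderiv_single_apply {ψ : EuclideanSpace ℝ (Fin n) → EuclideanSpace ℝ (Fin n)}
    {y : EuclideanSpace ℝ (Fin n)} (hψ : DifferentiableAt ℝ ψ y) (a k : Fin n) :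
    (fderiv ℝ ψ y (EuclideanSpace.single k 1)) a = jacobian ψ y a k := by
  have h := (PiLp.hasFDerivAt_apply (𝕜 := ℝ) 2 (ψ y) a).comp y hψ.hasFDerivAt
  simp only [jacobian, pd, of_apply]
  have h2 : fderiv ℝ (fun w => ψ w a) y = _ := h.fderiv
  rw [h2]; rfl

theorem pd_comp {ψ : EuclideanSpace ℝ (Fin n) → EuclideanSpace ℝ (Fin n)}
    {y : EuclideanSpace ℝ (Fin n)} (hf : DifferentiableAt ℝ f (ψ y))
    (hψ : DifferentiableAt ℝ ψ y) :
    pd k (fun w => f (ψ w)) y = ∑ c, jacobian ψ y c k * pd c f (ψ y) := by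
  have : pd k (fun w => f (ψ w)) y = fderiv ℝ f (ψ y) (fderiv ℝ ψ y (EuclideanSpace.single k 1)) := by
    unfold pd
    have h2 : fderiv ℝ (fun w => f (ψ w)) y = _ := fderiv_comp y hf hψ
    rw [h2]; rfl
  rw [this, fderiv_eq_sum_pd]
  simp_rw [fderiv_single_apply hψ]

/-- A matrix-valued function all of whose entries are smooth near `z`. -/
def MSmoothNear (A : EuclideanSpace ℝ (Fin n) → Matrix (Fin n) (Fin n) ℝ)
    (z : EuclideanSpace ℝ (Fin n)) : Prop :=
  ∀ i j, SmoothNear (fun y => A y i j) z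

/-- The entrywise partial derivative of a matrix-valued function. -/
def pdM (k : Fin n) (A : EuclideanSpace ℝ (Fin n) → Matrix (Fin n) (Fin n) ℝ)
    (z : EuclideanSpace ℝ (Fin n)) : Matrix (Fin n) (Fin n) ℝ :=
  Matrix.of fun i j => pd k (fun y => A y i j) z

variable {A B : EuclideanSpace ℝ (Fin n) → Matrix (Fin n) (Fin n) ℝ}

theorem MSmoothNear.eventually (h : MSmoothNear A z) : ∀ᶠ y in 𝓝 z, MSmoothNear A y := by
  have : ∀ i j, ∀ᶠ y in 𝓝 z, SmoothNear (fun y => A y i j) y := fun i j => (h i j).eventually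
  filter_upwards [eventually_all.2 fun i => eventually_all.2 fun j => this i j] with y hy
  exact hy

theorem MSmoothNear.congr (h : MSmoothNear A z) (e : B =ᶠ[𝓝 z] A) : MSmoothNear B z :=
  fun i j => (h i j).congr (by filter_upwards [e] with y hy; rw [hy])

theorem MSmoothNear.add (hA : MSmoothNear A z) (hB : MSmoothNear B z) :
    MSmoothNear (fun y => A y + B y) z := fun i j => (hA i j).add (hB i j)

theorem MSmoothNear.sub (hA : MSmoothNear A z) (hB : MSmoothNear B z) :
    MSmoothNear (fun y => A y - B y) z := fun i j => (hA i j).sub (hB i j)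

theorem MSmoothNear.mul (hA : MSmoothNear A z) (hB : MSmoothNear B z) :
    MSmoothNear (fun y => A y * B y) z := fun i j => by
  simp only [Matrix.mul_apply]
  exact SmoothNear.sum fun k _ => (hA i k).mul (hB k j)

theorem MSmoothNear.transpose (hA : MSmoothNear A z) : MSmoothNear (fun y => (A y)ᵀ) z :=
  fun i j => hA j i

theorem MSmoothNear.smul (hf : SmoothNear f z) (hA : MSmoothNear A z) :
    MSmoothNear (fun y => f y • A y) z := fun i j => hf.mul (hA i j)

theorem MSmoothNear.sum {ι : Type*} {s : Finset ι}
    {A : ι → EuclideanSpace ℝ (Fin n) → Matrix (Fin n) (Fin n) ℝ}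
    (h : ∀ i ∈ s, MSmoothNear (A i) z) : MSmoothNear (fun y => ∑ i ∈ s, A i y) z :=
  fun a b => by
    simp only [Matrix.sum_apply]
    exact SmoothNear.sum fun i hi => h i hi a b

theorem MSmoothNear.pdM (hA : MSmoothNear A z) (k : Fin n) : MSmoothNear (pdM k A) z :=
  fun i j => (hA i j).pd k

theorem MSmoothNear.comp {ψ : EuclideanSpace ℝ (Fin n) → EuclideanSpace ℝ (Fin n)}
    {y : EuclideanSpace ℝ (Fin n)} (hA : MSmoothNear A (ψ y)) (hψ : SmoothNear ψ y) :
    MSmoothNear (fun w => A (ψ w)) y := fun i j => (hA i j).comp hψ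

theorem MSmoothNear.jacobian {ψ : EuclideanSpace ℝ (Fin n) → EuclideanSpace ℝ (Fin n)}
    (hψ : SmoothNear ψ z) : MSmoothNear (jacobian ψ) z := fun i j => (hψ.apply i).pd j

theorem smoothNear_det {m : Type*} [Fintype m] [DecidableEq m] {E : Type*} [NormedAddCommGroup E]
    [NormedSpace ℝ E] {z : E} {A : E → Matrix m m ℝ}
    (hA : ∀ i j, SmoothNear (fun y => A y i j) z) : SmoothNear (fun y => (A y).det) z := by
  simp only [Matrix.det_apply']
  exact SmoothNear.sum fun σ _ => (smoothNear_const _).mul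
    (SmoothNear.prod fun i _ => hA _ _)

theorem smoothNear_inv_apply {m : Type*} [Fintype m] [DecidableEq m] {E : Type*}
    [NormedAddCommGroup E] [NormedSpace ℝ E] {z : E} {A : E → Matrix m m ℝ}
    (hA : ∀ i j, SmoothNear (fun y => A y i j) z) (h0 : (A z).det ≠ 0) (i j : m) :
    SmoothNear (fun y => (A y)⁻¹ i j) z := by
  simp only [Matrix.inv_def, Matrix.smul_apply, smul_eq_mul, Ring.inverse_eq_inv]
  refine ((smoothNear_det hA).inv h0).mul ?_
  simp only [Matrix.adjugate_apply]
  refine smoothNear_det fun a b => ?_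
  by_cases h : a = j
  · subst h; simp only [Matrix.updateRow_self]; exact smoothNear_const _
  · simp only [Matrix.updateRow_ne h]; exact hA a b

theorem MSmoothNear.inv (hA : MSmoothNear A z) (h0 : (A z).det ≠ 0) :
    MSmoothNear (fun y => (A y)⁻¹) z := fun i j => smoothNear_inv_apply hA h0 i j

theorem pdM_mul (hA : MSmoothNear A z) (hB : MSmoothNear B z) :
    pdM k (fun y => A y * B y) z = pdM k A z * B z + A z * pdM k B z := by
  ext i j
  simp only [pdM, Matrix.mul_apply, Matrix.of_apply, Matrix.add_apply]
  rw [pd_sum fun l _ => ((hA i l).mul (hB l j)).differentiableAt, ← Finset.sum_add_distrib]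
  exact Finset.sum_congr rfl fun l _ =>
    pd_mul (hA i l).differentiableAt (hB l j).differentiableAt

theorem pdM_add (hA : MSmoothNear A z) (hB : MSmoothNear B z) :
    pdM k (fun y => A y + B y) z = pdM k A z + pdM k B z := by
  ext i j
  exact pd_add (hA i j).differentiableAt (hB i j).differentiableAt

theorem pdM_smul (hf : SmoothNear f z) (hA : MSmoothNear A z) :
    pdM k (fun y => f y • A y) z = pd k f z • A z + f z • pdM k A z := by
  ext i j
  exact pd_mul hf.differentiableAt (hA i j).differentiableAt

theorem pdM_sum {ι : Type*} {s : Finset ι}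
    {A : ι → EuclideanSpace ℝ (Fin n) → Matrix (Fin n) (Fin n) ℝ}
    (h : ∀ i ∈ s, MSmoothNear (A i) z) :
    pdM k (fun y => ∑ i ∈ s, A i y) z = ∑ i ∈ s, pdM k (A i) z := by
  ext a b
  simp only [pdM, Matrix.sum_apply, Matrix.of_apply]
  exact pd_sum fun i hi => (h i hi a b).differentiableAt

theorem pdM_transpose : pdM k (fun y => (A y)ᵀ) z = (pdM k A z)ᵀ := rfl

theorem pdM_congr (h : A =ᶠ[𝓝 z] B) : pdM k A z = pdM k B z := by
  ext i j
  exact pd_congr (by filter_upwards [h] with y hy; rw [hy])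

theorem pdM_const (C : Matrix (Fin n) (Fin n) ℝ) : pdM k (fun _ => C) z = 0 := by
  ext i j; simp [pdM]

theorem pdM_comm (hA : MSmoothNear A z) (i j : Fin n) :
    pdM i (pdM j A) z = pdM j (pdM i A) z := by
  ext a b
  exact pd_comm (hA a b).contDiffAt i j

theorem pdM_comp {ψ : EuclideanSpace ℝ (Fin n) → EuclideanSpace ℝ (Fin n)}
    {y : EuclideanSpace ℝ (Fin n)} (hA : MSmoothNear A (ψ y)) (hψ : SmoothNear ψ y) :
    pdM k (fun w => A (ψ w)) y = ∑ c, jacobian ψ y c k • pdM c A (ψ y) := by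
  ext a b
  simp only [pdM, Matrix.sum_apply, Matrix.of_apply, Matrix.smul_apply, smul_eq_mul]
  exact pd_comp (hA a b).differentiableAt hψ.differentiableAt

theorem pdM_jacobian_symm {ψ : EuclideanSpace ℝ (Fin n) → EuclideanSpace ℝ (Fin n)}
    (hψ : SmoothNear ψ z) (a b c : Fin n) :
    pdM c (jacobian ψ) z a b = pdM b (jacobian ψ) z a c :=
  pd_comm (hψ.apply a).contDiffAt c b

end Calculus

/-! ### The Levi-Civita connection and its curvature under a change of coordinates -/

section Gauge

variable {n : ℕ} {G Gt : EuclideanSpace ℝ (Fin n) → Matrix (Fin n) (Fin n) ℝ}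
  {z y : EuclideanSpace ℝ (Fin n)} {ψ : EuclideanSpace ℝ (Fin n) → EuclideanSpace ℝ (Fin n)}

/-- `G` is the coefficient matrix of a smooth (pseudo-)Riemannian metric near `z`. -/
structure MetricNear (G : EuclideanSpace ℝ (Fin n) → Matrix (Fin n) (Fin n) ℝ)
    (z : EuclideanSpace ℝ (Fin n)) : Prop where
  smooth : MSmoothNear G z
  symm : ∀ᶠ y in 𝓝 z, (G y)ᵀ = G y
  det : (G z).det ≠ 0

theorem MetricNear.eventually (h : MetricNear G z) : ∀ᶠ y in 𝓝 z, MetricNear G y := by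
  filter_upwards [h.smooth.eventually, h.symm.eventually_nhds,
    (smoothNear_det h.smooth).continuousAt.eventually_ne h.det] with y h1 h2 h3
  exact ⟨h1, h2, h3⟩

/-- The connection matrix `(A_k)^a_b = Γ^a_kb`. -/
def conn (G : EuclideanSpace ℝ (Fin n) → Matrix (Fin n) (Fin n) ℝ) (k : Fin n)
    (z : EuclideanSpace ℝ (Fin n)) : Matrix (Fin n) (Fin n) ℝ :=
  Matrix.of fun a b => christoffel G a k b z

/-- The curvature matrix `F_cd = ∂_c A_d - ∂_d A_c + [A_c, A_d]`, with entries `R^a_{bcd}`. -/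
def curv (G : EuclideanSpace ℝ (Fin n) → Matrix (Fin n) (Fin n) ℝ) (c d : Fin n)
    (z : EuclideanSpace ℝ (Fin n)) : Matrix (Fin n) (Fin n) ℝ :=
  pdM c (conn G d) z - pdM d (conn G c) z + (conn G c z * conn G d z - conn G d z * conn G c z)

theorem curv_apply (a b c d : Fin n) : curv G c d z a b = riemannCoord G a b c d z := by
  simp only [curv, riemannCoord, pdM, conn, Matrix.add_apply, Matrix.sub_apply, Matrix.of_apply,
    Matrix.mul_apply, Finset.sum_sub_distrib]

/-- The Ricci tensor as a matrix. -/
def ricM (G : EuclideanSpace ℝ (Fin n) → Matrix (Fin n) (Fin n) ℝ)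
    (z : EuclideanSpace ℝ (Fin n)) : Matrix (Fin n) (Fin n) ℝ :=
  Matrix.of fun i j => ricciCoord G i j z

theorem MetricNear.smooth_christoffel (h : MetricNear G z) (k i j : Fin n) :
    SmoothNear (christoffel G k i j) z := by
  unfold christoffel
  refine (smoothNear_const _).mul (SmoothNear.sum fun l _ => (h.smooth.inv h.det k l).mul ?_)
  exact (((h.smooth j l).pd i).add ((h.smooth i l).pd j)).sub ((h.smooth i j).pd l)

theorem MetricNear.smooth_conn (h : MetricNear G z) (k : Fin n) : MSmoothNear (conn G k) z :=
  fun a b => h.smooth_christoffel a k b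

theorem MetricNear.smooth_curv (h : MetricNear G z) (c d : Fin n) : MSmoothNear (curv G c d) z :=
  (((h.smooth_conn d).pdM c).sub ((h.smooth_conn c).pdM d)).add
    (((h.smooth_conn c).mul (h.smooth_conn d)).sub ((h.smooth_conn d).mul (h.smooth_conn c)))

theorem MetricNear.smooth_ricM (h : MetricNear G z) : MSmoothNear (ricM G) z := by
  intro i j
  simp only [ricM, Matrix.of_apply, ricciCoord, ← curv_apply]
  exact SmoothNear.sum fun a _ => h.smooth_curv a j a i

theorem MetricNear.smooth_scalarCoord (h : MetricNear G z) : SmoothNear (scalarCoord G) z :=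
  SmoothNear.sum fun i _ => SmoothNear.sum fun j _ =>
    (h.smooth.inv h.det i j).mul (h.smooth_ricM i j)

theorem MetricNear.smooth_ricciNormSqCoord (h : MetricNear G z) :
    SmoothNear (ricciNormSqCoord G) z :=
  SmoothNear.sum fun i _ => SmoothNear.sum fun j _ => SmoothNear.sum fun k _ =>
    SmoothNear.sum fun l _ => (((h.smooth.inv h.det i k).mul (h.smooth.inv h.det j l)).mul
      (h.smooth_ricM i j)).mul (h.smooth_ricM k l)

theorem MetricNear.smooth_laplacianCoord (h : MetricNear G z)
    {f : EuclideanSpace ℝ (Fin n) → ℝ} (hf : SmoothNear f z) :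
    SmoothNear (laplacianCoord G f) z :=
  SmoothNear.neg <| SmoothNear.sum fun i _ => SmoothNear.sum fun j _ =>
    (h.smooth.inv h.det i j).mul <| ((hf.pd j).pd i).sub <| SmoothNear.sum fun k _ =>
      (h.smooth_christoffel k i j).mul (hf.pd k)

theorem MetricNear.pd_symm (h : MetricNear G z) (k i j : Fin n) :
    pd k (fun y => G y i j) z = pd k (fun y => G y j i) z :=
  pd_congr (by filter_upwards [h.symm] with y hy; rw [← hy, Matrix.transpose_apply, hy])

theorem MetricNear.christoffel_symm (h : MetricNear G z) (k i j : Fin n) :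
    christoffel G k i j z = christoffel G k j i z := by
  simp only [christoffel, h.pd_symm _ i j]
  congr 1
  exact Finset.sum_congr rfl fun l _ => by ring

theorem MetricNear.conn_symm (h : MetricNear G z) (k a b : Fin n) :
    conn G k z a b = conn G b z a k := h.christoffel_symm a k b

theorem MetricNear.inv_symm (h : MetricNear G z) : ((G z)⁻¹)ᵀ = (G z)⁻¹ := by
  rw [Matrix.transpose_nonsing_inv, h.symm.self_of_nhds]

theorem MetricNear.inv_mul (h : MetricNear G z) : (G z)⁻¹ * G z = 1 :=
  Matrix.nonsing_inv_mul _ (isUnit_iff_ne_zero.2 h.det)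

theorem MetricNear.mul_inv (h : MetricNear G z) : G z * (G z)⁻¹ = 1 :=
  Matrix.mul_nonsing_inv _ (isUnit_iff_ne_zero.2 h.det)

/-- The Christoffel symbols of the first kind. -/
theorem MetricNear.mul_conn_apply (h : MetricNear G z) (k i j : Fin n) :
    (G z * conn G k z) i j = (1 / 2 : ℝ) * (pd k (fun y => G y j i) z + pd j (fun y => G y k i) z
      - pd i (fun y => G y k j) z) := by
  set X : Fin n → ℝ := fun l => pd k (fun y => G y j l) z + pd j (fun y => G y k l) z
      - pd l (fun y => G y k j) z with hX
  have h1 : ∀ a, conn G k z a j = (1 / 2 : ℝ) * ((G z)⁻¹ *ᵥ X) a := fun a => rfl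
  have h2 : (G z * conn G k z) i j = (G z *ᵥ ((1 / 2 : ℝ) • ((G z)⁻¹ *ᵥ X))) i := by
    simp only [Matrix.mul_apply, Matrix.mulVec, dotProduct, h1, Pi.smul_apply, smul_eq_mul]
  rw [h2, Matrix.mulVec_smul, Matrix.mulVec_mulVec, h.mul_inv, Matrix.one_mulVec]
  rfl

/-- The Levi-Civita connection is compatible with the metric. -/
theorem MetricNear.compat (h : MetricNear G z) (k : Fin n) :
    pdM k G z = (conn G k z)ᵀ * G z + G z * conn G k z := by
  have e : (conn G k z)ᵀ * G z = (G z * conn G k z)ᵀ := by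
    rw [Matrix.transpose_mul, h.symm.self_of_nhds]
  rw [e]
  ext i j
  simp only [Matrix.add_apply, Matrix.transpose_apply, h.mul_conn_apply, pdM, Matrix.of_apply]
  rw [h.pd_symm k j i, h.pd_symm j k i, h.pd_symm i k j]
  ring

/-- The Levi-Civita connection is the only symmetric connection compatible with the metric. -/
theorem MetricNear.conn_unique (h : MetricNear G z) {B : Fin n → Matrix (Fin n) (Fin n) ℝ}
    (hs : ∀ k a b, B k a b = B b a k)
    (hc : ∀ k, pdM k G z = (B k)ᵀ * G z + G z * B k) (k : Fin n) : B k = conn G k z := by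
  have e : ∀ k, (B k)ᵀ * G z = (G z * B k)ᵀ := fun k => by
    rw [Matrix.transpose_mul, h.symm.self_of_nhds]
  have hs' : ∀ k i j, (G z * B k) i j = (G z * B j) i k := fun k i j => by
    simp only [Matrix.mul_apply]
    exact Finset.sum_congr rfl fun a _ => by rw [hs k a j]
  have hc' : ∀ k i j, pd k (fun y => G y i j) z = (G z * B k) j i + (G z * B k) i j :=
    fun k i j => by
      have := congrFun (congrFun (hc k) i) j
      rw [e k] at this
      exact this
  have : G z * B k = G z * conn G k z := by
    ext i j
    rw [h.mul_conn_apply, hc', hc', hc', hs' k j i, hs' j k i, hs' j i k]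
    ring
  have h2 := congrArg (fun X => (G z)⁻¹ * X) this
  simpa only [← Matrix.mul_assoc, h.inv_mul, Matrix.one_mul] using h2

/-- Near `y`, the metric `Gt` is the pullback of the metric `G` under the local diffeomorphism
`ψ`. -/
structure PullbackNear (ψ : EuclideanSpace ℝ (Fin n) → EuclideanSpace ℝ (Fin n))
    (G Gt : EuclideanSpace ℝ (Fin n) → Matrix (Fin n) (Fin n) ℝ)
    (y : EuclideanSpace ℝ (Fin n)) : Prop where
  smooth : SmoothNear ψ y
  jac : (jacobian ψ y).det ≠ 0
  metric : MetricNear G (ψ y)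
  eq : ∀ᶠ w in 𝓝 y, Gt w = (jacobian ψ w)ᵀ * G (ψ w) * jacobian ψ w

namespace PullbackNear

theorem eventually (h : PullbackNear ψ G Gt y) : ∀ᶠ w in 𝓝 y, PullbackNear ψ G Gt w := by
  filter_upwards [h.smooth.eventually,
    (smoothNear_det (MSmoothNear.jacobian h.smooth)).continuousAt.eventually_ne h.jac,
    h.smooth.continuousAt.eventually h.metric.eventually, h.eq.eventually_nhds] with w h1 h2 h3 h4
  exact ⟨h1, h2, h3, h4⟩

theorem smooth_jac (h : PullbackNear ψ G Gt y) : MSmoothNear (jacobian ψ) y :=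
  MSmoothNear.jacobian h.smooth

theorem metric' (h : PullbackNear ψ G Gt y) : MetricNear Gt y where
  smooth := ((h.smooth_jac.transpose.mul (h.metric.smooth.comp h.smooth)).mul h.smooth_jac).congr
    h.eq
  symm := by
    filter_upwards [h.eq, h.smooth.continuousAt.eventually h.metric.symm] with w h1 h2
    rw [h1]
    simp only [Matrix.transpose_mul, Matrix.transpose_transpose, h2, Matrix.mul_assoc]
  det := by
    rw [h.eq.self_of_nhds]
    simp only [Matrix.det_mul, Matrix.det_transpose]
    exact mul_ne_zero (mul_ne_zero h.jac h.metric.det) h.jac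

theorem jac_mul_inv (h : PullbackNear ψ G Gt y) : jacobian ψ y * (jacobian ψ y)⁻¹ = 1 :=
  Matrix.mul_nonsing_inv _ (isUnit_iff_ne_zero.2 h.jac)

theorem jac_inv_mul (h : PullbackNear ψ G Gt y) : (jacobian ψ y)⁻¹ * jacobian ψ y = 1 :=
  Matrix.nonsing_inv_mul _ (isUnit_iff_ne_zero.2 h.jac)

end PullbackNear

/-- The pullback of the connection form, before the change of frame. -/
def connPull (ψ : EuclideanSpace ℝ (Fin n) → EuclideanSpace ℝ (Fin n))
    (G : EuclideanSpace ℝ (Fin n) → Matrix (Fin n) (Fin n) ℝ) (k : Fin n)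
    (y : EuclideanSpace ℝ (Fin n)) : Matrix (Fin n) (Fin n) ℝ :=
  ∑ c, jacobian ψ y c k • conn G c (ψ y)

namespace PullbackNear

theorem smooth_connPull (h : PullbackNear ψ G Gt y) (k : Fin n) :
    MSmoothNear (connPull ψ G k) y :=
  MSmoothNear.sum fun c _ => MSmoothNear.smul (h.smooth_jac c k)
    ((h.metric.smooth_conn c).comp h.smooth)

/-- The transformation law of the connection. -/
theorem gauge (h : PullbackNear ψ G Gt y) (k : Fin n) :
    jacobian ψ y * conn Gt k y = pdM k (jacobian ψ) y + connPull ψ G k y * jacobian ψ y := by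
  set J := jacobian ψ y with hJ
  set X : Fin n → Matrix (Fin n) (Fin n) ℝ := fun k =>
    pdM k (jacobian ψ) y + connPull ψ G k y * J with hX
  have hXs : ∀ k a b, X k a b = X b a k := by
    intro k a b
    simp only [hX, Matrix.add_apply, pdM_jacobian_symm h.smooth a b k]
    congr 1
    simp only [connPull, Matrix.mul_apply, Matrix.sum_apply, Matrix.smul_apply, smul_eq_mul,
      Finset.sum_mul]
    rw [Finset.sum_comm]
    refine Finset.sum_congr rfl fun c _ => Finset.sum_congr rfl fun d _ => ?_
    rw [h.metric.conn_symm d a c]; ring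
  have hB : ∀ k, J * (J⁻¹ * X k) = X k := fun k => by
    rw [← Matrix.mul_assoc, h.jac_mul_inv, Matrix.one_mul]
  have key := h.metric'.conn_unique (B := fun k => J⁻¹ * X k) ?_ ?_ k
  · rw [← key, hB]
  · intro k a b
    simp only [Matrix.mul_apply, hXs k _ b]
  · intro k
    have e1 : pdM k Gt y = _ := pdM_congr h.eq
    have hG := h.metric.smooth.comp h.smooth
    rw [e1, pdM_mul (h.smooth_jac.transpose.mul hG) h.smooth_jac,
      pdM_mul h.smooth_jac.transpose hG, pdM_transpose, pdM_comp h.metric.smooth h.smooth,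
      h.eq.self_of_nhds]
    have e2 : ∑ c, jacobian ψ y c k • pdM c G (ψ y)
        = (connPull ψ G k y)ᵀ * G (ψ y) + G (ψ y) * connPull ψ G k y := by
      simp only [h.metric.compat, connPull, Matrix.transpose_sum, Matrix.transpose_smul,
        Matrix.sum_mul, Matrix.mul_sum, Matrix.smul_mul, Matrix.mul_smul, smul_add,
        Finset.sum_add_distrib]
    have e3 : (J⁻¹ * X k)ᵀ * (Jᵀ * G (ψ y) * J) = (X k)ᵀ * (G (ψ y) * J) := by
      rw [Matrix.mul_assoc Jᵀ, ← Matrix.mul_assoc, ← Matrix.transpose_mul, hB]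
    have e4 : (Jᵀ * G (ψ y) * J) * (J⁻¹ * X k) = Jᵀ * G (ψ y) * X k := by
      rw [Matrix.mul_assoc (Jᵀ * G (ψ y)), hB]
    rw [e2, e3, e4]
    simp only [hX, Matrix.transpose_add, Matrix.transpose_mul]
    noncomm_ring

/-- The curvature is a tensor. -/
theorem curv_eq (h : PullbackNear ψ G Gt y) (k l : Fin n) :
    jacobian ψ y * curv Gt k l y =
      (∑ c, ∑ d, (jacobian ψ y c k * jacobian ψ y d l) • curv G c d (ψ y)) * jacobian ψ y := by
  have hJ := h.smooth_jac
  have hC := h.metric'.smooth_conn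
  have hP := h.smooth_connPull
  have ev : ∀ k, (fun w => jacobian ψ w * conn Gt k w) =ᶠ[𝓝 y]
      fun w => pdM k (jacobian ψ) w + connPull ψ G k w * jacobian ψ w := fun k => by
    filter_upwards [h.eventually] with w hw using hw.gauge k
  -- the derivative of the transformation law `gauge`
  have D : ∀ k l, pdM k (jacobian ψ) y * conn Gt l y + jacobian ψ y * pdM k (conn Gt l) y
      = pdM k (pdM l (jacobian ψ)) y + (pdM k (connPull ψ G l) y * jacobian ψ y
        + connPull ψ G l y * pdM k (jacobian ψ) y) := fun k l => by
    rw [← pdM_mul hJ (hC l), pdM_congr (ev l), pdM_add (hJ.pdM l) ((hP l).mul hJ),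
      pdM_mul (hP l) hJ]
  have g : ∀ k, pdM k (jacobian ψ) y = jacobian ψ y * conn Gt k y
      - connPull ψ G k y * jacobian ψ y := fun k => by rw [h.gauge k]; abel
  -- the curvature formula commutes with the pullback of the connection form
  have hF : ∑ c, ∑ d, (jacobian ψ y c k * jacobian ψ y d l) • curv G c d (ψ y)
      = pdM k (connPull ψ G l) y - pdM l (connPull ψ G k) y
        + (connPull ψ G k y * connPull ψ G l y - connPull ψ G l y * connPull ψ G k y) := by
    have dP : ∀ k l, pdM k (connPull ψ G l) y =
        ∑ d, (pdM k (jacobian ψ) y d l • conn G d (ψ y)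
          + jacobian ψ y d l • ∑ c, jacobian ψ y c k • pdM c (conn G d) (ψ y)) := fun k l => by
      have : pdM k (connPull ψ G l) y = _ := pdM_sum (k := k) (s := Finset.univ)
        (A := fun c w => jacobian ψ w c l • conn G c (ψ w)) (fun c _ =>
        MSmoothNear.smul (h.smooth_jac c l) ((h.metric.smooth_conn c).comp h.smooth))
      rw [this]
      refine Finset.sum_congr rfl fun d _ => ?_
      rw [pdM_smul (h.smooth_jac d l) ((h.metric.smooth_conn d).comp h.smooth),
        pdM_comp (h.metric.smooth_conn d) h.smooth]
      rfl
    have PP : ∀ k l, connPull ψ G k y * connPull ψ G l y = ∑ c, ∑ d,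
        (jacobian ψ y c k * jacobian ψ y d l) • (conn G c (ψ y) * conn G d (ψ y)) :=
        fun k l => by
      simp only [connPull, Matrix.sum_mul, Matrix.mul_sum, Matrix.smul_mul, Matrix.mul_smul,
        Finset.smul_sum, smul_smul]
      rw [Finset.sum_comm]
      simp only [mul_comm]
    rw [dP, dP, PP k l, PP l k]
    simp only [curv, smul_add, smul_sub, Finset.sum_add_distrib, Finset.sum_sub_distrib,
      Finset.smul_sum, smul_smul]
    simp only [pdM_jacobian_symm h.smooth _ l k]
    rw [Finset.sum_comm (f := fun c d => (jacobian ψ y c k * jacobian ψ y d l) •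
      pdM c (conn G d) (ψ y)), Finset.sum_comm (f := fun c d => (jacobian ψ y c l *
        jacobian ψ y d k) • (conn G c (ψ y) * conn G d (ψ y)))]
    simp only [mul_comm (jacobian ψ y _ k)]
    abel
  rw [hF, curv]
  -- antisymmetrizing `D` removes the second derivatives of the Jacobian
  have s := pdM_comm hJ k l
  have D1 := D k l
  have D2 := D l k
  rw [g k, g l] at *
  have : jacobian ψ y * (pdM k (conn Gt l) y - pdM l (conn Gt k) y) =
      (pdM k (connPull ψ G l) y * jacobian ψ y - pdM l (connPull ψ G k) y * jacobian ψ y)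
      + connPull ψ G l y * (jacobian ψ y * conn Gt k y - connPull ψ G k y * jacobian ψ y)
      - connPull ψ G k y * (jacobian ψ y * conn Gt l y - connPull ψ G l y * jacobian ψ y)
      - (jacobian ψ y * conn Gt k y - connPull ψ G k y * jacobian ψ y) * conn Gt l y
      + (jacobian ψ y * conn Gt l y - connPull ψ G l y * jacobian ψ y) * conn Gt k y := by
    have E1 : jacobian ψ y * pdM k (conn Gt l) y = pdM k (pdM l (jacobian ψ)) y
      + (pdM k (connPull ψ G l) y * jacobian ψ y + connPull ψ G l y *
        (jacobian ψ y * conn Gt k y - connPull ψ G k y * jacobian ψ y))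
      - (jacobian ψ y * conn Gt k y - connPull ψ G k y * jacobian ψ y) * conn Gt l y := by
      rw [← D1]; abel
    have E2 : jacobian ψ y * pdM l (conn Gt k) y = pdM l (pdM k (jacobian ψ)) y
      + (pdM l (connPull ψ G k) y * jacobian ψ y + connPull ψ G k y *
        (jacobian ψ y * conn Gt l y - connPull ψ G l y * jacobian ψ y))
      - (jacobian ψ y * conn Gt l y - connPull ψ G l y * jacobian ψ y) * conn Gt k y := by
      rw [← D2]; abel
    rw [Matrix.mul_sub, E1, E2, s]; abel
  rw [Matrix.mul_add, this]
  noncomm_ring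

/-- The Ricci curvature is a tensor. -/
theorem ricM_eq (h : PullbackNear ψ G Gt y) :
    ricM Gt y = (jacobian ψ y)ᵀ * ricM G (ψ y) * jacobian ψ y := by
  set J := jacobian ψ y with hJ
  have hc : ∀ k l, curv Gt k l y =
      J⁻¹ * ((∑ c, ∑ d, (J c k * J d l) • curv G c d (ψ y)) * J) := fun k l => by
    rw [← h.curv_eq, ← Matrix.mul_assoc, h.jac_inv_mul, Matrix.one_mul]
  ext i j
  set N : Fin n → Matrix (Fin n) (Fin n) ℝ := fun c => ∑ d, J d j • curv G c d (ψ y) with hN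
  calc ricM Gt y i j = ∑ a, curv Gt a j y a i := by
        simp only [ricM, Matrix.of_apply, ricciCoord, curv_apply]
    _ = ∑ a, ∑ c, J c a * (J⁻¹ * (N c * J)) a i := by
        refine Finset.sum_congr rfl fun a _ => ?_
        have : ∑ c, ∑ d, (J c a * J d j) • curv G c d (ψ y) = ∑ c, J c a • N c := by
          simp only [hN, Finset.smul_sum, smul_smul]
        rw [hc, this]
        simp only [Matrix.sum_mul, Matrix.mul_sum, Matrix.sum_apply, Matrix.smul_mul,
          Matrix.mul_smul, Matrix.smul_apply, smul_eq_mul]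
    _ = ∑ c, (J * (J⁻¹ * (N c * J))) c i := by
        rw [Finset.sum_comm]
        simp only [Matrix.mul_apply (M := J)]
    _ = ∑ c, (N c * J) c i := by
        have hi : J * J⁻¹ = 1 := h.jac_mul_inv
        simp only [← Matrix.mul_assoc, hi, Matrix.one_mul]
    _ = ∑ f, ∑ d, J d j * ricM G (ψ y) f d * J f i := by
        simp only [Matrix.mul_apply, hN, Matrix.sum_apply, Matrix.smul_apply, smul_eq_mul]
        rw [Finset.sum_comm]
        refine Finset.sum_congr rfl fun f _ => ?_
        simp only [Finset.sum_mul]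
        rw [Finset.sum_comm]
        refine Finset.sum_congr rfl fun d _ => ?_
        simp only [ricM, Matrix.of_apply, ricciCoord, curv_apply, Finset.sum_mul, Finset.mul_sum]
    _ = (Jᵀ * ricM G (ψ y) * J) i j := by
        rw [Matrix.mul_apply]
        simp only [Matrix.mul_apply, Matrix.transpose_apply, Finset.sum_mul]
        rw [Finset.sum_comm]
        exact Finset.sum_congr rfl fun d _ => Finset.sum_congr rfl fun f _ => by ring

end PullbackNear

end Gauge

section Gauge

variable {n : ℕ} {G Gt : EuclideanSpace ℝ (Fin n) → Matrix (Fin n) (Fin n) ℝ}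
  {z y : EuclideanSpace ℝ (Fin n)} {ψ : EuclideanSpace ℝ (Fin n) → EuclideanSpace ℝ (Fin n)}

theorem scalarCoord_eq_trace (G : EuclideanSpace ℝ (Fin n) → Matrix (Fin n) (Fin n) ℝ)
    (z : EuclideanSpace ℝ (Fin n)) : scalarCoord G z = ((G z)⁻¹ * (ricM G z)ᵀ).trace := by
  simp only [scalarCoord, Matrix.trace, Matrix.diag, Matrix.mul_apply, Matrix.transpose_apply, ricM,
    Matrix.of_apply]

theorem ricciNormSqCoord_eq_trace (G : EuclideanSpace ℝ (Fin n) → Matrix (Fin n) (Fin n) ℝ)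
    (z : EuclideanSpace ℝ (Fin n)) : ricciNormSqCoord G z =
      ((ricM G z * (G z)⁻¹ * (ricM G z)ᵀ) * ((G z)⁻¹)ᵀ).trace := by
  simp only [ricciNormSqCoord, Matrix.trace, Matrix.diag, Matrix.mul_apply, Matrix.transpose_apply,
    ricM, Matrix.of_apply, Finset.sum_mul]
  refine Finset.sum_congr rfl fun i _ => ?_
  rw [Finset.sum_comm]
  refine Finset.sum_congr rfl fun k _ => ?_
  rw [Finset.sum_comm]
  exact Finset.sum_congr rfl fun l _ => Finset.sum_congr rfl fun j _ => by ring

/-- The Hessian `∂_i ∂_j f - Γ^k_ij ∂_k f`. -/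
def hessM (G : EuclideanSpace ℝ (Fin n) → Matrix (Fin n) (Fin n) ℝ)
    (f : EuclideanSpace ℝ (Fin n) → ℝ) (z : EuclideanSpace ℝ (Fin n)) :
    Matrix (Fin n) (Fin n) ℝ :=
  Matrix.of fun i j => pd i (pd j f) z - ∑ k, christoffel G k i j z * pd k f z

theorem laplacianCoord_eq_trace (G : EuclideanSpace ℝ (Fin n) → Matrix (Fin n) (Fin n) ℝ)
    (f : EuclideanSpace ℝ (Fin n) → ℝ) (z : EuclideanSpace ℝ (Fin n)) :
    laplacianCoord G f z = -((G z)⁻¹ * (hessM G f z)ᵀ).trace := by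
  simp only [laplacianCoord, Matrix.trace, Matrix.diag, Matrix.mul_apply, Matrix.transpose_apply,
    hessM, Matrix.of_apply]

namespace PullbackNear

theorem inv_eq (h : PullbackNear ψ G Gt y) :
    (Gt y)⁻¹ = (jacobian ψ y)⁻¹ * (G (ψ y))⁻¹ * ((jacobian ψ y)⁻¹)ᵀ := by
  rw [h.eq.self_of_nhds, Matrix.mul_inv_rev, Matrix.mul_inv_rev, Matrix.transpose_nonsing_inv,
    Matrix.mul_assoc]

theorem jac_mul_inv_mul (h : PullbackNear ψ G Gt y) :
    jacobian ψ y * (Gt y)⁻¹ * (jacobian ψ y)ᵀ = (G (ψ y))⁻¹ := by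
  have e : ((jacobian ψ y)⁻¹)ᵀ * (jacobian ψ y)ᵀ = 1 := by
    rw [← Matrix.transpose_mul, h.jac_mul_inv, Matrix.transpose_one]
  rw [h.inv_eq]
  calc _ = (jacobian ψ y * (jacobian ψ y)⁻¹) * (G (ψ y))⁻¹ *
        (((jacobian ψ y)⁻¹)ᵀ * (jacobian ψ y)ᵀ) := by noncomm_ring
    _ = _ := by rw [h.jac_mul_inv, e, Matrix.one_mul, Matrix.mul_one]

/-- Contraction of a covariant two-tensor with the metric is invariant. -/
theorem trace_eq (h : PullbackNear ψ G Gt y) (X : Matrix (Fin n) (Fin n) ℝ) :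
    ((Gt y)⁻¹ * ((jacobian ψ y)ᵀ * X * jacobian ψ y)).trace = ((G (ψ y))⁻¹ * X).trace := by
  rw [← h.jac_mul_inv_mul, Matrix.trace_mul_comm]
  rw [show (jacobian ψ y)ᵀ * X * jacobian ψ y * (Gt y)⁻¹ =
    (jacobian ψ y)ᵀ * (X * (jacobian ψ y * (Gt y)⁻¹)) by noncomm_ring, Matrix.trace_mul_comm,
    show X * (jacobian ψ y * (Gt y)⁻¹) * (jacobian ψ y)ᵀ
      = X * (jacobian ψ y * (Gt y)⁻¹ * (jacobian ψ y)ᵀ) by noncomm_ring, Matrix.trace_mul_comm]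

theorem scalarCoord_eq (h : PullbackNear ψ G Gt y) : scalarCoord Gt y = scalarCoord G (ψ y) := by
  rw [scalarCoord_eq_trace, scalarCoord_eq_trace, h.ricM_eq, ← h.trace_eq]
  simp only [Matrix.transpose_mul, Matrix.transpose_transpose, Matrix.mul_assoc]

theorem ricciNormSqCoord_eq (h : PullbackNear ψ G Gt y) :
    ricciNormSqCoord Gt y = ricciNormSqCoord G (ψ y) := by
  rw [ricciNormSqCoord_eq_trace, ricciNormSqCoord_eq_trace, h.ricM_eq, h.metric'.inv_symm,
    h.metric.inv_symm, Matrix.trace_mul_comm, Matrix.trace_mul_comm _ (G (ψ y))⁻¹, ← h.trace_eq,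
    ← h.jac_mul_inv_mul]
  simp only [Matrix.transpose_mul, Matrix.transpose_transpose, Matrix.mul_assoc]

/-- The Hessian is a tensor: the second derivatives of `ψ` cancel against the inhomogeneous term in
the transformation law of the connection. -/
theorem hessM_eq (h : PullbackNear ψ G Gt y) {f : EuclideanSpace ℝ (Fin n) → ℝ}
    (hf : SmoothNear f (ψ y)) :
    hessM Gt (fun w => f (ψ w)) y = (jacobian ψ y)ᵀ * hessM G f (ψ y) * jacobian ψ y := by
  set J := jacobian ψ y with hJ
  have d1 : ∀ j, pd j (fun w => f (ψ w)) =ᶠ[𝓝 y]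
      fun w => ∑ c, jacobian ψ w c j * pd c f (ψ w) := fun j => by
    filter_upwards [h.smooth.eventually, h.smooth.continuousAt.eventually hf.eventually]
      with w h1 h2 using pd_comp h2.differentiableAt h1.differentiableAt
  have d2 : ∀ i j, pd i (pd j (fun w => f (ψ w))) y = ∑ c, (pdM i (jacobian ψ) y c j * pd c f (ψ y)
      + J c j * ∑ d, J d i * pd d (pd c f) (ψ y)) := fun i j => by
    rw [pd_congr (d1 j), pd_sum fun c _ => ((h.smooth_jac c j).mul
      ((hf.pd c).comp h.smooth)).differentiableAt]
    refine Finset.sum_congr rfl fun c _ => ?_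
    rw [pd_mul (h.smooth_jac c j).differentiableAt ((hf.pd c).comp h.smooth).differentiableAt,
      pd_comp (hf.pd c).differentiableAt h.smooth.differentiableAt]
    rfl
  have g : ∀ i j c, ∑ k, J c k * christoffel Gt k i j y = pdM i (jacobian ψ) y c j
      + ∑ e, (∑ d, J d i * christoffel G c d e (ψ y)) * J e j := fun i j c => by
    have := congrFun (congrFun (h.gauge i) c) j
    simpa only [Matrix.mul_apply, Matrix.add_apply, connPull, Matrix.sum_apply, Matrix.smul_apply,
      smul_eq_mul, conn, Matrix.of_apply] using this
  ext i j
  simp only [hessM, Matrix.of_apply]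
  have e1 : ∑ k, christoffel Gt k i j y * pd k (fun w => f (ψ w)) y
      = ∑ c, (∑ k, J c k * christoffel Gt k i j y) * pd c f (ψ y) := by
    simp only [fun k => (d1 k).self_of_nhds, Finset.mul_sum, Finset.sum_mul]
    rw [Finset.sum_comm]
    exact Finset.sum_congr rfl fun c _ => Finset.sum_congr rfl fun k _ => by ring
  rw [e1, d2]
  simp only [g, add_mul, Finset.sum_add_distrib, Matrix.mul_apply, Matrix.transpose_apply,
    Matrix.of_apply, mul_sub, sub_mul, Finset.sum_sub_distrib]
  have e2 : ∑ c, J c j * ∑ d, J d i * pd d (pd c f) (ψ y) =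
      ∑ x, (∑ a, J a i * pd a (pd x f) (ψ y)) * J x j :=
    Finset.sum_congr rfl fun c _ => mul_comm _ _
  have e3 : ∑ c, (∑ e, (∑ d, J d i * christoffel G c d e (ψ y)) * J e j) * pd c f (ψ y) =
      ∑ x, (∑ a, J a i * ∑ k, christoffel G k a x (ψ y) * pd k f (ψ y)) * J x j := by
    simp only [Finset.sum_mul, Finset.mul_sum]
    rw [Finset.sum_comm]
    refine Finset.sum_congr rfl fun x _ => ?_
    rw [Finset.sum_comm]
    exact Finset.sum_congr rfl fun a _ => Finset.sum_congr rfl fun k _ => by ring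
  rw [e2, e3]
  ring

theorem laplacianCoord_eq (h : PullbackNear ψ G Gt y) {f : EuclideanSpace ℝ (Fin n) → ℝ}
    (hf : SmoothNear f (ψ y)) :
    laplacianCoord Gt (fun w => f (ψ w)) y = laplacianCoord G f (ψ y) := by
  rw [laplacianCoord_eq_trace, laplacianCoord_eq_trace, h.hessM_eq hf, ← h.trace_eq]
  simp only [Matrix.transpose_mul, Matrix.transpose_transpose, Matrix.mul_assoc]

end PullbackNear

end Gauge

/-! ### Normal coordinates and the contracted Bianchi identity -/

section Bianchi

variable {n : ℕ} {G Gt : EuclideanSpace ℝ (Fin n) → Matrix (Fin n) (Fin n) ℝ}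
  {z y : EuclideanSpace ℝ (Fin n)} {ψ : EuclideanSpace ℝ (Fin n) → EuclideanSpace ℝ (Fin n)}

theorem smoothNear_coord (i : Fin n) : SmoothNear (fun y : EuclideanSpace ℝ (Fin n) => y i) z :=
  Eventually.of_forall fun _ => contDiffAt_piLp_apply (p := 2)

theorem pd_coord (k i : Fin n) :
    pd k (fun y : EuclideanSpace ℝ (Fin n) => y i) z = if i = k then 1 else 0 := by
  have h := (PiLp.hasFDerivAt_apply (𝕜 := ℝ) (E := fun _ : Fin n => ℝ) 2 z i)
  rw [pd, h.fderiv]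
  simp [EuclideanSpace.single]

/-- A quadratic polynomial map with prescribed one-jet and second derivatives. -/
def quadMap (z : EuclideanSpace ℝ (Fin n)) (S : Matrix (Fin n) (Fin n) ℝ)
    (Γ : Fin n → Matrix (Fin n) (Fin n) ℝ) (y : EuclideanSpace ℝ (Fin n)) :
    EuclideanSpace ℝ (Fin n) :=
  WithLp.toLp 2 fun a => z a + ∑ b, S a b * y b
    - (1 / 2 : ℝ) * ∑ c, ∑ d, Γ c a d * ((∑ b, S c b * y b) * ∑ b, S d b * y b)

theorem quadMap_zero (z : EuclideanSpace ℝ (Fin n)) (S : Matrix (Fin n) (Fin n) ℝ)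
    (Γ : Fin n → Matrix (Fin n) (Fin n) ℝ) : quadMap z S Γ 0 = z := by
  ext a; simp [quadMap]

theorem smoothNear_linear (S : Matrix (Fin n) (Fin n) ℝ) (c : Fin n) :
    SmoothNear (fun y : EuclideanSpace ℝ (Fin n) => ∑ b, S c b * y b) z :=
  SmoothNear.sum fun b _ => (smoothNear_const _).mul (smoothNear_coord b)

theorem pd_linear (S : Matrix (Fin n) (Fin n) ℝ) (c k : Fin n) :
    pd k (fun y : EuclideanSpace ℝ (Fin n) => ∑ b, S c b * y b) z = S c k := by
  rw [pd_sum fun b _ => ((smoothNear_const _).mul (smoothNear_coord b)).differentiableAt]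
  simp [pd_const_mul, pd_coord]

theorem smoothNear_quadMap (S : Matrix (Fin n) (Fin n) ℝ)
    (Γ : Fin n → Matrix (Fin n) (Fin n) ℝ) : SmoothNear (quadMap z S Γ) y := by
  have h : ∀ a, SmoothNear (fun y => quadMap z S Γ y a) y := fun a =>
    ((smoothNear_const _).add (smoothNear_linear S a)).sub ((smoothNear_const _).mul
      (SmoothNear.sum fun c _ => SmoothNear.sum fun d _ => (smoothNear_const _).mul
        ((smoothNear_linear S c).mul (smoothNear_linear S d))))
  filter_upwards [eventually_all.2 h] with w hw
  exact contDiffAt_euclidean.2 hw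

/-- The quadratic part of `quadMap` is symmetric, so that the two terms of its derivative agree. -/
theorem jacobian_quadMap (S : Matrix (Fin n) (Fin n) ℝ) {Γ : Fin n → Matrix (Fin n) (Fin n) ℝ}
    (hΓ : ∀ k a b, Γ k a b = Γ b a k) (a k : Fin n) :
    jacobian (quadMap z S Γ) y a k =
      S a k - ∑ c, ∑ d, Γ c a d * (S d k * ∑ b, S c b * y b) := by
  have hq : ∀ c d, SmoothNear (fun y : EuclideanSpace ℝ (Fin n) =>
      Γ c a d * ((∑ b, S c b * y b) * ∑ b, S d b * y b)) y := fun c d =>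
    (smoothNear_const _).mul ((smoothNear_linear S c).mul (smoothNear_linear S d))
  have e : jacobian (quadMap z S Γ) y a k = S a k - (1 / 2 : ℝ) * ∑ c, ∑ d, Γ c a d *
      (S c k * (∑ b, S d b * y b) + (∑ b, S c b * y b) * S d k) := by
    simp only [jacobian, quadMap, Matrix.of_apply]
    rw [pd_sub ((smoothNear_const _).add (smoothNear_linear S a)).differentiableAt
      ((smoothNear_const _).mul (SmoothNear.sum fun c _ => SmoothNear.sum fun d _ =>
        hq c d)).differentiableAt, pd_add (smoothNear_const _).differentiableAt
      (smoothNear_linear S a).differentiableAt, pd_const, pd_linear, zero_add, pd_const_mul,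
      pd_sum fun c _ => (SmoothNear.sum fun d _ => hq c d).differentiableAt]
    congr 2
    refine Finset.sum_congr rfl fun c _ => ?_
    rw [pd_sum fun d _ => (hq c d).differentiableAt]
    refine Finset.sum_congr rfl fun d _ => ?_
    rw [pd_const_mul, pd_mul (smoothNear_linear S c).differentiableAt
      (smoothNear_linear S d).differentiableAt, pd_linear, pd_linear]
  rw [e]
  have : ∑ c, ∑ d, Γ c a d * (S c k * ∑ b, S d b * y b)
      = ∑ c, ∑ d, Γ c a d * (S d k * ∑ b, S c b * y b) := by
    rw [Finset.sum_comm]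
    exact Finset.sum_congr rfl fun c _ => Finset.sum_congr rfl fun d _ => by rw [hΓ d a c]
  simp only [mul_add, Finset.sum_add_distrib] at this ⊢
  rw [this]
  have h2 : ∑ c, ∑ d, Γ c a d * ((∑ b, S c b * y b) * S d k)
      = ∑ c, ∑ d, Γ c a d * (S d k * ∑ b, S c b * y b) :=
    Finset.sum_congr rfl fun c _ => Finset.sum_congr rfl fun d _ => by ring
  rw [h2]; ring

open scoped MatrixOrder Matrix.Norms.L2Operator in
theorem exists_transpose_mul_mul_eq_one {P : Matrix (Fin n) (Fin n) ℝ} (h : P.PosDef) :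
    ∃ S : Matrix (Fin n) (Fin n) ℝ, S.det ≠ 0 ∧ Sᵀ * P * S = 1 := by
  obtain ⟨B, hB, rfl⟩ : ∃ B : Matrix (Fin n) (Fin n) ℝ, IsUnit B ∧ P = Bᵀ * B := by
    obtain ⟨B, hB, e⟩ := CStarAlgebra.isStrictlyPositive_iff_eq_star_mul_self.1
      (Matrix.isStrictlyPositive_iff_posDef.2 h)
    exact ⟨B, hB, by simpa [Matrix.star_eq_conjTranspose] using e⟩
  have hd : IsUnit B.det := (Matrix.isUnit_iff_isUnit_det B).1 hB
  refine ⟨B⁻¹, ?_, ?_⟩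
  · exact (Matrix.isUnit_nonsing_inv_det B hd).ne_zero
  · calc (B⁻¹)ᵀ * (Bᵀ * B) * B⁻¹ = (B * B⁻¹)ᵀ * (B * B⁻¹) := by
          rw [Matrix.transpose_mul]; noncomm_ring
      _ = 1 := by rw [Matrix.mul_nonsing_inv _ hd]; simp

/-- Coordinates at a point in which the metric is Euclidean to first order. -/
theorem MetricNear.exists_normal (h : MetricNear G z) (hp : (G z).PosDef) :
    ∃ ψ : EuclideanSpace ℝ (Fin n) → EuclideanSpace ℝ (Fin n), ψ 0 = z ∧ SmoothNear ψ 0 ∧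
      (jacobian ψ 0).det ≠ 0 ∧
      (jacobian ψ 0)ᵀ * G (ψ 0) * jacobian ψ 0 = 1 ∧
      ∀ k, pdM k (fun y => (jacobian ψ y)ᵀ * G (ψ y) * jacobian ψ y) 0 = 0 := by
  obtain ⟨S, hS, hSG⟩ := exists_transpose_mul_mul_eq_one hp
  set Γ : Fin n → Matrix (Fin n) (Fin n) ℝ := fun k => conn G k z
  have hΓ : ∀ k a b, Γ k a b = Γ b a k := h.conn_symm
  -- `S` normalizes the metric at the point; the quadratic correction by the Christoffel symbols
  -- makes the pulled back connection, and with it the first derivatives of the metric, vanish there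
  set ψ := quadMap z S Γ with hψ
  have hJ : ∀ y a k, jacobian ψ y a k = S a k - ∑ c, ∑ d, Γ c a d * (S d k * ∑ b, S c b * y b) :=
    fun y a k => jacobian_quadMap S hΓ a k
  have hJ0 : jacobian ψ 0 = S := by ext a k; simp [hJ]
  have h0 : ψ 0 = z := quadMap_zero z S Γ
  have hsm : SmoothNear ψ 0 := smoothNear_quadMap S Γ
  have hP : PullbackNear ψ G (fun y => (jacobian ψ y)ᵀ * G (ψ y) * jacobian ψ y) 0 :=
    ⟨hsm, by rwa [hJ0], by rwa [h0], Eventually.of_forall fun _ => rfl⟩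
  refine ⟨ψ, h0, hsm, by rwa [hJ0], by rwa [hJ0, h0], fun k => ?_⟩
  have hd : pdM k (jacobian ψ) 0 = -(connPull ψ G k 0 * jacobian ψ 0) := by
    ext a b
    have hq : ∀ c d, SmoothNear (fun y : EuclideanSpace ℝ (Fin n) =>
        Γ c a d * (S d b * ∑ b, S c b * y b)) 0 := fun c d =>
      (smoothNear_const _).mul ((smoothNear_const _).mul (smoothNear_linear S c))
    have : pdM k (jacobian ψ) 0 a b = -∑ c, ∑ d, Γ c a d * (S d b * S c k) := by
      simp only [pdM, Matrix.of_apply, hJ]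
      rw [pd_sub (smoothNear_const _).differentiableAt (SmoothNear.sum fun c _ =>
        SmoothNear.sum fun d _ => hq c d).differentiableAt, pd_const, zero_sub,
        pd_sum fun c _ => (SmoothNear.sum fun d _ => hq c d).differentiableAt]
      congr 1
      refine Finset.sum_congr rfl fun c _ => ?_
      rw [pd_sum fun d _ => (hq c d).differentiableAt]
      refine Finset.sum_congr rfl fun d _ => ?_
      rw [pd_const_mul, pd_const_mul, pd_linear]
    rw [this, Matrix.neg_apply, hJ0]
    simp only [connPull, h0, hJ0, Matrix.sum_apply, Matrix.smul_apply, smul_eq_mul,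
      Matrix.mul_apply, Finset.sum_mul]
    congr 1
    change _ = ∑ d, ∑ c, S c k * Γ c a d * S d b
    rw [Finset.sum_comm]
    exact Finset.sum_congr rfl fun c _ => Finset.sum_congr rfl fun d _ => by ring
  have hA : conn (fun y => (jacobian ψ y)ᵀ * G (ψ y) * jacobian ψ y) k 0 = 0 := by
    have hg := hP.gauge k
    rw [hd, neg_add_cancel] at hg
    have := congrArg (fun X => (jacobian ψ 0)⁻¹ * X) hg
    simpa only [← Matrix.mul_assoc, hP.jac_inv_mul, Matrix.one_mul, Matrix.mul_zero] using this
  rw [hP.metric'.compat, hA]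
  simp

/-- The covariant derivative `∇_k Ric`. -/
def covRic (G : EuclideanSpace ℝ (Fin n) → Matrix (Fin n) (Fin n) ℝ) (k : Fin n)
    (z : EuclideanSpace ℝ (Fin n)) : Matrix (Fin n) (Fin n) ℝ :=
  pdM k (ricM G) z - (conn G k z)ᵀ * ricM G z - ricM G z * conn G k z

theorem PullbackNear.covRic_eq (h : PullbackNear ψ G Gt y) (k : Fin n) :
    covRic Gt k y = (jacobian ψ y)ᵀ * (∑ c, jacobian ψ y c k • covRic G c (ψ y)) * jacobian ψ y := by
  have ev : ricM Gt =ᶠ[𝓝 y] fun w => (jacobian ψ w)ᵀ * ricM G (ψ w) * jacobian ψ w := by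
    filter_upwards [h.eventually] with w hw using hw.ricM_eq
  have hR := h.metric.smooth_ricM.comp h.smooth
  have hJ := h.smooth_jac
  have e1 : ∑ c, jacobian ψ y c k • covRic G c (ψ y) = ∑ c, jacobian ψ y c k • pdM c (ricM G) (ψ y)
      - (connPull ψ G k y)ᵀ * ricM G (ψ y) - ricM G (ψ y) * connPull ψ G k y := by
    simp only [covRic, connPull, smul_sub, Finset.sum_sub_distrib, Matrix.transpose_sum,
      Matrix.transpose_smul, Matrix.sum_mul, Matrix.mul_sum, Matrix.smul_mul, Matrix.mul_smul]
  have g : pdM k (jacobian ψ) y = jacobian ψ y * conn Gt k y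
      - connPull ψ G k y * jacobian ψ y := by rw [h.gauge k]; abel
  rw [covRic, pdM_congr ev, pdM_mul (hJ.transpose.mul hR) hJ, pdM_mul hJ.transpose hR,
    pdM_transpose, pdM_comp h.metric.smooth_ricM h.smooth, h.ricM_eq, e1, g]
  simp only [Matrix.transpose_sub, Matrix.transpose_mul]
  noncomm_ring

theorem MetricNear.pdM_inv (h : MetricNear G z) (k : Fin n) :
    pdM k (fun y => (G y)⁻¹) z = -((G z)⁻¹ * pdM k G z * (G z)⁻¹) := by
  have hG := h.smooth
  have hI := h.smooth.inv h.det
  have e : pdM k (fun y => G y * (G y)⁻¹) z = 0 := by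
    rw [← pdM_const (z := z) (k := k) 1]
    refine pdM_congr ?_
    filter_upwards [h.eventually] with w hw using hw.mul_inv
  rw [pdM_mul hG hI] at e
  have e2 : G z * pdM k (fun y => (G y)⁻¹) z = -(pdM k G z * (G z)⁻¹) :=
    eq_neg_of_add_eq_zero_right e
  have := congrArg (fun X => (G z)⁻¹ * X) e2
  simpa only [← Matrix.mul_assoc, h.inv_mul, Matrix.one_mul, Matrix.mul_neg] using this

/-- Data of a metric that is Euclidean to first order at `z`. -/
structure NormalAt (G : EuclideanSpace ℝ (Fin n) → Matrix (Fin n) (Fin n) ℝ)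
    (z : EuclideanSpace ℝ (Fin n)) : Prop extends MetricNear G z where
  eq_one : G z = 1
  pd_eq_zero : ∀ k, pdM k G z = 0

namespace NormalAt

theorem inv_eq (h : NormalAt G z) : (G z)⁻¹ = 1 := by rw [h.eq_one, inv_one]

theorem pdM_inv (h : NormalAt G z) (k : Fin n) : pdM k (fun y => (G y)⁻¹) z = 0 := by
  rw [h.toMetricNear.pdM_inv, h.pd_eq_zero]; simp

theorem conn_eq (h : NormalAt G z) (k : Fin n) : conn G k z = 0 := by
  ext i j
  have := h.toMetricNear.mul_conn_apply k i j
  rw [h.eq_one, Matrix.one_mul] at this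
  have e : ∀ k i j, pd k (fun y => G y i j) z = 0 := fun k i j =>
    congrFun (congrFun (h.pd_eq_zero k) i) j
  rw [this, e, e, e]; simp

/-- In normal coordinates the second derivatives of the connection are those of the Christoffel
symbols of the first kind: in `∂_l ∂_k (G A_m)` every term with a derivative on `G` contains a
factor that vanishes at the point. -/
theorem pdM_pdM_conn (h : NormalAt G z) (l k m i j : Fin n) :
    pdM l (pdM k (conn G m)) z i j = (1 / 2 : ℝ) * (pd l (pd k (pd m fun y => G y j i)) z
      + pd l (pd k (pd j fun y => G y m i)) z - pd l (pd k (pd i fun y => G y m j)) z) := by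
  have hm := h.toMetricNear
  have hG := hm.smooth
  have hA := hm.smooth_conn m
  have e1 : pdM l (pdM k (fun y => G y * conn G m y)) z = pdM l (pdM k (conn G m)) z := by
    have : pdM k (fun y => G y * conn G m y) =ᶠ[𝓝 z]
        fun y => pdM k G y * conn G m y + G y * pdM k (conn G m) y := by
      filter_upwards [hG.eventually, hA.eventually] with w h1 h2 using pdM_mul h1 h2
    rw [pdM_congr this, pdM_add ((hG.pdM k).mul hA) (hG.mul (hA.pdM k)), pdM_mul (hG.pdM k) hA,
      pdM_mul hG (hA.pdM k), h.conn_eq, h.pd_eq_zero, h.pd_eq_zero, h.eq_one]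
    simp
  rw [← e1]
  have e2 : (fun y => (G y * conn G m y) i j) =ᶠ[𝓝 z] fun y => (1 / 2 : ℝ) *
      (pd m (fun y => G y j i) y + pd j (fun y => G y m i) y - pd i (fun y => G y m j) y) := by
    filter_upwards [hm.eventually] with w hw using hw.mul_conn_apply m i j
  have s := fun a b c : Fin n => (hG b c).pd a
  have e3 : pd k (fun y => (G y * conn G m y) i j) =ᶠ[𝓝 z] fun y => (1 / 2 : ℝ) *
      (pd k (pd m (fun y => G y j i)) y + pd k (pd j (fun y => G y m i)) y
        - pd k (pd i (fun y => G y m j)) y) := by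
    filter_upwards [e2.eventually_nhds, (s m j i).eventually, (s j m i).eventually,
      (s i m j).eventually] with w hw h1 h2 h3
    rw [pd_congr hw, pd_const_mul, pd_sub (h1.add h2).differentiableAt h3.differentiableAt,
      pd_add h1.differentiableAt h2.differentiableAt]
  change pd l (pd k (fun y => (G y * conn G m y) i j)) z = _
  have s' := fun a b c d : Fin n => (s b c d).pd a
  rw [pd_congr e3, pd_const_mul, pd_sub ((s' k m j i).add (s' k j m i)).differentiableAt
    (s' k i m j).differentiableAt, pd_add (s' k m j i).differentiableAt
    (s' k j m i).differentiableAt]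

/-- In normal coordinates the quadratic terms of the curvature do not contribute to `∂ Ric`. -/
theorem pd_ricM (h : NormalAt G z) (k i j : Fin n) :
    pdM k (ricM G) z i j = ∑ a, (pdM k (pdM a (conn G j)) z a i
      - pdM k (pdM j (conn G a)) z a i) := by
  have hm := h.toMetricNear
  have hA := hm.smooth_conn
  have e : (fun y => ricM G y i j) = fun y => ∑ a, curv G a j y a i := by
    ext y; simp only [ricM, Matrix.of_apply, ricciCoord, curv_apply]
  have : pdM k (ricM G) z i j = pd k (fun y => ricM G y i j) z := rfl
  rw [this, e, pd_sum fun a _ => (hm.smooth_curv a j a i).differentiableAt]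
  refine Finset.sum_congr rfl fun a _ => ?_
  have e2 : pdM k (curv G a j) z = pdM k (pdM a (conn G j)) z - pdM k (pdM j (conn G a)) z := by
    have e3 : curv G a j = fun y => (pdM a (conn G j) y + conn G a y * conn G j y)
      + ((-1 : ℝ) • (pdM j (conn G a) y + conn G j y * conn G a y)) := by
      ext y b c
      simp only [curv, Matrix.add_apply, Matrix.sub_apply, Matrix.smul_apply, smul_eq_mul]
      ring
    have s := fun a j : Fin n => ((hA j).pdM a).add ((hA a).mul (hA j))
    rw [e3, pdM_add (s a j) (MSmoothNear.smul (smoothNear_const _) (s j a)),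
      pdM_smul (smoothNear_const _) (s j a), pdM_add ((hA j).pdM a) ((hA a).mul (hA j)),
      pdM_add ((hA a).pdM j) ((hA j).mul (hA a)), pdM_mul (hA a) (hA j), pdM_mul (hA j) (hA a),
      h.conn_eq, h.conn_eq, pd_const]
    simp [sub_eq_add_neg]
  exact congrFun (congrFun e2 a) i

theorem pd_scalarCoord (h : NormalAt G z) (j : Fin n) :
    pd j (scalarCoord G) z = ∑ i, pdM j (ricM G) z i i := by
  have hm := h.toMetricNear
  have hI := hm.smooth.inv hm.det
  have hR := hm.smooth_ricM
  have e : scalarCoord G = fun z => ∑ i, ((G z)⁻¹ * (ricM G z)ᵀ) i i := by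
    ext w; rw [scalarCoord_eq_trace]; rfl
  rw [e, pd_sum fun i _ => (hI.mul hR.transpose i i).differentiableAt]
  refine Finset.sum_congr rfl fun i _ => ?_
  have := pdM_mul (k := j) hI hR.transpose
  rw [h.pdM_inv, h.inv_eq, pdM_transpose] at this
  have := congrFun (congrFun this i) i
  simp only [Matrix.zero_mul, Matrix.one_mul, zero_add, Matrix.transpose_apply] at this
  exact this

/-- In normal coordinates `∂ Ric` is a combination of third derivatives of the metric, and the
contracted Bianchi identity is a consequence of their symmetries. -/
theorem bianchi (h : NormalAt G z) (j : Fin n) :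
    ∑ k, covRic G k z k j = (1 / 2 : ℝ) * pd j (scalarCoord G) z := by
  have hm := h.toMetricNear
  have hG := hm.smooth
  set T : Fin n → Fin n → Fin n → Fin n → Fin n → ℝ := fun l k m a b =>
    pd l (pd k (pd m fun y => G y a b)) z with hT
  have T1 : ∀ l k m a b, T l k m a b = T k l m a b := fun l k m a b =>
    pd_comm ((hG a b).pd m).contDiffAt l k
  have T2 : ∀ l k m a b, T l k m a b = T l m k a b := fun l k m a b => by
    refine pd_congr ?_
    filter_upwards [hG a b] with w hw using pd_comm hw k m
  have T3 : ∀ l k m a b, T l k m a b = T l k m b a := fun l k m a b => by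
    refine pd_congr (pd_eventuallyEq (pd_eventuallyEq ?_))
    filter_upwards [hm.symm] with w hw
    conv_lhs => rw [← hw]
    rfl
  have hric : ∀ k i j, pdM k (ricM G) z i j = (1 / 2 : ℝ) * ∑ a, (T k a j i a + T k a i j a
      - T k a a j i - T k j i a a) := fun k i j => by
    rw [h.pd_ricM, Finset.mul_sum]
    refine Finset.sum_congr rfl fun a _ => ?_
    rw [h.pdM_pdM_conn, h.pdM_pdM_conn]
    change (1 / 2 : ℝ) * (T k a j i a + T k a i j a - T k a a j i) -
      (1 / 2 : ℝ) * (T k j a i a + T k j i a a - T k j a a i) = _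
    rw [T3 k j a a i]; ring
  have hcov : ∀ k, covRic G k z = pdM k (ricM G) z := fun k => by
    rw [covRic, h.conn_eq]; simp
  rw [h.pd_scalarCoord]
  simp only [hcov, hric, ← Finset.mul_sum, Finset.sum_add_distrib, Finset.sum_sub_distrib]
  have a1 : ∑ k, ∑ a, T k a k j a = ∑ k, ∑ a, T k a a j k := by
    rw [Finset.sum_comm]
    exact Finset.sum_congr rfl fun a _ => Finset.sum_congr rfl fun k _ => T1 _ _ _ _ _
  have a2 : ∑ k, ∑ a, T j a k k a = ∑ k, ∑ a, T k a j k a :=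
    Finset.sum_congr rfl fun k _ => Finset.sum_congr rfl fun a _ => by
      rw [T2 j, T1 j, T2 k]
  have a3 : ∑ k, ∑ a, T k j k a a = ∑ k, ∑ a, T j k k a a :=
    Finset.sum_congr rfl fun k _ => Finset.sum_congr rfl fun a _ => T1 _ _ _ _ _
  have a4 : ∑ k, ∑ a, T j a a k k = ∑ k, ∑ a, T j k k a a := by rw [Finset.sum_comm]
  rw [a1, a2, a3, a4]
  ring

end NormalAt

/-- The contracted Bianchi identity `g^{ki} ∇_k R_ij = 1/2 ∂_j R`. -/
theorem MetricNear.bianchi (h : MetricNear G z) (hp : (G z).PosDef) (j : Fin n) :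
    ∑ k, ∑ i, (G z)⁻¹ k i * covRic G k z i j = (1 / 2 : ℝ) * pd j (scalarCoord G) z := by
  obtain ⟨ψ, h0, hs, hJd, h1, hd⟩ := h.exists_normal hp
  set Gt := fun y => (jacobian ψ y)ᵀ * G (ψ y) * jacobian ψ y with hGt
  have hP : PullbackNear ψ G Gt 0 := ⟨hs, hJd, by rwa [h0], Eventually.of_forall fun _ => rfl⟩
  have hN : NormalAt Gt 0 := { hP.metric' with eq_one := h1, pd_eq_zero := hd }
  set J := jacobian ψ 0 with hJ
  -- the defect of the identity is a one-form, which vanishes in normal coordinates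
  set β : Fin n → ℝ := fun j => ∑ k, ∑ i, (G z)⁻¹ k i * covRic G k z i j
    - (1 / 2 : ℝ) * pd j (scalarCoord G) z with hβ
  have hinv : J * Jᵀ = (G z)⁻¹ := by
    have := hP.jac_mul_inv_mul
    rwa [hN.inv_eq, Matrix.mul_one, h0] at this
  have hz : ∀ j, ∑ b, β b * J b j = 0 := fun j => by
    have hb := hN.bianchi j
    have hR : pd j (scalarCoord Gt) 0 = ∑ b, J b j * pd b (scalarCoord G) z := by
      have : scalarCoord Gt =ᶠ[𝓝 0] fun w => scalarCoord G (ψ w) := by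
        filter_upwards [hP.eventually] with w hw using hw.scalarCoord_eq
      rw [pd_congr this, pd_comp hP.metric.smooth_scalarCoord.differentiableAt
        hs.differentiableAt, h0]
    have hL : ∑ k, covRic Gt k 0 k j = ∑ b, (∑ k, ∑ i, (G z)⁻¹ k i * covRic G k z i b) * J b j := by
      have : ∀ k, covRic Gt k 0 k j = ∑ b, (∑ c, ∑ a, (J c k * J a k) * covRic G c z a b) * J b j := by
        intro k
        rw [hP.covRic_eq, h0]
        simp only [Matrix.mul_apply, Matrix.transpose_apply, Matrix.sum_apply, Matrix.smul_apply,
          smul_eq_mul, Finset.mul_sum]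
        refine Finset.sum_congr rfl fun b _ => ?_
        congr 1
        exact Finset.sum_congr rfl fun c _ => Finset.sum_congr rfl fun d _ => by
          simp only [hJ]; ring
      simp only [this]
      rw [Finset.sum_comm]
      refine Finset.sum_congr rfl fun b _ => ?_
      rw [← Finset.sum_mul, Finset.sum_comm]
      congr 1
      refine Finset.sum_congr rfl fun c _ => ?_
      rw [Finset.sum_comm]
      refine Finset.sum_congr rfl fun a _ => ?_
      rw [← Finset.sum_mul, ← hinv]
      rfl
    rw [hL, hR] at hb
    simp only [hβ, sub_mul, Finset.sum_sub_distrib]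
    rw [hb, Finset.mul_sum]
    simp only [mul_assoc, mul_comm (J _ j), sub_self]
  have hv : β ᵥ* J = 0 := funext hz
  have := congrArg (fun v => v ᵥ* J⁻¹) hv
  simp only [Matrix.vecMul_vecMul, hP.jac_mul_inv, Matrix.vecMul_one, Matrix.zero_vecMul, hJ] at this
  exact sub_eq_zero.1 (congrFun this j)

end Bianchi

/-! ### Evolution of the scalar curvature -/

section Evolution

variable {n : ℕ}

theorem SmoothNear.fderiv_apply {W : Type*} [NormedAddCommGroup W] [NormedSpace ℝ W] {f : W → ℝ}
    {q : W} (h : SmoothNear f q) (v : W) : SmoothNear (fun p => fderiv ℝ f p v) q := by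
  filter_upwards [h] with p hp
  exact (hp.fderiv_right (m := ∞) (by simp)).clm_apply contDiffAt_const

theorem SmoothNear.fderiv_comm {W : Type*} [NormedAddCommGroup W] [NormedSpace ℝ W] {f : W → ℝ}
    {q : W} (h : SmoothNear f q) (v w : W) :
    fderiv ℝ (fun p => fderiv ℝ f p v) q w = fderiv ℝ (fun p => fderiv ℝ f p w) q v := by
  have hd : DifferentiableAt ℝ (fderiv ℝ f) q :=
    (h.contDiffAt.fderiv_right (m := ∞) (by simp)).differentiableAt (by simp)
  have key : ∀ v w : W, fderiv ℝ (fun p => fderiv ℝ f p v) q w =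
      fderiv ℝ (fderiv ℝ f) q w v := by
    intro v w
    rw [fderiv_clm_apply hd (differentiableAt_const v)]; simp
  rw [key, key]
  exact (h.contDiffAt.isSymmSndFDerivAt
    (by simp only [minSmoothness_of_isRCLikeNormedField]; exact WithTop.coe_le_coe.2 le_top)).eq _ _

/-- A time-dependent function that is smooth in time and space near `(t, z)`. -/
def TSmooth (F : ℝ → EuclideanSpace ℝ (Fin n) → ℝ) (t : ℝ) (z : EuclideanSpace ℝ (Fin n)) : Prop :=
  SmoothNear (fun q : ℝ × EuclideanSpace ℝ (Fin n) => F q.1 q.2) (t, z)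

/-- The time derivative. -/
def dt (F : ℝ → EuclideanSpace ℝ (Fin n) → ℝ) (t : ℝ) (z : EuclideanSpace ℝ (Fin n)) : ℝ :=
  deriv (fun s => F s z) t

variable {F F' : ℝ → EuclideanSpace ℝ (Fin n) → ℝ} {t : ℝ} {z : EuclideanSpace ℝ (Fin n)}

namespace TSmooth

theorem eventually (h : TSmooth F t z) : ∀ᶠ q in 𝓝 (t, z), TSmooth F q.1 q.2 :=
  SmoothNear.eventually h

theorem space (h : TSmooth F t z) : SmoothNear (F t) z :=
  SmoothNear.comp (f := fun q : ℝ × EuclideanSpace ℝ (Fin n) => F q.1 q.2) (ψ := fun y => (t, y)) h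
    (Eventually.of_forall fun _ => contDiffAt_const.prodMk contDiffAt_id)

theorem time (h : TSmooth F t z) : SmoothNear (fun s => F s z) t :=
  SmoothNear.comp (f := fun q : ℝ × EuclideanSpace ℝ (Fin n) => F q.1 q.2) (ψ := fun s => (s, z)) h
    (Eventually.of_forall fun _ => contDiffAt_id.prodMk contDiffAt_const)

theorem hasDerivAt (h : TSmooth F t z) : HasDerivAt (fun s => F s z) (dt F t z) t :=
  h.time.differentiableAt.hasDerivAt

theorem dt_eq (h : TSmooth F t z) :
    dt F t z = fderiv ℝ (fun q : ℝ × EuclideanSpace ℝ (Fin n) => F q.1 q.2) (t, z) (1, 0) := by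
  have hf : HasFDerivAt (fun q : ℝ × EuclideanSpace ℝ (Fin n) => F q.1 q.2) _ (t, z) :=
    h.differentiableAt.hasFDerivAt
  have h1 : HasDerivAt (fun s : ℝ => (s, z)) ((1 : ℝ), (0 : EuclideanSpace ℝ (Fin n))) t :=
    (hasDerivAt_id t).prodMk (hasDerivAt_const t z)
  exact (hf.comp_hasDerivAt t h1).deriv

theorem pd_eq (h : TSmooth F t z) (k : Fin n) : pd k (F t) z =
    fderiv ℝ (fun q : ℝ × EuclideanSpace ℝ (Fin n) => F q.1 q.2) (t, z)
      (0, EuclideanSpace.single k 1) := by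
  have h1 := h.differentiableAt.hasFDerivAt.comp z (hasFDerivAt_prodMk_right t z)
  have h2 : fderiv ℝ (F t) z = _ := h1.fderiv
  rw [pd, h2]; rfl

theorem pd (h : TSmooth F t z) (k : Fin n) : TSmooth (fun s => pd k (F s)) t z := by
  refine (SmoothNear.fderiv_apply h (0, EuclideanSpace.single k 1)).congr ?_
  filter_upwards [h.eventually] with q hq using hq.pd_eq k

theorem dt (h : TSmooth F t z) : TSmooth (dt F) t z := by
  refine (SmoothNear.fderiv_apply h (1, 0)).congr ?_
  filter_upwards [h.eventually] with q hq using hq.dt_eq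

/-- Time and space derivatives commute. -/
theorem dt_pd (h : TSmooth F t z) (k : Fin n) :
    ConformalRicci.dt (fun s => ConformalRicci.pd k (F s)) t z =
      ConformalRicci.pd k (ConformalRicci.dt F t) z := by
  rw [(h.pd k).dt_eq, h.dt.pd_eq]
  have e1 : (fun q : ℝ × EuclideanSpace ℝ (Fin n) => ConformalRicci.pd k (F q.1) q.2) =ᶠ[𝓝 (t, z)]
      fun q => fderiv ℝ (fun q : ℝ × EuclideanSpace ℝ (Fin n) => F q.1 q.2) q
        (0, EuclideanSpace.single k 1) := by
    filter_upwards [h.eventually] with q hq using hq.pd_eq k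
  have e2 : (fun q : ℝ × EuclideanSpace ℝ (Fin n) => ConformalRicci.dt F q.1 q.2) =ᶠ[𝓝 (t, z)]
      fun q => fderiv ℝ (fun q : ℝ × EuclideanSpace ℝ (Fin n) => F q.1 q.2) q (1, 0) := by
    filter_upwards [h.eventually] with q hq using hq.dt_eq
  rw [e1.fderiv_eq, e2.fderiv_eq]
  exact SmoothNear.fderiv_comm h _ _

theorem add (h : TSmooth F t z) (h' : TSmooth F' t z) : TSmooth (fun s y => F s y + F' s y) t z :=
  SmoothNear.add h h'

theorem sub (h : TSmooth F t z) (h' : TSmooth F' t z) : TSmooth (fun s y => F s y - F' s y) t z :=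
  SmoothNear.sub h h'

theorem mul (h : TSmooth F t z) (h' : TSmooth F' t z) : TSmooth (fun s y => F s y * F' s y) t z :=
  SmoothNear.mul h h'

theorem sum {ι : Type*} {s : Finset ι} {F : ι → ℝ → EuclideanSpace ℝ (Fin n) → ℝ}
    (h : ∀ i ∈ s, TSmooth (F i) t z) : TSmooth (fun u y => ∑ i ∈ s, F i u y) t z :=
  SmoothNear.sum h

theorem of_space {f : EuclideanSpace ℝ (Fin n) → ℝ} (h : SmoothNear f z) :
    TSmooth (fun _ => f) t z :=
  SmoothNear.comp (f := f) (ψ := fun q : ℝ × EuclideanSpace ℝ (Fin n) => q.2) h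
    (Eventually.of_forall fun _ => contDiffAt_snd)

end TSmooth

theorem dt_congr (h : (fun q : ℝ × EuclideanSpace ℝ (Fin n) => F q.1 q.2) =ᶠ[𝓝 (t, z)]
    fun q => F' q.1 q.2) : dt F t z = dt F' t z :=
  Filter.EventuallyEq.deriv_eq ((Continuous.prodMk_left z).continuousAt.eventually h)

/-- A time-dependent matrix-valued function, smooth in time and space near `(t, z)`. -/
def MTSmooth (A : ℝ → EuclideanSpace ℝ (Fin n) → Matrix (Fin n) (Fin n) ℝ) (t : ℝ)
    (z : EuclideanSpace ℝ (Fin n)) : Prop :=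
  ∀ i j, TSmooth (fun s y => A s y i j) t z

/-- The entrywise time derivative. -/
def dtM (A : ℝ → EuclideanSpace ℝ (Fin n) → Matrix (Fin n) (Fin n) ℝ) (t : ℝ)
    (z : EuclideanSpace ℝ (Fin n)) : Matrix (Fin n) (Fin n) ℝ :=
  Matrix.of fun i j => dt (fun s y => A s y i j) t z

variable {A B : ℝ → EuclideanSpace ℝ (Fin n) → Matrix (Fin n) (Fin n) ℝ}

namespace MTSmooth

theorem eventually (h : MTSmooth A t z) :
    ∀ᶠ q in 𝓝 (t, z), MTSmooth A q.1 q.2 :=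
  eventually_all.2 fun i => eventually_all.2 fun j => (h i j).eventually

theorem space (h : MTSmooth A t z) : MSmoothNear (A t) z := fun i j => (h i j).space

theorem mul (hA : MTSmooth A t z) (hB : MTSmooth B t z) :
    MTSmooth (fun s y => A s y * B s y) t z := fun i j => by
  simp only [Matrix.mul_apply]
  exact TSmooth.sum fun k _ => (hA i k).mul (hB k j)

theorem add (hA : MTSmooth A t z) (hB : MTSmooth B t z) :
    MTSmooth (fun s y => A s y + B s y) t z := fun i j => (hA i j).add (hB i j)

theorem sub (hA : MTSmooth A t z) (hB : MTSmooth B t z) :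
    MTSmooth (fun s y => A s y - B s y) t z := fun i j => (hA i j).sub (hB i j)

theorem transpose (hA : MTSmooth A t z) : MTSmooth (fun s y => (A s y)ᵀ) t z :=
  fun i j => hA j i

theorem pdM (hA : MTSmooth A t z) (k : Fin n) : MTSmooth (fun s => pdM k (A s)) t z :=
  fun i j => (hA i j).pd k

theorem dtM (hA : MTSmooth A t z) : MTSmooth (dtM A) t z := fun i j => (hA i j).dt

theorem inv (hA : MTSmooth A t z) (h0 : (A t z).det ≠ 0) :
    MTSmooth (fun s y => (A s y)⁻¹) t z := fun i j =>
  smoothNear_inv_apply (A := fun q : ℝ × EuclideanSpace ℝ (Fin n) => A q.1 q.2) hA h0 i j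

theorem dtM_mul (hA : MTSmooth A t z) (hB : MTSmooth B t z) :
    ConformalRicci.dtM (fun s y => A s y * B s y) t z =
      ConformalRicci.dtM A t z * B t z + A t z * ConformalRicci.dtM B t z := by
  ext i j
  simp only [ConformalRicci.dtM, Matrix.mul_apply, Matrix.of_apply, Matrix.add_apply,
    ← Finset.sum_add_distrib]
  exact (HasDerivAt.fun_sum fun l _ => (hA i l).hasDerivAt.mul (hB l j).hasDerivAt).deriv

theorem dtM_add (hA : MTSmooth A t z) (hB : MTSmooth B t z) :
    ConformalRicci.dtM (fun s y => A s y + B s y) t z =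
      ConformalRicci.dtM A t z + ConformalRicci.dtM B t z := by
  ext i j
  exact ((hA i j).hasDerivAt.add (hB i j).hasDerivAt).deriv

theorem dtM_sub (hA : MTSmooth A t z) (hB : MTSmooth B t z) :
    ConformalRicci.dtM (fun s y => A s y - B s y) t z =
      ConformalRicci.dtM A t z - ConformalRicci.dtM B t z := by
  ext i j
  exact ((hA i j).hasDerivAt.sub (hB i j).hasDerivAt).deriv

theorem dtM_pdM (hA : MTSmooth A t z) (k : Fin n) :
    ConformalRicci.dtM (fun s => ConformalRicci.pdM k (A s)) t z =
      ConformalRicci.pdM k (ConformalRicci.dtM A t) z := by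
  ext i j
  exact (hA i j).dt_pd k

end MTSmooth

theorem dtM_congr (h : (fun q : ℝ × EuclideanSpace ℝ (Fin n) => A q.1 q.2) =ᶠ[𝓝 (t, z)]
    fun q => B q.1 q.2) : dtM A t z = dtM B t z := by
  ext i j
  refine dt_congr (F := fun s y => A s y i j) (F' := fun s y => B s y i j) ?_
  filter_upwards [h] with q hq
  exact congrFun (congrFun hq i) j

theorem dtM_const (C : Matrix (Fin n) (Fin n) ℝ) : dtM (fun _ _ => C) t z = 0 := by
  ext i j; simp [dtM, dt]

/-- A smooth curve of metrics near `(t, z)`. -/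
structure MetricCurveNear (G : ℝ → EuclideanSpace ℝ (Fin n) → Matrix (Fin n) (Fin n) ℝ) (t : ℝ)
    (z : EuclideanSpace ℝ (Fin n)) : Prop where
  smooth : MTSmooth G t z
  pos : ∀ᶠ q in 𝓝 (t, z), (G q.1 q.2).PosDef

variable {G : ℝ → EuclideanSpace ℝ (Fin n) → Matrix (Fin n) (Fin n) ℝ}

namespace MetricCurveNear

theorem symm (h : MetricCurveNear G t z) : ∀ᶠ q in 𝓝 (t, z), (G q.1 q.2)ᵀ = G q.1 q.2 :=
  h.pos.mono fun q hq => by simpa using hq.isHermitian.eq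

theorem posDef (h : MetricCurveNear G t z) : (G t z).PosDef := h.pos.self_of_nhds

theorem det (h : MetricCurveNear G t z) : (G t z).det ≠ 0 := h.posDef.det_pos.ne'

theorem eventually (h : MetricCurveNear G t z) :
    ∀ᶠ q in 𝓝 (t, z), MetricCurveNear G q.1 q.2 := by
  filter_upwards [h.smooth.eventually, h.pos.eventually_nhds] with q h1 h2 using ⟨h1, h2⟩

theorem metric (h : MetricCurveNear G t z) : MetricNear (G t) z where
  smooth := h.smooth.space
  symm := (Continuous.prodMk_right t).continuousAt.eventually h.symm
  det := h.det

theorem metric_eventually (h : MetricCurveNear G t z) :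
    ∀ᶠ q in 𝓝 (t, z), MTSmooth G q.1 q.2 ∧ MetricNear (G q.1) q.2 := by
  have hc := (smoothNear_det (A := fun q : ℝ × EuclideanSpace ℝ (Fin n) => G q.1 q.2)
    h.smooth).continuousAt.eventually_ne h.det
  filter_upwards [h.smooth.eventually, h.symm.eventually_nhds, hc] with q h1 h2 h3
  exact ⟨h1, h1.space, (Continuous.prodMk_right q.1).continuousAt.eventually h2, h3⟩

theorem smooth_inv (h : MetricCurveNear G t z) : MTSmooth (fun s y => (G s y)⁻¹) t z :=
  h.smooth.inv h.det

theorem smooth_christoffel (h : MetricCurveNear G t z) (k i j : Fin n) :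
    TSmooth (fun s => christoffel (G s) k i j) t z := by
  unfold christoffel
  exact (TSmooth.of_space (smoothNear_const _)).mul (TSmooth.sum fun l _ => (h.smooth_inv k l).mul
    ((((h.smooth j l).pd i).add ((h.smooth i l).pd j)).sub ((h.smooth i j).pd l)))

theorem smooth_conn (h : MetricCurveNear G t z) (k : Fin n) :
    MTSmooth (fun s => conn (G s) k) t z := fun a b => h.smooth_christoffel a k b

theorem smooth_curv (h : MetricCurveNear G t z) (c d : Fin n) :
    MTSmooth (fun s => curv (G s) c d) t z :=
  (((h.smooth_conn d).pdM c).sub ((h.smooth_conn c).pdM d)).add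
    (((h.smooth_conn c).mul (h.smooth_conn d)).sub ((h.smooth_conn d).mul (h.smooth_conn c)))

theorem smooth_ricM (h : MetricCurveNear G t z) : MTSmooth (fun s => ricM (G s)) t z := by
  intro i j
  simp only [ricM, Matrix.of_apply, ricciCoord, ← curv_apply]
  exact TSmooth.sum fun a _ => h.smooth_curv a j a i

theorem smooth_scalarCoord (h : MetricCurveNear G t z) :
    TSmooth (fun s => scalarCoord (G s)) t z :=
  TSmooth.sum fun i _ => TSmooth.sum fun j _ => (h.smooth_inv i j).mul (h.smooth_ricM i j)

theorem dtM_inv (h : MetricCurveNear G t z) :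
    dtM (fun s y => (G s y)⁻¹) t z = -((G t z)⁻¹ * dtM G t z * (G t z)⁻¹) := by
  have hm := h.metric
  have e : dtM (fun s y => G s y * (G s y)⁻¹) t z = 0 := by
    rw [← dtM_const (t := t) (z := z) 1]
    exact dtM_congr (h.metric_eventually.mono fun q hq => hq.2.mul_inv)
  rw [h.smooth.dtM_mul h.smooth_inv] at e
  have e2 : G t z * dtM (fun s y => (G s y)⁻¹) t z = -(dtM G t z * (G t z)⁻¹) :=
    eq_neg_of_add_eq_zero_right e
  have := congrArg (fun X => (G t z)⁻¹ * X) e2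
  simpa only [← Matrix.mul_assoc, hm.inv_mul, Matrix.one_mul, Matrix.mul_neg] using this

/-- Time derivative of the compatibility of the connection with the metric. -/
theorem dt_compat (h : MetricCurveNear G t z) (k : Fin n) :
    pdM k (dtM G t) z = (dtM (fun s => conn (G s) k) t z)ᵀ * G t z
      + (conn (G t) k z)ᵀ * dtM G t z
      + (dtM G t z * conn (G t) k z + G t z * dtM (fun s => conn (G s) k) t z) := by
  have hA := h.smooth_conn k
  have e : dtM (fun s => pdM k (G s)) t z = dtM (fun s y => (conn (G s) k y)ᵀ * G s y
      + G s y * conn (G s) k y) t z :=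
    dtM_congr (h.metric_eventually.mono fun q hq => hq.2.compat k)
  rw [h.smooth.dtM_pdM, MTSmooth.dtM_add (hA.transpose.mul h.smooth) (h.smooth.mul hA),
    hA.transpose.dtM_mul h.smooth, h.smooth.dtM_mul hA] at e
  exact e

theorem dt_conn_symm (h : MetricCurveNear G t z) (k a b : Fin n) :
    dtM (fun s => conn (G s) k) t z a b = dtM (fun s => conn (G s) b) t z a k :=
  dt_congr (F := fun s y => conn (G s) k y a b) (F' := fun s y => conn (G s) b y a k)
    (h.metric_eventually.mono fun _ hq => hq.2.conn_symm k a b)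

end MetricCurveNear

/-- `∂_k R` is the trace of `∇_k Ric`. -/
theorem MetricNear.pd_scalarCoord {G : EuclideanSpace ℝ (Fin n) → Matrix (Fin n) (Fin n) ℝ}
    (h : MetricNear G z) (k : Fin n) :
    pd k (scalarCoord G) z = ((G z)⁻¹ * (covRic G k z)ᵀ).trace := by
  have hI := h.smooth.inv h.det
  have hR := h.smooth_ricM
  have e : scalarCoord G = fun z => ∑ i, ((G z)⁻¹ * (ricM G z)ᵀ) i i := by
    ext w; rw [scalarCoord_eq_trace]; rfl
  have e2 : pd k (scalarCoord G) z = (pdM k (fun y => (G y)⁻¹ * (ricM G y)ᵀ) z).trace := by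
    rw [e, pd_sum fun i _ => (hI.mul hR.transpose i i).differentiableAt]; rfl
  rw [e2, pdM_mul hI hR.transpose, h.pdM_inv, h.compat, pdM_transpose, covRic]
  have a1 : (G z)⁻¹ * ((conn G k z)ᵀ * G z + G z * conn G k z) * (G z)⁻¹ =
      (G z)⁻¹ * (conn G k z)ᵀ * (G z * (G z)⁻¹) + ((G z)⁻¹ * G z) * conn G k z * (G z)⁻¹ := by
    noncomm_ring
  rw [a1, h.mul_inv, h.inv_mul]
  simp only [Matrix.transpose_sub, Matrix.transpose_mul, Matrix.transpose_transpose, Matrix.mul_sub,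
    Matrix.mul_one, Matrix.one_mul, neg_add, Matrix.add_mul, Matrix.neg_mul, Matrix.trace_add,
    Matrix.trace_neg, Matrix.trace_sub]
  have t1 : (conn G k z * (G z)⁻¹ * (ricM G z)ᵀ).trace
      = ((G z)⁻¹ * ((ricM G z)ᵀ * conn G k z)).trace := by
    rw [Matrix.mul_assoc, Matrix.trace_mul_comm, Matrix.mul_assoc]
  rw [t1, Matrix.mul_assoc]
  ring

/-- The first variation of the connection along the flow is governed by the gradient of
`R + 2 (n - 1) φ`. -/
theorem MetricCurveNear.variation_eq (h : MetricCurveNear G t z)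
    {φ : EuclideanSpace ℝ (Fin n) → ℝ} (hφ : SmoothNear φ z)
    (hev : ∀ᶠ y in 𝓝 z, dtM G t y = (-2 : ℝ) • ricM (G t) y + (-2 * φ y) • G t y) (a : Fin n) :
    ∑ i, ∑ j, (G t z)⁻¹ i j * dtM (fun s => conn (G s) i) t z a j
      - ∑ b, (G t z)⁻¹ a b * (dtM (fun s => conn (G s) b) t z).trace
      = ∑ b, (G t z)⁻¹ a b *
        (pd b (scalarCoord (G t)) z + 2 * ((n : ℝ) - 1) * pd b φ z) := by
  have hm := h.metric
  set g := G t z with hg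
  set C : Fin n → Matrix (Fin n) (Fin n) ℝ := fun k => dtM (fun s => conn (G s) k) t z with hC
  -- the time derivative of the compatibility of the connection with the metric, in covariant form:
  -- `C_kᵀ g + g C_k = ∇_k ∂_t g`
  have star : ∀ k, (C k)ᵀ * g + g * C k = (-2 : ℝ) • covRic (G t) k z + (-2 * pd k φ z) • g := by
    intro k
    have e1 := h.dt_compat k
    have e2 : pdM k (dtM G t) z = (-2 : ℝ) • pdM k (ricM (G t)) z
        + ((-2 * pd k φ z) • g + (-2 * φ z) • pdM k (G t) z) := by
      have s2 : SmoothNear (fun y => -2 * φ y) z := (smoothNear_const _).mul hφ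
      rw [pdM_congr hev, pdM_add (MSmoothNear.smul (smoothNear_const _) hm.smooth_ricM)
        (MSmoothNear.smul s2 hm.smooth), pdM_smul (smoothNear_const _) hm.smooth_ricM,
        pdM_smul s2 hm.smooth, pd_const, pd_const_mul, zero_smul, zero_add]
    rw [e2, hm.compat, hev.self_of_nhds] at e1
    have e3 : (C k)ᵀ * g + g * C k = (-2 : ℝ) • pdM k (ricM (G t)) z
        + ((-2 * pd k φ z) • g + (-2 * φ z) • ((conn (G t) k z)ᵀ * g + g * conn (G t) k z))
        - (conn (G t) k z)ᵀ * ((-2 : ℝ) • ricM (G t) z + (-2 * φ z) • g)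
        - ((-2 : ℝ) • ricM (G t) z + (-2 * φ z) • g) * conn (G t) k z := by
      rw [e1]; abel
    rw [e3, covRic]
    simp only [smul_sub, smul_add, Matrix.mul_add, Matrix.add_mul, Matrix.mul_smul,
      Matrix.smul_mul]
    abel
  -- the trace of `star`
  have tr : ∀ k, (C k).trace = -pd k (scalarCoord (G t)) z - n * pd k φ z := by
    intro k
    have e := congrArg (fun X => (g⁻¹ * Xᵀ).trace) (star k)
    simp only [Matrix.transpose_add, Matrix.transpose_mul, Matrix.transpose_transpose,
      Matrix.transpose_smul, Matrix.mul_add, Matrix.mul_smul, Matrix.trace_add,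
      Matrix.trace_smul, smul_eq_mul] at e
    have hs : gᵀ = g := hm.symm.self_of_nhds
    rw [← hm.pd_scalarCoord, hs, ← Matrix.mul_assoc, hm.inv_mul, Matrix.one_mul, Matrix.trace_one,
      Matrix.trace_mul_comm, Matrix.mul_assoc, hm.mul_inv, Matrix.mul_one, Matrix.trace_transpose,
      Fintype.card_fin] at e
    linarith
  -- the divergence of `star`, by the contracted Bianchi identity
  have div : ∀ j, ∑ l, (∑ k, ∑ i, g⁻¹ k i * C k l i) * g l j + (C j).trace
      = -pd j (scalarCoord (G t)) z - 2 * pd j φ z := by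
    intro j
    have e : ∑ k, ∑ i, g⁻¹ k i * ((C k)ᵀ * g + g * C k) i j =
        ∑ k, ∑ i, g⁻¹ k i * ((-2 : ℝ) • covRic (G t) k z + (-2 * pd k φ z) • g) i j := by
      simp only [star]
    have r : ∑ k, ∑ i, g⁻¹ k i * ((-2 : ℝ) • covRic (G t) k z + (-2 * pd k φ z) • g) i j
        = -pd j (scalarCoord (G t)) z - 2 * pd j φ z := by
      simp only [Matrix.add_apply, Matrix.smul_apply, smul_eq_mul, mul_add, Finset.sum_add_distrib]
      have b := hm.bianchi h.posDef j
      have r1 : ∑ k, ∑ i, g⁻¹ k i * (-2 * covRic (G t) k z i j) = -pd j (scalarCoord (G t)) z := by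
        have : ∀ k i, g⁻¹ k i * (-2 * covRic (G t) k z i j) =
            (-2) * (g⁻¹ k i * covRic (G t) k z i j) := fun k i => by ring
        rw [← hg] at b
        simp only [this, ← Finset.mul_sum]
        rw [b]
        ring
      have r2 : ∑ k, ∑ i, g⁻¹ k i * (-2 * pd k φ z * g i j) = -2 * pd j φ z := by
        have : ∀ k, ∑ i, g⁻¹ k i * (-2 * pd k φ z * g i j) = -2 * pd k φ z * (g⁻¹ * g) k j := by
          intro k
          rw [Matrix.mul_apply, Finset.mul_sum]
          exact Finset.sum_congr rfl fun i _ => by ring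
        simp only [this]
        rw [hm.inv_mul]
        simp [Matrix.one_apply]
      rw [r1, r2]; ring
    rw [← r, ← e]
    simp only [Matrix.add_apply, mul_add, Finset.sum_add_distrib, Matrix.mul_apply,
      Matrix.transpose_apply]
    congr 1
    · simp only [Finset.sum_mul, Finset.mul_sum]
      rw [Finset.sum_comm]
      refine Finset.sum_congr rfl fun k _ => ?_
      rw [Finset.sum_comm]
      exact Finset.sum_congr rfl fun i _ => Finset.sum_congr rfl fun l _ => by ring
    · have : ∀ k, ∑ i, g⁻¹ k i * ∑ l, g i l * C k l j = C j k k := by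
        intro k
        have e4 : (g⁻¹ * (g * C k)) k j = ∑ i, g⁻¹ k i * ∑ l, g i l * C k l j := by
          simp only [Matrix.mul_apply]
        rw [← e4, ← Matrix.mul_assoc, hm.inv_mul, Matrix.one_mul]
        exact h.dt_conn_symm k k j
      simp only [this]; rfl
  set W : Fin n → ℝ := fun l => ∑ k, ∑ i, g⁻¹ k i * C k l i with hW
  -- `div` determines `W` with its index lowered; it is raised again by `g⁻¹`
  have hWv : W a = ∑ b, g⁻¹ a b * ∑ l, W l * g l b := by
    have e1 : W ᵥ* (g * g⁻¹) = W := by rw [hm.mul_inv, Matrix.vecMul_one]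
    rw [← Matrix.vecMul_vecMul] at e1
    conv_lhs => rw [← e1]
    simp only [Matrix.vecMul, dotProduct]
    refine Finset.sum_congr rfl fun b _ => ?_
    have : g⁻¹ b a = g⁻¹ a b := by
      conv_lhs => rw [← hm.inv_symm]
      rfl
    rw [this, mul_comm]
  change W a - ∑ b, g⁻¹ a b * (C b).trace = _
  rw [hWv, ← Finset.sum_sub_distrib]
  refine Finset.sum_congr rfl fun b _ => ?_
  rw [← mul_sub]
  have := div b
  have t2 := tr b
  congr 1
  linarith

/-- The evolution of the scalar curvature, at a point where the coordinates are normal. -/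
theorem MetricCurveNear.evolution_of_normal (h : MetricCurveNear G t z) (hN : NormalAt (G t) z)
    {φ : EuclideanSpace ℝ (Fin n) → ℝ} (hφ : SmoothNear φ z)
    (hev : ∀ᶠ y in 𝓝 z, dtM G t y = (-2 : ℝ) • ricM (G t) y + (-2 * φ y) • G t y) :
    dt (fun s => scalarCoord (G s)) t z = -laplacianCoord (G t) (scalarCoord (G t)) z
      - 2 * ((n : ℝ) - 1) * laplacianCoord (G t) φ z + 2 * ricciNormSqCoord (G t) z
      + 2 * φ z * scalarCoord (G t) z := by
  have hm := h.metric
  have hA := h.smooth_conn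
  have hR := h.smooth_ricM
  set C : Fin n → EuclideanSpace ℝ (Fin n) → Matrix (Fin n) (Fin n) ℝ := fun k y =>
    dtM (fun s => conn (G s) k) t y with hC
  have hCs : ∀ k, MSmoothNear (C k) z := fun k => (hA k).dtM.space
  -- the time derivative in terms of the variation of the connection
  have d1 : dt (fun s => scalarCoord (G s)) t z =
      (-(dtM G t z) * (ricM (G t) z)ᵀ).trace + ∑ i, ∑ a, (pd a (fun y => C i y a i) z
        - pd i (fun y => C a y a i) z) := by
    have e : dt (fun s => scalarCoord (G s)) t z =
        (dtM (fun s y => (G s y)⁻¹ * (ricM (G s) y)ᵀ) t z).trace := by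
      have e1 : (fun s => scalarCoord (G s)) = fun s y => ∑ i, ((G s y)⁻¹ * (ricM (G s) y)ᵀ) i i := by
        ext s y; rw [scalarCoord_eq_trace]; rfl
      rw [e1]
      exact (HasDerivAt.fun_sum fun i _ => (h.smooth_inv.mul hR.transpose i i).hasDerivAt).deriv
    rw [e, h.smooth_inv.dtM_mul hR.transpose, h.dtM_inv, hN.inv_eq, Matrix.trace_add]
    congr 1
    · simp
    · rw [Matrix.one_mul]
      refine Finset.sum_congr rfl fun i _ => ?_
      change dt (fun s y => ricM (G s) y i i) t z = _
      have e2 : (fun s y => ricM (G s) y i i) = fun s y => ∑ a, curv (G s) a i y a i := by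
        ext s y; simp only [ricM, Matrix.of_apply, ricciCoord, curv_apply]
      have e3 : dt (fun s y => ∑ a, curv (G s) a i y a i) t z
          = ∑ a, dtM (fun s => curv (G s) a i) t z a i :=
        (HasDerivAt.fun_sum fun a _ => (h.smooth_curv a i a i).hasDerivAt).deriv
      rw [e2, e3]
      refine Finset.sum_congr rfl fun a _ => ?_
      have e4 : dtM (fun s => curv (G s) a i) t z = pdM a (C i) z - pdM i (C a) z := by
        unfold curv
        have p1 := (hA i).pdM a
        have p2 := (hA a).pdM i
        have m1 := (hA a).mul (hA i)
        have m2 := (hA i).mul (hA a)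
        rw [(p1.sub p2).dtM_add (m1.sub m2), p1.dtM_sub p2, m1.dtM_sub m2,
          (hA a).dtM_mul (hA i), (hA i).dtM_mul (hA a), (hA i).dtM_pdM, (hA a).dtM_pdM,
          hN.conn_eq, hN.conn_eq]
        simp [hC]
      rw [e4]; rfl
  -- the divergence of the variation vector field
  set f : EuclideanSpace ℝ (Fin n) → ℝ := fun y =>
    scalarCoord (G t) y + 2 * ((n : ℝ) - 1) * φ y with hf
  have hfs : SmoothNear f z := hm.smooth_scalarCoord.add ((smoothNear_const _).mul hφ)
  have hI := hm.smooth.inv hm.det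
  have W : ∀ a, (fun y => ∑ i, ∑ j, (G t y)⁻¹ i j * C i y a j
      - ∑ b, (G t y)⁻¹ a b * (C b y).trace) =ᶠ[𝓝 z] fun y => ∑ b, (G t y)⁻¹ a b * pd b f y := by
    intro a
    have hG : ∀ᶠ y in 𝓝 z, MetricCurveNear G t y :=
      (Continuous.prodMk_right t).continuousAt.eventually h.eventually
    filter_upwards [hG, hφ.eventually, hev.eventually_nhds, hm.eventually] with y h1 h2 h3 h4
    rw [h1.variation_eq h2 h3 a]
    refine Finset.sum_congr rfl fun b _ => ?_
    congr 1
    rw [hf, pd_add h4.smooth_scalarCoord.differentiableAt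
      ((smoothNear_const _).mul h2).differentiableAt, pd_const_mul]
  have d2 : ∀ a, ∑ i, pd a (fun y => C i y a i) z - pd a (fun y => (C a y).trace) z
      = pd a (pd a f) z := by
    intro a
    have pI : ∀ i j, pd a (fun y => (G t y)⁻¹ i j) z = 0 := fun i j =>
      congrFun (congrFun (hN.pdM_inv a) i) j
    have key : ∀ (i j : Fin n) (u : EuclideanSpace ℝ (Fin n) → ℝ), SmoothNear u z →
        pd a (fun y => (G t y)⁻¹ i j * u y) z = (1 : Matrix (Fin n) (Fin n) ℝ) i j * pd a u z := by
      intro i j u hu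
      have e := pd_mul (k := a) (hI i j).differentiableAt hu.differentiableAt
      rw [pI] at e
      rw [e]
      change 0 * u z + (G t z)⁻¹ i j * pd a u z = _
      rw [hN.inv_eq, zero_mul, zero_add]
    have tS : ∀ b, SmoothNear (fun y => (C b y).trace) z := fun b =>
      SmoothNear.sum fun i _ => hCs b i i
    have l := pd_congr (k := a) (W a)
    rw [pd_sub (SmoothNear.sum fun i _ => SmoothNear.sum fun j _ =>
      (hI i j).mul (hCs i a j)).differentiableAt (SmoothNear.sum fun b _ =>
        (hI a b).mul (tS b)).differentiableAt, pd_sum fun i _ => (SmoothNear.sum fun j _ =>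
      (hI i j).mul (hCs i a j)).differentiableAt, pd_sum fun b _ =>
        ((hI a b).mul (tS b)).differentiableAt, pd_sum fun b _ =>
        ((hI a b).mul (hfs.pd b)).differentiableAt] at l
    simp only [fun i => pd_sum (k := a) (s := Finset.univ) (z := z)
      (f := fun j y => (G t y)⁻¹ i j * C i y a j)
      fun j _ => ((hI i j).mul (hCs i a j)).differentiableAt] at l
    simp only [fun i j => key i j _ (hCs i a j), fun b => key a b _ (tS b),
      fun b => key a b _ (hfs.pd b)] at l
    simpa [Matrix.one_apply] using l
  -- the second term of `d1` is the divergence of that vector field, as the variation of the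
  -- connection is symmetric
  have d3 : ∑ i, ∑ a, (pd a (fun y => C i y a i) z - pd i (fun y => C a y a i) z)
      = ∑ a, pd a (pd a f) z := by
    simp only [← d2, Finset.sum_sub_distrib]
    congr 1
    · rw [Finset.sum_comm]
    · refine Finset.sum_congr rfl fun i _ => ?_
      have : (fun y => (C i y).trace) =ᶠ[𝓝 z] fun y => ∑ a, C a y a i := by
        have hs := (Continuous.prodMk_right t).continuousAt.eventually
          h.metric_eventually.eventually_nhds
        filter_upwards [hs] with y hy
        refine Finset.sum_congr rfl fun a _ => ?_
        exact dt_congr (F := fun s y => conn (G s) i y a a) (F' := fun s y => conn (G s) a y a i)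
          (hy.mono fun _ hq => hq.2.conn_symm i a a)
      rw [pd_congr this, pd_sum fun a _ => (hCs a a i).differentiableAt]
  -- in normal coordinates the Laplacian is the flat one
  have d4 : ∀ u : EuclideanSpace ℝ (Fin n) → ℝ, laplacianCoord (G t) u z
      = -∑ a, pd a (pd a u) z := by
    intro u
    have c0 : ∀ k i j, christoffel (G t) k i j z = 0 := fun k i j =>
      congrFun (congrFun (hN.conn_eq i) k) j
    simp [laplacianCoord, hN.inv_eq, Matrix.one_apply, c0]
  have d5 : ∀ a, pd a (pd a f) z = pd a (pd a (scalarCoord (G t))) z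
      + 2 * ((n : ℝ) - 1) * pd a (pd a φ) z := by
    intro a
    have : pd a f =ᶠ[𝓝 z] fun y => pd a (scalarCoord (G t)) y + 2 * ((n : ℝ) - 1) * pd a φ y := by
      filter_upwards [hφ.eventually, hm.eventually] with y h2 h4
      rw [hf, pd_add h4.smooth_scalarCoord.differentiableAt
        ((smoothNear_const _).mul h2).differentiableAt, pd_const_mul]
    rw [pd_congr this, pd_add (hm.smooth_scalarCoord.pd a).differentiableAt
      ((smoothNear_const _).mul (hφ.pd a)).differentiableAt, pd_const_mul]
  -- the contribution of the variation of the inverse metric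
  have d6 : (-(dtM G t z) * (ricM (G t) z)ᵀ).trace = 2 * ricciNormSqCoord (G t) z
      + 2 * φ z * scalarCoord (G t) z := by
    rw [hev.self_of_nhds, ricciNormSqCoord_eq_trace, scalarCoord_eq_trace, hN.inv_eq, hN.eq_one]
    simp only [neg_add, Matrix.add_mul, ← neg_smul, Matrix.smul_mul, Matrix.trace_add,
      Matrix.trace_smul, smul_eq_mul, Matrix.mul_one, Matrix.transpose_one, Matrix.one_mul]
    ring
  rw [d1, d3, d6, d4, d4]
  simp only [d5, Finset.sum_add_distrib, ← Finset.mul_sum]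
  ring

/-- The evolution of the scalar curvature along the reduced flow, in arbitrary coordinates. -/
theorem MetricCurveNear.evolution (h : MetricCurveNear G t z)
    {φ : EuclideanSpace ℝ (Fin n) → ℝ} (hφ : SmoothNear φ z)
    (hev : ∀ᶠ y in 𝓝 z, dtM G t y = (-2 : ℝ) • ricM (G t) y + (-2 * φ y) • G t y) :
    dt (fun s => scalarCoord (G s)) t z = -laplacianCoord (G t) (scalarCoord (G t)) z
      - 2 * ((n : ℝ) - 1) * laplacianCoord (G t) φ z + 2 * ricciNormSqCoord (G t) z
      + 2 * φ z * scalarCoord (G t) z := by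
  obtain ⟨ψ, h0, hs, hJd, h1, hd⟩ := h.metric.exists_normal h.posDef
  -- the pullback of the curve of metrics by coordinates normal for `G t` is again a smooth curve of
  -- metrics, and all terms of the formula are invariant
  set Gt : ℝ → EuclideanSpace ℝ (Fin n) → Matrix (Fin n) (Fin n) ℝ :=
    fun s y => (jacobian ψ y)ᵀ * G s (ψ y) * jacobian ψ y with hGt
  have hJ := MSmoothNear.jacobian hs
  have hJT : MTSmooth (fun _ => jacobian ψ) t 0 := fun i j => TSmooth.of_space (hJ i j)
  have hc : ContinuousAt (fun q : ℝ × EuclideanSpace ℝ (Fin n) => (q.1, ψ q.2)) (t, 0) :=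
    continuousAt_fst.prodMk (hs.continuousAt.comp_of_eq continuousAt_snd rfl)
  have hc' : Tendsto (fun q : ℝ × EuclideanSpace ℝ (Fin n) => (q.1, ψ q.2)) (𝓝 (t, 0))
      (𝓝 (t, z)) := by simpa [ContinuousAt, h0] using hc
  have hGψ : MTSmooth (fun s y => G s (ψ y)) t 0 := fun i j => by
    have hsm : SmoothNear (fun q : ℝ × EuclideanSpace ℝ (Fin n) => (q.1, ψ q.2)) (t, 0) := by
      have := (continuousAt_snd (p := ((t, 0) : ℝ × EuclideanSpace ℝ (Fin n)))).eventually hs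
      filter_upwards [this] with q hq using contDiffAt_fst.prodMk (hq.comp q contDiffAt_snd)
    refine SmoothNear.comp (f := fun q : ℝ × EuclideanSpace ℝ (Fin n) => G q.1 q.2 i j)
      (ψ := fun q : ℝ × EuclideanSpace ℝ (Fin n) => (q.1, ψ q.2)) ?_ hsm
    have := h.smooth i j
    rw [← h0] at this
    exact this
  have hjne : ∀ᶠ q in 𝓝 ((t, 0) : ℝ × EuclideanSpace ℝ (Fin n)), (jacobian ψ q.2).det ≠ 0 :=
    (continuousAt_snd (p := ((t, 0) : ℝ × EuclideanSpace ℝ (Fin n)))).eventually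
      ((smoothNear_det hJ).continuousAt.eventually_ne hJd)
  have hCt : MetricCurveNear Gt t 0 := by
    refine ⟨(hJT.transpose.mul hGψ).mul hJT, ?_⟩
    filter_upwards [hc'.eventually h.pos, hjne] with q h2 h3
    have hu : IsUnit (jacobian ψ q.2) := (Matrix.isUnit_iff_isUnit_det _).2 (isUnit_iff_ne_zero.2 h3)
    have := h2.conjTranspose_mul_mul_same (B := jacobian ψ q.2)
      (Matrix.mulVec_injective_iff_isUnit.2 hu)
    simpa [hGt] using this
  have hP : ∀ᶠ q in 𝓝 ((t, 0) : ℝ × EuclideanSpace ℝ (Fin n)),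
      PullbackNear ψ (G q.1) (Gt q.1) q.2 := by
    filter_upwards [hc'.eventually h.metric_eventually, hjne,
      continuousAt_snd.eventually hs.eventually] with q h2 h3 h4
    exact ⟨h4, h3, h2.2, Eventually.of_forall fun _ => rfl⟩
  have hP0 : PullbackNear ψ (G t) (Gt t) 0 := hP.self_of_nhds
  have hN : NormalAt (Gt t) 0 := { hP0.metric' with eq_one := h1, pd_eq_zero := hd }
  have hev' : ∀ᶠ y in 𝓝 0, dtM Gt t y =
      (-2 : ℝ) • ricM (Gt t) y + (-2 * φ (ψ y)) • Gt t y := by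
    have c0 : Tendsto ψ (𝓝 0) (𝓝 z) := by simpa [ContinuousAt, h0] using hs.continuousAt
    filter_upwards [c0.eventually hev, hP0.eventually,
      (Continuous.prodMk_right t).continuousAt.eventually (hJT.eventually.and hGψ.eventually)]
      with y h2 h3 h4
    obtain ⟨h5, h6⟩ := h4
    have e1 : dtM (fun _ => jacobian ψ) t y = 0 := by ext i j; simp [dtM, dt]
    have e2 : dtM (fun _ y => (jacobian ψ y)ᵀ) t y = 0 := by ext i j; simp [dtM, dt]
    have e3 : dtM (fun s y => G s (ψ y)) t y = dtM G t (ψ y) := rfl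
    rw [MTSmooth.dtM_mul (h5.transpose.mul h6) h5, h5.transpose.dtM_mul h6, e1, e2, e3, h2,
      h3.ricM_eq]
    simp only [hGt, Matrix.zero_mul, Matrix.mul_zero, zero_add, add_zero, Matrix.mul_add,
      Matrix.add_mul, Matrix.mul_smul, Matrix.smul_mul]
  have hφ' : SmoothNear φ (ψ 0) := by rwa [h0]
  have key := hCt.evolution_of_normal hN (hφ'.comp hs) hev'
  have hRs : SmoothNear (scalarCoord (G t)) (ψ 0) := hP0.metric.smooth_scalarCoord
  have r1 : dt (fun s => scalarCoord (Gt s)) t 0 = dt (fun s => scalarCoord (G s)) t z := by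
    have : dt (fun s y => scalarCoord (G s) (ψ y)) t 0 = dt (fun s => scalarCoord (G s)) t z := by
      simp only [dt, h0]
    rw [← this]
    exact dt_congr (hP.mono fun q hq => hq.scalarCoord_eq)
  have r2 : laplacianCoord (Gt t) (scalarCoord (Gt t)) 0
      = laplacianCoord (G t) (scalarCoord (G t)) z := by
    have e : scalarCoord (Gt t) =ᶠ[𝓝 0] fun y => scalarCoord (G t) (ψ y) :=
      hP0.eventually.mono fun y hy => hy.scalarCoord_eq
    have e2 : laplacianCoord (Gt t) (scalarCoord (Gt t)) 0
        = laplacianCoord (Gt t) (fun y => scalarCoord (G t) (ψ y)) 0 := by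
      simp only [laplacianCoord, pd_congr e, fun i j => pd_congr (k := i) (pd_eventuallyEq (k := j) e)]
    rw [e2, hP0.laplacianCoord_eq hRs, h0]
  have r3 := hP0.laplacianCoord_eq hφ'
  have r4 := hP0.ricciNormSqCoord_eq
  have r5 := hP0.scalarCoord_eq
  rw [h0] at r3 r4 r5
  rw [r1, r2, r3, r4, r5, h0] at key
  exact key

end Evolution

end

section

set_option linter.unusedSectionVars false

open Filter Topology

/-! ### Differential operators generated by derivations -/

section Words

variable {Q : Type*} [TopologicalSpace Q] [CompactSpace Q] {F : Subalgebra ℝ C(Q, ℝ)}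
  {ι : Type} [Fintype ι]

/-- Words of length `k` in the letters `ι` and one further letter `none`, which stands for the
identity. With this letter, words of length `k` describe all derivatives of order at most `k`. -/
def Wd (ι : Type) : ℕ → Type
  | 0 => Unit
  | k + 1 => Option ι × Wd ι k

instance instFintypeWd : ∀ k, Fintype (Wd ι k)
  | 0 => inferInstanceAs (Fintype Unit)
  | k + 1 => haveI := instFintypeWd k; inferInstanceAs (Fintype (Option ι × Wd ι k))

theorem sum_wd_succ {β : Type*} [AddCommMonoid β] {k : ℕ} (f : Wd ι (k + 1) → β) :
    ∑ a, f a = ∑ b : Wd ι k, f (none, b) + ∑ l : ι, ∑ b : Wd ι k, f (some l, b) := by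
  exact (Fintype.sum_prod_type (fun a : Option ι × Wd ι k => f a)).trans
    (Fintype.sum_option fun o => ∑ b : Wd ι k, f (o, b))

/-- The operator of a letter. -/
def letterOp (X : ι → Derivation ℝ F F) : Option ι → F →ₗ[ℝ] F
  | none => LinearMap.id
  | some l => (X l : F →ₗ[ℝ] F)

/-- The differential operator of a word. -/
def wordOp (X : ι → Derivation ℝ F F) : (k : ℕ) → Wd ι k → F →ₗ[ℝ] F
  | 0, _ => LinearMap.id
  | k + 1, a => letterOp X a.1 ∘ₗ wordOp X k a.2

variable {X : ι → Derivation ℝ F F}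

@[simp] theorem wordOp_zero (a : Wd ι 0) (u : F) : wordOp X 0 a u = u := rfl

@[simp] theorem wordOp_none {k : ℕ} (a : Wd ι k) (u : F) :
    wordOp X (k + 1) (none, a) u = wordOp X k a u := rfl

@[simp] theorem wordOp_some {k : ℕ} (l : ι) (a : Wd ι k) (u : F) :
    wordOp X (k + 1) (some l, a) u = X l (wordOp X k a u) := rfl

/-! ### Jets and their supremum norms -/

variable {S : Type*} [Fintype S]

/-- The jet of a function with respect to a finite family of operators, as a continuous map into
a Euclidean space. -/
def jetMap (D : S → F →ₗ[ℝ] F) : F →ₗ[ℝ] C(Q, EuclideanSpace ℝ S) where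
  toFun u := ⟨fun x => WithLp.toLp 2 fun a => (D a u).1 x,
    (PiLp.continuous_toLp 2 _).comp (continuous_pi fun a => (D a u).1.continuous)⟩
  map_add' u v := by ext x a; simp
  map_smul' c u := by ext x a; simp

@[simp] theorem jetMap_apply (D : S → F →ₗ[ℝ] F) (u : F) (x : Q) (a : S) :
    jetMap D u x a = (D a u).1 x := rfl

theorem norm_jetMap_apply_sq (D : S → F →ₗ[ℝ] F) (u : F) (x : Q) :
    ‖jetMap D u x‖ ^ 2 = ∑ a, ((D a u).1 x) ^ 2 := by
  rw [EuclideanSpace.norm_sq_eq]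
  simp

theorem norm_apply_le (u : F) (x : Q) : |u.1 x| ≤ ‖u.1‖ := by
  simpa using u.1.norm_coe_le_norm x

theorem norm_le_norm_jetMap (D : S → F →ₗ[ℝ] F) (u : F) (a : S) :
    ‖(D a u).1‖ ≤ ‖jetMap D u‖ := by
  refine (ContinuousMap.norm_le _ (norm_nonneg _)).2 fun x => ?_
  have h1 : ‖jetMap D u x a‖ ≤ ‖jetMap D u x‖ := PiLp.norm_apply_le _ a
  exact h1.trans ((jetMap D u).norm_coe_le_norm x)

theorem euclidean_norm_le_sum (v : EuclideanSpace ℝ S) : ‖v‖ ≤ ∑ a, |v a| := by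
  refine abs_le_of_sq_le_sq' ?_ (Finset.sum_nonneg fun a _ => abs_nonneg _) |>.2
  rw [EuclideanSpace.norm_sq_eq]
  exact Finset.sum_sq_le_sq_sum_of_nonneg fun a _ => abs_nonneg _

theorem norm_jetMap_le (D : S → F →ₗ[ℝ] F) (u : F) :
    ‖jetMap D u‖ ≤ ∑ a, ‖(D a u).1‖ := by
  refine (ContinuousMap.norm_le _ (Finset.sum_nonneg fun a _ => norm_nonneg _)).2 fun x => ?_
  exact (euclidean_norm_le_sum _).trans (Finset.sum_le_sum fun a _ => norm_apply_le _ x)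

variable (X) in
/-- The `C^k` norm defined by the derivations `X`: the supremum over the points of the Euclidean
norm of the jet. The averages along a deformation increase it by a factor `1 + O(s²)` only because
the norm of the jet at a point is Euclidean. -/
def ckNorm (k : ℕ) (u : F) : ℝ := ‖jetMap (wordOp X k) u‖

theorem ckNorm_nonneg (k : ℕ) (u : F) : 0 ≤ ckNorm X k u := norm_nonneg _

theorem ckNorm_add_le (k : ℕ) (u v : F) : ckNorm X k (u + v) ≤ ckNorm X k u + ckNorm X k v := by
  unfold ckNorm; rw [map_add]; exact norm_add_le _ _

theorem ckNorm_sub_le (k : ℕ) (u v : F) : ckNorm X k (u - v) ≤ ckNorm X k u + ckNorm X k v := by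
  unfold ckNorm; rw [map_sub]; exact norm_sub_le _ _

theorem ckNorm_smul (k : ℕ) (c : ℝ) (u : F) : ckNorm X k (c • u) = |c| * ckNorm X k u := by
  unfold ckNorm; rw [map_smul, norm_smul, Real.norm_eq_abs]

theorem ckNorm_sum_le {α : Type*} (s : Finset α) (k : ℕ) (u : α → F) :
    ckNorm X k (∑ i ∈ s, u i) ≤ ∑ i ∈ s, ckNorm X k (u i) := by
  unfold ckNorm; rw [map_sum]; exact norm_sum_le _ _

theorem norm_wordOp_le (k : ℕ) (a : Wd ι k) (u : F) : ‖(wordOp X k a u).1‖ ≤ ckNorm X k u :=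
  norm_le_norm_jetMap _ u a

theorem ckNorm_mono_succ (k : ℕ) (u : F) : ckNorm X k u ≤ ckNorm X (k + 1) u := by
  refine (ContinuousMap.norm_le _ (norm_nonneg _)).2 fun x => ?_
  refine le_trans ?_ ((jetMap (wordOp X (k + 1)) u).norm_coe_le_norm x)
  refine abs_le_of_sq_le_sq' ?_ (norm_nonneg _) |>.2
  rw [norm_jetMap_apply_sq, norm_jetMap_apply_sq, sum_wd_succ]
  simp only [wordOp_none]
  have : 0 ≤ ∑ l : ι, ∑ b : Wd ι k, ((wordOp X (k + 1) (some l, b) u).1 x) ^ 2 :=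
    Finset.sum_nonneg fun _ _ => Finset.sum_nonneg fun _ _ => sq_nonneg _
  linarith

theorem ckNorm_mono {j k : ℕ} (h : j ≤ k) (u : F) : ckNorm X j u ≤ ckNorm X k u :=
  monotone_nat_of_le_succ (f := fun k => ckNorm X k u) (fun k => ckNorm_mono_succ k u) h

theorem ckNorm_zero_eq (u : F) : ckNorm X 0 u ≤ ‖u.1‖ := by
  refine (norm_jetMap_le _ u).trans ?_
  exact (Finset.sum_singleton (fun a : Wd ι 0 => ‖(wordOp X 0 a u).1‖) (() : Unit)).le

/-! ### The filtration by order -/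

variable (X) in
/-- Linear differential operators of order at most `k`: combinations of the words of length `k` with
functions as coefficients. -/
def diffOp (k : ℕ) : Submodule F (F →ₗ[ℝ] F) := Submodule.span F (Set.range (wordOp X k))

theorem wordOp_mem {k : ℕ} (a : Wd ι k) : wordOp X k a ∈ diffOp X k :=
  Submodule.subset_span ⟨a, rfl⟩

theorem diffOp_mono_succ {k : ℕ} {L : F →ₗ[ℝ] F} (h : L ∈ diffOp X k) : L ∈ diffOp X (k + 1) := by
  refine Submodule.span_le.2 ?_ h
  rintro _ ⟨a, rfl⟩
  exact wordOp_mem (k := k + 1) (none, a)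

theorem diffOp_mono {j k : ℕ} (hjk : j ≤ k) {L : F →ₗ[ℝ] F} (h : L ∈ diffOp X j) :
    L ∈ diffOp X k := by
  induction hjk with
  | refl => exact h
  | step _ ih => exact diffOp_mono_succ ih

theorem letterOp_comp_mem {k : ℕ} {L : F →ₗ[ℝ] F} (h : L ∈ diffOp X k) (o : Option ι) :
    letterOp X o ∘ₗ L ∈ diffOp X (k + 1) := by
  refine Submodule.span_induction (p := fun L _ => letterOp X o ∘ₗ L ∈ diffOp X (k + 1))
    ?_ ?_ ?_ ?_ h
  · rintro _ ⟨a, rfl⟩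
    exact wordOp_mem (k := k + 1) (o, a)
  · rw [LinearMap.comp_zero]; exact zero_mem _
  · intro L M _ _ hL hM
    rw [LinearMap.comp_add]; exact add_mem hL hM
  · intro b L hL' hL
    cases o with
    | none => exact Submodule.smul_mem _ b hL
    | some l =>
      have : letterOp X (some l) ∘ₗ (b • L) = (X l b) • L + b • (letterOp X (some l) ∘ₗ L) := by
        ext1 u
        change X l (b * L u) = X l b * L u + b * X l (L u)
        rw [Derivation.leibniz, smul_eq_mul, smul_eq_mul]; ring
      rw [this]
      exact add_mem (Submodule.smul_mem _ _ (diffOp_mono_succ hL')) (Submodule.smul_mem _ _ hL)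

theorem X_comp_mem {k : ℕ} {L : F →ₗ[ℝ] F} (h : L ∈ diffOp X k) (l : ι) :
    (X l : F →ₗ[ℝ] F) ∘ₗ L ∈ diffOp X (k + 1) := letterOp_comp_mem h (some l)

theorem wordOp_comp_mem {j : ℕ} {L : F →ₗ[ℝ] F} (h : L ∈ diffOp X j) :
    ∀ (k : ℕ) (a : Wd ι k), wordOp X k a ∘ₗ L ∈ diffOp X (j + k)
  | 0, _ => h
  | k + 1, a => letterOp_comp_mem (wordOp_comp_mem h k a.2) a.1

theorem comp_wordOp_mem {j k : ℕ} {L : F →ₗ[ℝ] F} (h : L ∈ diffOp X j) (a : Wd ι k) :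
    L ∘ₗ wordOp X k a ∈ diffOp X (k + j) := by
  refine Submodule.span_induction (p := fun L _ => L ∘ₗ wordOp X k a ∈ diffOp X (k + j))
    ?_ ?_ ?_ ?_ h
  · rintro _ ⟨b, rfl⟩
    exact wordOp_comp_mem (wordOp_mem a) j b
  · rw [LinearMap.zero_comp]; exact zero_mem _
  · intro L M _ _ hL hM
    rw [LinearMap.add_comp]; exact add_mem hL hM
  · intro b L _ hL
    exact Submodule.smul_mem _ b hL

theorem X_mem (l : ι) : (X l : F →ₗ[ℝ] F) ∈ diffOp X 1 := wordOp_mem (k := 1) (some l, ())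

/-- Commutators with the derivations do not raise the order if this is so for the derivations
themselves. -/
theorem commutator_mem (hc : ∀ l m, (X l : F →ₗ[ℝ] F) ∘ₗ (X m : F →ₗ[ℝ] F)
      - (X m : F →ₗ[ℝ] F) ∘ₗ (X l : F →ₗ[ℝ] F) ∈ diffOp X 1)
    {k : ℕ} {L : F →ₗ[ℝ] F} (h : L ∈ diffOp X k) (i : ι) :
    (X i : F →ₗ[ℝ] F) ∘ₗ L - L ∘ₗ (X i : F →ₗ[ℝ] F) ∈ diffOp X k := by
  have word : ∀ (k : ℕ) (a : Wd ι k), (X i : F →ₗ[ℝ] F) ∘ₗ wordOp X k a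
      - wordOp X k a ∘ₗ (X i : F →ₗ[ℝ] F) ∈ diffOp X k := by
    intro k
    induction k with
    | zero =>
      intro a
      have : (X i : F →ₗ[ℝ] F) ∘ₗ wordOp X 0 a - wordOp X 0 a ∘ₗ (X i : F →ₗ[ℝ] F) = 0 := by
        ext1 u; simp
      rw [this]; exact zero_mem _
    | succ k ih =>
      rintro ⟨o, a⟩
      have ih' := letterOp_comp_mem (ih a) o
      cases o with
      | none => exact diffOp_mono_succ (ih a)
      | some l =>
        have e : (X i : F →ₗ[ℝ] F) ∘ₗ wordOp X (k + 1) (some l, a)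
            - wordOp X (k + 1) (some l, a) ∘ₗ (X i : F →ₗ[ℝ] F)
            = ((X i : F →ₗ[ℝ] F) ∘ₗ (X l : F →ₗ[ℝ] F)
              - (X l : F →ₗ[ℝ] F) ∘ₗ (X i : F →ₗ[ℝ] F)) ∘ₗ wordOp X k a
            + (X l : F →ₗ[ℝ] F) ∘ₗ ((X i : F →ₗ[ℝ] F) ∘ₗ wordOp X k a
              - wordOp X k a ∘ₗ (X i : F →ₗ[ℝ] F)) := by
          ext1 u; simp
        rw [e]
        exact add_mem (comp_wordOp_mem (hc i l) a) ih'
  refine Submodule.span_induction (p := fun L _ => (X i : F →ₗ[ℝ] F) ∘ₗ L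
    - L ∘ₗ (X i : F →ₗ[ℝ] F) ∈ diffOp X k) ?_ ?_ ?_ ?_ h
  · rintro _ ⟨a, rfl⟩
    exact word k a
  · rw [LinearMap.comp_zero, LinearMap.zero_comp]
    have : (0 - 0 : F →ₗ[ℝ] F) = 0 := by ext1 u; simp
    rw [this]; exact zero_mem _
  · intro L M _ _ hL hM
    have e : (X i : F →ₗ[ℝ] F) ∘ₗ (L + M) - (L + M) ∘ₗ (X i : F →ₗ[ℝ] F)
        = ((X i : F →ₗ[ℝ] F) ∘ₗ L - L ∘ₗ (X i : F →ₗ[ℝ] F))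
          + ((X i : F →ₗ[ℝ] F) ∘ₗ M - M ∘ₗ (X i : F →ₗ[ℝ] F)) := by
      rw [LinearMap.comp_add, LinearMap.add_comp]; abel
    rw [e]; exact add_mem hL hM
  · intro b L hL' hL
    have e : (X i : F →ₗ[ℝ] F) ∘ₗ (b • L) - (b • L) ∘ₗ (X i : F →ₗ[ℝ] F)
        = (X i b) • L + b • ((X i : F →ₗ[ℝ] F) ∘ₗ L - L ∘ₗ (X i : F →ₗ[ℝ] F)) := by
      ext1 u
      change X i (b * L u) - b * L (X i u) = X i b * L u + b * (X i (L u) - L (X i u))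
      rw [Derivation.leibniz, smul_eq_mul, smul_eq_mul]; ring
    rw [e]; exact add_mem (Submodule.smul_mem _ _ hL') (Submodule.smul_mem _ _ hL)

/-- The commutator of an operator of order two with a word of length `k` has order `k + 1`. -/
theorem commutator_wordOp_mem (hc : ∀ l m, (X l : F →ₗ[ℝ] F) ∘ₗ (X m : F →ₗ[ℝ] F)
      - (X m : F →ₗ[ℝ] F) ∘ₗ (X l : F →ₗ[ℝ] F) ∈ diffOp X 1)
    {A : F →ₗ[ℝ] F} (hA : A ∈ diffOp X 2) :
    ∀ (k : ℕ) (a : Wd ι k), A ∘ₗ wordOp X k a - wordOp X k a ∘ₗ A ∈ diffOp X (k + 1)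
  | 0, a => by
    have : A ∘ₗ wordOp X 0 a - wordOp X 0 a ∘ₗ A = 0 := by ext1 u; simp
    rw [this]; exact zero_mem _
  | k + 1, (none, a) => diffOp_mono_succ (commutator_wordOp_mem hc hA k a)
  | k + 1, (some l, a) => by
    have e : A ∘ₗ wordOp X (k + 1) (some l, a) - wordOp X (k + 1) (some l, a) ∘ₗ A
        = (-1 : F) • (((X l : F →ₗ[ℝ] F) ∘ₗ A - A ∘ₗ (X l : F →ₗ[ℝ] F)) ∘ₗ wordOp X k a)
          + (X l : F →ₗ[ℝ] F) ∘ₗ (A ∘ₗ wordOp X k a - wordOp X k a ∘ₗ A) := by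
      ext1 u; simp; ring
    rw [e]
    exact add_mem (Submodule.smul_mem _ (-1) (comp_wordOp_mem (commutator_mem hc hA l) a))
      (X_comp_mem (commutator_wordOp_mem hc hA k a) l)

/-- A differential operator of order `k` is bounded pointwise by the `k`-jet. -/
theorem diffOp_bound {k : ℕ} {L : F →ₗ[ℝ] F} (h : L ∈ diffOp X k) :
    ∃ C : ℝ, 0 ≤ C ∧ ∀ u x, ((L u).1 x) ^ 2 ≤ C * ∑ a, ((wordOp X k a u).1 x) ^ 2 := by
  refine Submodule.span_induction (p := fun L _ => ∃ C : ℝ, 0 ≤ C ∧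
    ∀ u x, ((L u).1 x) ^ 2 ≤ C * ∑ a, ((wordOp X k a u).1 x) ^ 2) ?_ ?_ ?_ ?_ h
  · rintro _ ⟨a, rfl⟩
    refine ⟨1, zero_le_one, fun u x => ?_⟩
    rw [one_mul]
    exact Finset.single_le_sum (f := fun a => ((wordOp X k a u).1 x) ^ 2)
      (fun _ _ => sq_nonneg _) (Finset.mem_univ a)
  · exact ⟨0, le_rfl, fun u x => by simp⟩
  · rintro L M _ _ ⟨C, hC, h1⟩ ⟨C', hC', h2⟩
    refine ⟨2 * (C + C'), by positivity, fun u x => ?_⟩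
    have e : ((L + M) u).1 x = (L u).1 x + (M u).1 x := rfl
    rw [e]
    nlinarith [h1 u x, h2 u x, sq_nonneg ((L u).1 x - (M u).1 x)]
  · rintro b L _ ⟨C, hC, h1⟩
    refine ⟨‖b.1‖ ^ 2 * C, by positivity, fun u x => ?_⟩
    have e : ((b • L) u).1 x = b.1 x * (L u).1 x := rfl
    have hb : (b.1 x) ^ 2 ≤ ‖b.1‖ ^ 2 := by
      rw [← sq_abs]; exact pow_le_pow_left₀ (abs_nonneg _) (norm_apply_le b x) 2
    rw [e, mul_pow, mul_assoc]
    exact mul_le_mul hb (h1 u x) (sq_nonneg _) (sq_nonneg _)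

/-- A differential operator of order `k` is bounded from `C^k` to `C^0`. -/
theorem diffOp_norm_bound {k : ℕ} {L : F →ₗ[ℝ] F} (h : L ∈ diffOp X k) :
    ∃ C : ℝ, 0 ≤ C ∧ ∀ u, ‖(L u).1‖ ≤ C * ckNorm X k u := by
  obtain ⟨C, hC, hb⟩ := diffOp_bound h
  refine ⟨√C, Real.sqrt_nonneg _, fun u => ?_⟩
  refine (ContinuousMap.norm_le _ (mul_nonneg (Real.sqrt_nonneg _) (norm_nonneg _))).2 fun x => ?_
  refine abs_le_of_sq_le_sq ?_ (mul_nonneg (Real.sqrt_nonneg _) (norm_nonneg _))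
  rw [mul_pow, Real.sq_sqrt hC]
  refine (hb u x).trans (mul_le_mul_of_nonneg_left ?_ hC)
  rw [← norm_jetMap_apply_sq]
  exact pow_le_pow_left₀ (norm_nonneg _) ((jetMap (wordOp X k) u).norm_coe_le_norm x) 2

/-- A differential operator of order `j` is bounded from `C^(j + k)` to `C^k`. -/
theorem diffOp_ckNorm_bound {j : ℕ} {L : F →ₗ[ℝ] F} (h : L ∈ diffOp X j) (k : ℕ) :
    ∃ C : ℝ, 0 ≤ C ∧ ∀ u, ckNorm X k (L u) ≤ C * ckNorm X (j + k) u := by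
  choose C hC hb using fun a : Wd ι k => diffOp_norm_bound (wordOp_comp_mem h k a)
  refine ⟨∑ a, C a, Finset.sum_nonneg fun a _ => hC a, fun u => ?_⟩
  rw [Finset.sum_mul]
  exact (norm_jetMap_le _ _).trans (Finset.sum_le_sum fun a _ => hb a u)

end Words

/-! ### Symmetric differences of a function of one variable -/

section Taylor

variable {s₀ : ℝ}

/-- Integration of a bound for the derivative, by the mean value inequality. -/
theorem abs_le_of_deriv_le {φ φ' : ℝ → ℝ} {C : ℝ} {m : ℕ} (hC : 0 ≤ C)
    (hd : ∀ r, |r| < s₀ → HasDerivAt φ (φ' r) r) (h0 : φ 0 = 0)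
    (hb : ∀ r, |r| < s₀ → |φ' r| ≤ C * |r| ^ m) {s : ℝ} (hs : |s| < s₀) :
    |φ s| ≤ C * |s| ^ (m + 1) := by
  have hmem : ∀ r ∈ Set.Icc (-|s|) |s|, |r| ≤ |s| := fun r hr => abs_le.2 hr
  have key := (convex_Icc (-|s|) |s|).norm_image_sub_le_of_norm_hasDerivWithin_le
    (f := φ) (f' := φ') (C := C * |s| ^ m) (x := 0) (y := s)
    (fun r hr => (hd r ((hmem r hr).trans_lt hs)).hasDerivWithinAt)
    (fun r hr => (hb r ((hmem r hr).trans_lt hs)).trans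
      (mul_le_mul_of_nonneg_left (pow_le_pow_left₀ (abs_nonneg _) (hmem r hr) m) hC))
    ⟨by simp, by simp⟩ ⟨neg_abs_le s, le_abs_self s⟩
  rw [h0, sub_zero, sub_zero] at key
  simpa [pow_succ, mul_assoc] using key

theorem hasDerivAt_comp_neg' {φ φ' : ℝ → ℝ} (hd : ∀ r, |r| < s₀ → HasDerivAt φ (φ' r) r) {r : ℝ}
    (hr : |r| < s₀) : HasDerivAt (fun s => φ (-s)) (-φ' (-r)) r := by
  have := (hd (-r) (by rwa [abs_neg])).scomp r (hasDerivAt_neg r)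
  simpa [Function.comp_def] using this

variable {h h₁ h₂ h₃ : ℝ → ℝ} {C : ℝ} (hC : 0 ≤ C)
  (hd₁ : ∀ r, |r| < s₀ → HasDerivAt h (h₁ r) r)
  (hd₂ : ∀ r, |r| < s₀ → HasDerivAt h₁ (h₂ r) r)
  (hd₃ : ∀ r, |r| < s₀ → HasDerivAt h₂ (h₃ r) r)

include hC hd₁ in
theorem abs_sub_zero_le (hb : ∀ r, |r| < s₀ → |h₁ r| ≤ C) {s : ℝ} (hs : |s| < s₀) :
    |h s - h 0| ≤ C * |s| := by
  have := abs_le_of_deriv_le (φ := fun r => h r - h 0) (m := 0) hC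
    (fun r hr => (hd₁ r hr).sub_const _) (by simp) (fun r hr => by simpa using hb r hr) hs
  simpa using this

include hC hd₁ in
theorem abs_sub_neg_le (hb : ∀ r, |r| < s₀ → |h₁ r| ≤ C) {s : ℝ} (hs : |s| < s₀) :
    |h s - h (-s)| ≤ 2 * C * |s| := by
  have h1 := abs_sub_zero_le hC hd₁ hb hs
  have h2 := abs_sub_zero_le hC hd₁ hb (s := -s) (by rwa [abs_neg])
  rw [abs_neg] at h2
  rw [abs_le] at *
  constructor <;> linarith

include hC hd₁ hd₂ in
theorem abs_add_neg_le (hb : ∀ r, |r| < s₀ → |h₂ r| ≤ C) {s : ℝ} (hs : |s| < s₀) :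
    |h s + h (-s) - 2 * h 0| ≤ 2 * C * |s| ^ 2 :=
  abs_le_of_deriv_le (φ := fun r => h r + h (-r) - 2 * h 0) (φ' := fun r => h₁ r + -h₁ (-r))
    (m := 1) (by positivity)
    (fun r hr => ((hd₁ r hr).add (hasDerivAt_comp_neg' hd₁ hr)).sub_const _)
    (by simp; ring) (fun r hr => by
      rw [pow_one, ← sub_eq_add_neg]; exact abs_sub_neg_le hC hd₂ hb hr) hs

include hC hd₁ hd₂ in
theorem abs_sub_sub_le (hb : ∀ r, |r| < s₀ → |h₂ r| ≤ C) {s : ℝ} (hs : |s| < s₀) :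
    |h s - h 0 - s * h₁ 0| ≤ C * |s| ^ 2 := by
  refine abs_le_of_deriv_le (φ := fun r => h r - h 0 - r * h₁ 0) (φ' := fun r => h₁ r - h₁ 0)
    (m := 1) hC (fun r hr => ?_) (by simp) (fun r hr => ?_) hs
  · simpa using ((hd₁ r hr).sub_const (h 0)).fun_sub ((hasDerivAt_id r).mul_const (h₁ 0))
  · rw [pow_one]; exact abs_sub_zero_le hC hd₂ hb hr

include hC hd₁ hd₂ hd₃ in
/-- The second symmetric difference agrees with the second derivative up to third order: the terms
of odd order cancel. -/
theorem abs_add_neg_sub_le (hb : ∀ r, |r| < s₀ → |h₃ r| ≤ C) {s : ℝ} (hs : |s| < s₀) :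
    |h s + h (-s) - 2 * h 0 - s ^ 2 * h₂ 0| ≤ 2 * C * |s| ^ 3 := by
  refine abs_le_of_deriv_le (φ := fun r => h r + h (-r) - 2 * h 0 - r ^ 2 * h₂ 0)
    (φ' := fun r => h₁ r + -h₁ (-r) - 2 * r * h₂ 0)
    (m := 2) (by positivity) (fun r hr => ?_) (by simp; ring) (fun r hr => ?_) hs
  · simpa using (((hd₁ r hr).fun_add (hasDerivAt_comp_neg' hd₁ hr)).sub_const (2 * h 0)).fun_sub
      ((hasDerivAt_pow 2 r).mul_const (h₂ 0))
  · refine abs_le_of_deriv_le (φ := fun r => h₁ r + -h₁ (-r) - 2 * r * h₂ 0)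
      (φ' := fun r => h₂ r + h₂ (-r) - 2 * h₂ 0) (m := 1) (by positivity) (fun r hr => ?_)
      (by simp) (fun r hr => ?_) hr
    · simpa using ((hd₂ r hr).fun_add (hasDerivAt_comp_neg' hd₂ hr).fun_neg).fun_sub
        (((hasDerivAt_id r).const_mul 2).mul_const (h₂ 0))
    · have h1 := abs_sub_zero_le hC hd₃ hb hr
      have h2 := abs_sub_zero_le hC hd₃ hb (s := -r) (by rwa [abs_neg])
      rw [abs_neg] at h2
      rw [pow_one]
      rw [abs_le] at *
      constructor <;> linarith

end Taylor

/-! ### One-parameter deformations of the identity -/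

section Deformation

variable {Q : Type*} [TopologicalSpace Q] [CompactSpace Q] {F : Subalgebra ℝ C(Q, ℝ)}
  {ι : Type} [Fintype ι]

/-- A family `Φ s`, `|s| < s₀`, of self-maps of `Q` with `Φ 0 = id`, which in suitable coordinates
`y` is `y + s Y + s² Z`. The functions `y m` need only be coordinates where the maps move points, as
elsewhere the coefficients of `Y` and `Z` and the difference in `X_T` vanish. The map `T s` is
composition with `Φ s`, and the two last fields are the chain rule for derivatives in the space
variable and in `s`. -/
structure Deformation (X : ι → Derivation ℝ F F) (s₀ : ℝ) where
  /-- the maps -/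
  Φ : ℝ → Q → Q
  /-- composition with the maps -/
  T : ℝ → F →ₐ[ℝ] F
  T_apply : ∀ s u x, (T s u).1 x = u.1 (Φ s x)
  Φ_zero : ∀ x, Φ 0 x = x
  /-- the coordinates -/
  y : ι → F
  /-- the coefficient of `s` -/
  Y : ι → F
  /-- the coefficient of `s²` -/
  Z : ι → F
  X_T : ∀ s, |s| < s₀ → ∀ i u, X i (T s u) = T s (X i u) + ∑ m, (X i (y m) - T s (X i (y m))
    + s • X i (Y m) + s ^ 2 • X i (Z m)) * T s (X m u)
  hasDerivAt : ∀ s, |s| < s₀ → ∀ u x, HasDerivAt (fun r => u.1 (Φ r x))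
    (∑ m, ((Y m).1 x + 2 * s * (Z m).1 x) * (X m u).1 (Φ s x)) s

namespace Deformation

variable {X : ι → Derivation ℝ F F} {s₀ : ℝ} (D : Deformation X s₀)

/-- The first derivative of `T s u` at `s = 0`. -/
def V : F →ₗ[ℝ] F := ∑ m, D.Y m • (X m : F →ₗ[ℝ] F)

/-- The second derivative of `T s u` at `s = 0`. -/
def B : F →ₗ[ℝ] F := ∑ m, ((2 : ℝ) • D.Z m) • (X m : F →ₗ[ℝ] F)
  + ∑ m, ∑ l, (D.Y m * D.Y l) • ((X l : F →ₗ[ℝ] F) ∘ₗ (X m : F →ₗ[ℝ] F))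

theorem V_apply (u : F) : D.V u = ∑ m, D.Y m * X m u := by simp [V]

theorem B_apply (u : F) : D.B u = ∑ m, ((2 : ℝ) • D.Z m) * X m u
    + ∑ m, ∑ l, D.Y m * D.Y l * X l (X m u) := by simp [B]

theorem B_mem : D.B ∈ diffOp X 2 := by
  refine add_mem (sum_mem fun m _ => Submodule.smul_mem _ _ (diffOp_mono_succ (X_mem m)))
    (sum_mem fun m _ => sum_mem fun l _ => Submodule.smul_mem _ _ (X_comp_mem (X_mem m) l))

/-- The second derivative of a square. The term in `V u` is what makes the maximum principle for
sums of squares of derivatives give a bound for the derivatives of the next order. -/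
theorem V_sq (u : F) : D.B (u * u) = 2 * (u * D.B u) + 2 * (D.V u * D.V u) := by
  have e : D.V u * D.V u = ∑ m, ∑ l, (D.Y m * X m u) * (D.Y l * X l u) := by
    rw [V_apply, Finset.sum_mul_sum]
  rw [e]
  simp only [B_apply, Derivation.leibniz, smul_eq_mul, map_add,
    mul_add, Finset.mul_sum, ← Finset.sum_add_distrib]
  refine Finset.sum_congr rfl fun m _ => ?_
  refine (congrArg₂ (· + ·) ?_ ?_).trans (add_assoc _ _ _).symm
  · ring
  · rw [← Finset.sum_add_distrib]
    refine Finset.sum_congr rfl fun l _ => ?_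
    ring

/-- The velocity coefficients in `s`. -/
def vel (m : ι) (s : ℝ) (x : Q) : ℝ := (D.Y m).1 x + 2 * s * (D.Z m).1 x

/-- The first derivative of `u (Φ s x)` in `s`. -/
def d₁ (u : F) (x : Q) (s : ℝ) : ℝ := ∑ m, D.vel m s x * (X m u).1 (D.Φ s x)

/-- The second derivative of `u (Φ s x)` in `s`. -/
def d₂ (u : F) (x : Q) (s : ℝ) : ℝ :=
  ∑ m, (2 * (D.Z m).1 x * (X m u).1 (D.Φ s x) + D.vel m s x * D.d₁ (X m u) x s)

/-- The third derivative of `u (Φ s x)` in `s`. -/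
def d₃ (u : F) (x : Q) (s : ℝ) : ℝ :=
  ∑ m, (2 * (D.Z m).1 x * D.d₁ (X m u) x s
    + (2 * (D.Z m).1 x * D.d₁ (X m u) x s + D.vel m s x * D.d₂ (X m u) x s))

theorem hasDerivAt_vel (m : ι) (s : ℝ) (x : Q) :
    HasDerivAt (fun r => D.vel m r x) (2 * (D.Z m).1 x) s := by
  simpa [vel] using (((hasDerivAt_id s).const_mul 2).mul_const ((D.Z m).1 x)).const_add
    ((D.Y m).1 x)

theorem hasDerivAt₁ (u : F) (x : Q) {s : ℝ} (hs : |s| < s₀) :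
    HasDerivAt (fun r => u.1 (D.Φ r x)) (D.d₁ u x s) s := D.hasDerivAt s hs u x

theorem hasDerivAt₂ (u : F) (x : Q) {s : ℝ} (hs : |s| < s₀) :
    HasDerivAt (D.d₁ u x) (D.d₂ u x s) s :=
  HasDerivAt.fun_sum fun m _ => (D.hasDerivAt_vel m s x).mul (D.hasDerivAt₁ (X m u) x hs)

theorem hasDerivAt₃ (u : F) (x : Q) {s : ℝ} (hs : |s| < s₀) :
    HasDerivAt (D.d₂ u x) (D.d₃ u x s) s :=
  HasDerivAt.fun_sum fun m _ => ((D.hasDerivAt₁ (X m u) x hs).const_mul _).add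
    ((D.hasDerivAt_vel m s x).mul (D.hasDerivAt₂ (X m u) x hs))

theorem d₁_zero (u : F) (x : Q) : D.d₁ u x 0 = (D.V u).1 x := by
  simp [d₁, vel, V_apply, D.Φ_zero]

theorem d₂_zero (u : F) (x : Q) : D.d₂ u x 0 = (D.B u).1 x := by
  simp [d₂, B_apply, d₁_zero, V_apply, D.Φ_zero, vel, Finset.sum_add_distrib, Finset.mul_sum,
    mul_assoc]

theorem exists_ckNorm_X_le (k : ℕ) : ∃ C, 0 ≤ C ∧ ∀ (m : ι) (u : F),
    ckNorm X k (X m u) ≤ C * ckNorm X (k + 1) u := by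
  choose C hC hb using fun m : ι => diffOp_ckNorm_bound (X_mem (X := X) m) k
  refine ⟨∑ m, C m, Finset.sum_nonneg fun m _ => hC m, fun m u => ?_⟩
  refine (hb m u).trans ?_
  rw [add_comm 1 k]
  exact mul_le_mul_of_nonneg_right (Finset.single_le_sum (fun m _ => hC m) (Finset.mem_univ m))
    (ckNorm_nonneg _ _)

theorem exists_vel_le (hs₀ : s₀ ≤ 1) : ∃ K, 0 ≤ K ∧ ∀ m x,
    |2 * (D.Z m).1 x| ≤ K ∧ ∀ s, |s| < s₀ → |D.vel m s x| ≤ K := by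
  refine ⟨∑ m, (‖(D.Y m).1‖ + 2 * ‖(D.Z m).1‖), Finset.sum_nonneg fun m _ => by positivity,
    fun m x => ?_⟩
  have hle : ‖(D.Y m).1‖ + 2 * ‖(D.Z m).1‖ ≤ ∑ m, (‖(D.Y m).1‖ + 2 * ‖(D.Z m).1‖) :=
    Finset.single_le_sum (f := fun m => ‖(D.Y m).1‖ + 2 * ‖(D.Z m).1‖)
      (fun m _ => by positivity) (Finset.mem_univ m)
  have hY := norm_apply_le (D.Y m) x
  have hZ := norm_apply_le (D.Z m) x
  constructor
  · rw [abs_mul, abs_two]; linarith [norm_nonneg (D.Y m).1]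
  · intro s hs
    have : |2 * s * (D.Z m).1 x| ≤ 2 * ‖(D.Z m).1‖ := by
      rw [abs_mul, abs_mul, abs_two]
      have : |s| * |(D.Z m).1 x| ≤ 1 * ‖(D.Z m).1‖ :=
        mul_le_mul (hs.le.trans hs₀) hZ (abs_nonneg _) zero_le_one
      linarith
    exact (abs_add_le _ _).trans (by linarith)

theorem norm_X_le (m : ι) (u : F) : ‖(X m u).1‖ ≤ ckNorm X 1 u :=
  norm_wordOp_le (X := X) 1 (some m, ()) u

theorem exists_d₁_le (hs₀ : s₀ ≤ 1) : ∃ C, 0 ≤ C ∧ ∀ u x s, |s| < s₀ →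
    |D.d₁ u x s| ≤ C * ckNorm X 1 u := by
  obtain ⟨K, hK, hb⟩ := D.exists_vel_le hs₀
  refine ⟨∑ _m : ι, K, Finset.sum_nonneg fun _ _ => hK, fun u x s hs => ?_⟩
  rw [Finset.sum_mul]
  refine (Finset.abs_sum_le_sum_abs _ _).trans (Finset.sum_le_sum fun m _ => ?_)
  rw [abs_mul]
  exact mul_le_mul ((hb m x).2 s hs) ((norm_apply_le _ _).trans (norm_X_le m u))
    (abs_nonneg _) hK

theorem exists_d₂_le (hs₀ : s₀ ≤ 1) : ∃ C, 0 ≤ C ∧ ∀ u x s, |s| < s₀ →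
    |D.d₂ u x s| ≤ C * ckNorm X 2 u := by
  obtain ⟨K, hK, hb⟩ := D.exists_vel_le hs₀
  obtain ⟨C, hC, hb1⟩ := D.exists_d₁_le hs₀
  obtain ⟨C', hC', hX⟩ := exists_ckNorm_X_le (X := X) 1
  refine ⟨∑ _m : ι, (K + K * (C * C')), Finset.sum_nonneg fun _ _ => by positivity,
    fun u x s hs => ?_⟩
  rw [Finset.sum_mul]
  refine (Finset.abs_sum_le_sum_abs _ _).trans (Finset.sum_le_sum fun m _ => ?_)
  rw [add_mul, mul_assoc K]
  refine (abs_add_le _ _).trans (add_le_add ?_ ?_)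
  · rw [abs_mul]
    exact mul_le_mul (hb m x).1 (((norm_apply_le _ _).trans (norm_X_le m u)).trans
      (ckNorm_mono_succ 1 u)) (abs_nonneg _) hK
  · rw [abs_mul]
    refine mul_le_mul ((hb m x).2 s hs) ((hb1 _ x s hs).trans ?_) (abs_nonneg _) hK
    rw [mul_assoc]
    exact mul_le_mul_of_nonneg_left (hX m u) hC

theorem exists_d₃_le (hs₀ : s₀ ≤ 1) : ∃ C, 0 ≤ C ∧ ∀ u x s, |s| < s₀ →
    |D.d₃ u x s| ≤ C * ckNorm X 3 u := by
  obtain ⟨K, hK, hb⟩ := D.exists_vel_le hs₀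
  obtain ⟨C, hC, hb1⟩ := D.exists_d₁_le hs₀
  obtain ⟨C₂, hC₂, hb2⟩ := D.exists_d₂_le hs₀
  obtain ⟨C', hC', hX⟩ := exists_ckNorm_X_le (X := X) 1
  obtain ⟨C'', hC'', hX'⟩ := exists_ckNorm_X_le (X := X) 2
  refine ⟨∑ _m : ι, (K * (C * C') + (K * (C * C') + K * (C₂ * C''))),
    Finset.sum_nonneg fun _ _ => by positivity, fun u x s hs => ?_⟩
  rw [Finset.sum_mul]
  refine (Finset.abs_sum_le_sum_abs _ _).trans (Finset.sum_le_sum fun m _ => ?_)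
  have e1 : |2 * (D.Z m).1 x * D.d₁ (X m u) x s| ≤ K * (C * C') * ckNorm X 3 u := by
    rw [abs_mul, mul_assoc K]
    refine mul_le_mul (hb m x).1 ((hb1 _ x s hs).trans ?_) (abs_nonneg _) hK
    rw [mul_assoc]
    exact mul_le_mul_of_nonneg_left ((hX m u).trans
      (mul_le_mul_of_nonneg_left (ckNorm_mono_succ 2 u) hC')) hC
  have e2 : |D.vel m s x * D.d₂ (X m u) x s| ≤ K * (C₂ * C'') * ckNorm X 3 u := by
    rw [abs_mul, mul_assoc K]
    refine mul_le_mul ((hb m x).2 s hs) ((hb2 _ x s hs).trans ?_) (abs_nonneg _) hK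
    rw [mul_assoc]
    exact mul_le_mul_of_nonneg_left (hX' m u) hC₂
  rw [add_mul, add_mul]
  exact (abs_add_le _ _).trans (add_le_add e1 ((abs_add_le _ _).trans (add_le_add e1 e2)))

/-- First order Taylor expansion along a deformation. -/
theorem exists_taylor₂ (hs₀ : s₀ ≤ 1) : ∃ C, 0 ≤ C ∧ ∀ u x s, |s| < s₀ →
    |u.1 (D.Φ s x) - u.1 x - s * (D.V u).1 x| ≤ C * ckNorm X 2 u * |s| ^ 2 := by
  obtain ⟨C, hC, hb⟩ := D.exists_d₂_le hs₀
  refine ⟨C, hC, fun u x s hs => ?_⟩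
  have := abs_sub_sub_le (mul_nonneg hC (ckNorm_nonneg 2 u)) (fun r hr => D.hasDerivAt₁ u x hr)
    (fun r hr => D.hasDerivAt₂ u x hr) (fun r hr => hb u x r hr) hs
  rwa [D.d₁_zero, D.Φ_zero] at this

/-- Second order Taylor expansion of the symmetric difference along a deformation. -/
theorem exists_taylor₃ (hs₀ : s₀ ≤ 1) : ∃ C, 0 ≤ C ∧ ∀ u x s, |s| < s₀ →
    |u.1 (D.Φ s x) + u.1 (D.Φ (-s) x) - 2 * u.1 x - s ^ 2 * (D.B u).1 x|
      ≤ C * ckNorm X 3 u * |s| ^ 3 := by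
  obtain ⟨C, hC, hb⟩ := D.exists_d₃_le hs₀
  refine ⟨2 * C, by positivity, fun u x s hs => ?_⟩
  have := abs_add_neg_sub_le (mul_nonneg hC (ckNorm_nonneg 3 u)) (fun r hr => D.hasDerivAt₁ u x hr)
    (fun r hr => D.hasDerivAt₂ u x hr) (fun r hr => D.hasDerivAt₃ u x hr)
    (fun r hr => hb u x r hr) hs
  rwa [D.d₂_zero, D.Φ_zero, ← mul_assoc] at this

/-- At a maximum the second derivative along a deformation is not positive. -/
theorem B_nonpos_of_isMax (h0 : 0 < s₀) (hs₀ : s₀ ≤ 1) {u : F} {x : Q}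
    (hx : ∀ z, u.1 z ≤ u.1 x) : (D.B u).1 x ≤ 0 := by
  obtain ⟨C, hC, hb⟩ := D.exists_taylor₃ hs₀
  by_contra! hpos
  have hK : 0 ≤ C * ckNorm X 3 u := mul_nonneg hC (ckNorm_nonneg _ _)
  set K := C * ckNorm X 3 u
  obtain ⟨s, hs, hs'⟩ : ∃ s, 0 < s ∧ s < s₀ ∧ K * s < (D.B u).1 x := by
    refine ⟨min (s₀ / 2) ((D.B u).1 x / (2 * (K + 1))), by positivity, ?_, ?_⟩
    · exact (min_le_left _ _).trans_lt (by linarith)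
    · refine (mul_le_mul_of_nonneg_left (min_le_right _ _) hK).trans_lt ?_
      rw [← mul_div_assoc, div_lt_iff₀ (by positivity)]
      nlinarith
  have h1 := hb u x s (by rw [abs_of_pos hs]; exact hs'.1)
  rw [abs_of_pos hs] at h1
  have h2 := (abs_le.1 h1).1
  have h3 := hx (D.Φ s x)
  have h4 := hx (D.Φ (-s) x)
  have : s ^ 2 * (K * s) < s ^ 2 * (D.B u).1 x := mul_lt_mul_of_pos_left hs'.2 (by positivity)
  nlinarith

end Deformation

end Deformation

section Parity

variable {Q : Type*} [TopologicalSpace Q] [CompactSpace Q] {F : Subalgebra ℝ C(Q, ℝ)}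
  {ι : Type} [Fintype ι] {X : ι → Derivation ℝ F F} {s₀ : ℝ}

/-! ### Families whose odd part is `O(s)` and whose even part is constant up to `O(s²)` -/

/-- The family `c` is bounded for `|s| < s₀`, with `c s - c (-s) = O(s)` and
`c s + c (-s) - 2 c 0 = O(s²)` uniformly. -/
def ParitySmall (s₀ : ℝ) (c : ℝ → F) : Prop :=
  ∃ C : ℝ, 0 ≤ C ∧ ∀ s, |s| < s₀ → ‖(c s).1‖ ≤ C ∧ ‖(c s).1 - (c (-s)).1‖ ≤ C * |s| ∧
    ‖(c s).1 + (c (-s)).1 - (2 : ℝ) • (c 0).1‖ ≤ C * |s| ^ 2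

variable (X s₀) in
/-- The derivatives of the family up to order `k` satisfy `ParitySmall`. -/
def ParitySmallUpTo : ℕ → (ℝ → F) → Prop
  | 0, c => ParitySmall s₀ c
  | k + 1, c => ParitySmallUpTo k c ∧ ∀ l, ParitySmallUpTo k fun s => X l (c s)

theorem ParitySmall.add {c d : ℝ → F} (hc : ParitySmall s₀ c) (hd : ParitySmall s₀ d) :
    ParitySmall s₀ fun s => c s + d s := by
  obtain ⟨C, hC, h⟩ := hc
  obtain ⟨D, hD, h'⟩ := hd
  refine ⟨C + D, by positivity, fun s hs => ?_⟩
  obtain ⟨h1, h2, h3⟩ := h s hs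
  obtain ⟨h1', h2', h3'⟩ := h' s hs
  refine ⟨(norm_add_le _ _).trans (add_le_add h1 h1'), ?_, ?_⟩
  · have e : (c s + d s).1 - (c (-s) + d (-s)).1
        = ((c s).1 - (c (-s)).1) + ((d s).1 - (d (-s)).1) := by
      change (c s).1 + (d s).1 - ((c (-s)).1 + (d (-s)).1) = _; abel
    rw [e, add_mul]; exact (norm_add_le _ _).trans (add_le_add h2 h2')
  · have e : (c s + d s).1 + (c (-s) + d (-s)).1 - (2 : ℝ) • (c 0 + d 0).1
        = ((c s).1 + (c (-s)).1 - (2 : ℝ) • (c 0).1)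
          + ((d s).1 + (d (-s)).1 - (2 : ℝ) • (d 0).1) := by
      change (c s).1 + (d s).1 + ((c (-s)).1 + (d (-s)).1) - (2 : ℝ) • ((c 0).1 + (d 0).1) = _
      rw [smul_add]; abel
    rw [e, add_mul]; exact (norm_add_le _ _).trans (add_le_add h3 h3')

/-- In terms of even and odd parts: the even part of a product consists of the product of the even
parts and the product of the odd parts, and the latter is `O(s²)`. -/
theorem ParitySmall.mul (h0 : 0 < s₀) {c d : ℝ → F} (hc : ParitySmall s₀ c)
    (hd : ParitySmall s₀ d) : ParitySmall s₀ fun s => c s * d s := by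
  obtain ⟨C, hC, h⟩ := hc
  obtain ⟨D, hD, h'⟩ := hd
  refine ⟨3 * (C * D), by positivity, fun s hs => ?_⟩
  obtain ⟨h1, h2, h3⟩ := h s hs
  obtain ⟨h1', h2', h3'⟩ := h' s hs
  have hm : ‖(c (-s)).1‖ ≤ C := (h (-s) (by rwa [abs_neg])).1
  have hz' : ‖(d 0).1‖ ≤ D := (h' 0 (by simpa)).1
  have hCD : 0 ≤ C * D := mul_nonneg hC hD
  refine ⟨?_, ?_, ?_⟩
  · exact (norm_mul_le _ _).trans
      ((mul_le_mul h1 h1' (norm_nonneg _) hC).trans (by linarith))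
  · have e : (c s * d s).1 - (c (-s) * d (-s)).1
        = ((c s).1 - (c (-s)).1) * (d s).1 + (c (-s)).1 * ((d s).1 - (d (-s)).1) := by
      change (c s).1 * (d s).1 - (c (-s)).1 * (d (-s)).1 = _; ring
    rw [e]
    refine (norm_add_le _ _).trans ?_
    have i1 := (norm_mul_le ((c s).1 - (c (-s)).1) (d s).1).trans
      (mul_le_mul h2 h1' (norm_nonneg _) (by positivity))
    have i2 := (norm_mul_le (c (-s)).1 ((d s).1 - (d (-s)).1)).trans
      (mul_le_mul hm h2' (norm_nonneg _) hC)
    nlinarith [mul_nonneg hCD (abs_nonneg s)]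
  · have e : (c s * d s).1 + (c (-s) * d (-s)).1 - (2 : ℝ) • (c 0 * d 0).1
        = (1 / 2 : ℝ) • (((c s).1 + (c (-s)).1) * ((d s).1 + (d (-s)).1 - (2 : ℝ) • (d 0).1))
          + ((c s).1 + (c (-s)).1 - (2 : ℝ) • (c 0).1) * (d 0).1
          + (1 / 2 : ℝ) • (((c s).1 - (c (-s)).1) * ((d s).1 - (d (-s)).1)) := by
      change (c s).1 * (d s).1 + (c (-s)).1 * (d (-s)).1 - (2 : ℝ) • ((c 0).1 * (d 0).1) = _
      ext x
      simp
      ring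
    have i1 := (norm_mul_le ((c s).1 + (c (-s)).1)
      ((d s).1 + (d (-s)).1 - (2 : ℝ) • (d 0).1)).trans
      (mul_le_mul ((norm_add_le _ _).trans (add_le_add h1 hm)) h3' (norm_nonneg _) (by positivity))
    have i2 := (norm_mul_le ((c s).1 + (c (-s)).1 - (2 : ℝ) • (c 0).1) (d 0).1).trans
      (mul_le_mul h3 hz' (norm_nonneg _) (by positivity))
    have i3 := (norm_mul_le ((c s).1 - (c (-s)).1) ((d s).1 - (d (-s)).1)).trans
      (mul_le_mul h2 h2' (norm_nonneg _) (by positivity))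
    rw [e]
    refine (norm_add_le _ _).trans ((add_le_add_left (norm_add_le _ _) _).trans ?_)
    rw [norm_smul, norm_smul, Real.norm_of_nonneg (by norm_num : (0 : ℝ) ≤ 1 / 2)]
    nlinarith [mul_nonneg hCD (sq_nonneg |s|)]

theorem ParitySmall.const (f : F) : ParitySmall s₀ fun _ => f := by
  refine ⟨‖f.1‖, norm_nonneg _, fun s _ => ⟨le_rfl, ?_, ?_⟩⟩
  · rw [sub_self, norm_zero]; positivity
  · rw [two_smul, sub_self, norm_zero]; positivity

theorem ParitySmall.id_smul (hs₀ : s₀ ≤ 1) (f : F) : ParitySmall s₀ fun s => s • f := by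
  refine ⟨2 * ‖f.1‖, by positivity, fun s hs => ?_⟩
  have hs1 : |s| ≤ 1 := hs.le.trans hs₀
  have hf := norm_nonneg f.1
  refine ⟨?_, ?_, ?_⟩
  · change ‖s • f.1‖ ≤ _
    rw [norm_smul, Real.norm_eq_abs]; nlinarith
  · change ‖s • f.1 - (-s) • f.1‖ ≤ _
    rw [← sub_smul, norm_smul, Real.norm_eq_abs, sub_neg_eq_add, ← two_mul, abs_mul, abs_two]
    exact le_of_eq (by ring)
  · change ‖s • f.1 + (-s) • f.1 - (2 : ℝ) • (0 : ℝ) • f.1‖ ≤ _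
    rw [← add_smul, add_neg_cancel, zero_smul, smul_zero, sub_zero, norm_zero]
    positivity

theorem ParitySmallUpTo.add {k : ℕ} {c d : ℝ → F} (hc : ParitySmallUpTo X s₀ k c)
    (hd : ParitySmallUpTo X s₀ k d) : ParitySmallUpTo X s₀ k fun s => c s + d s := by
  induction k generalizing c d with
  | zero => exact ParitySmall.add hc hd
  | succ k ih =>
    refine ⟨ih hc.1 hd.1, fun l => ?_⟩
    simp only [map_add]
    exact ih (hc.2 l) (hd.2 l)

theorem ParitySmallUpTo.mul (h0 : 0 < s₀) {k : ℕ} {c d : ℝ → F} (hc : ParitySmallUpTo X s₀ k c)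
    (hd : ParitySmallUpTo X s₀ k d) : ParitySmallUpTo X s₀ k fun s => c s * d s := by
  induction k generalizing c d with
  | zero => exact ParitySmall.mul h0 hc hd
  | succ k ih =>
    refine ⟨ih hc.1 hd.1, fun l => ?_⟩
    simp only [Derivation.leibniz, smul_eq_mul]
    exact (ih hc.1 (hd.2 l)).add (ih hd.1 (hc.2 l))

theorem ParitySmallUpTo.const (k : ℕ) (f : F) : ParitySmallUpTo X s₀ k fun _ => f := by
  induction k generalizing f with
  | zero => exact ParitySmall.const f
  | succ k ih => exact ⟨ih f, fun l => ih _⟩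

theorem ParitySmallUpTo.id_smul (hs₀ : s₀ ≤ 1) (k : ℕ) (f : F) :
    ParitySmallUpTo X s₀ k fun s => s • f := by
  induction k generalizing f with
  | zero => exact ParitySmall.id_smul hs₀ f
  | succ k ih =>
    refine ⟨ih f, fun l => ?_⟩
    simp only [Derivation.map_smul]
    exact ih _

theorem ParitySmallUpTo.neg (h0 : 0 < s₀) {k : ℕ} {c : ℝ → F} (hc : ParitySmallUpTo X s₀ k c) :
    ParitySmallUpTo X s₀ k fun s => -c s := by
  have : (fun s => -c s) = fun s => (-1) * c s := by funext s; ring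
  rw [this]
  exact (ParitySmallUpTo.const k (-1)).mul h0 hc

theorem ParitySmallUpTo.sum {α : Type*} (t : Finset α) {k : ℕ} {c : α → ℝ → F}
    (hc : ∀ a, ParitySmallUpTo X s₀ k (c a)) : ParitySmallUpTo X s₀ k fun s => ∑ a ∈ t, c a s := by
  classical
  induction t using Finset.induction_on with
  | empty => simpa using ParitySmallUpTo.const k 0
  | insert a t ha ih =>
    simp only [Finset.sum_insert ha]
    exact (hc a).add ih

namespace Deformation

variable (D : Deformation X s₀)

/-- The coefficients of the Jacobian of the deformation, without the identity. -/
def jac (l m : ι) (s : ℝ) : F :=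
  X l (D.y m) - D.T s (X l (D.y m)) + s • X l (D.Y m) + s ^ 2 • X l (D.Z m)

theorem T_zero (u : F) : D.T 0 u = u := by
  ext x; rw [D.T_apply, D.Φ_zero]

theorem jac_zero (l m : ι) : D.jac l m 0 = 0 := by simp [jac, T_zero]

theorem paritySmall_T (hs₀ : s₀ ≤ 1) (u : F) : ParitySmall s₀ fun s => D.T s u := by
  obtain ⟨C₁, hC₁, h1⟩ := D.exists_d₁_le hs₀
  obtain ⟨C₂, hC₂, h2⟩ := D.exists_d₂_le hs₀
  have n1 : 0 ≤ C₁ * ckNorm X 1 u := mul_nonneg hC₁ (ckNorm_nonneg _ _)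
  have n2 : 0 ≤ C₂ * ckNorm X 2 u := mul_nonneg hC₂ (ckNorm_nonneg _ _)
  have n0 := norm_nonneg u.1
  refine ⟨‖u.1‖ + 2 * (C₁ * ckNorm X 1 u) + 2 * (C₂ * ckNorm X 2 u), by positivity,
    fun s hs => ⟨?_, ?_, ?_⟩⟩
  · refine (ContinuousMap.norm_le _ (by positivity)).2 fun x => ?_
    rw [D.T_apply, Real.norm_eq_abs]
    linarith [norm_apply_le u (D.Φ s x)]
  · refine (ContinuousMap.norm_le _ (by positivity)).2 fun x => ?_
    have := abs_sub_neg_le n1 (fun r hr => D.hasDerivAt₁ u x hr) (fun r hr => h1 u x r hr) hs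
    rw [ContinuousMap.sub_apply, D.T_apply, D.T_apply, Real.norm_eq_abs]
    refine this.trans (mul_le_mul_of_nonneg_right ?_ (abs_nonneg _))
    linarith
  · refine (ContinuousMap.norm_le _ (by positivity)).2 fun x => ?_
    have := abs_add_neg_le n2 (fun r hr => D.hasDerivAt₁ u x hr)
      (fun r hr => D.hasDerivAt₂ u x hr) (fun r hr => h2 u x r hr) hs
    rw [ContinuousMap.sub_apply, ContinuousMap.add_apply, ContinuousMap.smul_apply, D.T_apply,
      D.T_apply, D.T_apply, Real.norm_eq_abs, smul_eq_mul]
    refine this.trans (mul_le_mul_of_nonneg_right ?_ (by positivity))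
    linarith

theorem ParitySmallUpTo.congr (h0 : 0 < s₀) {k : ℕ} {c d : ℝ → F} (hc : ParitySmallUpTo X s₀ k c)
    (h : ∀ s, |s| < s₀ → c s = d s) : ParitySmallUpTo X s₀ k d := by
  induction k generalizing c d with
  | zero =>
    obtain ⟨C, hC, hb⟩ := hc
    refine ⟨C, hC, fun s hs => ?_⟩
    rw [← h s hs, ← h (-s) (by rwa [abs_neg]), ← h 0 (by simpa)]
    exact hb s hs
  | succ k ih => exact ⟨ih hc.1 h, fun l => ih (hc.2 l) fun s hs => by rw [h s hs]⟩

theorem paritySmallUpTo_jac_of (h0 : 0 < s₀) (hs₀ : s₀ ≤ 1) {k : ℕ}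
    (hT : ∀ u, ParitySmallUpTo X s₀ k fun s => D.T s u) (l m : ι) :
    ParitySmallUpTo X s₀ k (D.jac l m) := by
  have h2 : ParitySmallUpTo X s₀ k fun s => s ^ 2 • X l (D.Z m) := by
    have := (ParitySmallUpTo.id_smul hs₀ k (1 : F)).mul h0
      (ParitySmallUpTo.id_smul (X := X) hs₀ k (X l (D.Z m)))
    simpa [smul_smul, pow_two] using this
  have := (((ParitySmallUpTo.const k (X l (D.y m))).add ((hT (X l (D.y m))).neg h0)).add
    (ParitySmallUpTo.id_smul hs₀ k (X l (D.Y m)))).add h2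
  change ParitySmallUpTo X s₀ k fun s => D.jac l m s
  simpa only [jac, sub_eq_add_neg] using this

/-- The derivatives of `T s u` are again families of the form `T s v`, up to coefficients from the
Jacobian. -/
theorem paritySmallUpTo_T (h0 : 0 < s₀) (hs₀ : s₀ ≤ 1) (k : ℕ) (u : F) :
    ParitySmallUpTo X s₀ k fun s => D.T s u := by
  induction k generalizing u with
  | zero => exact D.paritySmall_T hs₀ u
  | succ k ih =>
    refine ⟨ih u, fun l => ?_⟩
    refine ParitySmallUpTo.congr h0 ((ih (X l u)).add (ParitySmallUpTo.sum Finset.univ fun m =>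
      (D.paritySmallUpTo_jac_of h0 hs₀ ih l m).mul h0 (ih (X m u)))) fun s hs => ?_
    exact (D.X_T s hs l u).symm

/-- The matrix which expresses the jet of `T s u` through the transported jet of `u`. -/
theorem exists_jet_matrix (h0 : 0 < s₀) (hs₀ : s₀ ≤ 1) (k : ℕ) :
    ∃ J : Wd ι k → Wd ι k → ℝ → F, (∀ j a b, ParitySmallUpTo X s₀ j (J a b)) ∧
      (∀ a (w : Wd ι k → F), ∑ b, J a b 0 * w b = w a) ∧
      (∀ a b l, X l (J a b 0) = 0) ∧
      ∀ s, |s| < s₀ → ∀ a u, wordOp X k a (D.T s u) = ∑ b, J a b s * D.T s (wordOp X k b u) := by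
  classical
  induction k with
  | zero =>
    refine ⟨fun _ _ _ => 1, fun j _ _ => ParitySmallUpTo.const j 1, fun a w => ?_, fun a b l => ?_,
      fun s _ a u => ?_⟩
    · exact (Finset.sum_singleton (fun b : Wd ι 0 => 1 * w b) (() : Unit)).trans (one_mul _)
    · simp
    · exact ((Finset.sum_singleton (fun b : Wd ι 0 => 1 * D.T s (wordOp X 0 b u))
        (() : Unit)).trans (one_mul _)).symm
  | succ k ih =>
    obtain ⟨J, hJ, hJ0, hJX, hJf⟩ := ih
    have hjac := fun j l m => D.paritySmallUpTo_jac_of h0 hs₀ (D.paritySmallUpTo_T h0 hs₀ j) l m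
        -- the full Jacobian
    let e : ι → ι → ℝ → F := fun l m s => (if l = m then 1 else 0) + D.jac l m s
    have he : ∀ j l m, ParitySmallUpTo X s₀ j (e l m) := fun j l m =>
      (ParitySmallUpTo.const j _).add (hjac j l m)
        -- the matrix for words with one more letter, by the product rule and the chain rule `X_T`
    let J' : Wd ι (k + 1) → Wd ι (k + 1) → ℝ → F := fun a b s =>
      match a.1, b.1 with
      | none, none => J a.2 b.2 s
      | none, some _ => 0
      | some l, none => X l (J a.2 b.2 s)
      | some l, some m => J a.2 b.2 s * e l m s
    refine ⟨J', ?_, ?_, ?_, ?_⟩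
    · rintro j ⟨_ | l, a⟩ ⟨_ | m, b⟩
      · exact hJ j a b
      · exact ParitySmallUpTo.const j 0
      · exact (hJ (j + 1) a b).2 l
      · exact (hJ j a b).mul h0 (he j l m)
    · rintro ⟨_ | l, a⟩ w
      · rw [sum_wd_succ]
        simp [J', hJ0 a fun b => w (none, b)]
      · rw [sum_wd_succ]
        simp only [J', hJX, zero_mul, Finset.sum_const_zero, zero_add, e, jac_zero, add_zero]
        rw [Finset.sum_eq_single l]
        · simpa using hJ0 a fun b => w (some l, b)
        · intro m _ hm; simp [hm.symm]
        · simp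
    · rintro ⟨_ | l, a⟩ ⟨_ | m, b⟩ i
      · exact hJX a b i
      · exact map_zero _
      · simp only [J', hJX, map_zero]
      · simp only [J', e, jac_zero, add_zero]
        split_ifs <;> simp [hJX]
    · rintro s hs ⟨_ | l, a⟩ u
      · rw [sum_wd_succ]
        simpa [J'] using hJf s hs a u
      · have hX : ∀ v, X l (D.T s v) = D.T s (X l v) + ∑ m, D.jac l m s * D.T s (X m v) :=
          fun v => D.X_T s hs l v
        rw [sum_wd_succ, wordOp_some, hJf s hs a u, map_sum]
        simp only [J', Derivation.leibniz, smul_eq_mul, wordOp_none, wordOp_some]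
        rw [Finset.sum_add_distrib, add_comm]
        congr 1
        · exact Finset.sum_congr rfl fun b _ => mul_comm _ _
        · rw [Finset.sum_comm]
          refine Finset.sum_congr rfl fun b _ => ?_
          rw [hX]
          simp only [e, add_mul, mul_add, Finset.sum_add_distrib, Finset.mul_sum, mul_assoc]
          congr 1
          simp [ite_mul]

/-- Average of the compositions with `Φ s` and `Φ (-s)`. -/
def avg (s : ℝ) : F →ₗ[ℝ] F :=
  (1 / 2 : ℝ) • ((D.T s).toLinearMap + (D.T (-s)).toLinearMap)

theorem avg_apply (s : ℝ) (u : F) (x : Q) :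
    (D.avg s u).1 x = (1 / 2 : ℝ) * (u.1 (D.Φ s x) + u.1 (D.Φ (-s) x)) := by
  rw [← D.T_apply, ← D.T_apply]; rfl

/-- If `v` is obtained from the mean `α` and the half difference `β` of two vectors of norm at most
`N` by matrices that are `1 + O(s²)` and `O(s)`, then `‖v‖ ≤ (1 + O(s²)) N`. The parallelogram law
`‖α‖² + ‖β‖² ≤ N²` compensates the term of first order in `β`. -/
theorem norm_le_of_parity {S : Type*} [Fintype S] {C N s : ℝ} (hC : 0 ≤ C)
    {E O : S → S → ℝ} (hE : ∀ a b, |E a b| ≤ C * |s| ^ 2) (hO : ∀ a b, |O a b| ≤ C * |s|)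
    {p m v : EuclideanSpace ℝ S} (hp : ‖p‖ ≤ N) (hm : ‖m‖ ≤ N)
    (hv : ∀ a, v a = (p a + m a) / 2 + ∑ b, E a b * ((p b + m b) / 2)
      + ∑ b, O a b * ((p b - m b) / 2)) :
    ‖v‖ ≤ (1 + ((∑ _a : S, ∑ _b : S, C) + (∑ _a : S, ∑ _b : S, C) ^ 2) * s ^ 2) * N := by
  set K := ∑ _a : S, ∑ _b : S, C
  have hK : 0 ≤ K := Finset.sum_nonneg fun _ _ => Finset.sum_nonneg fun _ _ => hC
  have small : ∀ (M : S → S → ℝ) (c : ℝ) (q : EuclideanSpace ℝ S), 0 ≤ c →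
      (∀ a b, |M a b| ≤ C * c) →
      ‖(WithLp.toLp 2 fun a => ∑ b, M a b * q b : EuclideanSpace ℝ S)‖ ≤ K * c * ‖q‖ := by
    intro M c q hc hM
    refine (euclidean_norm_le_sum _).trans ?_
    rw [Finset.sum_mul, Finset.sum_mul]
    refine Finset.sum_le_sum fun a _ => ?_
    rw [Finset.sum_mul, Finset.sum_mul]
    refine (Finset.abs_sum_le_sum_abs _ _).trans (Finset.sum_le_sum fun b _ => ?_)
    rw [abs_mul]
    exact mul_le_mul (hM a b) (PiLp.norm_apply_le q b) (abs_nonneg _) (by positivity)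
  set α : EuclideanSpace ℝ S := (1 / 2 : ℝ) • (p + m)
  set β : EuclideanSpace ℝ S := (1 / 2 : ℝ) • (p - m)
  have e : v = α + WithLp.toLp 2 (fun a => ∑ b, E a b * α b)
      + WithLp.toLp 2 (fun a => ∑ b, O a b * β b) := by
    ext a
    rw [hv a]
    simp only [α, β, PiLp.add_apply, PiLp.smul_apply, PiLp.sub_apply, smul_eq_mul]
    congr 1
    · congr 1
      · ring
      · exact Finset.sum_congr rfl fun b _ => by ring
    · exact Finset.sum_congr rfl fun b _ => by ring
  have h1 := small E (|s| ^ 2) α (by positivity) hE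
  have h2 := small O |s| β (by positivity) hO
  have hpar : ‖α‖ ^ 2 + ‖β‖ ^ 2 ≤ N ^ 2 := by
    have := parallelogram_law_with_norm ℝ p m
    simp only [α, β, norm_smul, mul_pow]
    rw [Real.norm_of_nonneg (by norm_num : (0 : ℝ) ≤ 1 / 2)]
    have hp2 := pow_le_pow_left₀ (norm_nonneg p) hp 2
    have hm2 := pow_le_pow_left₀ (norm_nonneg m) hm 2
    nlinarith
  have hN : 0 ≤ N := (norm_nonneg p).trans hp
  have hα : ‖α‖ ≤ N := abs_le_of_sq_le_sq' (by nlinarith [sq_nonneg ‖β‖]) hN |>.2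
  have hs2 : |s| ^ 2 = s ^ 2 := sq_abs s
    -- the Cauchy-Schwarz inequality for the pairs `(1, K |s|)` and `(‖α‖, ‖β‖)`
  have h3 : ‖α‖ + K * |s| * ‖β‖ ≤ (1 + K ^ 2 * s ^ 2) * N := by
    refine abs_le_of_sq_le_sq' ?_ (by positivity) |>.2
    rw [← hs2]
    have t0 : 0 ≤ K * |s| := by positivity
    have : (‖α‖ + K * |s| * ‖β‖) ^ 2 ≤ (1 + (K * |s|) ^ 2) * (‖α‖ ^ 2 + ‖β‖ ^ 2) := by
      nlinarith [sq_nonneg (K * |s| * ‖α‖ - ‖β‖)]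
    refine this.trans ?_
    have h5 : (1 + (K * |s|) ^ 2) * (‖α‖ ^ 2 + ‖β‖ ^ 2) ≤ (1 + (K * |s|) ^ 2) * N ^ 2 :=
      mul_le_mul_of_nonneg_left hpar (by positivity)
    have h6 : (1 + K ^ 2 * |s| ^ 2) * N ^ 2 ≤ ((1 + K ^ 2 * |s| ^ 2) * N) ^ 2 := by
      rw [mul_pow]
      refine mul_le_mul_of_nonneg_right ?_ (sq_nonneg _)
      nlinarith [mul_nonneg (sq_nonneg K) (sq_nonneg |s|)]
    rw [mul_pow] at h5 ⊢
    exact h5.trans h6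
  rw [e]
  refine (norm_add_le _ _).trans ((add_le_add_left (norm_add_le _ _) _).trans ?_)
  have h4 : K * |s| ^ 2 * ‖α‖ ≤ K * s ^ 2 * N := by
    rw [hs2]; exact mul_le_mul_of_nonneg_left hα (by positivity)
  nlinarith

/-- The average along a deformation increases the `C^k` norm at most by a factor `1 + O(s²)`. -/
theorem exists_avg_le (h0 : 0 < s₀) (hs₀ : s₀ ≤ 1) (k : ℕ) : ∃ C, 0 ≤ C ∧ ∀ s, |s| < s₀ → ∀ u,
    ckNorm X k (D.avg s u) ≤ (1 + C * s ^ 2) * ckNorm X k u := by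
  obtain ⟨J, hJ, hJ0, -, hJf⟩ := D.exists_jet_matrix h0 hs₀ k
  choose C hC hb using fun a b => hJ 0 a b
  set K := ∑ a, ∑ b, C a b with hKdef
  have hK : 0 ≤ K := Finset.sum_nonneg fun a _ => Finset.sum_nonneg fun b _ => hC a b
  have hCK : ∀ a b, C a b ≤ K := fun a b =>
    (Finset.single_le_sum (fun b _ => hC a b) (Finset.mem_univ b)).trans
      (Finset.single_le_sum (f := fun a => ∑ b, C a b)
        (fun a _ => Finset.sum_nonneg fun b _ => hC a b) (Finset.mem_univ a))
  have hKK : 0 ≤ ∑ _a : Wd ι k, ∑ _b : Wd ι k, K :=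
    Finset.sum_nonneg fun _ _ => Finset.sum_nonneg fun _ _ => hK
  refine ⟨(∑ _a : Wd ι k, ∑ _b : Wd ι k, K) + (∑ _a : Wd ι k, ∑ _b : Wd ι k, K) ^ 2,
    by positivity, fun s hs u => ?_⟩
  refine (ContinuousMap.norm_le _ (mul_nonneg ?_ (norm_nonneg _))).2 fun x => ?_
  · positivity
  -- `E` and `O` are the even part, without its value at `0`, and the odd part of the jet matrix
  refine norm_le_of_parity hK (s := s)
    (E := fun a b => ((J a b s).1 x + (J a b (-s)).1 x - 2 * (J a b 0).1 x) / 2)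
    (O := fun a b => ((J a b s).1 x - (J a b (-s)).1 x) / 2)
    (p := jetMap (wordOp X k) u (D.Φ s x)) (m := jetMap (wordOp X k) u (D.Φ (-s) x)) ?_ ?_
    ((jetMap (wordOp X k) u).norm_coe_le_norm _) ((jetMap (wordOp X k) u).norm_coe_le_norm _) ?_
  · intro a b
    have h1 := (hb a b s hs).2.2
    have h2 := ((((J a b s).1 + (J a b (-s)).1 - (2 : ℝ) • (J a b 0).1).norm_coe_le_norm x)).trans
      (h1.trans (mul_le_mul_of_nonneg_right (hCK a b) (by positivity)))
    rw [abs_div, abs_two]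
    have h3 : |(J a b s).1 x + (J a b (-s)).1 x - 2 * (J a b 0).1 x| ≤ K * |s| ^ 2 := h2
    have := abs_nonneg ((J a b s).1 x + (J a b (-s)).1 x - 2 * (J a b 0).1 x)
    linarith
  · intro a b
    have h1 := (hb a b s hs).2.1
    have h3 : |(J a b s).1 x - (J a b (-s)).1 x| ≤ K * |s| :=
      (((J a b s).1 - (J a b (-s)).1).norm_coe_le_norm x).trans
      (h1.trans (mul_le_mul_of_nonneg_right (hCK a b) (by positivity)))
    rw [abs_div, abs_two]
    have := abs_nonneg ((J a b s).1 x - (J a b (-s)).1 x)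
    linarith
  · intro a
    have hs' : |-s| < s₀ := by rwa [abs_neg]
    have hval : ∀ r, |r| < s₀ → (wordOp X k a (D.T r u)).1 x
        = ∑ b, (J a b r).1 x * (wordOp X k b u).1 (D.Φ r x) := by
      intro r hr
      rw [hJf r hr a u]
      simp [D.T_apply]
    have hid : ∀ w : Wd ι k → ℝ, ∑ b, (J a b 0).1 x * w b = w a := by
      intro w
      have := congrArg (fun f : F => f.1 x) (hJ0 a fun b => algebraMap ℝ F (w b))
      simpa using this
    have h1 := hid fun b => ((wordOp X k b u).1 (D.Φ s x) + (wordOp X k b u).1 (D.Φ (-s) x)) / 2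
    simp only [jetMap_apply]
    rw [← h1]
    have h2 : (wordOp X k a (D.avg s u)).1 x
        = (1 / 2) * ((wordOp X k a (D.T s u)).1 x + (wordOp X k a (D.T (-s) u)).1 x) := by
      have : D.avg s u = (1 / 2 : ℝ) • (D.T s u + D.T (-s) u) := rfl
      rw [this, map_smul, map_add]; rfl
    rw [h2, hval s hs, hval (-s) hs', ← Finset.sum_add_distrib, Finset.mul_sum,
      ← Finset.sum_add_distrib, ← Finset.sum_add_distrib]
    exact Finset.sum_congr rfl fun b _ => by ring

end Deformation

end Parity

/-! ### Approximate solutions for a large zeroth order term -/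

section Approx

/-- The equation `μ u - P u = f` with `P` of norm at most `q < μ` is solved up to an arbitrarily
small error by iteration of `u ↦ μ⁻¹ (f + P u)`; no completeness is needed. -/
theorem exists_approx_solution {V : Type*} [AddCommGroup V] [Module ℝ V] (N : Seminorm ℝ V)
    (P : V →ₗ[ℝ] V) {q μ : ℝ} (hq : 0 ≤ q) (hqμ : q < μ) (hP : ∀ u, N (P u) ≤ q * N u) (f : V)
    {η : ℝ} (hη : 0 < η) :
    ∃ u, N (μ • u - P u - f) ≤ η ∧ N u ≤ N f / (μ - q) := by
  have hμ : 0 < μ := hq.trans_lt hqμ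
  have hgap : 0 < μ - q := by linarith
  let step : V → V := fun u => μ⁻¹ • (f + P u)
  let u : ℕ → V := fun j => step^[j] 0
  have hu : ∀ j, u (j + 1) = μ⁻¹ • (f + P (u j)) := fun j =>
    Function.iterate_succ_apply' step j 0
  have hbound : ∀ j, N (u j) ≤ N f / (μ - q) := by
    intro j
    induction j with
    | zero => simp only [u, Function.iterate_zero, id, map_zero]; positivity
    | succ j ih =>
      rw [hu, map_smul_eq_mul, Real.norm_of_nonneg (inv_nonneg.2 hμ.le), inv_mul_le_iff₀ hμ]
      refine (map_add_le_add N _ _).trans ?_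
      have h1 := (hP (u j)).trans (mul_le_mul_of_nonneg_left ih hq)
      have h2 : N f = (μ - q) * (N f / (μ - q)) := by field_simp
      nlinarith
  have hdiff : ∀ j, N (u (j + 1) - u j) ≤ (q / μ) ^ j * N (u 1 - u 0) := by
    intro j
    induction j with
    | zero => simp
    | succ j ih =>
      have e : u (j + 1 + 1) - u (j + 1) = μ⁻¹ • P (u (j + 1) - u j) := by
        rw [hu (j + 1)]
        nth_rw 2 [hu j]
        rw [← smul_sub, map_sub]; congr 1; abel
      rw [e, map_smul_eq_mul, Real.norm_of_nonneg (inv_nonneg.2 hμ.le)]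
      have h1 := (hP (u (j + 1) - u j)).trans (mul_le_mul_of_nonneg_left ih hq)
      calc μ⁻¹ * N (P (u (j + 1) - u j)) ≤ μ⁻¹ * (q * ((q / μ) ^ j * N (u 1 - u 0))) :=
            mul_le_mul_of_nonneg_left h1 (inv_nonneg.2 hμ.le)
        _ = _ := by rw [pow_succ]; ring
  have hlim : Tendsto (fun j : ℕ => μ * ((q / μ) ^ j * N (u 1 - u 0))) atTop (𝓝 0) := by
    have := (tendsto_pow_atTop_nhds_zero_of_lt_one (div_nonneg hq hμ.le)
      ((div_lt_one hμ).2 hqμ)).mul_const (N (u 1 - u 0))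
    simpa using this.const_mul μ
  obtain ⟨j, hj⟩ := (hlim.eventually (gt_mem_nhds hη)).exists
  refine ⟨u j, ?_, hbound j⟩
  have e : μ • u j - P (u j) - f = -(μ • (u (j + 1) - u j)) := by
    rw [hu, smul_sub, smul_inv_smul₀ hμ.ne']; abel
  rw [e, map_neg_eq_map, map_smul_eq_mul, Real.norm_of_nonneg hμ.le]
  exact (mul_le_mul_of_nonneg_left (hdiff j) hμ.le).trans hj.le

end Approx

section Solve

variable {Q : Type*} [TopologicalSpace Q] [CompactSpace Q] {F : Subalgebra ℝ C(Q, ℝ)}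
  {ι : Type} [Fintype ι] {X : ι → Derivation ℝ F F} {s₀ : ℝ} {ν : Type*} [Fintype ν]

variable (X) in
/-- The `C^k` norm as a seminorm. -/
def ckSeminorm (k : ℕ) : Seminorm ℝ F :=
  (normSeminorm ℝ C(Q, EuclideanSpace ℝ (Wd ι k))).comp (jetMap (wordOp X k))

@[simp] theorem ckSeminorm_apply (k : ℕ) (u : F) : ckSeminorm X k u = ckNorm X k u := rfl

/-- The generator of a family of deformations: minus one half of the sum of the second
derivatives along the deformations. -/
def generator (D : ν → Deformation X s₀) : F →ₗ[ℝ] F := (-(1 / 2) : ℝ) • ∑ i, (D i).B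

theorem generator_mem (D : ν → Deformation X s₀) : generator D ∈ diffOp X 2 :=
  Submodule.smul_of_tower_mem _ _ (sum_mem fun i _ => (D i).B_mem)

theorem generator_apply (D : ν → Deformation X s₀) (u : F) (x : Q) :
    (generator D u).1 x = -(1 / 2) * ∑ i, ((D i).B u).1 x := by
  have : generator D u = (-(1 / 2) : ℝ) • ∑ i, (D i).B u := by
    simp [generator]
  rw [this]
  simp

/-- Interpolation: the derivatives of first order are controlled by the function and its
derivatives of second order. -/
theorem exists_interpolation (hs₀ : s₀ ≤ 1) (D : ν → Deformation X s₀)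
    (hspan : ∀ l, ∃ b : ν → F, ∀ u, X l u = ∑ i, b i * (D i).V u) (k : ℕ) :
    ∃ C, 0 ≤ C ∧ ∀ w s, 0 < s → s < s₀ →
      ckNorm X (k + 1) w ≤ C * (ckNorm X k w / s + s * ckNorm X (k + 2) w) := by
  choose b hb using hspan
  choose CT hCT hT using fun i => (D i).exists_taylor₂ hs₀
  -- the estimate for the derivative of a function `v` along one deformation, by Taylor expansion
  have hV : ∀ i v s, 0 < s → s < s₀ →
      ‖((D i).V v).1‖ ≤ (2 + CT i) * (‖v.1‖ / s + s * ckNorm X 2 v) := by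
    intro i v s hs hs'
    have hn2 := ckNorm_nonneg (X := X) 2 v
    refine (ContinuousMap.norm_le _ (mul_nonneg (by linarith [hCT i]) (by positivity))).2
      fun x => ?_
    have h1 := hT i v x s (by rwa [abs_of_pos hs])
    rw [abs_of_pos hs] at h1
    have h2 := abs_le.1 (norm_apply_le v ((D i).Φ s x))
    have h3 := abs_le.1 (norm_apply_le v x)
    have h4 := abs_le.1 h1
    have key : s * |((D i).V v).1 x| ≤ 2 * ‖v.1‖ + CT i * ckNorm X 2 v * s ^ 2 := by
      rw [← abs_of_pos hs, ← abs_mul, abs_of_pos hs, abs_le]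
      constructor <;> linarith
    have h5 : |((D i).V v).1 x| ≤ 2 * (‖v.1‖ / s) + CT i * (s * ckNorm X 2 v) := by
      rw [← mul_le_mul_iff_right₀ hs]
      refine key.trans (le_of_eq ?_)
      field_simp
    refine h5.trans ?_
    have e1 : 0 ≤ CT i * (‖v.1‖ / s) := mul_nonneg (hCT i) (by positivity)
    have e2 : 0 ≤ s * ckNorm X 2 v := by positivity
    nlinarith
  choose CW hCW hW using fun a : Wd ι k => diffOp_ckNorm_bound (wordOp_mem (X := X) a) 2
  let c : ι → Wd ι k → ℝ := fun l a => ∑ i, ‖(b l i).1‖ * ((2 + CT i) * (1 + CW a))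
  have hc : ∀ l a, 0 ≤ c l a := fun l a => Finset.sum_nonneg fun i _ =>
    mul_nonneg (norm_nonneg _) (mul_nonneg (by linarith [hCT i]) (by linarith [hCW a]))
  refine ⟨(∑ _a : Wd ι k, 1) + ∑ l, ∑ a, c l a, add_nonneg
    (Finset.sum_nonneg fun _ _ => zero_le_one)
    (Finset.sum_nonneg fun l _ => Finset.sum_nonneg fun a _ => hc l a), fun w s hs hs' => ?_⟩
  have hnk := ckNorm_nonneg (X := X) k w
  have hnk2 := ckNorm_nonneg (X := X) (k + 2) w
  set R := ckNorm X k w / s + s * ckNorm X (k + 2) w with hR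
  have hk : ckNorm X k w ≤ ckNorm X k w / s := by
    rw [le_div_iff₀ hs]; nlinarith
  have hkR : ckNorm X k w ≤ R := by
    have : 0 ≤ s * ckNorm X (k + 2) w := by positivity
    linarith
  refine (norm_jetMap_le _ _).trans ?_
  rw [sum_wd_succ, add_mul, Finset.sum_mul, Finset.sum_mul]
  refine add_le_add (Finset.sum_le_sum fun a _ => ?_) (Finset.sum_le_sum fun l _ => ?_)
  · rw [one_mul]; exact (norm_wordOp_le k a w).trans hkR
  · rw [Finset.sum_mul]
    refine Finset.sum_le_sum fun a _ => ?_
    rw [wordOp_some, hb l]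
    have e : (∑ i, b l i * (D i).V (wordOp X k a w)).1
        = ∑ i, (b l i).1 * ((D i).V (wordOp X k a w)).1 := by
      simp
    rw [e, Finset.sum_mul]
    refine (norm_sum_le _ _).trans (Finset.sum_le_sum fun i _ => ?_)
    refine (norm_mul_le _ _).trans ?_
    rw [mul_assoc]
    refine mul_le_mul_of_nonneg_left ?_ (norm_nonneg _)
    refine (hV i _ s hs hs').trans ?_
    rw [mul_assoc]
    refine mul_le_mul_of_nonneg_left ?_ (by linarith [hCT i])
    have h1 : ‖(wordOp X k a w).1‖ / s ≤ ckNorm X k w / s :=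
      div_le_div_of_nonneg_right (norm_wordOp_le k a w) hs.le
    have h2 : s * ckNorm X 2 (wordOp X k a w) ≤ s * (CW a * ckNorm X (k + 2) w) :=
      mul_le_mul_of_nonneg_left (hW a w) hs.le
    have h3 : 0 ≤ CW a * (ckNorm X k w / s) := mul_nonneg (hCW a) (by positivity)
    have h4 : 0 ≤ s * ckNorm X (k + 2) w := by positivity
    rw [hR]
    nlinarith

/-- A function that is small in `C^0` and bounded in `C^(k + 1)` is small in `C^k`. -/
theorem exists_small_of_small (h0 : 0 < s₀) (hs₀ : s₀ ≤ 1) (D : ν → Deformation X s₀)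
    (hspan : ∀ l, ∃ b : ν → F, ∀ u, X l u = ∑ i, b i * (D i).V u) (K : ℝ) (k : ℕ) {η : ℝ}
    (hη : 0 < η) :
    ∃ δ, 0 < δ ∧ ∀ w : F, ckNorm X 0 w ≤ δ → ckNorm X (k + 1) w ≤ K → ckNorm X k w ≤ η := by
  induction k generalizing η with
  | zero => exact ⟨η, hη, fun w hw _ => hw⟩
  | succ k ih =>
    obtain ⟨C, hC, hb⟩ := exists_interpolation hs₀ D hspan k
    let s := min (s₀ / 2) (η / (2 * (C * |K| + 1)))
    have hs : 0 < s := by positivity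
    have hs' : s < s₀ := (min_le_left _ _).trans_lt (by linarith)
    have hsK : C * (s * |K|) ≤ η / 2 := by
      have h1 : s ≤ η / (2 * (C * |K| + 1)) := min_le_right _ _
      rw [le_div_iff₀ (by positivity)] at h1
      nlinarith
    obtain ⟨δ, hδ, hδ'⟩ := ih (η := η / 2 * s / (C + 1)) (by positivity)
    refine ⟨δ, hδ, fun w hw hK => ?_⟩
    have h1 := hδ' w hw ((ckNorm_mono_succ _ _).trans hK)
    refine (hb w s hs hs').trans ?_
    have h2 : C * (ckNorm X k w / s) ≤ η / 2 := by
      rw [← mul_div_assoc, div_le_iff₀ hs]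
      rw [le_div_iff₀ (by positivity)] at h1
      nlinarith [ckNorm_nonneg (X := X) k w]
    have h3 : C * (s * ckNorm X (k + 2) w) ≤ C * (s * |K|) :=
      mul_le_mul_of_nonneg_left (mul_le_mul_of_nonneg_left (hK.trans (le_abs_self K)) hs.le) hC
    rw [mul_add]
    linarith

/-- For a large zeroth order term the equation can be solved up to a small error in `C^k`, by
replacing the generator by difference quotients along the deformations. -/
theorem exists_approx_of_large (h0 : 0 < s₀) (hs₀ : s₀ ≤ 1) (D : ν → Deformation X s₀)
    (hspan : ∀ l, ∃ b : ν → F, ∀ u, X l u = ∑ i, b i * (D i).V u) (k : ℕ) :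
    ∃ Λ : ℝ, ∀ μ, Λ ≤ μ → ∀ (f : F) (η : ℝ), 0 < η →
      ∃ u, ckNorm X k (μ • u + generator D u - f) ≤ η := by
  choose CG hCG hG using fun i => (D i).exists_avg_le h0 hs₀ (k + 3)
  choose CT hCT hT using fun i => (D i).exists_taylor₃ hs₀
  obtain ⟨CA, hCA, hA⟩ := diffOp_ckNorm_bound (generator_mem D) (k + 1)
  have hsumG : 0 ≤ ∑ i, CG i := Finset.sum_nonneg fun i _ => hCG i
  have hsumT : 0 ≤ ∑ i, CT i := Finset.sum_nonneg fun i _ => hCT i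
  refine ⟨(∑ i, CG i) + 1, fun μ hμ f η hη => ?_⟩
  have hμ0 : 0 ≤ μ := by linarith
  set N := ckNorm X (k + 3) f with hN
  have hN0 : 0 ≤ N := ckNorm_nonneg _ _
  -- bounds for the three terms of the error in `C^(k + 1)`, independent of `s`; it therefore
  -- suffices to make the error small in `C^0`
  obtain ⟨δ, hδ, hsmall⟩ := exists_small_of_small h0 hs₀ D hspan (μ * N + CA * N + N) k hη
  let C' := 1 + (∑ i, CT i) * N
  have hC' : 0 < C' := by positivity
  let s := min (s₀ / 2) (δ / C')
  have hs : 0 < s := by positivity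
  have hs' : s < s₀ := (min_le_left _ _).trans_lt (by linarith)
  have hsδ : s * C' ≤ δ := by
    have : s ≤ δ / C' := min_le_right _ _
    rwa [le_div_iff₀ hC'] at this
  -- `s⁻² (m - ∑ avg)` is the difference quotient that replaces the generator; on `C^(k + 3)` the
  -- norm of `P` exceeds `s⁻² m` at most by a constant independent of `s`
  let P : F →ₗ[ℝ] F := (s ^ 2)⁻¹ • ∑ i, (D i).avg s
  let m : ℝ := Fintype.card ν
  have hP : ∀ u, ckSeminorm X (k + 3) (P u)
      ≤ ((s ^ 2)⁻¹ * (m + (∑ i, CG i) * s ^ 2)) * ckSeminorm X (k + 3) u := by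
    intro u
    have e : P u = (s ^ 2)⁻¹ • ∑ i, (D i).avg s u := by simp [P]
    rw [e, ckSeminorm_apply, ckNorm_smul, abs_of_pos (by positivity), mul_assoc]
    refine mul_le_mul_of_nonneg_left ?_ (by positivity)
    refine (ckNorm_sum_le _ _ _).trans ?_
    refine (Finset.sum_le_sum fun i _ => hG i s (by rwa [abs_of_pos hs]) u).trans ?_
    rw [← Finset.sum_mul]
    refine mul_le_mul_of_nonneg_right (le_of_eq ?_) (ckNorm_nonneg _ _)
    rw [Finset.sum_add_distrib, Finset.sum_mul]
    simp [m]
  have hm : 0 ≤ m := Nat.cast_nonneg _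
  have hq : (s ^ 2)⁻¹ * (m + (∑ i, CG i) * s ^ 2) = (s ^ 2)⁻¹ * m + ∑ i, CG i := by
    field_simp
  obtain ⟨u, hu1, hu2⟩ := exists_approx_solution (ckSeminorm X (k + 3)) P
    (q := (s ^ 2)⁻¹ * (m + (∑ i, CG i) * s ^ 2)) (μ := μ + (s ^ 2)⁻¹ * m) (by positivity)
    (by rw [hq]; linarith) hP f hs
  have hu : ckNorm X (k + 3) u ≤ N := by
    refine hu2.trans (div_le_self hN0 ?_)
    rw [hq]; linarith
  refine ⟨u, hsmall _ ?_ ?_⟩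
  · -- the error in `C^0`: the error of the iteration and that of the difference quotient
    refine (ckNorm_zero_eq _).trans ((ContinuousMap.norm_le _ hδ.le).2 fun x => ?_)
    have h1 : |((μ + (s ^ 2)⁻¹ * m) • u - P u - f).1 x| ≤ s :=
      (norm_apply_le _ x).trans ((norm_wordOp_le (X := X) 0 () _).trans
        ((ckNorm_mono (Nat.zero_le _) _).trans hu1))
    have h2 : |∑ i, (u.1 ((D i).Φ s x) + u.1 ((D i).Φ (-s) x) - 2 * u.1 x
        - s ^ 2 * ((D i).B u).1 x)| ≤ (∑ i, CT i) * N * s ^ 3 := by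
      refine (Finset.abs_sum_le_sum_abs _ _).trans ?_
      rw [Finset.sum_mul, Finset.sum_mul]
      refine Finset.sum_le_sum fun i _ => ?_
      have := hT i u x s (by rwa [abs_of_pos hs])
      rw [abs_of_pos hs] at this
      refine this.trans (mul_le_mul_of_nonneg_right (mul_le_mul_of_nonneg_left ?_ (hCT i))
        (by positivity))
      exact (ckNorm_mono (by omega) u).trans hu
    have e1 : ((μ + (s ^ 2)⁻¹ * m) • u - P u - f).1 x = (μ + (s ^ 2)⁻¹ * m) * u.1 x
        - (s ^ 2)⁻¹ * ∑ i, (1 / 2 : ℝ) * (u.1 ((D i).Φ s x) + u.1 ((D i).Φ (-s) x)) - f.1 x := by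
      have : P u = (s ^ 2)⁻¹ • ∑ i, (D i).avg s u := by simp [P]
      rw [this]
      simp [Deformation.avg_apply]
    have e2 : (μ • u + generator D u - f).1 x = ((μ + (s ^ 2)⁻¹ * m) • u - P u - f).1 x
        + (s ^ 2)⁻¹ * ((1 / 2) * ∑ i, (u.1 ((D i).Φ s x) + u.1 ((D i).Φ (-s) x) - 2 * u.1 x
          - s ^ 2 * ((D i).B u).1 x)) := by
      rw [e1]
      have : (μ • u + generator D u - f).1 x = μ * u.1 x + (generator D u).1 x - f.1 x := rfl
      rw [this, generator_apply]
      simp only [Finset.sum_sub_distrib, ← Finset.mul_sum, Finset.sum_const, Finset.card_univ,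
        nsmul_eq_mul]
      field_simp
      ring
    rw [e2, Real.norm_eq_abs]
    refine (abs_add_le _ _).trans ?_
    rw [abs_mul, abs_mul, abs_of_pos (by positivity : 0 < (s ^ 2)⁻¹),
      abs_of_pos (by norm_num : (0 : ℝ) < 1 / 2)]
    have h3 : (s ^ 2)⁻¹ * (1 / 2 * |∑ i, (u.1 ((D i).Φ s x) + u.1 ((D i).Φ (-s) x) - 2 * u.1 x
        - s ^ 2 * ((D i).B u).1 x)|) ≤ (∑ i, CT i) * N * s := by
      rw [inv_mul_le_iff₀ (by positivity)]
      have : 0 ≤ (∑ i, CT i) * N * s ^ 3 := by positivity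
      nlinarith
    refine (add_le_add h1 h3).trans (le_trans (le_of_eq ?_) hsδ)
    simp only [C']; ring
  · refine (ckNorm_sub_le _ _ _).trans (add_le_add ((ckNorm_add_le _ _ _).trans
      (add_le_add ?_ ?_)) (ckNorm_mono (by omega) _))
    · rw [ckNorm_smul, abs_of_nonneg hμ0]
      exact mul_le_mul_of_nonneg_left ((ckNorm_mono (by omega) u).trans hu) hμ0
    · refine (hA u).trans (mul_le_mul_of_nonneg_left ?_ hCA)
      rw [show 2 + (k + 1) = k + 3 by omega]
      exact hu

end Solve

section Bernstein

variable {Q : Type*} [TopologicalSpace Q] [CompactSpace Q] {F : Subalgebra ℝ C(Q, ℝ)}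
  {ι : Type} [Fintype ι] {X : ι → Derivation ℝ F F} {s₀ : ℝ} {ν : Type*} [Fintype ν]

/-! ### Bernstein estimates -/

/-- The Bochner type formula for the generator applied to a square. -/
theorem generator_sq (D : ν → Deformation X s₀) (u : F) (x : Q) :
    (generator D (u * u)).1 x
      = 2 * (u.1 x * (generator D u).1 x) - ∑ i, (((D i).V u).1 x) ^ 2 := by
  simp only [generator_apply, Deformation.V_sq]
  have : ∀ i, (2 * (u * (D i).B u) + 2 * ((D i).V u * (D i).V u)).1 x
      = 2 * (u.1 x * ((D i).B u).1 x) + 2 * (((D i).V u).1 x) ^ 2 := by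
    intro i; rw [pow_two]; rfl
  simp only [this, Finset.sum_add_distrib, ← Finset.mul_sum]
  ring

/-- The generator is elliptic: the derivatives along the deformations control all derivations. The
bound `c ≤ 1 / 4` is what leads to the constant `1 / 8` in `exists_bernstein`. -/
theorem exists_gradient_bound (D : ν → Deformation X s₀)
    (hspan : ∀ l, ∃ b : ν → F, ∀ u, X l u = ∑ i, b i * (D i).V u) :
    ∃ c : ℝ, 0 < c ∧ c ≤ 1 / 4 ∧ ∀ u x,
      c * ∑ l, ((X l u).1 x) ^ 2 ≤ ∑ i, (((D i).V u).1 x) ^ 2 := by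
  choose b hb using hspan
  set K := ∑ l, ∑ i, ‖(b l i).1‖ ^ 2 with hK
  have hK0 : 0 ≤ K := Finset.sum_nonneg fun _ _ => Finset.sum_nonneg fun _ _ => sq_nonneg _
  refine ⟨min (1 / 4) (K + 1)⁻¹, by positivity, min_le_left _ _, fun u x => ?_⟩
  set S := ∑ i, (((D i).V u).1 x) ^ 2 with hS
  have hS0 : 0 ≤ S := Finset.sum_nonneg fun _ _ => sq_nonneg _
  have h1 : ∑ l, ((X l u).1 x) ^ 2 ≤ K * S := by
    rw [hK, Finset.sum_mul]
    refine Finset.sum_le_sum fun l _ => ?_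
    have e : (X l u).1 x = ∑ i, (b l i).1 x * ((D i).V u).1 x := by
      rw [hb l u]; simp
    rw [e]
    refine (Finset.sum_mul_sq_le_sq_mul_sq _ _ _).trans (mul_le_mul_of_nonneg_right ?_ hS0)
    refine Finset.sum_le_sum fun i _ => ?_
    rw [← sq_abs]
    exact pow_le_pow_left₀ (abs_nonneg _) (norm_apply_le _ _) 2
  calc min (1 / 4) (K + 1)⁻¹ * ∑ l, ((X l u).1 x) ^ 2 ≤ (K + 1)⁻¹ * (K * S) :=
        mul_le_mul (min_le_right _ _) h1 (Finset.sum_nonneg fun _ _ => sq_nonneg _)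
          (by positivity)
    _ ≤ S := by
        rw [inv_mul_le_iff₀ (by positivity)]; nlinarith

variable (X) in
/-- The sum of the products of the derivatives of order at most `k` of two functions. -/
def wordPair (k : ℕ) (u v : F) : F := ∑ a, wordOp X k a u * wordOp X k a v

theorem wordPair_apply (k : ℕ) (u v : F) (x : Q) :
    (wordPair X k u v).1 x = ∑ a, (wordOp X k a u).1 x * (wordOp X k a v).1 x := by
  simp [wordPair]

theorem wordPair_self_nonneg (k : ℕ) (u : F) (x : Q) : 0 ≤ (wordPair X k u u).1 x := by
  rw [wordPair_apply]; exact Finset.sum_nonneg fun _ _ => mul_self_nonneg _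

theorem wordPair_succ (k : ℕ) (u : F) (x : Q) : (wordPair X (k + 1) u u).1 x
    = (wordPair X k u u).1 x + ∑ a, ∑ l, ((X l (wordOp X k a u)).1 x) ^ 2 := by
  rw [wordPair_apply, wordPair_apply, sum_wd_succ, Finset.sum_comm]
  simp only [wordOp_none, wordOp_some, pow_two]

/-- The differential inequality for the sum of squares of the derivatives of order at most `k`. The
formula for squares contributes the derivatives of order `k + 1` with a negative sign, and half of
this term absorbs the commutators of `A` with the words of length `k`. There are no commutators for
`k = 0`, where the constant is therefore as small as `c`. -/
theorem exists_wordPair_estimate (D : ν → Deformation X s₀)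
    (hcomm : ∀ l m, (X l : F →ₗ[ℝ] F) ∘ₗ (X m : F →ₗ[ℝ] F)
      - (X m : F →ₗ[ℝ] F) ∘ₗ (X l : F →ₗ[ℝ] F) ∈ diffOp X 1)
    {c : ℝ} (hc : 0 < c) (hgrad : ∀ u x,
      c * ∑ l, ((X l u).1 x) ^ 2 ≤ ∑ i, (((D i).V u).1 x) ^ 2) (k : ℕ) :
    ∃ K : ℝ, 0 ≤ K ∧ (k = 0 → K = c) ∧ ∀ (μ : ℝ) (u : F) (x : Q),
      (generator D (wordPair X k u u)).1 x + 2 * μ * (wordPair X k u u).1 x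
        ≤ 2 * (wordPair X k u (μ • u + generator D u)).1 x + K * (wordPair X k u u).1 x
          - c / 2 * (wordPair X (k + 1) u u).1 x := by
  set G := generator D with hG
  have hR := fun a => diffOp_bound (commutator_wordOp_mem hcomm (generator_mem D) k a)
  choose C hC hCb using hR
  have hC0 : 0 ≤ ∑ a, C a := Finset.sum_nonneg fun a _ => hC a
  set C' := (∑ a, C a) + 1 with hC'
  have hC'0 : 0 < C' := by positivity
  have main : ∀ (μ : ℝ) (u : F) (x : Q),
      (G (wordPair X k u u)).1 x + 2 * μ * (wordPair X k u u).1 x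
        = 2 * (wordPair X k u (μ • u + G u)).1 x
          + ∑ a, 2 * (wordOp X k a u).1 x * ((G ∘ₗ wordOp X k a - wordOp X k a ∘ₗ G) u).1 x
          - ∑ a, ∑ i, (((D i).V (wordOp X k a u)).1 x) ^ 2 := by
    intro μ u x
    have e1 : (G (wordPair X k u u)).1 x = ∑ a, (G (wordOp X k a u * wordOp X k a u)).1 x := by
      rw [wordPair, map_sum]; simp
    rw [e1]
    simp only [hG, generator_sq]
    rw [wordPair_apply, wordPair_apply, Finset.mul_sum, Finset.mul_sum, ← Finset.sum_add_distrib,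
      ← Finset.sum_add_distrib, ← Finset.sum_sub_distrib]
    refine Finset.sum_congr rfl fun a _ => ?_
    have e2 : (wordOp X k a (μ • u + generator D u)).1 x
        = μ * (wordOp X k a u).1 x + (wordOp X k a (generator D u)).1 x := by
      rw [map_add, map_smul]; rfl
    have e3 : ((generator D ∘ₗ wordOp X k a - wordOp X k a ∘ₗ generator D) u).1 x
        = (generator D (wordOp X k a u)).1 x - (wordOp X k a (generator D u)).1 x := rfl
    rw [e2, e3]
    ring
  have hΓ : ∀ u x, c * (wordPair X (k + 1) u u).1 x - c * (wordPair X k u u).1 x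
      ≤ ∑ a, ∑ i, (((D i).V (wordOp X k a u)).1 x) ^ 2 := by
    intro u x
    rw [wordPair_succ, mul_add, add_sub_cancel_left, Finset.mul_sum]
    exact Finset.sum_le_sum fun a _ => hgrad _ x
  by_cases hk : k = 0
  · subst hk
    refine ⟨c, hc.le, fun _ => rfl, fun μ u x => ?_⟩
    rw [main]
    have e : ∑ a, 2 * (wordOp X 0 a u).1 x
        * ((G ∘ₗ wordOp X 0 a - wordOp X 0 a ∘ₗ G) u).1 x = 0 := by
      refine Finset.sum_eq_zero fun a _ => ?_
      have : (G ∘ₗ wordOp X 0 a - wordOp X 0 a ∘ₗ G) u = 0 := by simp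
      rw [this]; simp
    rw [e]
    have := hΓ u x
    have := wordPair_self_nonneg (X := X) (0 + 1) u x
    nlinarith
  · refine ⟨2 * C' / c + c, by positivity, fun h => absurd h hk, fun μ u x => ?_⟩
    rw [main]
    have h1 := hΓ u x
    have h2 : ∑ a, 2 * (wordOp X k a u).1 x
        * ((G ∘ₗ wordOp X k a - wordOp X k a ∘ₗ G) u).1 x
        ≤ 2 * C' / c * (wordPair X k u u).1 x + c / 2 * (wordPair X (k + 1) u u).1 x := by
      have hle : ∀ a, 2 * (wordOp X k a u).1 x
          * ((G ∘ₗ wordOp X k a - wordOp X k a ∘ₗ G) u).1 x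
          ≤ 2 * C' / c * ((wordOp X k a u).1 x * (wordOp X k a u).1 x)
            + c / (2 * C') * (C a * (wordPair X (k + 1) u u).1 x) := by
        intro a
        set p := (wordOp X k a u).1 x
        set r := ((G ∘ₗ wordOp X k a - wordOp X k a ∘ₗ G) u).1 x
        have hr : r ^ 2 ≤ C a * (wordPair X (k + 1) u u).1 x := by
          have := hCb a u x
          rw [wordPair_apply]
          simpa only [pow_two] using this
        -- Young's inequality, with weights such that the sum over the words gives `c / 2`
        have hy : 2 * p * r ≤ 2 * C' / c * (p * p) + c / (2 * C') * r ^ 2 := by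
          have h := sq_nonneg (2 * C' * p - c * r)
          have e : 2 * C' / c * (p * p) + c / (2 * C') * r ^ 2 - 2 * p * r
              = (2 * C' * p - c * r) ^ 2 / (2 * C' * c) := by
            field_simp; ring
          have : 0 ≤ (2 * C' * p - c * r) ^ 2 / (2 * C' * c) := by positivity
          linarith
        have := mul_le_mul_of_nonneg_left hr (by positivity : 0 ≤ c / (2 * C'))
        linarith
      refine (Finset.sum_le_sum fun a _ => hle a).trans ?_
      rw [Finset.sum_add_distrib, ← Finset.mul_sum, ← Finset.mul_sum, ← Finset.sum_mul,
        ← wordPair_apply]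
      refine add_le_add le_rfl ?_
      rw [← mul_assoc]
      refine mul_le_mul_of_nonneg_right ?_ (wordPair_self_nonneg _ _ _)
      rw [div_mul_eq_mul_div, div_le_div_iff₀ (by positivity) (by norm_num)]
      nlinarith
    nlinarith

/-- A priori estimates in all `C^k` norms. They come from the maximum principle for a weighted
sum of squares of derivatives. As the constant `1 / 8` is smaller than one, they apply in
particular to `u + A u`. -/
theorem exists_bernstein [Nonempty Q] (h0 : 0 < s₀) (hs₀ : s₀ ≤ 1) (D : ν → Deformation X s₀)
    (hspan : ∀ l, ∃ b : ν → F, ∀ u, X l u = ∑ i, b i * (D i).V u)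
    (hcomm : ∀ l m, (X l : F →ₗ[ℝ] F) ∘ₗ (X m : F →ₗ[ℝ] F)
      - (X m : F →ₗ[ℝ] F) ∘ₗ (X l : F →ₗ[ℝ] F) ∈ diffOp X 1) (k : ℕ) :
    ∃ (N : Seminorm ℝ F) (C C' : ℝ), 0 ≤ C ∧ 0 ≤ C' ∧ (∀ u, N u ≤ C * ckNorm X k u) ∧
      (∀ u, ckNorm X k u ≤ C' * N u) ∧
      ∀ (μ : ℝ) (u : F), (μ - 1 / 8) * N u ≤ N (μ • u + generator D u) := by
  obtain ⟨c, hc, hc4, hgrad⟩ := exists_gradient_bound D hspan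
  choose K hK hK0 hest using fun k => exists_wordPair_estimate D hcomm hc hgrad k
  -- the weights decrease so fast that the term with `K` in the inequality of order `j + 1` is
  -- absorbed by the negative term in the inequality of order `j`
  let α : ℕ → ℝ := fun k => Nat.rec 1 (fun j a => a * (c / (2 * (K (j + 1) + 1)))) k
  have hαs : ∀ j, α (j + 1) = α j * (c / (2 * (K (j + 1) + 1))) := fun _ => rfl
  have hα : ∀ j, 0 < α j := by
    intro j
    induction j with
    | zero => exact zero_lt_one
    | succ j ih => rw [hαs]; have := hK (j + 1); positivity
  have hαK : ∀ j, α (j + 1) * K (j + 1) ≤ α j * (c / 2) := by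
    intro j
    rw [hαs, mul_assoc]
    refine mul_le_mul_of_nonneg_left ?_ (hα j).le
    have := hK (j + 1)
    rw [div_mul_eq_mul_div, div_le_div_iff₀ (by positivity) (by norm_num)]
    nlinarith
  let pair : ℕ → F → F → F := fun k u v => ∑ w ∈ Finset.range (k + 1), α w • wordPair X w u v
  have hpair : ∀ k u v x, (pair k u v).1 x
      = ∑ w ∈ Finset.range (k + 1), α w * (wordPair X w u v).1 x := by
    intro k u v x; simp [pair]
  -- in the weighted sum of the inequalities only the term of order zero remains
  have ineq : ∀ k (μ : ℝ) (u : F) (x : Q),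
      (generator D (pair k u u)).1 x + 2 * μ * (pair k u u).1 x
        ≤ 2 * (pair k u (μ • u + generator D u)).1 x + c * (wordPair X 0 u u).1 x
          - α k * (c / 2) * (wordPair X (k + 1) u u).1 x := by
    intro k μ u x
    induction k with
    | zero =>
      have h := hest 0 μ u x
      rw [hK0 0 rfl] at h
      have e : ∀ v, pair 0 u v = wordPair X 0 u v := by
        intro v; simp [pair, α]
      rw [e, e]
      have : α 0 = 1 := rfl
      rw [this, one_mul]
      exact h
    | succ k ih =>
      have e : ∀ v, pair (k + 1) u v = pair k u v + α (k + 1) • wordPair X (k + 1) u v := by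
        intro v; simp only [pair]; rw [Finset.sum_range_succ _ (k + 1)]
      have e1 : ∀ v, (pair (k + 1) u v).1 x
          = (pair k u v).1 x + α (k + 1) * (wordPair X (k + 1) u v).1 x := by
        intro v; rw [e]; rfl
      have e2 : (generator D (pair (k + 1) u u)).1 x = (generator D (pair k u u)).1 x
          + α (k + 1) * (generator D (wordPair X (k + 1) u u)).1 x := by
        rw [e, map_add, map_smul]; rfl
      rw [e1, e1, e2]
      have h := mul_le_mul_of_nonneg_left (hest (k + 1) μ u x) (hα (k + 1)).le
      have h3 := mul_le_mul_of_nonneg_right (hαK k) (wordPair_self_nonneg (X := X) (k + 1) u x)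
      nlinarith
  -- `pair k` is the scalar product of the jets with respect to the weighted words, so that the
  -- seminorm is the supremum norm of a jet
  let S := Σ w : Fin (k + 1), Wd ι w
  let W : S → F →ₗ[ℝ] F := fun a => √(α a.1) • wordOp X a.1 a.2
  have hW : ∀ (a : S) u x, (W a u).1 x = √(α a.1) * (wordOp X a.1 a.2 u).1 x := fun _ _ _ => rfl
  have hinner : ∀ u v x, ∑ a : S, (W a u).1 x * (W a v).1 x = (pair k u v).1 x := by
    intro u v x
    rw [hpair, Fintype.sum_sigma, Finset.sum_range]
    refine Finset.sum_congr rfl fun w _ => ?_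
    rw [wordPair_apply, Finset.mul_sum]
    refine Finset.sum_congr rfl fun a _ => ?_
    rw [hW, hW, mul_mul_mul_comm, Real.mul_self_sqrt (hα _).le]
  choose Cw hCw hbw using fun a : S => diffOp_norm_bound
    (diffOp_mono (Nat.lt_succ_iff.1 a.1.2) (wordOp_mem (X := X) a.2))
  refine ⟨(normSeminorm ℝ C(Q, EuclideanSpace ℝ S)).comp (jetMap W), ∑ a : S, √(α a.1) * Cw a,
    ∑ _a : Wd ι k, (√(α k))⁻¹,
    Finset.sum_nonneg fun a _ => mul_nonneg (Real.sqrt_nonneg _) (hCw a),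
    Finset.sum_nonneg fun _ _ => inv_nonneg.2 (Real.sqrt_nonneg _),
    fun u => ?_, fun u => ?_, fun μ u => ?_⟩
  · refine (norm_jetMap_le W u).trans ?_
    rw [Finset.sum_mul]
    refine Finset.sum_le_sum fun a _ => ?_
    have : (W a u).1 = √(α a.1) • (wordOp X a.1 a.2 u).1 := rfl
    rw [this, norm_smul, Real.norm_of_nonneg (Real.sqrt_nonneg _), mul_assoc]
    exact mul_le_mul_of_nonneg_left (hbw a u) (Real.sqrt_nonneg _)
  · refine (norm_jetMap_le (wordOp X k) u).trans ?_
    rw [Finset.sum_mul]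
    refine Finset.sum_le_sum fun a _ => ?_
    have h1 := norm_le_norm_jetMap W u ⟨⟨k, Nat.lt_succ_self k⟩, a⟩
    have : (W ⟨⟨k, Nat.lt_succ_self k⟩, a⟩ u).1 = √(α k) • (wordOp X k a u).1 := rfl
    rw [this, norm_smul, Real.norm_of_nonneg (Real.sqrt_nonneg _)] at h1
    rw [← div_eq_inv_mul, le_div_iff₀ (Real.sqrt_pos.2 (hα k)), mul_comm]
    exact h1
  · set f := μ • u + generator D u with hf
    change (μ - 1 / 8) * ‖jetMap W u‖ ≤ ‖jetMap W f‖
    -- at a maximum of the weighted sum of squares the generator applied to it is nonnegative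
    obtain ⟨x, -, hx⟩ := isCompact_univ.exists_isMaxOn (Set.univ_nonempty (α := Q))
      (pair k u u).1.continuous.continuousOn
    have hx' : ∀ z, (pair k u u).1 z ≤ (pair k u u).1 x := fun z => hx (Set.mem_univ z)
    have hG : 0 ≤ (generator D (pair k u u)).1 x := by
      rw [generator_apply]
      have : ∑ i, ((D i).B (pair k u u)).1 x ≤ 0 :=
        Finset.sum_nonpos fun i _ => (D i).B_nonpos_of_isMax h0 hs₀ hx'
      linarith
    have hsq : ∀ v z, ‖jetMap W v z‖ ^ 2 = (pair k v v).1 z := by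
      intro v z
      rw [norm_jetMap_apply_sq, ← hinner]
      simp only [pow_two]
    have hnorm : ‖jetMap W u‖ = ‖jetMap W u x‖ := by
      refine le_antisymm ((ContinuousMap.norm_le _ (norm_nonneg _)).2 fun z => ?_)
        ((jetMap W u).norm_coe_le_norm x)
      refine abs_le_of_sq_le_sq' ?_ (norm_nonneg _) |>.2
      rw [hsq, hsq]; exact hx' z
    have hcs : (pair k u f).1 x ≤ ‖jetMap W u‖ * ‖jetMap W f‖ := by
      rw [← hinner, hnorm]
      have h1 := real_inner_le_norm (jetMap W u x) (jetMap W f x)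
      have h2 : inner ℝ (jetMap W u x) (jetMap W f x) = ∑ a : S, (W a u).1 x * (W a f).1 x := by
        rw [PiLp.inner_apply]
        exact Finset.sum_congr rfl fun a _ => by simp [mul_comm]
      rw [← h2]
      exact h1.trans (mul_le_mul_of_nonneg_left ((jetMap W f).norm_coe_le_norm x)
        (norm_nonneg _))
    have h0le : (wordPair X 0 u u).1 x ≤ (pair k u u).1 x := by
      rw [hpair]
      have := Finset.single_le_sum (f := fun w => α w * (wordPair X w u u).1 x)
        (fun w _ => mul_nonneg (hα w).le (wordPair_self_nonneg w u x))
        (Finset.mem_range.2 (Nat.succ_pos k))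
      have e : α 0 = 1 := rfl
      simpa [e] using this
    have hi := ineq k μ u x
    rw [← hf, ← hsq u x, ← hnorm] at hi
    rw [← hsq u x, ← hnorm] at h0le
    have hlast : 0 ≤ α k * (c / 2) * (wordPair X (k + 1) u u).1 x :=
      mul_nonneg (mul_nonneg (hα k).le (by positivity)) (wordPair_self_nonneg _ _ _)
    rcases (norm_nonneg (jetMap W u)).eq_or_lt with h | h
    · rw [← h, mul_zero]; exact norm_nonneg _
    · have hz : (wordPair X 0 u u).1 x * c ≤ ‖jetMap W u‖ ^ 2 * (1 / 4) :=
        mul_le_mul h0le hc4 hc.le (sq_nonneg _)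
      have : ‖jetMap W u‖ * ((μ - 1 / 8) * ‖jetMap W u‖) ≤ ‖jetMap W u‖ * ‖jetMap W f‖ := by
        nlinarith
      exact le_of_mul_le_mul_left this h

/-! ### Solvability -/

/-- The equation `u + A u = f` can be solved up to a small error in `C^k`: the residual `r` is
corrected by an approximate solution `v` of `Λ v + A v = r`, which leaves `(Λ - 1) v`. Since
`(Λ - 1 / 8) N v ≤ N r` by `exists_bernstein`, the residual shrinks by a factor close to
`(Λ - 1) / (Λ - 1 / 8) < 1`. -/
theorem exists_approx_one [Nonempty Q] (h0 : 0 < s₀) (hs₀ : s₀ ≤ 1) (D : ν → Deformation X s₀)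
    (hspan : ∀ l, ∃ b : ν → F, ∀ u, X l u = ∑ i, b i * (D i).V u)
    (hcomm : ∀ l m, (X l : F →ₗ[ℝ] F) ∘ₗ (X m : F →ₗ[ℝ] F)
      - (X m : F →ₗ[ℝ] F) ∘ₗ (X l : F →ₗ[ℝ] F) ∈ diffOp X 1) (k : ℕ) (f : F) {η : ℝ}
    (hη : 0 < η) : ∃ u, ckNorm X k (u + generator D u - f) ≤ η := by
  obtain ⟨N, C, C', hC, hC', hNC, hNC', hN⟩ := exists_bernstein h0 hs₀ D hspan hcomm k
  obtain ⟨Λ₀, hΛ⟩ := exists_approx_of_large h0 hs₀ D hspan k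
  set Λ := max Λ₀ 1 with hΛdef
  have hΛ1 : 1 ≤ Λ := le_max_right _ _
  set ρ := (Λ - 1) / (Λ - 1 / 8) with hρ
  have hden : 0 < Λ - 1 / 8 := by linarith
  have hρ0 : 0 ≤ ρ := div_nonneg (by linarith) hden.le
  have hρ1 : ρ < 1 := by rw [hρ, div_lt_one hden]; linarith
  -- one correction step multiplies the residual by a factor less than one
  have step : ∀ r : F, ∃ v, N (r - (v + generator D v)) ≤ (1 + ρ) / 2 * N r := by
    intro r
    rcases (apply_nonneg N r).eq_or_lt with h | h
    · exact ⟨0, by simp [← h]⟩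
    set ε := (1 - ρ) / 4 * N r with hε
    have hε0 : 0 < ε := mul_pos (by linarith) h
    obtain ⟨v, hv⟩ := hΛ Λ (le_max_left _ _) r (ε / (C + 1)) (by positivity)
    have h1 : N (Λ • v + generator D v - r) ≤ ε := by
      refine (hNC _).trans ((mul_le_mul_of_nonneg_left hv hC).trans ?_)
      rw [← mul_div_assoc, div_le_iff₀ (by positivity)]
      nlinarith
    have h2 : N (Λ • v + generator D v) ≤ ε + N r := by
      have := map_add_le_add N (Λ • v + generator D v - r) r
      rw [sub_add_cancel] at this
      linarith
    have h3 : N v ≤ (ε + N r) / (Λ - 1 / 8) := by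
      rw [le_div_iff₀ hden, mul_comm]; exact (hN Λ v).trans h2
    refine ⟨v, ?_⟩
    have e : r - (v + generator D v) = -(Λ • v + generator D v - r) + (Λ - 1) • v := by
      rw [sub_smul, one_smul]; abel
    rw [e]
    refine (map_add_le_add N _ _).trans ?_
    rw [map_neg_eq_map, map_smul_eq_mul, Real.norm_of_nonneg (by linarith)]
    have h4 : (Λ - 1) * N v ≤ ρ * (ε + N r) := by
      refine (mul_le_mul_of_nonneg_left h3 (by linarith)).trans (le_of_eq ?_)
      rw [hρ]; ring
    have h5 : ρ * ε ≤ ε := by nlinarith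
    rw [hε] at *
    nlinarith
  have iter : ∀ j : ℕ, ∃ v, N (f - (v + generator D v)) ≤ ((1 + ρ) / 2) ^ j * N f := by
    intro j
    induction j with
    | zero => exact ⟨0, by simp⟩
    | succ j ih =>
      obtain ⟨v, hv⟩ := ih
      obtain ⟨w, hw⟩ := step (f - (v + generator D v))
      refine ⟨v + w, ?_⟩
      have e : f - (v + w + generator D (v + w))
          = f - (v + generator D v) - (w + generator D w) := by
        rw [map_add]; abel
      rw [e, pow_succ', mul_assoc]
      exact hw.trans (mul_le_mul_of_nonneg_left hv (by linarith))
  have hlim : Tendsto (fun j : ℕ => C' * (((1 + ρ) / 2) ^ j * N f)) atTop (𝓝 0) := by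
    have := (tendsto_pow_atTop_nhds_zero_of_lt_one (r := (1 + ρ) / 2) (by linarith)
      (by linarith)).mul_const (N f)
    simpa using this.const_mul C'
  obtain ⟨j, hj⟩ := (hlim.eventually (gt_mem_nhds hη)).exists
  obtain ⟨v, hv⟩ := iter j
  refine ⟨v, (hNC' _).trans ((mul_le_mul_of_nonneg_left ?_ hC').trans hj.le)⟩
  rw [← map_neg_eq_map N, neg_sub]
  exact hv

/-- Solvability of `u + A u = f` for the generator `A` of a family of deformations. The derivations
are required to be combinations of the derivatives along the deformations, which is the ellipticity
of `A`, and to have commutators of order one; the functions are required to be complete with respect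
to the `C^k` norms. -/
theorem exists_solution [Nonempty Q] (h0 : 0 < s₀) (hs₀ : s₀ ≤ 1) (D : ν → Deformation X s₀)
    (hspan : ∀ l, ∃ b : ν → F, ∀ u, X l u = ∑ i, b i * (D i).V u)
    (hcomm : ∀ l m, (X l : F →ₗ[ℝ] F) ∘ₗ (X m : F →ₗ[ℝ] F)
      - (X m : F →ₗ[ℝ] F) ∘ₗ (X l : F →ₗ[ℝ] F) ∈ diffOp X 1)
    (hcomplete : ∀ u : ℕ → F, (∀ k, ∀ ε > 0, ∃ j₀, ∀ i ≥ j₀, ∀ j ≥ j₀,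
      ckNorm X k (u i - u j) ≤ ε) → ∃ v, ∀ k, Tendsto (fun j => ckNorm X k (u j - v)) atTop (𝓝 0))
    (f : F) : ∃ u, u + generator D u = f := by
  choose u hu using fun j : ℕ => exists_approx_one h0 hs₀ D hspan hcomm j f
    (η := ((j : ℝ) + 1)⁻¹) (by positivity)
  have hsmall : ∀ k, ∀ ε > 0, ∃ j₀ : ℕ, ∀ j ≥ j₀, ckNorm X k (u j + generator D (u j) - f) ≤ ε := by
    intro k ε hε
    obtain ⟨m, hm⟩ := exists_nat_gt ε⁻¹
    refine ⟨max k m, fun j hj => ?_⟩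
    refine (ckNorm_mono ((le_max_left _ _).trans hj) _).trans ((hu j).trans ?_)
    have h1 : (m : ℝ) ≤ j := by exact_mod_cast (le_max_right _ _).trans hj
    exact inv_le_of_inv_le₀ hε (by linarith)
  -- approximate solutions form a Cauchy sequence by the a priori estimate for `μ = 1`
  obtain ⟨v, hv⟩ := hcomplete u fun k ε hε => by
    obtain ⟨N, C, C', hC, hC', hNC, hNC', hN⟩ := exists_bernstein h0 hs₀ D hspan hcomm k
    obtain ⟨j₀, hj⟩ := hsmall k (ε / (4 * (C' + 1) * (C + 1))) (by positivity)
    refine ⟨j₀, fun i hi j hj' => ?_⟩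
    set w := u i - u j with hw
    have h1 : (1 : ℝ) • w + generator D w
        = (u i + generator D (u i) - f) - (u j + generator D (u j) - f) := by
      rw [one_smul, hw, map_sub]; abel
    have h2 := hN 1 w
    rw [h1] at h2
    have h3 := (h2.trans (hNC _)).trans (mul_le_mul_of_nonneg_left
      ((ckNorm_sub_le _ _ _).trans (add_le_add (hj i hi) (hj j hj'))) hC)
    set δ := ε / (4 * (C' + 1) * (C + 1)) with hδ
    have hδ0 : 0 < δ := by positivity
    have h5 : δ * (4 * (C' + 1) * (C + 1)) = ε := by rw [hδ]; field_simp
    have hNw := apply_nonneg N w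
    have h6 : N w ≤ 4 * (C + 1) * δ := by nlinarith
    refine (hNC' w).trans ?_
    rw [← h5]
    have := mul_le_mul_of_nonneg_left h6 hC'
    nlinarith [mul_nonneg hC hδ0.le]
  refine ⟨v, ?_⟩
  obtain ⟨CA, hCA, hA⟩ := diffOp_norm_bound (generator_mem D)
  have hz : ‖(v + generator D v - f).1‖ = 0 := by
    refine le_antisymm ?_ (norm_nonneg _)
    have hlim : Tendsto (fun j => ckNorm X 0 (u j - v) + CA * ckNorm X 2 (u j - v)
        + ((j : ℝ) + 1)⁻¹) atTop (𝓝 0) := by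
      have h3 : Tendsto (fun j : ℕ => ((j : ℝ) + 1)⁻¹) atTop (𝓝 0) := by
        simpa using tendsto_one_div_add_atTop_nhds_zero_nat (𝕜 := ℝ)
      simpa using ((hv 0).add ((hv 2).const_mul CA)).add h3
    refine ge_of_tendsto' hlim fun j => ?_
    have e : (v + generator D v - f).1 = (u j + generator D (u j) - f).1
        - ((u j - v).1 + (generator D (u j - v)).1) := by
      have : v + generator D v - f = (u j + generator D (u j) - f)
          - ((u j - v) + generator D (u j - v)) := by
        rw [map_sub]; abel
      exact congrArg Subtype.val this
    rw [e]
    have h1 : ‖(u j + generator D (u j) - f).1‖ ≤ ((j : ℝ) + 1)⁻¹ :=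
      (norm_wordOp_le (X := X) 0 () _).trans ((ckNorm_mono (Nat.zero_le _) _).trans (hu j))
    have h2 : ‖(u j - v).1‖ ≤ ckNorm X 0 (u j - v) := norm_wordOp_le (X := X) 0 () _
    refine (norm_sub_le _ _).trans ?_
    have h3 := norm_add_le (u j - v).1 (generator D (u j - v)).1
    have h4 := hA (u j - v)
    linarith
  have : v + generator D v - f = 0 := Subtype.ext (norm_eq_zero.1 hz)
  exact sub_eq_zero.1 this

end Bernstein

end

section

set_option linter.unusedSectionVars false

open Filter Topology
open Matrix (of_apply)

/-! ### The metric in the charts of the manifold -/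

section Charts

variable {n : ℕ} {M : Type*} [TopologicalSpace M] [ChartedSpace (EuclideanSpace ℝ (Fin n)) M]
  [IsManifold (𝓡 n) ∞ M]

/-- The change of coordinates from the chart at `c` to the chart at `c'`. -/
def transition (n : ℕ) {M : Type*} [TopologicalSpace M] [ChartedSpace (EuclideanSpace ℝ (Fin n)) M]
    (c c' : M) : EuclideanSpace ℝ (Fin n) → EuclideanSpace ℝ (Fin n) :=
  fun z => extChartAt (𝓡 n) c' ((extChartAt (𝓡 n) c).symm z)

variable {c c' x : M} {z : EuclideanSpace ℝ (Fin n)}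

theorem target_mem_nhds (hz : z ∈ (extChartAt (𝓡 n) c).target) :
    (extChartAt (𝓡 n) c).target ∈ 𝓝 z := (isOpen_extChartAt_target c).mem_nhds hz

theorem continuousAt_chart_symm (hz : z ∈ (extChartAt (𝓡 n) c).target) :
    ContinuousAt (extChartAt (𝓡 n) c).symm z :=
  (continuousOn_extChartAt_symm c).continuousAt (target_mem_nhds hz)

theorem eventually_mem_source (hz : z ∈ (extChartAt (𝓡 n) c).target)
    (hz' : (extChartAt (𝓡 n) c).symm z ∈ (extChartAt (𝓡 n) c').source) :
    ∀ᶠ w in 𝓝 z, w ∈ (extChartAt (𝓡 n) c).target ∧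
      (extChartAt (𝓡 n) c).symm w ∈ (extChartAt (𝓡 n) c').source := by
  filter_upwards [target_mem_nhds hz, (continuousAt_chart_symm hz).eventually
    ((isOpen_extChartAt_source (I := 𝓡 n) c').mem_nhds hz')] with w h1 h2 using ⟨h1, h2⟩

theorem contMDiffAt_chart_symm (hz : z ∈ (extChartAt (𝓡 n) c).target) :
    ContMDiffAt 𝓘(ℝ, EuclideanSpace ℝ (Fin n)) (𝓡 n) ∞ (extChartAt (𝓡 n) c).symm z :=
  (contMDiffOn_extChartAt_symm c).contMDiffAt (target_mem_nhds hz)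

theorem contMDiffAt_chart (hx : x ∈ (extChartAt (𝓡 n) c).source) :
    ContMDiffAt (𝓡 n) 𝓘(ℝ, EuclideanSpace ℝ (Fin n)) ∞ (extChartAt (𝓡 n) c) x :=
  contMDiffAt_extChartAt' (by rwa [← extChartAt_source (𝓡 n)])

theorem smoothNear_transition (hz : z ∈ (extChartAt (𝓡 n) c).target)
    (hz' : (extChartAt (𝓡 n) c).symm z ∈ (extChartAt (𝓡 n) c').source) :
    SmoothNear (transition n c c') z := by
  filter_upwards [eventually_mem_source hz hz'] with w hw
  exact ((contMDiffAt_chart hw.2).comp w (contMDiffAt_chart_symm hw.1)).contDiffAt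

theorem transition_mem
    (hz' : (extChartAt (𝓡 n) c).symm z ∈ (extChartAt (𝓡 n) c').source) :
    transition n c c' z ∈ (extChartAt (𝓡 n) c').target :=
  (extChartAt (𝓡 n) c').map_source hz'

theorem symm_transition (hz' : (extChartAt (𝓡 n) c).symm z ∈ (extChartAt (𝓡 n) c').source) :
    (extChartAt (𝓡 n) c').symm (transition n c c' z) = (extChartAt (𝓡 n) c).symm z :=
  (extChartAt (𝓡 n) c').left_inv hz'

variable (c z) in
/-- The coordinate vector with components `v` at the point with coordinates `z` in the chart
at `c`. -/
def chartVector (v : EuclideanSpace ℝ (Fin n)) :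
    TangentSpace (𝓡 n) ((extChartAt (𝓡 n) c).symm z) :=
  mfderiv 𝓘(ℝ, EuclideanSpace ℝ (Fin n)) (𝓡 n) (extChartAt (𝓡 n) c).symm z v

/-- Coordinate vectors are the vectors with constant components in the trivialization of the tangent
bundle. -/
theorem chartVector_eq_symmL (hz : z ∈ (extChartAt (𝓡 n) c).target)
    (v : EuclideanSpace ℝ (Fin n)) : chartVector c z v =
      (trivializationAt (EuclideanSpace ℝ (Fin n)) (TangentSpace (𝓡 n)) c).symmL ℝ
        ((extChartAt (𝓡 n) c).symm z) v := by
  have hs : (extChartAt (𝓡 n) c).symm z ∈ (chartAt (EuclideanSpace ℝ (Fin n)) c).source := by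
    rw [← extChartAt_source (𝓡 n)]; exact (extChartAt (𝓡 n) c).map_target hz
  rw [TangentBundle.symmL_trivializationAt hs, (extChartAt (𝓡 n) c).right_inv hz]
  simp only [ModelWithCorners.range_eq_univ, mfderivWithin_univ]
  rfl

theorem contMDiffAt_chartVector (hz : z ∈ (extChartAt (𝓡 n) c).target)
    (v : EuclideanSpace ℝ (Fin n)) :
    ContMDiffAt 𝓘(ℝ, EuclideanSpace ℝ (Fin n)) ((𝓡 n).prod 𝓘(ℝ, EuclideanSpace ℝ (Fin n))) ∞
      (fun w => Bundle.TotalSpace.mk' (EuclideanSpace ℝ (Fin n))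
        (E := fun x : M => TangentSpace (𝓡 n) x) ((extChartAt (𝓡 n) c).symm w)
        (chartVector c w v)) z := by
  have hs : ∀ w ∈ (extChartAt (𝓡 n) c).target, (extChartAt (𝓡 n) c).symm w ∈
      (trivializationAt (EuclideanSpace ℝ (Fin n)) (fun x : M => TangentSpace (𝓡 n) x) c).baseSet := by
    intro w hw
    rw [TangentBundle.trivializationAt_baseSet, ← extChartAt_source (𝓡 n)]
    exact (extChartAt (𝓡 n) c).map_target hw
  rw [Bundle.Trivialization.contMDiffAt_iff (e := trivializationAt (EuclideanSpace ℝ (Fin n))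
    (fun x : M => TangentSpace (𝓡 n) x) c) (hs z hz)]
  refine ⟨contMDiffAt_chart_symm hz, ?_⟩
  refine (contMDiffAt_const (c := v)).congr_of_eventuallyEq ?_
  filter_upwards [target_mem_nhds hz] with w hw
  change ((trivializationAt (EuclideanSpace ℝ (Fin n)) (fun x : M => TangentSpace (𝓡 n) x) c)
    ⟨_, chartVector c w v⟩).2 = v
  rw [chartVector_eq_symmL hw]
  have := (trivializationAt (EuclideanSpace ℝ (Fin n)) (fun x : M => TangentSpace (𝓡 n) x) c
    ).continuousLinearMapAt_symmL (R := ℝ) (hs w hw) v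
  rw [Bundle.Trivialization.continuousLinearMapAt_apply,
    Bundle.Trivialization.linearMapAt_apply, if_pos (hs w hw)] at this
  exact this

/-- The coefficients of a smooth curve of metrics are smooth in time and space. -/
theorem contDiffOn_metricCoord {T : EReal} {g : ℝ → Metric n M} (hg : IsSmoothMetricCurve T g)
    (c : M) (i j : Fin n) :
    ContDiffOn ℝ ∞ (fun q : ℝ × EuclideanSpace ℝ (Fin n) => metricCoord (g q.1) c q.2 i j)
      (timeInterval T ×ˢ (extChartAt (𝓡 n) c).target) := by
  have hb : ∀ q ∈ timeInterval T ×ˢ (extChartAt (𝓡 n) c).target,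
      ContMDiffAt (𝓘(ℝ, ℝ).prod 𝓘(ℝ, EuclideanSpace ℝ (Fin n))) (𝓘(ℝ, ℝ).prod (𝓡 n)) ∞
        (fun q : ℝ × EuclideanSpace ℝ (Fin n) => (q.1, (extChartAt (𝓡 n) c).symm q.2)) q :=
    fun q hq => contMDiffAt_fst.prodMk
      (ContMDiffAt.comp q (contMDiffAt_chart_symm hq.2) contMDiffAt_snd)
  have h1 := hg.comp (fun q hq => (hb q hq).contMDiffWithinAt) (t := timeInterval T ×ˢ Set.univ)
    (fun q hq => ⟨hq.1, Set.mem_univ _⟩)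
  have hv : ∀ i : Fin n, ContMDiffOn (𝓘(ℝ, ℝ).prod 𝓘(ℝ, EuclideanSpace ℝ (Fin n)))
      ((𝓡 n).prod 𝓘(ℝ, EuclideanSpace ℝ (Fin n))) ∞
      (fun q : ℝ × EuclideanSpace ℝ (Fin n) => Bundle.TotalSpace.mk' (EuclideanSpace ℝ (Fin n))
        (E := fun x : M => TangentSpace (𝓡 n) x) ((extChartAt (𝓡 n) c).symm q.2)
        (chartVector c q.2 (EuclideanSpace.single i 1)))
      (timeInterval T ×ˢ (extChartAt (𝓡 n) c).target) := fun i q hq =>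
    (ContMDiffAt.comp q (contMDiffAt_chartVector hq.2 (EuclideanSpace.single i (1 : ℝ)))
      contMDiffAt_snd).contMDiffWithinAt
  have h2 := ContMDiffOn.clm_bundle_apply₂ (F₃ := ℝ) (E₃ := fun _ : M => ℝ) h1 (hv i) (hv j)
  intro q hq
  have h3 := h2 q hq
  rw [Bundle.contMDiffWithinAt_totalSpace] at h3
  have h4 := h3.2
  rw [← modelWithCornersSelf_prod, chartedSpaceSelf_prod] at h4
  exact h4.contDiffWithinAt

end Charts

end

section

set_option linter.unusedSectionVars false

open Filter Topology
open scoped Matrix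

/-! ### Independence of the chart -/

section Invariance

variable {n : ℕ} {M : Type*} [TopologicalSpace M] [ChartedSpace (EuclideanSpace ℝ (Fin n)) M]
  [IsManifold (𝓡 n) ∞ M] {c c' x : M} {z : EuclideanSpace ℝ (Fin n)}

theorem timeInterval_top_mem (t : ℝ) (ht : 0 ≤ t) : t ∈ timeInterval ⊤ :=
  ⟨ht, EReal.coe_lt_top t⟩

theorem isSmoothMetricCurve_const (T : EReal) (g : Metric n M) :
    IsSmoothMetricCurve T fun _ => g :=
  (g.contMDiff.comp contMDiff_snd).contMDiffOn

theorem contDiffOn_metricCoord_const (g : Metric n M) (c : M) (i j : Fin n) :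
    ContDiffOn ℝ ∞ (fun z => metricCoord g c z i j) (extChartAt (𝓡 n) c).target :=
  (contDiffOn_metricCoord (isSmoothMetricCurve_const ⊤ g) c i j).comp
    (contDiff_prodMk_right (0 : ℝ)).contDiffOn
    fun _ hz => ⟨timeInterval_top_mem 0 le_rfl, hz⟩

theorem metricCoord_apply (g : Metric n M) (c : M) (z : EuclideanSpace ℝ (Fin n)) (i j : Fin n) :
    metricCoord g c z i j = g.inner ((extChartAt (𝓡 n) c).symm z)
      (chartVector c z (EuclideanSpace.single i 1)) (chartVector c z (EuclideanSpace.single j 1)) :=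
  rfl

theorem sum_single (v : EuclideanSpace ℝ (Fin n)) :
    v = ∑ i, v i • EuclideanSpace.single i (1 : ℝ) := by
  conv_lhs => rw [← (EuclideanSpace.basisFun (Fin n) ℝ).sum_repr v]
  simp

theorem chartVector_eq_sum (v : EuclideanSpace ℝ (Fin n)) :
    chartVector c z v = ∑ i, v i • chartVector c z (EuclideanSpace.single i 1) := by
  set L : EuclideanSpace ℝ (Fin n) →L[ℝ] TangentSpace (𝓡 n) ((extChartAt (𝓡 n) c).symm z) :=
    mfderiv 𝓘(ℝ, EuclideanSpace ℝ (Fin n)) (𝓡 n) (extChartAt (𝓡 n) c).symm z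
  have hL : ∀ v, chartVector c z v = L v := fun _ => rfl
  simp only [hL]
  conv_lhs => rw [sum_single v]
  rw [map_sum]
  simp only [map_smul]

theorem bilinear_sum_sum {V : Type*} [AddCommGroup V] [Module ℝ V] [TopologicalSpace V]
    [IsTopologicalAddGroup V] [ContinuousSMul ℝ V] (B : V →L[ℝ] V →L[ℝ] ℝ) (a : Fin n → V)
    (v w : Fin n → ℝ) :
    B (∑ i, v i • a i) (∑ j, w j • a j) = ∑ i, ∑ j, B (a i) (a j) * v i * w j := by
  rw [map_sum B, sum_apply]
  refine Finset.sum_congr rfl fun i _ => ?_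
  rw [map_sum]
  refine Finset.sum_congr rfl fun j _ => ?_
  rw [map_smul, map_smul, smul_apply, smul_eq_mul, smul_eq_mul]
  ring

theorem inner_chartVector (g : Metric n M) (v w : EuclideanSpace ℝ (Fin n)) :
    g.inner ((extChartAt (𝓡 n) c).symm z) (chartVector c z v) (chartVector c z w)
      = ∑ i, ∑ j, metricCoord g c z i j * v i * w j := by
  rw [chartVector_eq_sum v, chartVector_eq_sum w]
  exact bilinear_sum_sum _ _ _ _

theorem chartVector_injective (hz : z ∈ (extChartAt (𝓡 n) c).target)
    {v : EuclideanSpace ℝ (Fin n)} (h : chartVector c z v = 0) : v = 0 := by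
  have hs : (extChartAt (𝓡 n) c).symm z ∈ (trivializationAt (EuclideanSpace ℝ (Fin n))
      (fun x : M => TangentSpace (𝓡 n) x) c).baseSet := by
    rw [TangentBundle.trivializationAt_baseSet, ← extChartAt_source (𝓡 n)]
    exact (extChartAt (𝓡 n) c).map_target hz
  have := (trivializationAt (EuclideanSpace ℝ (Fin n)) (fun x : M => TangentSpace (𝓡 n) x) c
    ).continuousLinearMapAt_symmL (R := ℝ) hs v
  rw [chartVector_eq_symmL hz] at h
  rw [← this, h, map_zero]

theorem posDef_metricCoord (g : Metric n M) (hz : z ∈ (extChartAt (𝓡 n) c).target) :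
    (metricCoord g c z).PosDef := by
  refine Matrix.PosDef.of_dotProduct_mulVec_pos ?_ fun v hv => ?_
  · ext i j
    simp only [Matrix.conjTranspose_apply, star_trivial, metricCoord_apply]
    exact g.symm _ _ _
  · have h1 := inner_chartVector (c := c) (z := z) g (WithLp.toLp 2 v) (WithLp.toLp 2 v)
    have h2 : chartVector c z (WithLp.toLp 2 v) ≠ 0 := fun h =>
      hv (by simpa using congrArg (WithLp.ofLp) (chartVector_injective hz h))
    have h3 := g.pos _ _ h2
    rw [h1] at h3
    refine h3.trans_eq ?_
    simp only [dotProduct, Matrix.mulVec, star_trivial, Finset.mul_sum, Pi.star_apply]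
    exact Finset.sum_congr rfl fun i _ => Finset.sum_congr rfl fun j _ => by ring

theorem metricNear_metricCoord (g : Metric n M) (hz : z ∈ (extChartAt (𝓡 n) c).target) :
    MetricNear (metricCoord g c) z where
  smooth i j := by
    filter_upwards [target_mem_nhds hz] with w hw
    exact (contDiffOn_metricCoord_const g c i j).contDiffAt (target_mem_nhds hw)
  symm := by
    filter_upwards [target_mem_nhds hz] with w hw
    simpa using (posDef_metricCoord g hw).isHermitian.eq
  det := (posDef_metricCoord g hz).det_pos.ne'

/-- Coordinate vectors in two charts. As the base points are equal only propositionally, the vectors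
are compared in the model space, to which all tangent spaces reduce. -/
theorem chartVector_transition (hz : z ∈ (extChartAt (𝓡 n) c).target)
    (hz' : (extChartAt (𝓡 n) c).symm z ∈ (extChartAt (𝓡 n) c').source)
    (v : EuclideanSpace ℝ (Fin n)) :
    (show EuclideanSpace ℝ (Fin n) from chartVector c z v)
      = (show EuclideanSpace ℝ (Fin n) from
        chartVector c' (transition n c c' z) (fderiv ℝ (transition n c c') z v)) := by
  have h1 : (extChartAt (𝓡 n) c).symm =ᶠ[𝓝 z]
      (extChartAt (𝓡 n) c').symm ∘ transition n c c' := by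
    filter_upwards [eventually_mem_source hz hz'] with w hw
    exact (symm_transition hw.2).symm
  have h2 := h1.mfderiv_eq (I := 𝓘(ℝ, EuclideanSpace ℝ (Fin n))) (I' := 𝓡 n)
  have h3 : MDifferentiableAt 𝓘(ℝ, EuclideanSpace ℝ (Fin n)) 𝓘(ℝ, EuclideanSpace ℝ (Fin n))
      (transition n c c') z := (smoothNear_transition hz hz').differentiableAt.mdifferentiableAt
  have h4 : MDifferentiableAt 𝓘(ℝ, EuclideanSpace ℝ (Fin n)) (𝓡 n) (extChartAt (𝓡 n) c').symm
      (transition n c c' z) :=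
    (contMDiffAt_chart_symm (transition_mem hz')).mdifferentiableAt (by simp)
  have h5 := mfderiv_comp z h4 h3
  rw [mfderiv_eq_fderiv] at h5
  change (mfderiv 𝓘(ℝ, EuclideanSpace ℝ (Fin n)) (𝓡 n) (extChartAt (𝓡 n) c).symm z) v = _
  have h6 := DFunLike.congr_fun (h2.trans h5) v
  exact h6

theorem inner_congr_point (g : Metric n M) {x y : M} (h : x = y) (v w : EuclideanSpace ℝ (Fin n)) :
    g.inner x (show TangentSpace (𝓡 n) x from v) (show TangentSpace (𝓡 n) x from w)
      = g.inner y (show TangentSpace (𝓡 n) y from v) (show TangentSpace (𝓡 n) y from w) := by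
  subst h; rfl

theorem jacobian_transition_mul (hz : z ∈ (extChartAt (𝓡 n) c).target)
    (hz' : (extChartAt (𝓡 n) c).symm z ∈ (extChartAt (𝓡 n) c').source) :
    jacobian (transition n c' c) (transition n c c' z) * jacobian (transition n c c') z = 1 := by
  have hb : (extChartAt (𝓡 n) c').symm (transition n c c' z) ∈ (extChartAt (𝓡 n) c).source := by
    rw [symm_transition hz']; exact (extChartAt (𝓡 n) c).map_target hz
  have hs := smoothNear_transition (transition_mem hz') hb
  ext a k
  rw [Matrix.mul_apply]
  have h1 := pd_comp (k := k) (hs.apply a).differentiableAt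
    (smoothNear_transition hz hz').differentiableAt
  have h2 : (fun w => transition n c' c (transition n c c' w) a) =ᶠ[𝓝 z] fun w => w a := by
    filter_upwards [eventually_mem_source hz hz'] with w hw
    have : transition n c' c (transition n c c' w) = w := by
      change extChartAt (𝓡 n) c ((extChartAt (𝓡 n) c').symm (transition n c c' w)) = w
      rw [symm_transition hw.2, (extChartAt (𝓡 n) c).right_inv hw.1]
    rw [this]
  rw [pd_congr h2, pd_coord] at h1
  rw [Matrix.one_apply, h1]
  exact Finset.sum_congr rfl fun i _ => mul_comm _ _

theorem metricCoord_transition (g : Metric n M) (hz : z ∈ (extChartAt (𝓡 n) c).target)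
    (hz' : (extChartAt (𝓡 n) c).symm z ∈ (extChartAt (𝓡 n) c').source) :
    metricCoord g c z = (jacobian (transition n c c') z)ᵀ
      * metricCoord g c' (transition n c c' z) * jacobian (transition n c c') z := by
  have hd := (smoothNear_transition hz hz').differentiableAt
  ext i j
  rw [metricCoord_apply]
  have e := inner_congr_point g (symm_transition (c' := c') hz').symm
    (show EuclideanSpace ℝ (Fin n) from chartVector c z (EuclideanSpace.single i 1))
    (show EuclideanSpace ℝ (Fin n) from chartVector c z (EuclideanSpace.single j 1))
  refine e.trans ?_
  rw [chartVector_transition hz hz', chartVector_transition hz hz']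
  refine (inner_chartVector g _ _).trans ?_
  simp only [fderiv_single_apply hd, Matrix.mul_apply, Matrix.transpose_apply, Finset.sum_mul]
  rw [Finset.sum_comm]
  exact Finset.sum_congr rfl fun b _ => Finset.sum_congr rfl fun a _ => by ring

theorem pullbackNear_transition (g : Metric n M) (hz : z ∈ (extChartAt (𝓡 n) c).target)
    (hz' : (extChartAt (𝓡 n) c).symm z ∈ (extChartAt (𝓡 n) c').source) :
    PullbackNear (transition n c c') (metricCoord g c') (metricCoord g c) z where
  smooth := smoothNear_transition hz hz'
  jac h := by
    have := congrArg Matrix.det (jacobian_transition_mul hz hz')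
    rw [Matrix.det_mul, h, mul_zero, Matrix.det_one] at this
    exact zero_ne_one this
  metric := metricNear_metricCoord g (transition_mem hz')
  eq := by
    filter_upwards [eventually_mem_source hz hz'] with w hw
    exact metricCoord_transition g hw.1 hw.2

theorem transition_self (c : M) (z : EuclideanSpace ℝ (Fin n)) :
    transition n c ((extChartAt (𝓡 n) c).symm z) z
      = extChartAt (𝓡 n) ((extChartAt (𝓡 n) c).symm z) ((extChartAt (𝓡 n) c).symm z) := rfl

/-- The quantities of the metric at a point are defined in the preferred chart at this point; the
coefficients in another chart are a pullback of those in the preferred chart. -/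
theorem pullbackNear_self (g : Metric n M) (hz : z ∈ (extChartAt (𝓡 n) c).target) :
    PullbackNear (transition n c ((extChartAt (𝓡 n) c).symm z))
      (metricCoord g ((extChartAt (𝓡 n) c).symm z)) (metricCoord g c) z :=
  pullbackNear_transition g hz (mem_extChartAt_source _)

theorem scalarCurvature_chart (g : Metric n M) (hz : z ∈ (extChartAt (𝓡 n) c).target) :
    scalarCurvature g ((extChartAt (𝓡 n) c).symm z) = scalarCoord (metricCoord g c) z :=
  (pullbackNear_self g hz).scalarCoord_eq.symm

theorem ricciNormSq_chart (g : Metric n M) (hz : z ∈ (extChartAt (𝓡 n) c).target) :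
    ricciNormSq g ((extChartAt (𝓡 n) c).symm z) = ricciNormSqCoord (metricCoord g c) z :=
  (pullbackNear_self g hz).ricciNormSqCoord_eq.symm

theorem smoothNear_comp_chart {f : M → ℝ} (hf : f ∈ smoothFunctions n M)
    (hz : z ∈ (extChartAt (𝓡 n) c).target) :
    SmoothNear (f ∘ (extChartAt (𝓡 n) c).symm) z := by
  filter_upwards [target_mem_nhds hz] with w hw
  exact (ContMDiffAt.comp w (hf.contMDiffAt) (contMDiffAt_chart_symm hw)).contDiffAt

theorem mem_smoothFunctions_of_charts {f : M → ℝ}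
    (h : ∀ (c : M) (z : EuclideanSpace ℝ (Fin n)), z ∈ (extChartAt (𝓡 n) c).target →
      ContDiffAt ℝ ∞ (f ∘ (extChartAt (𝓡 n) c).symm) z) : f ∈ smoothFunctions n M := by
  intro x
  have h1 := (h x (extChartAt (𝓡 n) x x) (mem_extChartAt_target x)).contMDiffAt
  have h2 := ContMDiffAt.comp x h1 (contMDiffAt_chart (mem_extChartAt_source x))
  refine h2.congr_of_eventuallyEq ?_
  filter_upwards [extChartAt_source_mem_nhds (I := 𝓡 n) x] with y hy
  simp only [Function.comp_apply, (extChartAt (𝓡 n) x).left_inv hy]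

theorem laplacianCoord_congr {G : EuclideanSpace ℝ (Fin n) → Matrix (Fin n) (Fin n) ℝ}
    {f f' : EuclideanSpace ℝ (Fin n) → ℝ} (h : f =ᶠ[𝓝 z] f') :
    laplacianCoord G f z = laplacianCoord G f' z := by
  unfold laplacianCoord
  simp only [pd_congr h, pd_congr (pd_eventuallyEq h)]

theorem laplacian_chart (g : Metric n M) {f : M → ℝ} (hf : f ∈ smoothFunctions n M)
    (hz : z ∈ (extChartAt (𝓡 n) c).target) :
    laplacian g f ((extChartAt (𝓡 n) c).symm z)
      = laplacianCoord (metricCoord g c) (f ∘ (extChartAt (𝓡 n) c).symm) z := by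
  have h := (pullbackNear_self g hz).laplacianCoord_eq
    (smoothNear_comp_chart (c := (extChartAt (𝓡 n) c).symm z) hf
      (transition_mem (mem_extChartAt_source _)))
  refine h.symm.trans (laplacianCoord_congr ?_)
  filter_upwards [eventually_mem_source hz (mem_extChartAt_source _)] with w hw
  simp only [Function.comp_apply, symm_transition hw.2]

theorem scalarCurvature_mem (g : Metric n M) : scalarCurvature g ∈ smoothFunctions n M := by
  refine mem_smoothFunctions_of_charts fun c z hz => ?_
  refine (metricNear_metricCoord g hz).smooth_scalarCoord.contDiffAt.congr_of_eventuallyEq ?_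
  filter_upwards [target_mem_nhds hz] with w hw using scalarCurvature_chart g hw

theorem ricciNormSq_mem (g : Metric n M) : ricciNormSq g ∈ smoothFunctions n M := by
  refine mem_smoothFunctions_of_charts fun c z hz => ?_
  refine (metricNear_metricCoord g hz).smooth_ricciNormSqCoord.contDiffAt.congr_of_eventuallyEq ?_
  filter_upwards [target_mem_nhds hz] with w hw using ricciNormSq_chart g hw

theorem laplacian_mem (g : Metric n M) {f : M → ℝ} (hf : f ∈ smoothFunctions n M) :
    laplacian g f ∈ smoothFunctions n M := by
  refine mem_smoothFunctions_of_charts fun c z hz => ?_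
  refine ((metricNear_metricCoord g hz).smooth_laplacianCoord
    (smoothNear_comp_chart hf hz)).contDiffAt.congr_of_eventuallyEq ?_
  filter_upwards [target_mem_nhds hz] with w hw using laplacian_chart g hf hw

theorem conformalOp_mem (g : Metric n M) {f : M → ℝ} (hf : f ∈ smoothFunctions n M) :
    conformalOp g f ∈ smoothFunctions n M :=
  (contMDiff_const.mul (laplacian_mem g hf)).add hf

theorem chartVector_self (x : M) (v : EuclideanSpace ℝ (Fin n)) :
    (show EuclideanSpace ℝ (Fin n) from chartVector x (extChartAt (𝓡 n) x x) v) = v := by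
  have h1 := chartVector_eq_symmL (mem_extChartAt_target (I := 𝓡 n) x) v
  have h2 : ∀ y : M, y = x → (show EuclideanSpace ℝ (Fin n) from
      (trivializationAt (EuclideanSpace ℝ (Fin n)) (TangentSpace (𝓡 n)) x).symmL ℝ y v) = v := by
    rintro y rfl
    rw [TangentBundle.symmL_trivializationAt_eq_core (mem_chart_source _ _)]
    exact (tangentBundleCore (𝓡 n) M).coordChange_self _ _ (mem_chart_source _ _) v
  exact h1.trans (h2 _ (extChartAt_to_inv x))

/-- The components of the Ricci tensor in an arbitrary chart. -/
theorem ricci_chartVector (g : Metric n M) (hz : z ∈ (extChartAt (𝓡 n) c).target) (i j : Fin n) :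
    ricci g ((extChartAt (𝓡 n) c).symm z) (chartVector c z (EuclideanSpace.single i 1))
      (chartVector c z (EuclideanSpace.single j 1)) = ricciCoord (metricCoord g c) i j z := by
  set p := (extChartAt (𝓡 n) c).symm z with hp
  have hz' : p ∈ (extChartAt (𝓡 n) p).source := mem_extChartAt_source _
  have hd := (smoothNear_transition (c' := p) hz hz').differentiableAt
  have hv : ∀ (i a : Fin n), tangentCoord (chartVector c z (EuclideanSpace.single i 1)) a
      = jacobian (transition n c p) z a i := by
    intro i a
    have h1 := chartVector_transition (c' := p) hz hz' (EuclideanSpace.single i 1)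
    have h2 := chartVector_self p (fderiv ℝ (transition n c p) z (EuclideanSpace.single i 1))
    rw [← fderiv_single_apply hd]
    exact congrArg (fun v : EuclideanSpace ℝ (Fin n) => v a) (h1.trans h2)
  have h := (pullbackNear_self g hz).ricM_eq
  have h3 := congrFun (congrFun h i) j
  simp only [ricM, Matrix.of_apply, Matrix.mul_apply, Matrix.transpose_apply] at h3
  rw [h3]
  unfold ricci
  simp only [hv, Finset.sum_mul]
  rw [Finset.sum_comm]
  refine Finset.sum_congr rfl fun b _ => Finset.sum_congr rfl fun a _ => ?_
  rw [transition_self]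
  ring

end Invariance

/-! ### Finite covers by charts and the coordinate derivations -/

section Cover

variable (n : ℕ) (M : Type*) [TopologicalSpace M] [ChartedSpace (EuclideanSpace ℝ (Fin n)) M]
  [IsManifold (𝓡 n) ∞ M]

/-- The algebra of smooth functions, inside the continuous functions. -/
def smoothAlg : Subalgebra ℝ C(M, ℝ) where
  carrier := {f | ContMDiff (𝓡 n) 𝓘(ℝ, ℝ) ∞ f}
  mul_mem' := fun hf hg => ContMDiff.mul hf hg
  add_mem' := fun hf hg => ContMDiff.add hf hg
  algebraMap_mem' := fun _ => contMDiff_const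

variable {n M}

/-- A smooth function as an element of the algebra of smooth functions. -/
def mkSmooth (f : M → ℝ) (hf : f ∈ smoothFunctions n M) : smoothAlg n M :=
  ⟨⟨f, ContMDiff.continuous hf⟩, hf⟩

theorem coe_mem (u : smoothAlg n M) : (fun x => u.1 x) ∈ smoothFunctions n M := u.2

theorem smoothAlg_ext {u v : smoothAlg n M} (h : ∀ x, u.1 x = v.1 x) : u = v :=
  Subtype.ext (ContinuousMap.ext h)

variable (n M) in
/-- Finitely many charts with centers `center c`, open sets `U c` that cover `M`, cutoff functions
`χ c` in the domain of the chart, equal to one on `U c`, and functions `η c` with support in `U c`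
whose squares form a partition of unity. -/
structure ChartCover where
  /-- the number of charts -/
  m : ℕ
  /-- the centers of the charts -/
  center : Fin m → M
  /-- the sets of the cover -/
  U : Fin m → Set M
  /-- cutoff functions -/
  χ : Fin m → smoothAlg n M
  /-- square roots of a partition of unity -/
  η : Fin m → smoothAlg n M
  isOpen_U : ∀ c, IsOpen (U c)
  χ_tsupport : ∀ c, tsupport (χ c).1 ⊆ (extChartAt (𝓡 n) (center c)).source
  χ_one : ∀ c, ∀ x ∈ U c, (χ c).1 x = 1
  η_tsupport : ∀ c, tsupport (η c).1 ⊆ U c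
  sum_sq : ∀ x, ∑ c, ((η c).1 x) ^ 2 = 1

/-- Compactness gives finitely many bump functions with supports in the sets on which larger bump
functions are one; they are divided by the root of the sum of their squares. The sets of the cover
can be chosen inside prescribed neighbourhoods of the centers. -/
theorem exists_chartCover [T2Space M] [CompactSpace M] (W : M → Set M) (hW : ∀ x, W x ∈ 𝓝 x) :
    ∃ A : ChartCover n M, ∀ c, A.U c ⊆ W (A.center c) := by
  have hχ : ∀ x : M, ∃ f : SmoothBumpFunction (𝓡 n) x, tsupport f ⊆ W x := fun x => by
    obtain ⟨f, -, hf⟩ := (SmoothBumpFunction.nhds_basis_tsupport (I := 𝓡 n) x).mem_iff.1 (hW x)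
    exact ⟨f, hf⟩
  choose χ _ using hχ
  let U : M → Set M := fun x => interior {y | χ x y = 1} ∩ interior (W x)
  have hU : ∀ x, U x ∈ 𝓝 x := fun x =>
    inter_mem (interior_mem_nhds.2 (χ x).eventuallyEq_one) (interior_mem_nhds.2 (hW x))
  have hη : ∀ x : M, ∃ f : SmoothBumpFunction (𝓡 n) x, tsupport f ⊆ U x := fun x => by
    obtain ⟨f, -, hf⟩ := (SmoothBumpFunction.nhds_basis_tsupport (I := 𝓡 n) x).mem_iff.1 (hU x)
    exact ⟨f, hf⟩
  choose η hη using hη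
  obtain ⟨t, ht⟩ := CompactSpace.elim_nhds_subcover (fun x => Function.support (η x))
    fun x => (η x).support_mem_nhds
  let e := t.equivFin
  let c : Fin t.card → M := fun k => (e.symm k : M)
  have hpos : ∀ x, 0 < ∑ k, (η (c k) x) ^ 2 := by
    intro x
    have hx : x ∈ ⋃ y ∈ t, Function.support (η y) := by rw [ht]; trivial
    simp only [Set.mem_iUnion] at hx
    obtain ⟨y, hy, hxy⟩ := hx
    refine Finset.sum_pos' (fun k _ => sq_nonneg _) ⟨e ⟨y, hy⟩, Finset.mem_univ _, ?_⟩
    have : c (e ⟨y, hy⟩) = y := by simp [c]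
    rw [this]
    have : η y x ≠ 0 := hxy
    positivity
  have hsum : ContMDiff (𝓡 n) 𝓘(ℝ, ℝ) ∞ fun x => ∑ k, (η (c k) x) ^ 2 :=
    contMDiff_finsetSum fun k _ => (η (c k)).contMDiff.pow 2
  have hinv : ContMDiff (𝓡 n) 𝓘(ℝ, ℝ) ∞ fun x => (√(∑ k, (η (c k) x) ^ 2))⁻¹ := fun x =>
    ContMDiffAt.comp x (g := fun s : ℝ => (√s)⁻¹)
      (((Real.contDiffAt_sqrt (hpos x).ne').inv
        (Real.sqrt_ne_zero'.2 (hpos x))).contMDiffAt) (hsum x)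
  have hη' : ∀ k, (fun x => η (c k) x * (√(∑ k, (η (c k) x) ^ 2))⁻¹) ∈ smoothFunctions n M :=
    fun k => (η (c k)).contMDiff.mul hinv
  refine ⟨⟨t.card, c, fun k => U (c k), fun k => mkSmooth (χ (c k)) (χ (c k)).contMDiff,
    fun k => mkSmooth _ (hη' k),
    fun k => isOpen_interior.inter isOpen_interior, fun k => (χ (c k)).tsupport_subset_extChartAt_source,
    fun k x hx => interior_subset (s := {y | χ (c k) y = 1}) hx.1, fun k => ?_, fun x => ?_⟩,
    fun k => Set.inter_subset_right.trans interior_subset⟩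
  · exact (closure_mono (Function.support_mul_subset_left _ _)).trans (hη (c k))
  · change ∑ k, (η (c k) x * (√(∑ k, (η (c k) x) ^ 2))⁻¹) ^ 2 = 1
    simp only [mul_pow, inv_pow, Real.sq_sqrt (hpos x).le, ← Finset.sum_mul]
    exact mul_inv_cancel₀ (hpos x).ne'

/-- A product of a cutoff function and a function that is smooth in a chart is smooth. -/
theorem mem_smoothFunctions_mul_chart {η : M → ℝ} (hη : η ∈ smoothFunctions n M) {c : M}
    (hs : tsupport η ⊆ (extChartAt (𝓡 n) c).source) {h : EuclideanSpace ℝ (Fin n) → ℝ}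
    (hh : ∀ x ∈ tsupport η, ContDiffAt ℝ ∞ h (extChartAt (𝓡 n) c x)) :
    (fun x => η x * h (extChartAt (𝓡 n) c x)) ∈ smoothFunctions n M := by
  intro x
  by_cases hx : x ∈ tsupport η
  · exact (hη x).mul (ContMDiffAt.comp x (hh x hx).contMDiffAt (contMDiffAt_chart (hs hx)))
  · refine (contMDiffAt_const (c := (0 : ℝ))).congr_of_eventuallyEq ?_
    filter_upwards [notMem_tsupport_iff_eventuallyEq.1 hx] with y hy
    rw [hy]; simp

namespace ChartCover

variable (A : ChartCover n M) {x : M}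

/-- The chart with index `c`. -/
abbrev chart (c : Fin A.m) : PartialEquiv M (EuclideanSpace ℝ (Fin n)) :=
  extChartAt (𝓡 n) (A.center c)

theorem U_subset_source (c : Fin A.m) : A.U c ⊆ (A.chart c).source := fun x hx =>
  A.χ_tsupport c (subset_tsupport _ (by simp [Function.mem_support, A.χ_one c x hx]))

theorem exists_mem_U (x : M) : ∃ c, x ∈ A.U c := by
  by_contra! h
  have : ∀ c, (A.η c).1 x = 0 := fun c => by
    by_contra h'
    exact h c (A.η_tsupport c (subset_tsupport _ h'))
  have h2 := A.sum_sq x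
  simp [this] at h2

theorem η_eq_zero {c : Fin A.m} (hx : x ∉ A.U c) : (A.η c).1 x = 0 := by
  by_contra h'
  exact hx (A.η_tsupport c (subset_tsupport _ h'))

/-- The set `U c` in coordinates. -/
def V (c : Fin A.m) : Set (EuclideanSpace ℝ (Fin n)) :=
  (A.chart c).target ∩ (A.chart c).symm ⁻¹' A.U c

theorem isOpen_V (c : Fin A.m) : IsOpen (A.V c) :=
  (continuousOn_extChartAt_symm _).isOpen_inter_preimage (isOpen_extChartAt_target _)
    (A.isOpen_U c)

theorem chart_mem_V {c : Fin A.m} (hx : x ∈ A.U c) : A.chart c x ∈ A.V c :=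
  ⟨(A.chart c).map_source (A.U_subset_source c hx), by
    rw [Set.mem_preimage, (A.chart c).left_inv (A.U_subset_source c hx)]; exact hx⟩

theorem symm_chart {c : Fin A.m} (hx : x ∈ A.U c) : (A.chart c).symm (A.chart c x) = x :=
  (A.chart c).left_inv (A.U_subset_source c hx)

/-- The partial derivatives in the chart with index `c`. -/
def coordDeriv (c : Fin A.m) (i : Fin n) (u : M → ℝ) (x : M) : ℝ :=
  pd i (u ∘ (A.chart c).symm) (A.chart c x)

theorem χ_mul_coordDeriv_mem (c : Fin A.m) (i : Fin n) (u : smoothAlg n M) :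
    (fun x => (A.χ c).1 x * A.coordDeriv c i u.1 x) ∈ smoothFunctions n M :=
  mem_smoothFunctions_mul_chart (A.χ c).2 (A.χ_tsupport c) fun _ hx =>
    ((smoothNear_comp_chart u.2 ((A.chart c).map_source (A.χ_tsupport c hx))).pd i).contDiffAt

theorem χ_eq_zero {c : Fin A.m} (hx : x ∉ (A.chart c).source) : (A.χ c).1 x = 0 := by
  by_contra h
  exact hx (A.χ_tsupport c (subset_tsupport _ h))

/-- The derivations `χ_c ∂_i`. -/
def X (l : Fin A.m × Fin n) : Derivation ℝ (smoothAlg n M) (smoothAlg n M) :=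
  Derivation.mk'
    { toFun := fun u => mkSmooth _ (A.χ_mul_coordDeriv_mem l.1 l.2 u)
      map_add' := fun u v => smoothAlg_ext fun x => by
        by_cases hx : x ∈ (A.chart l.1).source
        · have hu := smoothNear_comp_chart (coe_mem u) ((A.chart l.1).map_source hx)
          have hv := smoothNear_comp_chart (coe_mem v) ((A.chart l.1).map_source hx)
          have := pd_add (k := l.2) hu.differentiableAt hv.differentiableAt
          change (A.χ l.1).1 x * _ = (A.χ l.1).1 x * _ + (A.χ l.1).1 x * _
          rw [← mul_add]
          exact congrArg _ this
        · change (A.χ l.1).1 x * _ = (A.χ l.1).1 x * _ + (A.χ l.1).1 x * _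
          rw [A.χ_eq_zero hx]; ring
      map_smul' := fun r u => smoothAlg_ext fun x => by
        have := pd_const_mul (k := l.2) (z := A.chart l.1 x)
          (f := (fun x => u.1 x) ∘ (A.chart l.1).symm) r
        change (A.χ l.1).1 x * _ = r * ((A.χ l.1).1 x * _)
        rw [mul_left_comm]
        exact congrArg _ this }
    fun u v => smoothAlg_ext fun x => by
      by_cases hx : x ∈ (A.chart l.1).source
      · have hu := smoothNear_comp_chart (coe_mem u) ((A.chart l.1).map_source hx)
        have hv := smoothNear_comp_chart (coe_mem v) ((A.chart l.1).map_source hx)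
        have := pd_mul (k := l.2) hu.differentiableAt hv.differentiableAt
        simp only [Function.comp_apply, (A.chart l.1).left_inv hx] at this
        have e : (A.χ l.1).1 x * A.coordDeriv l.1 l.2 (fun y => u.1 y * v.1 y) x
            = u.1 x * ((A.χ l.1).1 x * A.coordDeriv l.1 l.2 v.1 x)
              + v.1 x * ((A.χ l.1).1 x * A.coordDeriv l.1 l.2 u.1 x) := by
          have e1 : A.coordDeriv l.1 l.2 (fun y => u.1 y * v.1 y) x
            = A.coordDeriv l.1 l.2 u.1 x * v.1 x + u.1 x * A.coordDeriv l.1 l.2 v.1 x := this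
          rw [e1]; ring
        exact e
      · change (A.χ l.1).1 x * _ = u.1 x * ((A.χ l.1).1 x * _) + v.1 x * ((A.χ l.1).1 x * _)
        rw [A.χ_eq_zero hx]; ring

theorem X_apply (l : Fin A.m × Fin n) (u : smoothAlg n M) (x : M) :
    (A.X l u).1 x = (A.χ l.1).1 x * A.coordDeriv l.1 l.2 u.1 x := rfl

theorem X_apply_of_mem {c : Fin A.m} (hx : x ∈ A.U c) (i : Fin n) (u : smoothAlg n M) :
    (A.X (c, i) u).1 x = pd i (u.1 ∘ (A.chart c).symm) (A.chart c x) := by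
  rw [X_apply, A.χ_one c x hx, one_mul]; rfl

/-- Derivations are local. -/
theorem X_congr {u v : smoothAlg n M} (h : ∀ᶠ y in 𝓝 x, u.1 y = v.1 y) (l : Fin A.m × Fin n) :
    (A.X l u).1 x = (A.X l v).1 x := by
  rw [X_apply, X_apply]
  by_cases hx : x ∈ (A.chart l.1).source
  · congr 1
    refine pd_congr ?_
    have hc := continuousAt_chart_symm ((A.chart l.1).map_source hx)
    have h' : ∀ᶠ y in 𝓝 ((A.chart l.1).symm (A.chart l.1 x)), u.1 y = v.1 y := by
      rwa [(A.chart l.1).left_inv hx]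
    exact hc.eventually h'
  · rw [A.χ_eq_zero hx, zero_mul, zero_mul]

theorem X_eq_zero {u : smoothAlg n M} (h : ∀ᶠ y in 𝓝 x, u.1 y = 0) (l : Fin A.m × Fin n) :
    (A.X l u).1 x = 0 := by
  rw [A.X_congr (v := 0) h, map_zero]; rfl

/-- The coordinates of the chart with index `c`, cut off. -/
def y (c : Fin A.m) (k : Fin n) : smoothAlg n M :=
  mkSmooth _ (mem_smoothFunctions_mul_chart (A.χ c).2 (A.χ_tsupport c)
    (h := fun z => z k) fun _ _ => (smoothNear_coord k).contDiffAt)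

theorem y_apply_of_mem {c : Fin A.m} (hx : x ∈ A.U c) (k : Fin n) :
    (A.y c k).1 x = A.chart c x k := by
  change (A.χ c).1 x * _ = _
  rw [A.χ_one c x hx, one_mul]

/-- On `U c` all the derivations are combinations of the coordinate derivations of the chart
with index `c`. -/
theorem X_eq_sum {c : Fin A.m} (hx : x ∈ A.U c) (l : Fin A.m × Fin n) (u : smoothAlg n M) :
    (A.X l u).1 x = ∑ k, (A.X l (A.y c k)).1 x * (A.X (c, k) u).1 x := by
  by_cases hl : x ∈ (A.chart l.1).source
  · have hz := (A.chart l.1).map_source hl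
    have hinv := (A.chart l.1).left_inv hl
    have hz' : (A.chart l.1).symm (A.chart l.1 x) ∈ (A.chart c).source := by
      rw [hinv]; exact A.U_subset_source c hx
    have hψ := smoothNear_transition hz hz'
    have htr : transition n (A.center l.1) (A.center c) (A.chart l.1 x) = A.chart c x :=
      congrArg (A.chart c) hinv
    have hu := smoothNear_comp_chart (coe_mem u) (transition_mem hz')
    have h1 := pd_comp (k := l.2) hu.differentiableAt hψ.differentiableAt
    have hU : ∀ᶠ w in 𝓝 (A.chart l.1 x), (A.chart l.1).symm w ∈ A.U c :=
      (continuousAt_chart_symm hz).eventually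
        ((A.isOpen_U c).mem_nhds (by rw [hinv]; exact hx))
    have h2 : A.coordDeriv l.1 l.2 u.1 x
        = ∑ k, jacobian (transition n (A.center l.1) (A.center c)) (A.chart l.1 x) k l.2
          * pd k (u.1 ∘ (A.chart c).symm) (A.chart c x) := by
      rw [htr] at h1
      refine Eq.trans (pd_congr ?_) h1
      filter_upwards [eventually_mem_source hz hz'] with w hw
      simp only [Function.comp_apply]
      rw [symm_transition hw.2]
    have h3 : ∀ k, A.coordDeriv l.1 l.2 (A.y c k).1 x
        = jacobian (transition n (A.center l.1) (A.center c)) (A.chart l.1 x) k l.2 := by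
      intro k
      refine pd_congr ?_
      filter_upwards [hU] with w hw
      exact A.y_apply_of_mem hw k
    rw [X_apply, h2, Finset.mul_sum]
    refine Finset.sum_congr rfl fun k _ => ?_
    rw [X_apply, h3, A.X_apply_of_mem hx]
    ring
  · simp only [X_apply A l, A.χ_eq_zero hl, zero_mul, Finset.sum_const_zero]

/-- On the open set `U c` the cutoff function is one, so that iterated derivations of the chart are
iterated partial derivatives. -/
theorem X_comm_of_mem {c : Fin A.m} (hx : x ∈ A.U c) (i j : Fin n) (u : smoothAlg n M) :
    (A.X (c, i) (A.X (c, j) u)).1 x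
      = pd i (pd j (u.1 ∘ (A.chart c).symm)) (A.chart c x) := by
  rw [A.X_apply_of_mem hx]
  refine pd_congr ?_
  filter_upwards [(A.isOpen_V c).mem_nhds (A.chart_mem_V hx)] with w hw
  have := A.X_apply_of_mem hw.2 j u
  rw [(A.chart c).right_inv hw.1] at this
  exact this

/-- On `U c` the commutators of the derivations are again combinations of the coordinate
derivations. -/
theorem commutator_apply {c : Fin A.m} (hx : x ∈ A.U c) (l m : Fin A.m × Fin n)
    (u : smoothAlg n M) :
    (A.X l (A.X m u) - A.X m (A.X l u)).1 x
      = ∑ k, (A.X l (A.X m (A.y c k)) - A.X m (A.X l (A.y c k))).1 x * (A.X (c, k) u).1 x := by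
  -- the second term of the inner sum is symmetric in `l` and `m` by `hsym`
  have key : ∀ l m, (A.X l (A.X m u)).1 x = ∑ k, ((A.X l (A.X m (A.y c k))).1 x * (A.X (c, k) u).1 x
      + ∑ j, (A.X m (A.y c k)).1 x * (A.X l (A.y c j)).1 x * (A.X (c, j) (A.X (c, k) u)).1 x) := by
    intro l m
    have h1 : ∀ᶠ y in 𝓝 x, (A.X m u).1 y = (∑ k, A.X m (A.y c k) * A.X (c, k) u).1 y := by
      filter_upwards [(A.isOpen_U c).mem_nhds hx] with y hy
      rw [A.X_eq_sum hy]; simp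
    rw [A.X_congr h1, map_sum]
    have e : (∑ k, A.X l (A.X m (A.y c k) * A.X (c, k) u)).1 x
        = ∑ k, (A.X l (A.X m (A.y c k) * A.X (c, k) u)).1 x := by simp
    rw [e]
    refine Finset.sum_congr rfl fun k _ => ?_
    rw [Derivation.leibniz]
    change (A.X m (A.y c k)).1 x * (A.X l (A.X (c, k) u)).1 x
      + (A.X (c, k) u).1 x * (A.X l (A.X m (A.y c k))).1 x = _
    rw [A.X_eq_sum hx l (A.X (c, k) u), Finset.mul_sum, add_comm]
    congr 1
    · ring
    · exact Finset.sum_congr rfl fun j _ => by ring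
  have hsym : ∀ j k, (A.X (c, j) (A.X (c, k) u)).1 x = (A.X (c, k) (A.X (c, j) u)).1 x := by
    intro j k
    rw [A.X_comm_of_mem hx, A.X_comm_of_mem hx]
    exact pd_comm (smoothNear_comp_chart u.2 (A.chart_mem_V hx).1).contDiffAt j k
  change (A.X l (A.X m u)).1 x - (A.X m (A.X l u)).1 x = _
  rw [key l m, key m l, Finset.sum_add_distrib, Finset.sum_add_distrib]
  have hs : ∑ k, ∑ j, (A.X m (A.y c k)).1 x * (A.X l (A.y c j)).1 x
        * (A.X (c, j) (A.X (c, k) u)).1 x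
      = ∑ k, ∑ j, (A.X l (A.y c k)).1 x * (A.X m (A.y c j)).1 x
        * (A.X (c, j) (A.X (c, k) u)).1 x := by
    rw [Finset.sum_comm]
    refine Finset.sum_congr rfl fun k _ => Finset.sum_congr rfl fun j _ => ?_
    rw [hsym]; ring
  rw [hs, add_sub_add_right_eq_sub, ← Finset.sum_sub_distrib]
  refine Finset.sum_congr rfl fun k _ => ?_
  change _ = ((A.X l (A.X m (A.y c k))).1 x - (A.X m (A.X l (A.y c k))).1 x) * _
  ring

/-- An operator which on each `U c` is a combination of the coordinate derivations has order
one. -/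
theorem mem_diffOp_one [CompactSpace M] {L : smoothAlg n M →ₗ[ℝ] smoothAlg n M}
    (a : Fin A.m → Fin n → smoothAlg n M)
    (h : ∀ c, ∀ x ∈ A.U c, ∀ u, (L u).1 x = ∑ k, (a c k).1 x * (A.X (c, k) u).1 x) :
    L ∈ diffOp A.X 1 := by
  have : L = ∑ c, ∑ k, (A.η c * A.η c * a c k) • (A.X (c, k) : smoothAlg n M →ₗ[ℝ] smoothAlg n M) := by
    ext1 u
    refine smoothAlg_ext fun x => ?_
    have e : ((∑ c, ∑ k, (A.η c * A.η c * a c k) •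
        (A.X (c, k) : smoothAlg n M →ₗ[ℝ] smoothAlg n M)) u).1 x
        = ∑ c, ∑ k, (A.η c).1 x * (A.η c).1 x * (a c k).1 x * (A.X (c, k) u).1 x := by
      simp
    rw [e]
    calc (L u).1 x = ∑ c, ((A.η c).1 x) ^ 2 * (L u).1 x := by
          rw [← Finset.sum_mul, A.sum_sq, one_mul]
      _ = _ := by
          refine Finset.sum_congr rfl fun c _ => ?_
          by_cases hx : x ∈ A.U c
          · rw [h c x hx, Finset.mul_sum]
            exact Finset.sum_congr rfl fun k _ => by ring
          · simp [A.η_eq_zero hx]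
  rw [this]
  exact sum_mem fun c _ => sum_mem fun k _ => Submodule.smul_mem _ _ (X_mem _)

/-- The commutators of the derivations have order one, as the terms of second order are symmetric.
-/
theorem commutator_mem_diffOp [CompactSpace M] (l m : Fin A.m × Fin n) :
    (A.X l : smoothAlg n M →ₗ[ℝ] smoothAlg n M) ∘ₗ (A.X m : smoothAlg n M →ₗ[ℝ] smoothAlg n M)
      - (A.X m : smoothAlg n M →ₗ[ℝ] smoothAlg n M) ∘ₗ (A.X l : smoothAlg n M →ₗ[ℝ] smoothAlg n M)
      ∈ diffOp A.X 1 :=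
  A.mem_diffOp_one (fun c k => A.X l (A.X m (A.y c k)) - A.X m (A.X l (A.y c k)))
    fun _ _ hx u => A.commutator_apply hx l m u

end ChartCover

end Cover

/-! ### Frames for the inverse metric -/

section Frame

variable {n : ℕ} {G : EuclideanSpace ℝ (Fin n) → Matrix (Fin n) (Fin n) ℝ}
  {z : EuclideanSpace ℝ (Fin n)}

/-- Near a point the inverse metric is a sum of squares of smooth vector fields.

If `S` is the matrix of an orthonormal basis at `z`, then `G⁻¹ = S (1 + H) Sᵀ` with `H` symmetric
and `H z = 0`, and `1 + H` is the sum of `(δ ± H_ij / 4) (e_i ± e_j) (e_i ± e_j)ᵀ` for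
`δ = 1 / (4 n)`, where the coefficients are positive near `z`. -/
theorem MetricNear.exists_frame (h : MetricNear G z) (hp : (G z).PosDef) {a : ℝ} (ha : 0 < a) :
    ∃ Y : (Fin n × Fin n) × Bool → Fin n → EuclideanSpace ℝ (Fin n) → ℝ,
      (∀ ν k, SmoothNear (Y ν k) z) ∧
      ∀ᶠ w in 𝓝 z, ∀ k l, ∑ ν, Y ν k w * Y ν l w = a * (G w)⁻¹ k l := by
  obtain ⟨S, hS, hSG⟩ := exists_transpose_mul_mul_eq_one hp
  have hSu : IsUnit S.det := isUnit_iff_ne_zero.2 hS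
  set H : EuclideanSpace ℝ (Fin n) → Matrix (Fin n) (Fin n) ℝ :=
    fun w => S⁻¹ * (G w)⁻¹ * (S⁻¹)ᵀ - 1 with hH
  have hSS : S * S⁻¹ = 1 := Matrix.mul_nonsing_inv _ hSu
  have hSS' : S⁻¹ * S = 1 := Matrix.nonsing_inv_mul _ hSu
  have hSSt : (S⁻¹)ᵀ * Sᵀ = 1 := by rw [← Matrix.transpose_mul, hSS, Matrix.transpose_one]
  have hSSt' : Sᵀ * (S⁻¹)ᵀ = 1 := by rw [← Matrix.transpose_mul, hSS', Matrix.transpose_one]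
  have hinv : ∀ w, (G w)⁻¹ = S * (1 + H w) * Sᵀ := by
    intro w
    have : S * (1 + H w) * Sᵀ = (S * S⁻¹) * (G w)⁻¹ * ((S⁻¹)ᵀ * Sᵀ) := by
      simp only [hH, add_sub_cancel, Matrix.mul_assoc]
    rw [this, hSS, hSSt, Matrix.one_mul, Matrix.mul_one]
  have hH0 : H z = 0 := by
    have : (G z)⁻¹ = S * Sᵀ := by
      refine Matrix.inv_eq_left_inv ?_
      calc S * Sᵀ * G z = S * (Sᵀ * G z * S) * S⁻¹ := by
            simp only [Matrix.mul_assoc, hSS, Matrix.mul_one]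
        _ = 1 := by rw [hSG, Matrix.mul_one, hSS]
    simp only [hH, this]
    rw [← Matrix.mul_assoc, hSS', Matrix.one_mul, hSSt', sub_self]
  have hHs : ∀ i j, SmoothNear (fun w => H w i j) z := by
    intro i j
    have hc : ∀ B : Matrix (Fin n) (Fin n) ℝ, MSmoothNear (fun _ => B) z :=
      fun B i j => Eventually.of_forall fun _ => contDiffAt_const
    exact (((hc S⁻¹).mul (h.smooth.inv h.det)).mul (hc (S⁻¹)ᵀ)).sub (hc 1) i j
  set δ : ℝ := 1 / (4 * n) with hδ
  have hn : ∀ _ : Fin n, 0 < (n : ℝ) := fun k => by exact_mod_cast k.pos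
  let σ : Bool → ℝ := fun b => if b then 1 else -1
  have hc0 : ∀ (i j : Fin n) b, 0 < a * (δ + σ b * (H z i j / 4)) := by
    intro i j b
    have := hn i
    rw [hH0]; simp only [Matrix.zero_apply, zero_div, mul_zero, add_zero]
    positivity
  have hcs : ∀ (i j : Fin n) b, SmoothNear (fun w => a * (δ + σ b * (H w i j / 4))) z := by
    intro i j b
    filter_upwards [hHs i j] with w hw
    exact contDiffAt_const.mul (contDiffAt_const.add (contDiffAt_const.mul (hw.div_const 4)))
  refine ⟨fun ν k w => √(a * (δ + σ ν.2 * (H w ν.1.1 ν.1.2 / 4)))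
      * (S k ν.1.1 + σ ν.2 * S k ν.1.2), fun ν k => ?_, ?_⟩
  · filter_upwards [hcs ν.1.1 ν.1.2 ν.2,
      (hcs ν.1.1 ν.1.2 ν.2).continuousAt.eventually_ne (hc0 ν.1.1 ν.1.2 ν.2).ne'] with w hw hw0
    exact (hw.sqrt hw0).mul contDiffAt_const
  · have hpos : ∀ᶠ w in 𝓝 z, ∀ (i j : Fin n) b, 0 < a * (δ + σ b * (H w i j / 4)) := by
      simp only [eventually_all]
      exact fun i j b => (hcs i j b).continuousAt.eventually (lt_mem_nhds (hc0 i j b))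
    filter_upwards [hpos, h.eventually] with w hw hGw k l
    have hsym : ∀ i j, H w i j = H w j i := by
      intro i j
      have : (H w)ᵀ = H w := by
        simp only [hH, Matrix.transpose_sub, Matrix.transpose_mul, Matrix.transpose_transpose,
          hGw.inv_symm, Matrix.transpose_one, Matrix.mul_assoc]
      exact congrFun (congrFun this j) i
    have hδ4 : 4 * (n : ℝ) * δ = 1 := by
      have := hn k
      rw [hδ]; field_simp
    -- the sum over the two signs leaves the terms in which `σ` occurs an even number of times
    have e1 : ∀ i j, ∑ b, √(a * (δ + σ b * (H w i j / 4))) * (S k i + σ b * S k j)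
        * (√(a * (δ + σ b * (H w i j / 4))) * (S l i + σ b * S l j))
        = a * (2 * δ * (S k i * S l i) + 2 * δ * (S k j * S l j)
          + (S k i * H w i j * S l j) / 2 + (S k j * H w j i * S l i) / 2) := by
      intro i j
      have e : ∀ b, √(a * (δ + σ b * (H w i j / 4))) * (S k i + σ b * S k j)
        * (√(a * (δ + σ b * (H w i j / 4))) * (S l i + σ b * S l j))
        = a * (δ + σ b * (H w i j / 4)) * ((S k i + σ b * S k j) * (S l i + σ b * S l j)) := by
        intro b
        have := Real.mul_self_sqrt (hw i j b).le
        linear_combination ((S k i + σ b * S k j) * (S l i + σ b * S l j)) * this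
      simp only [e, Fintype.sum_bool, σ, hsym j i]
      simp
      ring
    have e2 : (G w)⁻¹ k l = ∑ i, S k i * S l i + ∑ i, ∑ j, S k i * H w i j * S l j := by
      rw [hinv w, Matrix.mul_add, Matrix.add_mul, Matrix.mul_one, Matrix.add_apply]
      congr 1
      rw [Matrix.mul_apply]
      simp only [Matrix.mul_apply, Matrix.transpose_apply, Finset.sum_mul]
      exact Finset.sum_comm
    rw [Fintype.sum_prod_type, Fintype.sum_prod_type]
    simp only [e1, ← Finset.mul_sum, e2]
    congr 1
    have e3 : ∑ i : Fin n, ∑ _j : Fin n, 2 * δ * (S k i * S l i)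
        = n * (2 * δ * ∑ i, S k i * S l i) := by
      simp only [Finset.sum_const, Finset.card_univ, Fintype.card_fin, nsmul_eq_mul,
        ← Finset.mul_sum]
    have e4 : ∑ _i : Fin n, ∑ j : Fin n, 2 * δ * (S k j * S l j)
        = n * (2 * δ * ∑ i, S k i * S l i) := by
      rw [Finset.sum_comm, e3]
    simp only [Finset.sum_add_distrib, e3, e4, ← Finset.sum_div]
    rw [Finset.sum_comm (f := fun i j => S k j * H w j i * S l i)]
    linear_combination (∑ i, S k i * S l i) * hδ4

end Frame

/-! ### Deformations along vector fields in a chart -/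

namespace ChartCover

section Flow

variable {n : ℕ} {M : Type*} [TopologicalSpace M] [ChartedSpace (EuclideanSpace ℝ (Fin n)) M]
  [IsManifold (𝓡 n) ∞ M] (A : ChartCover n M) {x : M} {c : Fin A.m}

/-- The family indexed by all charts that is `Y` in the chart with index `c` and zero in the other
charts. -/
def extend (c : Fin A.m) (Y : Fin n → smoothAlg n M) (l : Fin A.m × Fin n) : smoothAlg n M :=
  if l.1 = c then Y l.2 else 0

@[simp] theorem extend_self (Y : Fin n → smoothAlg n M) (k : Fin n) :
    A.extend c Y (c, k) = Y k := by simp [extend]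

theorem extend_of_ne (Y : Fin n → smoothAlg n M) {l : Fin A.m × Fin n} (h : l.1 ≠ c) :
    A.extend c Y l = 0 := by simp [extend, h]

theorem sum_eq_sum_chart {R : Type*} [AddCommMonoid R] (f : Fin A.m × Fin n → R)
    (h : ∀ l, l.1 ≠ c → f l = 0) : ∑ l, f l = ∑ k, f (c, k) := by
  rw [Fintype.sum_prod_type, Finset.sum_eq_single c]
  · exact fun b _ hb => Finset.sum_eq_zero fun k _ => h (b, k) hb
  · simp

/-- The displacement `s Y + s² Z` in coordinates. -/
def shift (Y Z : Fin n → smoothAlg n M) (s : ℝ) (x : M) : EuclideanSpace ℝ (Fin n) :=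
  WithLp.toLp 2 fun k => s * (Y k).1 x + s ^ 2 * (Z k).1 x

theorem shift_zero {Y Z : Fin n → smoothAlg n M} {s : ℝ} (hY : ∀ k, (Y k).1 x = 0)
    (hZ : ∀ k, (Z k).1 x = 0) : shift Y Z s x = 0 := by
  ext k; simp [shift, hY, hZ]

theorem contMDiff_shift (Y Z : Fin n → smoothAlg n M) (s : ℝ) :
    ContMDiff (𝓡 n) (𝓡 n) ∞ (shift Y Z s) := by
  have h : ContMDiff (𝓡 n) 𝓘(ℝ, Fin n → ℝ) ∞ fun x k => s * (Y k).1 x + s ^ 2 * (Z k).1 x :=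
    contMDiff_pi_space.2 fun k =>
      (contMDiff_const.mul (Y k).2).add (contMDiff_const.mul (Z k).2)
  exact (PiLp.contDiff_toLp (𝕜 := ℝ) (p := 2)).contMDiff.comp h

/-- The displacement `s Y + s² Z` maps `U c` into the coordinate image of `U c`. -/
def Stays (c : Fin A.m) (Y Z : Fin n → smoothAlg n M) (s : ℝ) : Prop :=
  ∀ x ∈ A.U c, A.chart c x + shift Y Z s x ∈ A.V c

/-- `Y` vanishes outside of the support of the cutoff function `η c`. -/
def Supported (c : Fin A.m) (Y : Fin n → smoothAlg n M) : Prop :=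
  ∀ x ∉ tsupport (A.η c).1, ∀ k, (Y k).1 x = 0

/-- The compact support of `η c` stays in the open set `U c` for small displacements, and the other
points are not moved. -/
theorem eventually_stays [CompactSpace M] {Y Z : Fin n → smoothAlg n M} (hY : A.Supported c Y)
    (hZ : A.Supported c Z) : ∀ᶠ s in 𝓝 0, A.Stays c Y Z s := by
  have hK : IsCompact (A.chart c '' tsupport (A.η c).1) :=
    (isClosed_tsupport _).isCompact.image_of_continuousOn
      ((continuousOn_extChartAt (A.center c)).mono
        ((A.η_tsupport c).trans (A.U_subset_source c)))
  have hKV : A.chart c '' tsupport (A.η c).1 ⊆ A.V c := by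
    rintro _ ⟨x, hx, rfl⟩
    exact A.chart_mem_V (A.η_tsupport c hx)
  obtain ⟨δ, hδ, hδV⟩ := hK.exists_thickening_subset_open (A.isOpen_V c) hKV
  have hcont : Continuous fun q : ℝ × M => shift Y Z q.1 q.2 := by
    refine (PiLp.continuous_toLp 2 _).comp (continuous_pi fun k => ?_)
    have h1 := (Y k).1.continuous
    have h2 := (Z k).1.continuous
    fun_prop
  have hsmall : ∀ᶠ s in 𝓝 (0 : ℝ), ∀ x, ‖shift Y Z s x‖ < δ := by
    have : ∀ x ∈ (Set.univ : Set M), ∀ᶠ q : M × ℝ in 𝓝 x ×ˢ 𝓝 (0 : ℝ), ‖shift Y Z q.2 q.1‖ < δ := by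
      intro x _
      have h0 : ‖shift Y Z 0 x‖ < δ := by
        have : shift Y Z 0 x = 0 := by ext k; simp [shift]
        simpa [this] using hδ
      rw [← nhds_prod_eq]
      have hc2 : Continuous fun q : M × ℝ => ‖shift Y Z q.2 q.1‖ :=
        (hcont.comp continuous_swap).norm
      exact hc2.continuousAt.eventually (p := fun r => r < δ) (gt_mem_nhds h0)
    have h2 := isCompact_univ.eventually_forall_of_forall_eventually (x₀ := (0 : ℝ))
      (P := fun s x => ‖shift Y Z s x‖ < δ) (by
        intro x hx
        have h3 := this x hx
        rw [← nhds_prod_eq] at h3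
        exact (continuous_swap.tendsto ((0 : ℝ), x)).eventually h3)
    simpa using h2
  filter_upwards [hsmall] with s hs x hx
  by_cases hxK : x ∈ tsupport (A.η c).1
  · refine hδV (Metric.mem_thickening_iff.2 ⟨_, ⟨x, hxK, rfl⟩, ?_⟩)
    simpa [dist_eq_norm] using hs x
  · rw [shift_zero (hY x hxK) (hZ x hxK), add_zero]
    exact A.chart_mem_V hx

open Classical in
/-- The maps that move the points of `U c` by `s Y + s² Z` in coordinates. -/
def move (c : Fin A.m) (Y Z : Fin n → smoothAlg n M) (s : ℝ) (x : M) : M :=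
  if A.Stays c Y Z s ∧ x ∈ A.U c then (A.chart c).symm (A.chart c x + shift Y Z s x) else x

variable {Y Z : Fin n → smoothAlg n M} {s : ℝ}

theorem move_of_mem (hs : A.Stays c Y Z s) (hx : x ∈ A.U c) :
    A.move c Y Z s x = (A.chart c).symm (A.chart c x + shift Y Z s x) := if_pos ⟨hs, hx⟩

theorem move_of_notMem (hY : A.Supported c Y) (hZ : A.Supported c Z)
    (hx : x ∉ tsupport (A.η c).1) : A.move c Y Z s x = x := by
  unfold move
  split_ifs with h
  · rw [shift_zero (hY x hx) (hZ x hx), add_zero, A.symm_chart h.2]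
  · rfl

theorem move_mem (hs : A.Stays c Y Z s) (hx : x ∈ A.U c) : A.move c Y Z s x ∈ A.U c := by
  rw [A.move_of_mem hs hx]; exact (hs x hx).2

theorem chart_move (hs : A.Stays c Y Z s) (hx : x ∈ A.U c) :
    A.chart c (A.move c Y Z s x) = A.chart c x + shift Y Z s x := by
  rw [A.move_of_mem hs hx]; exact (A.chart c).right_inv (hs x hx).1

theorem move_zero (x : M) : A.move c Y Z 0 x = x := by
  unfold move
  split_ifs with h
  · have : shift Y Z 0 x = 0 := by ext k; simp [shift]
    rw [this, add_zero, A.symm_chart h.2]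
  · rfl

theorem contMDiff_move (hY : A.Supported c Y) (hZ : A.Supported c Z) (s : ℝ) :
    ContMDiff (𝓡 n) (𝓡 n) ∞ (A.move c Y Z s) := by
  intro x
  by_cases hs : A.Stays c Y Z s
  · by_cases hx : x ∈ tsupport (A.η c).1
    · have hxU := A.η_tsupport c hx
      have h1 : ContMDiffAt (𝓡 n) (𝓡 n) ∞ (fun x => A.chart c x + shift Y Z s x) x :=
        (contMDiffAt_chart (A.U_subset_source c hxU)).add (contMDiff_shift Y Z s x)
      refine (ContMDiffAt.comp x (contMDiffAt_chart_symm (hs x hxU).1) h1).congr_of_eventuallyEq ?_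
      filter_upwards [(A.isOpen_U c).mem_nhds hxU] with y hy
      exact A.move_of_mem hs hy
    · refine contMDiffAt_id.congr_of_eventuallyEq ?_
      filter_upwards [(isClosed_tsupport _).isOpen_compl.mem_nhds hx] with y hy
      exact A.move_of_notMem hY hZ hy
  · refine contMDiffAt_id.congr_of_eventuallyEq (Eventually.of_forall fun y => ?_)
    exact if_neg fun h => hs h.1

/-- Composition with `move`. -/
def moveHom (hY : A.Supported c Y) (hZ : A.Supported c Z) (s : ℝ) :
    smoothAlg n M →ₐ[ℝ] smoothAlg n M where
  toFun u := mkSmooth (fun x => u.1 (A.move c Y Z s x)) (ContMDiff.comp u.2 (A.contMDiff_move hY hZ s))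
  map_one' := rfl
  map_mul' _ _ := rfl
  map_zero' := rfl
  map_add' _ _ := rfl
  commutes' _ := rfl

theorem moveHom_apply (hY : A.Supported c Y) (hZ : A.Supported c Z) (u : smoothAlg n M) :
    (A.moveHom hY hZ s u).1 x = u.1 (A.move c Y Z s x) := rfl

/-- The chain rule in the chart in which the deformation is defined. -/
theorem X_moveHom_of_mem (hY : A.Supported c Y) (hZ : A.Supported c Z) (hs : A.Stays c Y Z s)
    (hx : x ∈ A.U c) (k : Fin n) (u : smoothAlg n M) :
    (A.X (c, k) (A.moveHom hY hZ s u)).1 x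
      = ∑ l, (A.X (c, k) (A.y c l + s • Y l + s ^ 2 • Z l)).1 x
        * (A.X (c, l) u).1 (A.move c Y Z s x) := by
  set ψ : EuclideanSpace ℝ (Fin n) → EuclideanSpace ℝ (Fin n) :=
    fun w => w + shift Y Z s ((A.chart c).symm w) with hψ
  have hz := (A.chart_mem_V hx).1
  have hψs : ContDiffAt ℝ ∞ ψ (A.chart c x) :=
    contDiffAt_id.add (ContMDiffAt.comp _ (contMDiff_shift Y Z s _)
      (contMDiffAt_chart_symm hz)).contDiffAt
  have hψx : ψ (A.chart c x) = A.chart c (A.move c Y Z s x) := by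
    rw [A.chart_move hs hx, hψ]; simp only [A.symm_chart hx]
  have hV := (A.isOpen_V c).mem_nhds (A.chart_mem_V hx)
  have hu := smoothNear_comp_chart (coe_mem u) (A.chart_mem_V (A.move_mem hs hx)).1
  rw [A.X_apply_of_mem hx]
  have h1 : pd k ((A.moveHom hY hZ s u).1 ∘ (A.chart c).symm) (A.chart c x)
      = pd k ((u.1 ∘ (A.chart c).symm) ∘ ψ) (A.chart c x) := by
    refine pd_congr ?_
    filter_upwards [hV] with w hw
    simp only [Function.comp_apply]
    rw [moveHom_apply, A.move_of_mem hs hw.2, (A.chart c).right_inv hw.1]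
  have h2 := pd_comp (k := k) (y := A.chart c x) (ψ := ψ) (f := u.1 ∘ (A.chart c).symm)
    (by rw [hψx]; exact hu.differentiableAt) (hψs.differentiableAt (by simp))
  rw [h1]
  refine h2.trans (Finset.sum_congr rfl fun l _ => ?_)
  rw [hψx, A.X_apply_of_mem (A.move_mem hs hx), A.X_apply_of_mem hx]
  have h3 : jacobian ψ (A.chart c x) l k
      = pd k ((A.y c l + s • Y l + s ^ 2 • Z l).1 ∘ (A.chart c).symm) (A.chart c x) := by
    refine pd_congr ?_
    filter_upwards [hV] with w hw
    have e := A.y_apply_of_mem hw.2 l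
    rw [(A.chart c).right_inv hw.1] at e
    change w l + (s * _ + s ^ 2 * _) = (A.y c l).1 ((A.chart c).symm w) + s * _ + s ^ 2 * _
    rw [e, add_assoc]
  rw [h3]

/-- The chain rule for all the derivations. On `U c` they are combinations of the coordinate
derivations of the chart, at a point and at its image with different coefficients; this is the
origin of the difference `X (y m) - T (X (y m))`. Outside of the support of `η c` nothing moves. -/
theorem X_moveHom (hY : A.Supported c Y) (hZ : A.Supported c Z) (hs : A.Stays c Y Z s)
    (i : Fin A.m × Fin n) (u : smoothAlg n M) :
    A.X i (A.moveHom hY hZ s u) = A.moveHom hY hZ s (A.X i u)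
      + ∑ m, (A.X i (A.extend c (A.y c) m) - A.moveHom hY hZ s (A.X i (A.extend c (A.y c) m))
        + s • A.X i (A.extend c Y m) + s ^ 2 • A.X i (A.extend c Z m))
          * A.moveHom hY hZ s (A.X m u) := by
  rw [A.sum_eq_sum_chart (c := c) _ fun l hl => by
    simp [A.extend_of_ne _ hl]]
  simp only [extend_self]
  refine smoothAlg_ext fun x => ?_
  have e : (A.moveHom hY hZ s (A.X i u)
      + ∑ k, (A.X i (A.y c k) - A.moveHom hY hZ s (A.X i (A.y c k))
        + s • A.X i (Y k) + s ^ 2 • A.X i (Z k)) * A.moveHom hY hZ s (A.X (c, k) u)).1 x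
      = (A.X i u).1 (A.move c Y Z s x) + ∑ k, ((A.X i (A.y c k)).1 x
        - (A.X i (A.y c k)).1 (A.move c Y Z s x) + s * (A.X i (Y k)).1 x
        + s ^ 2 * (A.X i (Z k)).1 x) * (A.X (c, k) u).1 (A.move c Y Z s x) := by
    simp [moveHom_apply]
  rw [e]
  by_cases hx : x ∈ tsupport (A.η c).1
  · have hxU := A.η_tsupport c hx
    rw [A.X_eq_sum hxU, A.X_eq_sum (A.move_mem hs hxU) i u, ← Finset.sum_add_distrib]
    simp only [A.X_moveHom_of_mem hY hZ hs hxU, Finset.mul_sum]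
    rw [Finset.sum_comm]
    refine Finset.sum_congr rfl fun l _ => ?_
    have h1 := A.X_eq_sum hxU i (A.y c l + s • Y l + s ^ 2 • Z l)
    have h2 : (A.X i (A.y c l + s • Y l + s ^ 2 • Z l)).1 x
        = (A.X i (A.y c l)).1 x + s * (A.X i (Y l)).1 x + s ^ 2 * (A.X i (Z l)).1 x := by
      simp only [map_add, Derivation.map_smul]; rfl
    simp only [← mul_assoc, ← Finset.sum_mul]
    rw [← h1, h2]
    ring
  · have hn : ∀ᶠ y in 𝓝 x, y ∉ tsupport (A.η c).1 :=
      (isClosed_tsupport _).isOpen_compl.mem_nhds hx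
    have hm := A.move_of_notMem (s := s) hY hZ hx
    rw [hm, A.X_congr (v := u) (by
      filter_upwards [hn] with y hy
      rw [moveHom_apply, A.move_of_notMem hY hZ hy])]
    have hY' : ∀ k, (A.X i (Y k)).1 x = 0 := fun k =>
      A.X_eq_zero (by filter_upwards [hn] with y hy using hY y hy k) i
    have hZ' : ∀ k, (A.X i (Z k)).1 x = 0 := fun k =>
      A.X_eq_zero (by filter_upwards [hn] with y hy using hZ y hy k) i
    simp [hY', hZ']

theorem hasDerivAt_move (hY : A.Supported c Y) (hZ : A.Supported c Z)
    (hs : ∀ᶠ r in 𝓝 s, A.Stays c Y Z r) (u : smoothAlg n M) (x : M) :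
    HasDerivAt (fun r => u.1 (A.move c Y Z r x))
      (∑ m, ((A.extend c Y m).1 x + 2 * s * (A.extend c Z m).1 x)
        * (A.X m u).1 (A.move c Y Z s x)) s := by
  rw [A.sum_eq_sum_chart (c := c) _ fun l hl => by
    simp [A.extend_of_ne _ hl]]
  simp only [extend_self]
  by_cases hx : x ∈ tsupport (A.η c).1
  · have hxU := A.η_tsupport c hx
    have hs0 := hs.self_of_nhds
    have hu := smoothNear_comp_chart (coe_mem u) (A.chart_mem_V (A.move_mem hs0 hxU)).1
    rw [A.chart_move hs0 hxU] at hu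
    have hd : HasDerivAt (fun r => A.chart c x + shift Y Z r x)
        (WithLp.toLp 2 fun k => (Y k).1 x + 2 * s * (Z k).1 x) s := by
      refine HasDerivAt.const_add _ ?_
      have h1 : HasDerivAt (fun r k => r * (Y k).1 x + r ^ 2 * (Z k).1 x)
          (fun k => (Y k).1 x + 2 * s * (Z k).1 x) s := by
        refine hasDerivAt_pi.2 fun k => ?_
        have := ((hasDerivAt_id s).mul_const ((Y k).1 x)).add
          ((hasDerivAt_pow 2 s).mul_const ((Z k).1 x))
        exact this.congr_deriv (by simp)
      exact (PiLp.hasFDerivAt_toLp (𝕜 := ℝ) 2 _).comp_hasDerivAt s h1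
    have h := hu.differentiableAt.hasFDerivAt.comp_hasDerivAt s hd
    rw [fderiv_eq_sum_pd] at h
    refine (h.congr_of_eventuallyEq ?_).congr_deriv ?_
    · filter_upwards [hs] with r hr
      rw [A.move_of_mem hr hxU]; rfl
    · refine Finset.sum_congr rfl fun k _ => ?_
      rw [A.X_apply_of_mem (A.move_mem hs0 hxU), A.chart_move hs0 hxU]
  · have : (fun r => u.1 (A.move c Y Z r x)) = fun _ => u.1 x := by
      funext r; rw [A.move_of_notMem hY hZ hx]
    rw [this]
    simpa [hY x hx, hZ x hx] using hasDerivAt_const s (u.1 x)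

/-- The deformation that moves the points of `U c` by `s Y + s² Z` in coordinates. -/
def deformation [CompactSpace M] (hY : A.Supported c Y) (hZ : A.Supported c Z) {s₀ : ℝ}
    (h : ∀ s, |s| < s₀ → A.Stays c Y Z s) : Deformation A.X s₀ where
  Φ := A.move c Y Z
  T := A.moveHom hY hZ
  T_apply _ _ _ := rfl
  Φ_zero := A.move_zero
  y := A.extend c (A.y c)
  Y := A.extend c Y
  Z := A.extend c Z
  X_T s hs i u := A.X_moveHom hY hZ (h s hs) i u
  hasDerivAt s hs u x := A.hasDerivAt_move hY hZ (by
    filter_upwards [(continuous_abs.tendsto s).eventually (gt_mem_nhds hs)] with r hr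
    exact h r hr) u x

end Flow

end ChartCover

/-! ### The Laplacian as a generator -/

namespace ChartCover

section Laplacian

variable {n : ℕ} {M : Type*} [TopologicalSpace M] [ChartedSpace (EuclideanSpace ℝ (Fin n)) M]
  [IsManifold (𝓡 n) ∞ M] (A : ChartCover n M) {x : M} {c : Fin A.m}

/-- The smooth function `η c · (h ∘ chart c)`. -/
def cut (c : Fin A.m) (h : EuclideanSpace ℝ (Fin n) → ℝ)
    (hh : ∀ x ∈ A.U c, ContDiffAt ℝ ∞ h (A.chart c x)) : smoothAlg n M :=
  mkSmooth _ (mem_smoothFunctions_mul_chart (A.η c).2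
    ((A.η_tsupport c).trans (A.U_subset_source c)) fun x hx => hh x (A.η_tsupport c hx))

theorem cut_apply (h : EuclideanSpace ℝ (Fin n) → ℝ)
    (hh : ∀ x ∈ A.U c, ContDiffAt ℝ ∞ h (A.chart c x)) (x : M) :
    (A.cut c h hh).1 x = (A.η c).1 x * h (A.chart c x) := rfl

theorem cut_eq_zero (h : EuclideanSpace ℝ (Fin n) → ℝ)
    (hh : ∀ x ∈ A.U c, ContDiffAt ℝ ∞ h (A.chart c x)) (hx : x ∉ tsupport (A.η c).1) :
    (A.cut c h hh).1 x = 0 := by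
  rw [cut_apply, image_eq_zero_of_notMem_tsupport hx, zero_mul]

variable [CompactSpace M] {Y Z : Fin n → smoothAlg n M}

theorem deformation_V_apply (hY : A.Supported c Y) (hZ : A.Supported c Z) {s₀ : ℝ}
    (h : ∀ s, |s| < s₀ → A.Stays c Y Z s) (u : smoothAlg n M) (x : M) :
    ((A.deformation hY hZ h).V u).1 x = ∑ k, (Y k).1 x * (A.X (c, k) u).1 x := by
  have : (A.deformation hY hZ h).V u = ∑ k, Y k * A.X (c, k) u := by
    rw [Deformation.V_apply, A.sum_eq_sum_chart (c := c)]
    · simp [deformation]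
    · intro l hl
      simp [deformation, A.extend_of_ne _ hl]
  rw [this]; simp

theorem deformation_B_apply (hY : A.Supported c Y) (hZ : A.Supported c Z) {s₀ : ℝ}
    (h : ∀ s, |s| < s₀ → A.Stays c Y Z s) (u : smoothAlg n M) (x : M) :
    ((A.deformation hY hZ h).B u).1 x = ∑ k, 2 * (Z k).1 x * (A.X (c, k) u).1 x
      + ∑ k, ∑ l, (Y k).1 x * (Y l).1 x * (A.X (c, l) (A.X (c, k) u)).1 x := by
  have : (A.deformation hY hZ h).B u = ∑ k, ((2 : ℝ) • Z k) * A.X (c, k) u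
      + ∑ k, ∑ l, Y k * Y l * A.X (c, l) (A.X (c, k) u) := by
    rw [Deformation.B_apply, A.sum_eq_sum_chart (c := c), A.sum_eq_sum_chart (c := c)]
    · congr 1
      · simp [deformation]
      · refine Finset.sum_congr rfl fun k _ => ?_
        rw [A.sum_eq_sum_chart (c := c)]
        · simp [deformation]
        · intro l hl
          simp [deformation, A.extend_of_ne _ hl]
    · intro l hl
      simp [deformation, A.extend_of_ne _ hl]
    · intro l hl
      simp [deformation, A.extend_of_ne _ hl]
  rw [this]; simp [mul_assoc]

end Laplacian

end ChartCover

section Generator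

variable {n : ℕ} {M : Type*} [TopologicalSpace M] [ChartedSpace (EuclideanSpace ℝ (Fin n)) M]
  [IsManifold (𝓡 n) ∞ M] [T2Space M] [CompactSpace M]

/-- A positive multiple of the Laplacian is the generator of a family of deformations that span
all derivations. The deformation along a field `Y` of a frame for the inverse metric moves points
along the second order Taylor polynomials of the geodesics with velocity `Y`. -/
theorem exists_generator_eq_laplacian (g : Metric n M) {a : ℝ} (ha : 0 < a) :
    ∃ (A : ChartCover n M) (s₀ : ℝ) (ν : Type) (_ : Fintype ν) (D : ν → Deformation A.X s₀),
      0 < s₀ ∧ s₀ ≤ 1 ∧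
      (∀ l, ∃ b : ν → smoothAlg n M, ∀ u, A.X l u = ∑ i, b i * (D i).V u) ∧
      ∀ u x, (generator D u).1 x = a * laplacian g u.1 x := by
  -- frames for `2 a g⁻¹` near the center of each chart, where the factor is `2 a` since the
  -- generator is one half of the sum of the second derivatives
  have hframe := fun c : M => (metricNear_metricCoord g
    (mem_extChartAt_target (I := 𝓡 n) c)).exists_frame
    (posDef_metricCoord g (mem_extChartAt_target (I := 𝓡 n) c)) (a := 2 * a) (by positivity)
  choose Y hYs hYid using hframe
  -- a cover such that each frame exists on the corresponding set `U c`
  obtain ⟨A, hA⟩ := exists_chartCover (n := n) (fun c : M => extChartAt (𝓡 n) c ⁻¹'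
    {w | (∀ ν k, ContDiffAt ℝ ∞ (Y c ν k) w) ∧
      ∀ k l, ∑ ν, Y c ν k w * Y c ν l w = 2 * a * (metricCoord g c w)⁻¹ k l}) fun c => by
    refine (continuousAt_extChartAt (I := 𝓡 n) c).preimage_mem_nhds ?_
    filter_upwards [hYid c, eventually_all.2 fun ν => eventually_all.2 fun k => hYs c ν k]
      with w h1 h2 using ⟨h2, h1⟩
  let G := fun c => metricCoord g (A.center c)
  have hGn : ∀ c, ∀ x ∈ A.U c, MetricNear (G c) (A.chart c x) := fun c x hx =>
    metricNear_metricCoord g (A.chart_mem_V hx).1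
  have hYc : ∀ c ν k, ∀ x ∈ A.U c, ContDiffAt ℝ ∞ (Y (A.center c) ν k) (A.chart c x) :=
    fun c ν k x hx => (hA c hx).1 ν k
  -- the coefficient of `s²` in the geodesics is `-Γ(Y, Y) / 2`
  have hΓc : ∀ c ν k, ∀ x ∈ A.U c, ContDiffAt ℝ ∞ (fun w => -(1 / 2) * ∑ i, ∑ j,
      christoffel (G c) k i j w * Y (A.center c) ν i w * Y (A.center c) ν j w) (A.chart c x) :=
    fun c ν k x hx => contDiffAt_const.mul (ContDiffAt.sum fun i _ => ContDiffAt.sum fun j _ =>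
      (((hGn c x hx).smooth_christoffel k i j).contDiffAt.mul (hYc c ν i x hx)).mul
        (hYc c ν j x hx))
  -- the dual frame `(2 a)⁻¹ g Y`
  have hβc : ∀ c ν k, ∀ x ∈ A.U c, ContDiffAt ℝ ∞ (fun w => (2 * a)⁻¹ * ∑ i,
      G c w k i * Y (A.center c) ν i w) (A.chart c x) :=
    fun c ν k x hx => contDiffAt_const.mul (ContDiffAt.sum fun i _ =>
      ((hGn c x hx).smooth k i).contDiffAt.mul (hYc c ν i x hx))
  -- the fields `η Y` and `-η² Γ(Y, Y) / 2`: the cutoff functions enter the second derivative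
  -- through their squares, which form a partition of unity
  let Yg := fun c ν k => A.cut c _ (hYc c ν k)
  let Zg := fun c ν k => A.η c * A.cut c _ (hΓc c ν k)
  have hYg : ∀ c ν, A.Supported c (Yg c ν) := fun c ν x hx k => A.cut_eq_zero _ _ hx
  have hZg : ∀ c ν, A.Supported c (Zg c ν) := fun c ν x hx k => by
    change (A.η c).1 x * (A.cut c _ (hΓc c ν k)).1 x = 0
    rw [A.cut_eq_zero _ _ hx, mul_zero]
  have hst : ∀ᶠ s in 𝓝 (0 : ℝ), ∀ c ν, A.Stays c (Yg c ν) (Zg c ν) s :=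
    eventually_all.2 fun c => eventually_all.2 fun ν => A.eventually_stays (hYg c ν) (hZg c ν)
  obtain ⟨ε, hε, hst⟩ := Metric.eventually_nhds_iff.1 hst
  have hst' : ∀ c ν s, |s| < min ε 1 → A.Stays c (Yg c ν) (Zg c ν) s := fun c ν s hs =>
    hst (by rw [Real.dist_eq, sub_zero]; exact hs.trans_le (min_le_left _ _)) c ν
  refine ⟨A, min ε 1, Fin A.m × ((Fin n × Fin n) × Bool), inferInstance,
    fun i => A.deformation (hYg i.1 i.2) (hZg i.1 i.2) (hst' i.1 i.2), lt_min hε one_pos,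
    min_le_right _ _, fun l => ?_, fun u x => ?_⟩
  · -- a derivation is expanded in the frame by means of the dual frame
    refine ⟨fun i => ∑ k, A.X l (A.y i.1 k) * A.cut i.1 _ (hβc i.1 i.2 k), fun u =>
      smoothAlg_ext fun x => ?_⟩
    have e : (∑ i : Fin A.m × ((Fin n × Fin n) × Bool),
        (∑ k, A.X l (A.y i.1 k) * A.cut i.1 _ (hβc i.1 i.2 k))
          * (A.deformation (hYg i.1 i.2) (hZg i.1 i.2) (hst' i.1 i.2)).V u).1 x
        = ∑ c, ∑ ν, (∑ k, (A.X l (A.y c k)).1 x * (A.cut c _ (hβc c ν k)).1 x)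
          * (∑ j, (Yg c ν j).1 x * (A.X (c, j) u).1 x) := by
      rw [← Fintype.sum_prod_type']
      simp [A.deformation_V_apply]
    rw [e]
    calc (A.X l u).1 x = ∑ c, ((A.η c).1 x) ^ 2 * (A.X l u).1 x := by
          rw [← Finset.sum_mul, A.sum_sq, one_mul]
      _ = _ := Finset.sum_congr rfl fun c _ => ?_
    by_cases hx : x ∈ A.U c
    · have hid := (hA c hx).2
      have h1 : ∀ k j, ∑ ν, ((2 * a)⁻¹ * ∑ i, G c (A.chart c x) k i
          * Y (A.center c) ν i (A.chart c x)) * Y (A.center c) ν j (A.chart c x)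
          = (1 : Matrix (Fin n) (Fin n) ℝ) k j := by
        intro k j
        rw [← (hGn c x hx).mul_inv, Matrix.mul_apply]
        have h2 : ∀ ν, ((2 * a)⁻¹ * ∑ i, G c (A.chart c x) k i
          * Y (A.center c) ν i (A.chart c x)) * Y (A.center c) ν j (A.chart c x)
          = ∑ i, (2 * a)⁻¹ * G c (A.chart c x) k i
            * (Y (A.center c) ν i (A.chart c x) * Y (A.center c) ν j (A.chart c x)) := by
          intro ν
          rw [Finset.mul_sum, Finset.sum_mul]
          exact Finset.sum_congr rfl fun i _ => by ring
        simp only [h2]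
        rw [Finset.sum_comm]
        refine Finset.sum_congr rfl fun i _ => ?_
        have h3 := hid i j
        rw [← Finset.mul_sum]
        refine (congrArg _ h3).trans ?_
        change (2 * a)⁻¹ * G c (A.chart c x) k i * (2 * a * (G c (A.chart c x))⁻¹ i j) = _
        field_simp
      have h4 : ∀ ν, (∑ k, (A.X l (A.y c k)).1 x * (A.cut c _ (hβc c ν k)).1 x)
          * (∑ j, (Yg c ν j).1 x * (A.X (c, j) u).1 x)
          = ∑ k, ∑ j, ((A.η c).1 x) ^ 2 * (A.X l (A.y c k)).1 x * (A.X (c, j) u).1 x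
            * (((2 * a)⁻¹ * ∑ i, G c (A.chart c x) k i
          * Y (A.center c) ν i (A.chart c x)) * Y (A.center c) ν j (A.chart c x)) := by
        intro ν
        rw [Finset.sum_mul_sum]
        refine Finset.sum_congr rfl fun k _ => Finset.sum_congr rfl fun j _ => ?_
        rw [A.cut_apply, show (Yg c ν j).1 x = _ from A.cut_apply _ _ _]
        ring
      simp only [h4]
      rw [Finset.sum_comm, A.X_eq_sum hx, Finset.mul_sum]
      refine Finset.sum_congr rfl fun k _ => ?_
      rw [Finset.sum_comm]
      simp only [← Finset.mul_sum, h1, Matrix.one_apply]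
      simp
      ring
    · have h0 : (A.η c).1 x = 0 := A.η_eq_zero hx
      have h1 : ∀ ν j, (Yg c ν j).1 x = 0 := fun ν j => by
        rw [show (Yg c ν j).1 x = _ from A.cut_apply _ _ _, h0, zero_mul]
      simp [h0, h1]
  · rw [generator_apply, Fintype.sum_prod_type]
    simp only [A.deformation_B_apply]
    -- the second derivatives along the deformations in one chart add up to the contraction of the
    -- Hessian with `2 a g⁻¹`, multiplied by `η²`
    have key : ∀ c, ∑ ν, (∑ k, 2 * (Zg c ν k).1 x * (A.X (c, k) u).1 x
        + ∑ k, ∑ l, (Yg c ν k).1 x * (Yg c ν l).1 x * (A.X (c, l) (A.X (c, k) u)).1 x)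
        = ((A.η c).1 x) ^ 2 * (-(2 * a) * laplacian g u.1 x) := by
      intro c
      by_cases hx : x ∈ A.U c
      · set w := A.chart c x with hw
        set û := u.1 ∘ (A.chart c).symm with hû
        have hlap := laplacian_chart g (coe_mem u) (A.chart_mem_V hx).1
        rw [A.symm_chart hx] at hlap
        have hlap' : laplacian g u.1 x = laplacianCoord (G c) û w := hlap
        have hid := (hA c hx).2
        have h1 : ∀ ν, (∑ k, 2 * (Zg c ν k).1 x * (A.X (c, k) u).1 x
            + ∑ k, ∑ l, (Yg c ν k).1 x * (Yg c ν l).1 x * (A.X (c, l) (A.X (c, k) u)).1 x)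
            = ∑ i, ∑ j, ((A.η c).1 x) ^ 2
              * (pd i (pd j û) w - ∑ k, christoffel (G c) k i j w * pd k û w)
              * (Y (A.center c) ν i w * Y (A.center c) ν j w) := by
          intro ν
          have e1 : ∀ k, (Zg c ν k).1 x = (A.η c).1 x * ((A.η c).1 x * (-(1 / 2) * ∑ i, ∑ j,
            christoffel (G c) k i j w * Y (A.center c) ν i w * Y (A.center c) ν j w)) :=
            fun k => rfl
          have e2 : ∀ k, (Yg c ν k).1 x = (A.η c).1 x * Y (A.center c) ν k w := fun k => rfl
          have e3 : ∀ k, (A.X (c, k) u).1 x = pd k û w := fun k => A.X_apply_of_mem hx k u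
          have e4 : ∀ k l, (A.X (c, l) (A.X (c, k) u)).1 x = pd l (pd k û) w :=
            fun k l => A.X_comm_of_mem hx l k u
          simp only [e1, e2, e3, e4]
          have e5 : ∑ k, 2 * ((A.η c).1 x * ((A.η c).1 x * (-(1 / 2) * ∑ i, ∑ j,
              christoffel (G c) k i j w * Y (A.center c) ν i w * Y (A.center c) ν j w)))
              * pd k û w
              = ∑ i, ∑ j, ∑ k, -(((A.η c).1 x) ^ 2 * (christoffel (G c) k i j w * pd k û w)
              * (Y (A.center c) ν i w * Y (A.center c) ν j w)) := by
            have : ∀ k, 2 * ((A.η c).1 x * ((A.η c).1 x * (-(1 / 2) * ∑ i, ∑ j,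
              christoffel (G c) k i j w * Y (A.center c) ν i w * Y (A.center c) ν j w)))
              * pd k û w
              = ∑ i, ∑ j, -(((A.η c).1 x) ^ 2 * (christoffel (G c) k i j w * pd k û w)
              * (Y (A.center c) ν i w * Y (A.center c) ν j w)) := by
              intro k
              have h : ∀ S : ℝ, 2 * ((A.η c).1 x * ((A.η c).1 x * (-(1 / 2) * S))) * pd k û w
                = (-(((A.η c).1 x) ^ 2 * pd k û w)) * S := fun S => by ring
              rw [h]
              simp only [Finset.mul_sum]
              exact Finset.sum_congr rfl fun i _ => Finset.sum_congr rfl fun j _ => by ring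
            simp only [this]
            rw [Finset.sum_comm]
            exact Finset.sum_congr rfl fun i _ => Finset.sum_comm
          rw [e5, Finset.sum_comm (f := fun k l => (A.η c).1 x * Y (A.center c) ν k w
            * ((A.η c).1 x * Y (A.center c) ν l w) * pd l (pd k û) w), ← Finset.sum_add_distrib]
          refine Finset.sum_congr rfl fun i _ => ?_
          rw [← Finset.sum_add_distrib]
          refine Finset.sum_congr rfl fun j _ => ?_
          rw [mul_sub, sub_mul, Finset.sum_neg_distrib, Finset.mul_sum, Finset.sum_mul]
          ring
        simp only [h1]
        rw [Finset.sum_comm, hlap', laplacianCoord, mul_neg, neg_mul, neg_neg, Finset.mul_sum,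
          Finset.mul_sum]
        refine Finset.sum_congr rfl fun i _ => ?_
        rw [Finset.sum_comm, Finset.mul_sum, Finset.mul_sum]
        refine Finset.sum_congr rfl fun j _ => ?_
        rw [← Finset.mul_sum, hid i j]
        change _ * (2 * a * (G c w)⁻¹ i j) = _
        ring
      · have h0 : (A.η c).1 x = 0 := A.η_eq_zero hx
        have h1 : ∀ ν j, (Yg c ν j).1 x = 0 := fun ν j => by
          rw [show (Yg c ν j).1 x = _ from A.cut_apply _ _ _, h0, zero_mul]
        have h2 : ∀ ν j, (Zg c ν j).1 x = 0 := fun ν j => by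
          change (A.η c).1 x * _ = 0
          rw [h0, zero_mul]
        simp [h0, h1, h2]
    simp only [key, ← Finset.sum_mul, A.sum_sq]
    ring

end Generator

/-! ### Completeness of the space of smooth functions -/

namespace ChartCover

section Complete

variable {n : ℕ} {M : Type*} [TopologicalSpace M] [ChartedSpace (EuclideanSpace ℝ (Fin n)) M]
  [IsManifold (𝓡 n) ∞ M] [CompactSpace M] (A : ChartCover n M) {x : M} {c : Fin A.m}

/-- A sequence that is Cauchy with respect to all the norms `ckNorm`. -/
def IsCauchy (u : ℕ → smoothAlg n M) : Prop :=
  ∀ k, ∀ ε > 0, ∃ j₀, ∀ i ≥ j₀, ∀ j ≥ j₀, ckNorm A.X k (u i - u j) ≤ ε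

variable {A} {u : ℕ → smoothAlg n M}

theorem IsCauchy.map (hu : A.IsCauchy u) {p : ℕ} {L : smoothAlg n M →ₗ[ℝ] smoothAlg n M}
    (hL : L ∈ diffOp A.X p) : A.IsCauchy fun j => L (u j) := by
  intro k ε hε
  obtain ⟨C, hC, hb⟩ := diffOp_ckNorm_bound hL k
  obtain ⟨j₀, hj⟩ := hu (p + k) (ε / (C + 1)) (by positivity)
  refine ⟨j₀, fun i hi j hj' => ?_⟩
  rw [← map_sub]
  refine (hb _).trans ((mul_le_mul_of_nonneg_left (hj i hi j hj') hC).trans ?_)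
  rw [mul_div_assoc', div_le_iff₀ (by positivity)]
  nlinarith

theorem IsCauchy.exists_tendsto (hu : A.IsCauchy u) :
    ∃ w : C(M, ℝ), Tendsto (fun j => (u j).1) atTop (𝓝 w) := by
  refine cauchySeq_tendsto_of_complete (Metric.cauchySeq_iff'.2 fun ε hε => ?_)
  obtain ⟨j₀, hj⟩ := hu 0 (ε / 2) (by positivity)
  refine ⟨j₀, fun i hi => ?_⟩
  rw [dist_eq_norm]
  have := (norm_wordOp_le (X := A.X) 0 () (u i - u j₀)).trans (hj i hi j₀ le_rfl)
  exact lt_of_le_of_lt this (by linarith)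

/-- The uniform limit of smooth functions whose derivatives converge uniformly is
differentiable. -/
theorem hasFDerivAt_limit {w : C(M, ℝ)} {w' : Fin n → C(M, ℝ)}
    (h : Tendsto (fun j => (u j).1) atTop (𝓝 w))
    (h' : ∀ k, Tendsto (fun j => (A.X (c, k) (u j)).1) atTop (𝓝 (w' k)))
    {z : EuclideanSpace ℝ (Fin n)} (hz : z ∈ A.V c) :
    HasFDerivAt (w ∘ (A.chart c).symm)
      (∑ k, w' k ((A.chart c).symm z) • (EuclideanSpace.proj k : EuclideanSpace ℝ (Fin n) →L[ℝ] ℝ))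
      z := by
  refine hasFDerivAt_of_tendstoUniformlyOn (l := atTop) (A.isOpen_V c)
    (f := fun j => (u j).1 ∘ (A.chart c).symm)
    (f' := fun j z => ∑ k, (A.X (c, k) (u j)).1 ((A.chart c).symm z) •
      (EuclideanSpace.proj k : EuclideanSpace ℝ (Fin n) →L[ℝ] ℝ))
    (g' := fun z => ∑ k, w' k ((A.chart c).symm z) •
      (EuclideanSpace.proj k : EuclideanSpace ℝ (Fin n) →L[ℝ] ℝ)) ?_ ?_ ?_ hz
  · have h0 : Tendsto (fun j => ∑ k, ‖w' k - (A.X (c, k) (u j)).1‖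
        * ‖(EuclideanSpace.proj k : EuclideanSpace ℝ (Fin n) →L[ℝ] ℝ)‖) atTop (𝓝 0) := by
      have : Tendsto (fun j => ∑ k, ‖w' k - (A.X (c, k) (u j)).1‖
        * ‖(EuclideanSpace.proj k : EuclideanSpace ℝ (Fin n) →L[ℝ] ℝ)‖) atTop
        (𝓝 (∑ k, ‖w' k - w' k‖
        * ‖(EuclideanSpace.proj k : EuclideanSpace ℝ (Fin n) →L[ℝ] ℝ)‖)) :=
        tendsto_finsetSum _ fun k _ => ((tendsto_const_nhds.sub (h' k)).norm).mul_const _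
      simpa using this
    refine Metric.tendstoUniformlyOn_iff.2 fun ε hε => ?_
    filter_upwards [h0.eventually (gt_mem_nhds hε)] with j hj y _
    refine lt_of_le_of_lt ?_ hj
    rw [dist_eq_norm, ← Finset.sum_sub_distrib]
    refine (norm_sum_le _ _).trans (Finset.sum_le_sum fun k _ => ?_)
    rw [← sub_smul, norm_smul]
    exact mul_le_mul_of_nonneg_right
      ((w' k - (A.X (c, k) (u j)).1).norm_coe_le_norm _) (norm_nonneg _)
  · intro j y hy
    have hs := smoothNear_comp_chart (coe_mem (u j)) hy.1
    refine hs.differentiableAt.hasFDerivAt.congr_fderiv ?_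
    ext1 v
    rw [fderiv_eq_sum_pd]
    simp only [sum_apply, smul_apply, smul_eq_mul]
    refine Finset.sum_congr rfl fun k _ => ?_
    rw [A.X_apply_of_mem hy.2, (A.chart c).right_inv hy.1, mul_comm]
    rfl
  · intro y _
    exact ((continuous_eval_const _).tendsto w).comp h

/-- By induction on `k`, as the sequences of the derivatives are again Cauchy. -/
theorem IsCauchy.contDiffOn_limit (k : ℕ) : ∀ {u : ℕ → smoothAlg n M} {w : C(M, ℝ)},
    A.IsCauchy u → Tendsto (fun j => (u j).1) atTop (𝓝 w) → ∀ c,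
    ContDiffOn ℝ k (w ∘ (A.chart c).symm) (A.V c) := by
  induction k with
  | zero =>
    intro u w _ _ c
    exact contDiffOn_zero.2 (w.continuous.comp_continuousOn
      ((continuousOn_extChartAt_symm _).mono Set.inter_subset_left))
  | succ k ih =>
    intro u w hu hw c
    choose w' hw' using fun l => (hu.map (X_mem (X := A.X) l)).exists_tendsto
    push_cast
    refine (contDiffOn_succ_iff_hasFDerivWithinAt_of_uniqueDiffOn (A.isOpen_V c).uniqueDiffOn).2
      ⟨fun h => absurd h (by simp), _, ?_, fun z hz =>
        (hasFDerivAt_limit hw (fun k => hw' (c, k)) hz).hasFDerivWithinAt⟩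
    exact ContDiffOn.sum fun l _ => (ih (hu.map (X_mem (X := A.X) (c, l))) (hw' (c, l)) c).smul
      contDiffOn_const

theorem IsCauchy.exists_limit (hu : A.IsCauchy u) :
    ∃ v : smoothAlg n M, Tendsto (fun j => (u j).1) atTop (𝓝 v.1) := by
  obtain ⟨w, hw⟩ := hu.exists_tendsto
  refine ⟨⟨w, fun x => ?_⟩, hw⟩
  obtain ⟨c, hx⟩ := A.exists_mem_U x
  have h1 : ContDiffAt ℝ ∞ (w ∘ (A.chart c).symm) (A.chart c x) :=
    (contDiffOn_infty.2 fun k => hu.contDiffOn_limit k hw c).contDiffAt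
      ((A.isOpen_V c).mem_nhds (A.chart_mem_V hx))
  refine (ContMDiffAt.comp x h1.contMDiffAt
    (contMDiffAt_chart (A.U_subset_source c hx))).congr_of_eventuallyEq ?_
  filter_upwards [(A.isOpen_U c).mem_nhds hx] with y hy
  simp only [Function.comp_apply]
  rw [A.symm_chart hy]

/-- The derivatives converge to the derivatives of the limit. -/
theorem IsCauchy.tendsto_X (hu : A.IsCauchy u) {v : smoothAlg n M}
    (hv : Tendsto (fun j => (u j).1) atTop (𝓝 v.1)) (l : Fin A.m × Fin n) :
    Tendsto (fun j => (A.X l (u j)).1) atTop (𝓝 (A.X l v).1) := by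
  choose w' hw' using fun l => (hu.map (X_mem (X := A.X) l)).exists_tendsto
  have hpt : ∀ l x, Tendsto (fun j => (A.X l (u j)).1 x) atTop (𝓝 (w' l x)) := fun l x =>
    ((continuous_eval_const _).tendsto (w' l)).comp (hw' l)
  suffices h : w' l = (A.X l v).1 by rw [← h]; exact hw' l
  ext x
  obtain ⟨c, hx⟩ := A.exists_mem_U x
  have h1 : ∀ k, (A.X (c, k) v).1 x = w' (c, k) x := by
    intro k
    have h := (hasFDerivAt_limit hv (fun k => hw' (c, k)) (A.chart_mem_V hx)).fderiv
    rw [A.X_apply_of_mem hx, pd, h, A.symm_chart hx]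
    simp
  rw [A.X_eq_sum hx]
  simp only [h1]
  refine tendsto_nhds_unique (hpt l x) ?_
  simp only [A.X_eq_sum hx l (u _)]
  exact tendsto_finsetSum _ fun k _ => (hpt (c, k) x).const_mul _

theorem IsCauchy.tendsto_wordOp (hu : A.IsCauchy u) {v : smoothAlg n M}
    (hv : Tendsto (fun j => (u j).1) atTop (𝓝 v.1)) :
    ∀ (k : ℕ) (a : Wd (Fin A.m × Fin n) k),
      Tendsto (fun j => (wordOp A.X k a (u j)).1) atTop (𝓝 (wordOp A.X k a v).1)
  | 0, _ => hv
  | k + 1, (none, a) => hu.tendsto_wordOp hv k a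
  | k + 1, (some l, a) => (hu.map (wordOp_mem a)).tendsto_X (hu.tendsto_wordOp hv k a) l

/-- The space of smooth functions is complete with respect to the norms `ckNorm`. -/
theorem IsCauchy.exists_ckNorm_limit (hu : A.IsCauchy u) :
    ∃ v, ∀ k, Tendsto (fun j => ckNorm A.X k (u j - v)) atTop (𝓝 0) := by
  obtain ⟨v, hv⟩ := hu.exists_limit
  refine ⟨v, fun k => ?_⟩
  have h1 : Tendsto (fun j => ∑ a, ‖(wordOp A.X k a (u j)).1 - (wordOp A.X k a v).1‖) atTop
      (𝓝 0) := by
    rw [← Finset.sum_const_zero (s := Finset.univ (α := Wd (Fin A.m × Fin n) k))]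
    exact tendsto_finsetSum _ fun a _ => tendsto_iff_norm_sub_tendsto_zero.1
      (hu.tendsto_wordOp hv k a)
  refine squeeze_zero (fun j => ckNorm_nonneg _ _) (fun j => ?_) h1
  refine (norm_jetMap_le _ _).trans (Finset.sum_le_sum fun a _ => ?_)
  rw [map_sub]; rfl

end Complete

end ChartCover

/-! ### Solvability of the elliptic equation -/

section Elliptic

variable {n : ℕ} {M : Type*} [TopologicalSpace M] [ChartedSpace (EuclideanSpace ℝ (Fin n)) M]
  [IsManifold (𝓡 n) ∞ M] [T2Space M] [CompactSpace M] [Nonempty M]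

/-- The operator `L_g` is onto: `(n - 1) Δ_g` is the generator of a family of deformations. -/
theorem exists_conformalOp_eq (hn : 1 < n) (g : Metric n M) {f : M → ℝ}
    (hf : f ∈ smoothFunctions n M) : ∃ u ∈ smoothFunctions n M, conformalOp g u = f := by
  have ha : (0 : ℝ) < (n : ℝ) - 1 := by
    have : (1 : ℝ) < n := by exact_mod_cast hn
    linarith
  obtain ⟨A, s₀, ν, _, D, h0, h1, hspan, hgen⟩ := exists_generator_eq_laplacian g ha
  obtain ⟨u, hu⟩ := exists_solution h0 h1 D hspan A.commutator_mem_diffOp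
    (fun u hu => ChartCover.IsCauchy.exists_ckNorm_limit hu) (mkSmooth f hf)
  refine ⟨fun x => u.1 x, coe_mem u, funext fun x => ?_⟩
  have h := congrArg (fun v : smoothAlg n M => v.1 x) hu
  have h2 : u.1 x + (generator D u).1 x = f x := h
  rw [hgen] at h2
  change ((n : ℝ) - 1) * laplacian g u.1 x + u.1 x = f x
  linarith

end Elliptic

/-! ### Ellipticity and the maximum principle -/

section Local

variable {n : ℕ} {G : EuclideanSpace ℝ (Fin n) → Matrix (Fin n) (Fin n) ℝ}
  {f : EuclideanSpace ℝ (Fin n) → ℝ} {z : EuclideanSpace ℝ (Fin n)}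

theorem pd_eq_zero_of_isLocalMax (h : IsLocalMax f z) (k : Fin n) : pd k f z = 0 := by
  simp [pd, h.fderiv_eq_zero]

theorem hasDerivAt_line (hf : DifferentiableAt ℝ f z) {v w : EuclideanSpace ℝ (Fin n)} {s : ℝ}
    (hz : w + s • v = z) :
    HasDerivAt (fun r : ℝ => f (w + r • v)) (∑ i, v i * pd i f z) s := by
  have hd : HasDerivAt (fun r : ℝ => w + r • v) v s := by
    simpa using ((hasDerivAt_id s).smul_const v).const_add w
  rw [← fderiv_eq_sum_pd]
  subst hz
  exact hf.hasFDerivAt.comp_hasDerivAt s hd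

/-- The second derivative test. If the second derivative of `f` along a line were positive, the
point would also be a minimum along this line, and `f` would be constant on it. -/
theorem hess_nonpos_of_isLocalMax (hf : SmoothNear f z) (h : IsLocalMax f z)
    (v : EuclideanSpace ℝ (Fin n)) : ∑ j, v j * ∑ i, v i * pd i (pd j f) z ≤ 0 := by
  by_contra! hpos
  set p : ℝ → ℝ := fun s => f (z + s • v) with hp
  have hcont : Tendsto (fun s : ℝ => z + s • v) (𝓝 0) (𝓝 z) := by
    have : Continuous fun s : ℝ => z + s • v := by fun_prop
    simpa using this.tendsto 0
  have hd1 : deriv p =ᶠ[𝓝 0] fun s => ∑ j, v j * pd j f (z + s • v) := by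
    filter_upwards [hcont.eventually hf] with s hs
    exact (hasDerivAt_line (hs.differentiableAt (by simp)) rfl).deriv
  have hd2 : deriv (deriv p) 0 = ∑ j, v j * ∑ i, v i * pd i (pd j f) z := by
    rw [hd1.deriv_eq]
    refine HasDerivAt.deriv (HasDerivAt.fun_sum fun j _ => HasDerivAt.const_mul _ ?_)
    exact hasDerivAt_line (hf.pd j).differentiableAt (by simp)
  have hd0 : deriv p 0 = 0 := by
    rw [hd1.eq_of_nhds]
    simp [pd_eq_zero_of_isLocalMax h]
  have hmax : IsLocalMax p 0 := by
    have h' : ∀ᶠ y in 𝓝 z, f y ≤ f z := h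
    have := hcont.eventually h'
    filter_upwards [this] with s hs
    simpa [hp] using hs
  have hmin : IsLocalMin p 0 := isLocalMin_of_deriv_deriv_pos (by rw [hd2]; exact hpos) hd0
    (hasDerivAt_line (w := z) (s := 0) (v := v) hf.differentiableAt (by simp)).continuousAt
  have hconst : p =ᶠ[𝓝 0] fun _ => p 0 := by
    filter_upwards [hmax, hmin] with s h1 h2 using le_antisymm h1 h2
  have : deriv (deriv p) 0 = 0 := by
    rw [hconst.deriv.deriv_eq]; simp
  rw [hd2] at this
  exact hpos.ne' this

theorem exists_inv_eq_mul_transpose {P : Matrix (Fin n) (Fin n) ℝ} (h : P.PosDef) :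
    ∃ S : Matrix (Fin n) (Fin n) ℝ, P⁻¹ = S * Sᵀ := by
  obtain ⟨S, hS, hSG⟩ := exists_transpose_mul_mul_eq_one h
  have hSS : S * S⁻¹ = 1 := Matrix.mul_nonsing_inv _ (isUnit_iff_ne_zero.2 hS)
  refine ⟨S, Matrix.inv_eq_left_inv ?_⟩
  calc S * Sᵀ * P = S * (Sᵀ * P * S) * S⁻¹ := by
        simp only [Matrix.mul_assoc, hSS, Matrix.mul_one]
    _ = 1 := by rw [hSG, Matrix.mul_one, hSS]

theorem laplacianCoord_nonneg_of_isLocalMax (hp : (G z).PosDef) (hf : SmoothNear f z)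
    (h : IsLocalMax f z) : 0 ≤ laplacianCoord G f z := by
  obtain ⟨S, hS⟩ := exists_inv_eq_mul_transpose hp
  have : laplacianCoord G f z
      = -∑ a, ∑ j, S j a * ∑ i, S i a * pd i (pd j f) z := by
    simp only [laplacianCoord, pd_eq_zero_of_isLocalMax h, mul_zero, Finset.sum_const_zero,
      sub_zero, hS, Matrix.mul_apply, Matrix.transpose_apply, Finset.sum_mul, Finset.mul_sum]
    congr 1
    rw [Finset.sum_comm]
    conv_rhs => rw [Finset.sum_comm]
    refine Finset.sum_congr rfl fun j _ => ?_
    rw [Finset.sum_comm]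
    exact Finset.sum_congr rfl fun a _ => Finset.sum_congr rfl fun i _ => by ring
  rw [this, neg_nonneg]
  exact Finset.sum_nonpos fun a _ => hess_nonpos_of_isLocalMax hf h (WithLp.toLp 2 fun i => S i a)

/-- The Laplacian of half the square of a function at a zero of this function. -/
theorem laplacianCoord_sq_half (hf : SmoothNear f z) (h0 : f z = 0) :
    laplacianCoord G (fun y => f y ^ 2 / 2) z
      = -∑ i, ∑ j, (G z)⁻¹ i j * (pd i f z * pd j f z) := by
  have h1 : ∀ k, ∀ᶠ y in 𝓝 z, pd k (fun y => f y ^ 2 / 2) y = f y * pd k f y := by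
    intro k
    filter_upwards [hf] with y hy
    have hd := hy.differentiableAt (by simp)
    have e : (fun y => f y ^ 2 / 2) = fun y => (1 / 2) * (f y * f y) := by funext y; ring
    rw [e, pd_const_mul, pd_mul hd hd]; ring
  have h2 : ∀ i j, pd i (pd j (fun y => f y ^ 2 / 2)) z = pd i f z * pd j f z := by
    intro i j
    rw [pd_congr (h1 j), pd_mul hf.differentiableAt (hf.pd j).differentiableAt, h0]; ring
  have h3 : ∀ k, pd k (fun y => f y ^ 2 / 2) z = 0 := fun k => by
    rw [(h1 k).self_of_nhds, h0, zero_mul]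
  simp only [laplacianCoord, h2, h3, mul_zero, Finset.sum_const_zero, sub_zero]

end Local

section Global

variable {n : ℕ} {M : Type*} [TopologicalSpace M] [ChartedSpace (EuclideanSpace ℝ (Fin n)) M]
  [IsManifold (𝓡 n) ∞ M] {x : M} {f u v : M → ℝ}

/-- The Laplacian is `-g^{ij} ∇_i ∇_j`, and hence nonnegative at a maximum. -/
theorem laplacian_nonneg_of_max (g : Metric n M) (hf : f ∈ smoothFunctions n M)
    (h : ∀ y, f y ≤ f x) : 0 ≤ laplacian g f x := by
  have hz := mem_extChartAt_target (I := 𝓡 n) x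
  refine laplacianCoord_nonneg_of_isLocalMax (posDef_metricCoord g hz)
    (smoothNear_comp_chart hf hz) (Eventually.of_forall fun w => ?_)
  simpa using h _

theorem laplacian_sub (g : Metric n M) (hu : u ∈ smoothFunctions n M)
    (hv : v ∈ smoothFunctions n M) (x : M) :
    laplacian g (fun y => u y - v y) x = laplacian g u x - laplacian g v x := by
  have hz := mem_extChartAt_target (I := 𝓡 n) x
  have hu' := smoothNear_comp_chart hu hz
  have hv' := smoothNear_comp_chart hv hz
  set uz := u ∘ (extChartAt (𝓡 n) x).symm
  set vz := v ∘ (extChartAt (𝓡 n) x).symm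
  set z := extChartAt (𝓡 n) x x
  have h1 : ∀ k, ∀ᶠ y in 𝓝 z, pd k (fun w => uz w - vz w) y = pd k uz y - pd k vz y := by
    intro k
    filter_upwards [hu', hv'] with y h1 h2
    exact pd_sub (h1.differentiableAt (by simp)) (h2.differentiableAt (by simp))
  have h2 : ∀ i j, pd i (pd j (fun w => uz w - vz w)) z = pd i (pd j uz) z - pd i (pd j vz) z := by
    intro i j
    rw [pd_congr (h1 j), pd_sub (hu'.pd j).differentiableAt (hv'.pd j).differentiableAt]
  change laplacianCoord (metricCoord g x) (fun w => uz w - vz w) z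
    = laplacianCoord (metricCoord g x) uz z - laplacianCoord (metricCoord g x) vz z
  have h3 : ∀ k, pd k (fun w => uz w - vz w) z = pd k uz z - pd k vz z :=
    fun k => (h1 k).self_of_nhds
  simp only [laplacianCoord, h2, h3, mul_sub, Finset.sum_sub_distrib]
  ring

theorem zero_mem_smoothFunctions : (fun _ => 0 : M → ℝ) ∈ smoothFunctions n M := contMDiff_const

theorem laplacian_zero (g : Metric n M) (x : M) : laplacian g (fun _ => 0) x = 0 := by
  have := laplacian_sub g (zero_mem_smoothFunctions (n := n)) zero_mem_smoothFunctions x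
  simpa using this

theorem laplacian_neg (g : Metric n M) (hu : u ∈ smoothFunctions n M) (x : M) :
    laplacian g (fun y => -u y) x = -laplacian g u x := by
  have := laplacian_sub g (zero_mem_smoothFunctions (n := n)) hu x
  simpa [laplacian_zero] using this

variable [CompactSpace M] [Nonempty M]

/-- The elliptic maximum principle for `L_g`. -/
theorem le_of_conformalOp_le (hn : 1 ≤ n) (g : Metric n M) (hu : u ∈ smoothFunctions n M) {K : ℝ}
    (h : ∀ x, conformalOp g u x ≤ K) (x : M) : u x ≤ K := by
  obtain ⟨x₀, -, hx₀⟩ := isCompact_univ.exists_isMaxOn Set.univ_nonempty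
    (ContMDiff.continuous hu).continuousOn
  have hmax : ∀ y, u y ≤ u x₀ := fun y => hx₀ (Set.mem_univ y)
  have h1 := laplacian_nonneg_of_max g hu hmax
  have h2 := h x₀
  have h3 : (0 : ℝ) ≤ (n : ℝ) - 1 := by
    have : (1 : ℝ) ≤ n := by exact_mod_cast hn
    linarith
  unfold conformalOp at h2
  have := mul_nonneg h3 h1
  exact (hmax x).trans (by linarith)

theorem neg_conformalOp (g : Metric n M) (hu : u ∈ smoothFunctions n M) (x : M) :
    conformalOp g (fun y => -u y) x = -conformalOp g u x := by
  simp only [conformalOp, laplacian_neg g hu]; ring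

theorem neg_mem_smoothFunctions (hu : u ∈ smoothFunctions n M) :
    (fun y => -u y) ∈ smoothFunctions n M := ContMDiff.neg hu

theorem abs_le_of_abs_conformalOp_le (hn : 1 ≤ n) (g : Metric n M) (hu : u ∈ smoothFunctions n M)
    {K : ℝ} (h : ∀ x, |conformalOp g u x| ≤ K) (x : M) : |u x| ≤ K := by
  refine abs_le.2 ⟨?_, le_of_conformalOp_le hn g hu (fun y => (abs_le.1 (h y)).2) x⟩
  have := le_of_conformalOp_le hn g (neg_mem_smoothFunctions hu) (K := K)
    (fun y => by rw [neg_conformalOp g hu]; linarith [(abs_le.1 (h y)).1]) x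
  linarith

theorem conformalOp_injOn (hn : 1 ≤ n) (g : Metric n M) :
    Set.InjOn (conformalOp g) (smoothFunctions n M) := by
  intro u hu v hv huv
  have hw : (fun y => u y - v y) ∈ smoothFunctions n M := ContMDiff.sub hu hv
  have h : ∀ x, |conformalOp g (fun y => u y - v y) x| ≤ 0 := by
    intro x
    have : conformalOp g (fun y => u y - v y) x = conformalOp g u x - conformalOp g v x := by
      simp only [conformalOp, laplacian_sub g hu hv]; ring
    rw [this, huv, sub_self, abs_zero]
  funext x
  have := abs_le_of_abs_conformalOp_le hn g hw h x
  linarith [abs_nonpos_iff.1 this]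

theorem conformalOp_bijOn [T2Space M] (hn : 1 < n) (g : Metric n M) :
    Set.BijOn (conformalOp g) (smoothFunctions n M) (smoothFunctions n M) :=
  ⟨fun _ hu => conformalOp_mem g hu, conformalOp_injOn hn.le g, fun _ hf =>
    exists_conformalOp_eq hn g hf⟩

theorem conformalOpInv_mem [T2Space M] (hn : 1 < n) (g : Metric n M)
    (hf : f ∈ smoothFunctions n M) : conformalOpInv g f ∈ smoothFunctions n M :=
  Function.invFunOn_mem (exists_conformalOp_eq hn g hf)

theorem conformalOp_conformalOpInv [T2Space M] (hn : 1 < n) (g : Metric n M)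
    (hf : f ∈ smoothFunctions n M) : conformalOp g (conformalOpInv g f) = f :=
  Function.invFunOn_eq (exists_conformalOp_eq hn g hf)

/-- The principal symbol of `L_g` at a covector `p` is `-(n - 1) |p|²`. -/
theorem conformalOp_isElliptic (hn : 1 < n) (g : Metric n M) :
    IsEllipticOrderTwo n (conformalOp g) := by
  intro x ψ hψ hdψ
  have hz := mem_extChartAt_target (I := 𝓡 n) x
  set z := extChartAt (𝓡 n) x x with hzdef
  have hxz : (extChartAt (𝓡 n) x).symm z = x := extChartAt_to_inv x
  have hf : SmoothNear (fun w => (ψ ∘ (extChartAt (𝓡 n) x).symm) w - ψ x) z :=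
    (smoothNear_comp_chart hψ hz).sub (smoothNear_const _)
  have h0 : (fun w => (ψ ∘ (extChartAt (𝓡 n) x).symm) w - ψ x) z = 0 := by
    change ψ ((extChartAt (𝓡 n) x).symm z) - ψ x = 0
    rw [hxz, sub_self]
  have hlap := laplacianCoord_sq_half (G := metricCoord g x) hf h0
  set p : Fin n → ℝ := fun i => pd i (fun w => (ψ ∘ (extChartAt (𝓡 n) x).symm) w - ψ x) z with hpdef
  have hp : p ≠ 0 := by
    intro hp
    apply hdψ
    have hd := (hψ x).mdifferentiableAt (by simp)
    rw [hd.mfderiv]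
    have : fderiv ℝ (fun w => (ψ ∘ (extChartAt (𝓡 n) x).symm) w - ψ x) z = 0 := by
      ext1 v
      rw [fderiv_eq_sum_pd]
      refine Finset.sum_eq_zero fun i _ => ?_
      change v i * p i = 0
      rw [hp, Pi.zero_apply, mul_zero]
    rw [fderiv_sub_const] at this
    rw [(𝓡 n).range_eq_univ, fderivWithin_univ]
    exact this
  have hpos := (posDef_metricCoord g hz).inv.dotProduct_mulVec_pos hp
  have hsum : star p ⬝ᵥ ((metricCoord g x z)⁻¹ *ᵥ p)
      = ∑ i, ∑ j, (metricCoord g x z)⁻¹ i j * (p i * p j) := by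
    simp only [dotProduct, Matrix.mulVec, star_trivial, Finset.mul_sum]
    exact Finset.sum_congr rfl fun i _ => Finset.sum_congr rfl fun j _ => by ring
  rw [hsum] at hpos
  have hn' : (0 : ℝ) < (n : ℝ) - 1 := by
    have : (1 : ℝ) < n := by exact_mod_cast hn
    linarith
  have e : conformalOp g (fun y => (ψ y - ψ x) ^ 2 / 2) x
      = ((n : ℝ) - 1) * -∑ i, ∑ j, (metricCoord g x z)⁻¹ i j * (p i * p j) := by
    rw [← hlap]
    simp [conformalOp, laplacian, Function.comp_def, hzdef]
  rw [e]
  exact mul_ne_zero hn'.ne' (neg_ne_zero.2 hpos.ne')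

end Global

/-! ### The parabolic maximum principle -/

section Parabolic

variable {M : Type*} [TopologicalSpace M] [CompactSpace M] [Nonempty M]

/-- If `u ≤ 0` initially and `∂u/∂t ≤ C u` at every positive spatial maximum, then `u ≤ 0`. At a
positive maximum of `exp (-(C + 1) t) u` over space and time the time derivative is negative,
which excludes such a maximum. -/
theorem nonpos_of_deriv_le_at_max {u : ℝ → M → ℝ} {τ C : ℝ}
    (hcont : ContinuousOn (fun q : ℝ × M => u q.1 q.2) (Set.Icc 0 τ ×ˢ Set.univ))
    (h0 : ∀ x, u 0 x ≤ 0)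
    (hder : ∀ t ∈ Set.Ioc 0 τ, ∀ x, (∀ y, u t y ≤ u t x) → 0 < u t x →
      ∃ d, HasDerivAt (fun s => u s x) d t ∧ d ≤ C * u t x) :
    ∀ t ∈ Set.Icc 0 τ, ∀ x, u t x ≤ 0 := by
  intro t₁ ht₁ x₁
  by_contra! hpos
  set v : ℝ × M → ℝ := fun q => Real.exp (-(C + 1) * q.1) * u q.1 q.2 with hv
  have hvc : ContinuousOn v (Set.Icc 0 τ ×ˢ Set.univ) :=
    (Continuous.continuousOn (by fun_prop)).mul hcont
  obtain ⟨⟨t, x⟩, hmem, hmax⟩ := (isCompact_Icc.prod isCompact_univ).exists_isMaxOn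
    ⟨(t₁, x₁), ht₁, Set.mem_univ _⟩ hvc
  have ht : t ∈ Set.Icc 0 τ := hmem.1
  have hvpos : 0 < v (t, x) := lt_of_lt_of_le (mul_pos (Real.exp_pos _) hpos)
    (hmax (Set.mk_mem_prod ht₁ (Set.mem_univ x₁)))
  have hupos : 0 < u t x := pos_of_mul_pos_right hvpos (Real.exp_pos _).le
  have ht0 : 0 < t := by
    rcases ht.1.eq_or_lt with h | h
    · rw [← h] at hupos; exact absurd hupos (not_lt.2 (h0 x))
    · exact h
  have hsp : ∀ y, u t y ≤ u t x := fun y =>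
    le_of_mul_le_mul_left (hmax (Set.mk_mem_prod ht (Set.mem_univ y))) (Real.exp_pos _)
  obtain ⟨d, hd, hdC⟩ := hder t ⟨ht0, ht.2⟩ x hsp hupos
  have hdv : HasDerivAt (fun s => v (s, x))
      (Real.exp (-(C + 1) * t) * (-(C + 1)) * u t x + Real.exp (-(C + 1) * t) * d) t := by
    have he : HasDerivAt (fun s => Real.exp (-(C + 1) * s))
        (Real.exp (-(C + 1) * t) * (-(C + 1))) t := by
      simpa using ((hasDerivAt_id t).const_mul (-(C + 1))).exp
    exact he.mul hd
  have hneg : Real.exp (-(C + 1) * t) * (-(C + 1)) * u t x + Real.exp (-(C + 1) * t) * d < 0 := by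
    have : Real.exp (-(C + 1) * t) * (-(C + 1)) * u t x + Real.exp (-(C + 1) * t) * d
      = Real.exp (-(C + 1) * t) * (d - C * u t x - u t x) := by ring
    rw [this]
    exact mul_neg_of_pos_of_neg (Real.exp_pos _) (by linarith)
  -- since the derivative is negative, `v` is larger at slightly earlier times
  have hlt : ∀ᶠ s in 𝓝[<] t, v (t, x) < v (s, x) := by
    have hslope := (hasDerivWithinAt_iff_tendsto_slope' (s := Set.Iio t) (by simp)).1
      hdv.hasDerivWithinAt
    filter_upwards [hslope.eventually (gt_mem_nhds hneg), self_mem_nhdsWithin] with s hs hst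
    rw [slope_def_field] at hs
    have hst' : s - t < 0 := sub_neg.2 hst
    have := (div_neg_iff.1 hs).resolve_right fun h => absurd h.2 (not_lt.2 hst'.le)
    linarith [this.1]
  have hge : ∀ᶠ s in 𝓝[<] t, 0 < s :=
    mem_nhdsWithin_of_mem_nhds (lt_mem_nhds ht0)
  obtain ⟨s, h1, h2, h3⟩ := (hlt.and (hge.and self_mem_nhdsWithin)).exists
  exact absurd (hmax (Set.mk_mem_prod (⟨h2.le, h3.le.trans ht.2⟩ : s ∈ Set.Icc 0 τ)
    (Set.mem_univ x))) (not_le.2 h1)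

end Parabolic

/-! ### Smoothness in time and space up to the initial time -/

section Slab

variable {n : ℕ} {I : Set ℝ} {O : Set (EuclideanSpace ℝ (Fin n))}
  {F F' : ℝ → EuclideanSpace ℝ (Fin n) → ℝ}

/-- Smoothness in `(t, z)` on `I × O`, one-sidedly at the end points of `I`. -/
def SlabSmooth (I : Set ℝ) (O : Set (EuclideanSpace ℝ (Fin n)))
    (F : ℝ → EuclideanSpace ℝ (Fin n) → ℝ) : Prop :=
  ContDiffOn ℝ ∞ (fun q : ℝ × EuclideanSpace ℝ (Fin n) => F q.1 q.2) (I ×ˢ O)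

namespace SlabSmooth

theorem const (a : ℝ) : SlabSmooth I O fun _ _ => a := contDiffOn_const

theorem add (h : SlabSmooth I O F) (h' : SlabSmooth I O F') :
    SlabSmooth I O fun t z => F t z + F' t z := ContDiffOn.add h h'

theorem sub (h : SlabSmooth I O F) (h' : SlabSmooth I O F') :
    SlabSmooth I O fun t z => F t z - F' t z := ContDiffOn.sub h h'

theorem mul (h : SlabSmooth I O F) (h' : SlabSmooth I O F') :
    SlabSmooth I O fun t z => F t z * F' t z := ContDiffOn.mul h h'

theorem sum {α : Type*} {s : Finset α} {F : α → ℝ → EuclideanSpace ℝ (Fin n) → ℝ}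
    (h : ∀ i ∈ s, SlabSmooth I O (F i)) : SlabSmooth I O fun t z => ∑ i ∈ s, F i t z :=
  ContDiffOn.sum h

theorem prod {α : Type*} {s : Finset α} {F : α → ℝ → EuclideanSpace ℝ (Fin n) → ℝ}
    (h : ∀ i ∈ s, SlabSmooth I O (F i)) : SlabSmooth I O fun t z => ∏ i ∈ s, F i t z :=
  contDiffOn_prod h

theorem inv (h : SlabSmooth I O F) (h0 : ∀ t ∈ I, ∀ z ∈ O, F t z ≠ 0) :
    SlabSmooth I O fun t z => (F t z)⁻¹ := ContDiffOn.inv h fun q hq => h0 q.1 hq.1 q.2 hq.2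

theorem congr (h : SlabSmooth I O F) (h' : ∀ t ∈ I, ∀ z ∈ O, F' t z = F t z) :
    SlabSmooth I O F' := ContDiffOn.congr h fun q hq => h' q.1 hq.1 q.2 hq.2

theorem pd (hI : UniqueDiffOn ℝ I) (hO : IsOpen O) (h : SlabSmooth I O F) (k : Fin n) :
    SlabSmooth I O fun t z => pd k (F t) z := by
  have h1 := (ContDiffOn.fderivWithin h (hI.prod hO.uniqueDiffOn) (m := ∞) (by simp)).clm_apply
    (contDiffOn_const (c := ((0 : ℝ), EuclideanSpace.single k (1 : ℝ))))
  refine ContDiffOn.congr h1 fun q hq => ?_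
  have hd := (ContDiffOn.differentiableOn h (by simp) q hq).hasFDerivWithinAt
  have hm : HasFDerivAt (fun z => ((q.1, z) : ℝ × EuclideanSpace ℝ (Fin n)))
      (ContinuousLinearMap.inr ℝ ℝ (EuclideanSpace ℝ (Fin n))) q.2 := hasFDerivAt_prodMk_right _ _
  have h2 := (HasFDerivWithinAt.comp q.2 (f := fun z => (q.1, z)) hd
    (hm.hasFDerivWithinAt (s := O)) fun z hz => ⟨hq.1, hz⟩).hasFDerivAt (hO.mem_nhds hq.2)
  have h3 : fderiv ℝ (F q.1) q.2 = _ := h2.fderiv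
  simp only [ConformalRicci.pd, h3]
  rfl

theorem derivWithin (hI : UniqueDiffOn ℝ I) (hO : IsOpen O) (h : SlabSmooth I O F) :
    SlabSmooth I O fun t z => derivWithin (fun s => F s z) I t := by
  have h1 := (ContDiffOn.fderivWithin h (hI.prod hO.uniqueDiffOn) (m := ∞) (by simp)).clm_apply
    (contDiffOn_const (c := ((1 : ℝ), (0 : EuclideanSpace ℝ (Fin n)))))
  refine ContDiffOn.congr h1 fun q hq => ?_
  have hd := (ContDiffOn.differentiableOn h (by simp) q hq).hasFDerivWithinAt
  have hm : HasFDerivAt (fun t => ((t, q.2) : ℝ × EuclideanSpace ℝ (Fin n)))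
      (ContinuousLinearMap.inl ℝ ℝ (EuclideanSpace ℝ (Fin n))) q.1 := hasFDerivAt_prodMk_left _ _
  have h2 := (HasFDerivWithinAt.comp q.1 (f := fun t => (t, q.2)) hd
    (hm.hasFDerivWithinAt (s := I)) fun t ht => ⟨ht, hq.2⟩).hasDerivWithinAt
  exact h2.derivWithin (hI _ hq.1)

theorem det {A : ℝ → EuclideanSpace ℝ (Fin n) → Matrix (Fin n) (Fin n) ℝ}
    (h : ∀ i j, SlabSmooth I O fun t z => A t z i j) : SlabSmooth I O fun t z => (A t z).det := by
  simp only [Matrix.det_apply']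
  exact sum fun σ _ => (const _).mul (prod fun i _ => h _ _)

theorem matrix_inv {A : ℝ → EuclideanSpace ℝ (Fin n) → Matrix (Fin n) (Fin n) ℝ}
    (h : ∀ i j, SlabSmooth I O fun t z => A t z i j) (h0 : ∀ t ∈ I, ∀ z ∈ O, (A t z).det ≠ 0)
    (i j : Fin n) : SlabSmooth I O fun t z => (A t z)⁻¹ i j := by
  simp only [Matrix.inv_def, Matrix.smul_apply, smul_eq_mul, Ring.inverse_eq_inv]
  refine ((det h).inv h0).mul ?_
  simp only [Matrix.adjugate_apply]
  refine det fun a b => ?_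
  by_cases hab : a = j
  · subst hab; simp only [Matrix.updateRow_self]; exact const _
  · simp only [Matrix.updateRow_ne hab]; exact h a b

end SlabSmooth

variable {G : ℝ → EuclideanSpace ℝ (Fin n) → Matrix (Fin n) (Fin n) ℝ}

theorem slabSmooth_ricciCoord (hI : UniqueDiffOn ℝ I) (hO : IsOpen O)
    (h : ∀ i j, SlabSmooth I O fun t z => G t z i j) (h0 : ∀ t ∈ I, ∀ z ∈ O, (G t z).det ≠ 0)
    (i j : Fin n) : SlabSmooth I O fun t z => ricciCoord (G t) i j z := by
  have hΓ : ∀ k i j, SlabSmooth I O fun t z => christoffel (G t) k i j z := fun k i j =>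
    (SlabSmooth.const _).mul (SlabSmooth.sum fun l _ => (SlabSmooth.matrix_inv h h0 k l).mul
      ((((h j l).pd hI hO i).add ((h i l).pd hI hO j)).sub ((h i j).pd hI hO l)))
  exact SlabSmooth.sum fun a _ => (((hΓ a j i).pd hI hO a).sub ((hΓ a a i).pd hI hO j)).add
    (SlabSmooth.sum fun e _ => ((hΓ a a e).mul (hΓ e j i)).sub ((hΓ a j e).mul (hΓ e a i)))

theorem slabSmooth_scalarCoord (hI : UniqueDiffOn ℝ I) (hO : IsOpen O)
    (h : ∀ i j, SlabSmooth I O fun t z => G t z i j) (h0 : ∀ t ∈ I, ∀ z ∈ O, (G t z).det ≠ 0) :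
    SlabSmooth I O fun t z => scalarCoord (G t) z :=
  SlabSmooth.sum fun i _ => SlabSmooth.sum fun j _ => (SlabSmooth.matrix_inv h h0 i j).mul
    (slabSmooth_ricciCoord hI hO h h0 i j)

theorem slabSmooth_ricciNormSqCoord (hI : UniqueDiffOn ℝ I) (hO : IsOpen O)
    (h : ∀ i j, SlabSmooth I O fun t z => G t z i j) (h0 : ∀ t ∈ I, ∀ z ∈ O, (G t z).det ≠ 0) :
    SlabSmooth I O fun t z => ricciNormSqCoord (G t) z :=
  SlabSmooth.sum fun i _ => SlabSmooth.sum fun j _ => SlabSmooth.sum fun k _ =>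
    SlabSmooth.sum fun l _ => (((SlabSmooth.matrix_inv h h0 i k).mul
      (SlabSmooth.matrix_inv h h0 j l)).mul (slabSmooth_ricciCoord hI hO h h0 i j)).mul
      (slabSmooth_ricciCoord hI hO h h0 k l)

end Slab

section Curves

variable {n : ℕ} {M : Type*} [TopologicalSpace M] [ChartedSpace (EuclideanSpace ℝ (Fin n)) M]
  [IsManifold (𝓡 n) ∞ M] {T : EReal} {g : ℝ → Metric n M}

theorem timeInterval_mem_nhds {t : ℝ} (h0 : 0 < t) (ht : (t : EReal) < T) :
    timeInterval T ∈ 𝓝 t := by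
  obtain ⟨r, h1, h2⟩ := EReal.lt_iff_exists_real_btwn.1 ht
  filter_upwards [Ioo_mem_nhds h0 (EReal.coe_lt_coe_iff.1 h1)] with s hs
  exact ⟨hs.1.le, (EReal.coe_lt_coe_iff.2 hs.2).trans h2⟩

theorem uniqueDiffOn_timeInterval (hT : 0 < T) : UniqueDiffOn ℝ (timeInterval T) := by
  have hord : (timeInterval T).OrdConnected := ⟨fun a ha b hb s hs =>
    ⟨ha.1.trans hs.1, (EReal.coe_le_coe_iff.2 hs.2).trans_lt hb.2⟩⟩
  refine uniqueDiffOn_convex hord.convex ?_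
  obtain ⟨r, h1, h2⟩ := EReal.lt_iff_exists_real_btwn.1 hT
  have h1' : 0 < r := by exact_mod_cast h1
  exact ⟨r, mem_interior_iff_mem_nhds.2 (timeInterval_mem_nhds h1' h2)⟩

theorem slabSmooth_metricCoord (hg : IsSmoothMetricCurve T g) (c : M) (i j : Fin n) :
    SlabSmooth (timeInterval T) (extChartAt (𝓡 n) c).target
      fun t z => metricCoord (g t) c z i j := contDiffOn_metricCoord hg c i j

theorem det_metricCoord_ne_zero {c : M} (t : ℝ) (z : EuclideanSpace ℝ (Fin n))
    (hz : z ∈ (extChartAt (𝓡 n) c).target) : (metricCoord (g t) c z).det ≠ 0 :=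
  (posDef_metricCoord (g t) hz).det_pos.ne'

theorem metricCurveNear_metricCoord (hg : IsSmoothMetricCurve T g) {t : ℝ} (h0 : 0 < t)
    (ht : (t : EReal) < T) {c : M} {z : EuclideanSpace ℝ (Fin n)}
    (hz : z ∈ (extChartAt (𝓡 n) c).target) :
    MetricCurveNear (fun s => metricCoord (g s) c) t z := by
  have hmem : timeInterval T ×ˢ (extChartAt (𝓡 n) c).target ∈ 𝓝 (t, z) :=
    prod_mem_nhds (timeInterval_mem_nhds h0 ht) (target_mem_nhds hz)
  refine ⟨fun i j => ?_, ?_⟩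
  · filter_upwards [eventually_mem_nhds_iff.2 hmem] with q hq
    exact (contDiffOn_metricCoord hg c i j).contDiffAt hq
  · filter_upwards [hmem] with q hq using posDef_metricCoord (g q.1) hq.2

/-- Smoothness of a curve of functions can be checked in the charts of the manifold. -/
theorem isSmoothFunctionCurve_of_charts {p : ℝ → M → ℝ}
    (h : ∀ c : M, SlabSmooth (timeInterval T) (extChartAt (𝓡 n) c).target
      fun t z => p t ((extChartAt (𝓡 n) c).symm z)) : IsSmoothFunctionCurve n T p := by
  rintro ⟨t, x⟩ ⟨ht, -⟩
  have hx := mem_extChartAt_source (I := 𝓡 n) x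
  have h1 : ContMDiffWithinAt 𝓘(ℝ, ℝ × EuclideanSpace ℝ (Fin n)) 𝓘(ℝ, ℝ) ∞
      (fun q : ℝ × EuclideanSpace ℝ (Fin n) => p q.1 ((extChartAt (𝓡 n) x).symm q.2))
      (timeInterval T ×ˢ (extChartAt (𝓡 n) x).target) (t, extChartAt (𝓡 n) x x) :=
    contMDiffWithinAt_iff_contDiffWithinAt.2
      (h x (t, extChartAt (𝓡 n) x x) (Set.mk_mem_prod ht (mem_extChartAt_target x)))
  have h2 : ContMDiffWithinAt (𝓘(ℝ, ℝ).prod (𝓡 n)) 𝓘(ℝ, ℝ × EuclideanSpace ℝ (Fin n)) ∞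
      (fun q : ℝ × M => (q.1, extChartAt (𝓡 n) x q.2))
      (timeInterval T ×ˢ (extChartAt (𝓡 n) x).source) (t, x) := by
    have h3 : ContMDiffAt (𝓘(ℝ, ℝ).prod (𝓡 n)) (𝓡 n) ∞
        (fun q : ℝ × M => extChartAt (𝓡 n) x q.2) (t, x) :=
      ContMDiffAt.comp (t, x) (contMDiffAt_chart hx) contMDiffAt_snd
    exact (contMDiffAt_fst.prodMk_space h3).contMDiffWithinAt
  have hmaps : Set.MapsTo (fun q : ℝ × M => (q.1, extChartAt (𝓡 n) x q.2))
      (timeInterval T ×ˢ (extChartAt (𝓡 n) x).source)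
      (timeInterval T ×ˢ (extChartAt (𝓡 n) x).target) :=
    fun q hq => ⟨hq.1, (extChartAt (𝓡 n) x).map_source hq.2⟩
  have h4 := ContMDiffWithinAt.comp (t, x) h1 h2 hmaps
  have hmem : Set.univ ×ˢ (extChartAt (𝓡 n) x).source ∈ 𝓝 (t, x) :=
    prod_mem_nhds univ_mem (extChartAt_source_mem_nhds x)
  have h5 : ContMDiffWithinAt (𝓘(ℝ, ℝ).prod (𝓡 n)) 𝓘(ℝ, ℝ) ∞ (fun q : ℝ × M => p q.1 q.2)
      (timeInterval T ×ˢ (extChartAt (𝓡 n) x).source) (t, x) := by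
    refine h4.congr (fun q hq => ?_) ?_
    · simp only [Function.comp_apply, (extChartAt (𝓡 n) x).left_inv hq.2]
    · simp only [Function.comp_apply, (extChartAt (𝓡 n) x).left_inv hx]
  refine h5.mono_of_mem_nhdsWithin ?_
  filter_upwards [mem_nhdsWithin_of_mem_nhds hmem, self_mem_nhdsWithin] with q h6 h7
  exact ⟨h7.1, h6.2⟩

theorem isSmoothFunctionCurve_scalarCurvature (hT : 0 < T) (hg : IsSmoothMetricCurve T g) :
    IsSmoothFunctionCurve n T fun t => scalarCurvature (g t) :=
  isSmoothFunctionCurve_of_charts fun c => (slabSmooth_scalarCoord (uniqueDiffOn_timeInterval hT)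
    (isOpen_extChartAt_target c) (slabSmooth_metricCoord hg c) fun t _ z hz =>
      det_metricCoord_ne_zero t z hz).congr fun t _ _ hz => scalarCurvature_chart (g t) hz

theorem isSmoothFunctionCurve_ricciNormSq (hT : 0 < T) (hg : IsSmoothMetricCurve T g) :
    IsSmoothFunctionCurve n T fun t => ricciNormSq (g t) :=
  isSmoothFunctionCurve_of_charts fun c =>
    (slabSmooth_ricciNormSqCoord (uniqueDiffOn_timeInterval hT)
      (isOpen_extChartAt_target c) (slabSmooth_metricCoord hg c) fun t _ z hz =>
        det_metricCoord_ne_zero t z hz).congr fun t _ _ hz => ricciNormSq_chart (g t) hz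

end Curves

/-! ### The reduced flow -/

section Flow

variable {n : ℕ} {M : Type*} [TopologicalSpace M] [ChartedSpace (EuclideanSpace ℝ (Fin n)) M]
  [IsManifold (𝓡 n) ∞ M] [T2Space M] [CompactSpace M] [Nonempty M] {T : EReal}
  {g : ℝ → Metric n M}

/-- The metric coefficients in a chart along a solution of the reduced flow. -/
theorem SolvesReducedFlow.hasDerivWithinAt_metricCoord (h : SolvesReducedFlow T g) {t : ℝ}
    (ht : t ∈ timeInterval T) {c : M} {z : EuclideanSpace ℝ (Fin n)}
    (hz : z ∈ (extChartAt (𝓡 n) c).target) (i j : Fin n) :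
    HasDerivWithinAt (fun s => metricCoord (g s) c z i j)
      (-2 * ricciCoord (metricCoord (g t) c) i j z
        - 2 * conformalOpInv (g t) (ricciNormSq (g t)) ((extChartAt (𝓡 n) c).symm z)
          * metricCoord (g t) c z i j) (timeInterval T) t := by
  have := h t ht ((extChartAt (𝓡 n) c).symm z) (chartVector c z (EuclideanSpace.single i 1))
    (chartVector c z (EuclideanSpace.single j 1))
  beta_reduce at this
  rw [ricci_chartVector (g t) hz] at this
  exact this

/-- Along the reduced flow `R + 1` satisfies a linear heat equation. With `φ = L_g⁻¹ |Ric|²` the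
terms `-2 (n - 1) Δ φ + 2 |Ric|²` in the evolution of the scalar curvature are `2 φ`, which turns `2
φ R` into `2 φ (R + 1)`. -/
theorem SolvesReducedFlow.hasDerivAt_scalarCurvature (hn : 1 < n) (hg : IsSmoothMetricCurve T g)
    (h : SolvesReducedFlow T g) {t : ℝ} (h0 : 0 < t) (ht : (t : EReal) < T) (x : M) :
    HasDerivAt (fun s => scalarCurvature (g s) x)
      (-laplacian (g t) (scalarCurvature (g t)) x
        + 2 * conformalOpInv (g t) (ricciNormSq (g t)) x * (scalarCurvature (g t) x + 1)) t := by
  set φ := conformalOpInv (g t) (ricciNormSq (g t)) with hφ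
  have hφm : φ ∈ smoothFunctions n M := conformalOpInv_mem hn (g t) (ricciNormSq_mem (g t))
  have hz := mem_extChartAt_target (I := 𝓡 n) x
  set z := extChartAt (𝓡 n) x x with hzdef
  have hxz : (extChartAt (𝓡 n) x).symm z = x := extChartAt_to_inv x
  have hG := metricCurveNear_metricCoord hg h0 ht hz
  have hev : ∀ᶠ y in 𝓝 z, dtM (fun s => metricCoord (g s) x) t y
      = (-2 : ℝ) • ricM (metricCoord (g t) x) y
        + (-2 * (φ ∘ (extChartAt (𝓡 n) x).symm) y) • metricCoord (g t) x y := by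
    filter_upwards [target_mem_nhds hz] with y hy
    ext i j
    have := ((h.hasDerivWithinAt_metricCoord ⟨h0.le, ht⟩ hy i j).hasDerivAt
      (timeInterval_mem_nhds h0 ht)).deriv
    change deriv (fun s => metricCoord (g s) x y i j) t = _
    rw [this]
    simp only [ricM, Matrix.add_apply, Matrix.smul_apply, Matrix.of_apply, smul_eq_mul,
      Function.comp_apply, ← hφ]
    ring
  have hevol := hG.evolution (smoothNear_comp_chart hφm hz) hev
  have hd : DifferentiableAt ℝ (fun s => scalarCurvature (g s) x) t := by
    have h1 : DifferentiableAt ℝ (fun q : ℝ × EuclideanSpace ℝ (Fin n) =>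
        scalarCoord (metricCoord (g q.1) x) q.2) (t, z) := hG.smooth_scalarCoord.differentiableAt
    exact h1.comp (f := fun s : ℝ => (s, z)) t
      (differentiableAt_id.prodMk (differentiableAt_const z))
  have hL := congrFun (conformalOp_conformalOpInv hn (g t) (ricciNormSq_mem (g t))) x
  have hR : laplacianCoord (metricCoord (g t) x) (scalarCoord (metricCoord (g t) x)) z
      = laplacian (g t) (scalarCurvature (g t)) x := by
    refine laplacianCoord_congr ?_
    filter_upwards [target_mem_nhds hz] with y hy using (scalarCurvature_chart (g t) hy).symm
  have hlapφ : laplacianCoord (metricCoord (g t) x) (φ ∘ (extChartAt (𝓡 n) x).symm) z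
      = laplacian (g t) φ x := rfl
  have hRx : scalarCoord (metricCoord (g t) x) z = scalarCurvature (g t) x := rfl
  have hNx : ricciNormSqCoord (metricCoord (g t) x) z = ricciNormSq (g t) x := rfl
  rw [hR, hlapφ, hRx, hNx, Function.comp_apply, hxz] at hevol
  refine hd.hasDerivAt.congr_deriv (hevol.trans ?_)
  rw [← hφ] at hL
  unfold conformalOp at hL
  rw [← hL]
  ring

/-- The reduced flow preserves the constraint: by the maximum principle for the linear heat equation
both `R + 1` and `-(R + 1)` are nonpositive. The coefficient of this equation is bounded on compact
time intervals, as `|φ|` is at most the maximum of `|Ric|²` by the elliptic maximum principle. -/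
theorem SolvesReducedFlow.scalarCurvature_eq (hn : 1 < n) (hT : 0 < T)
    (hg : IsSmoothMetricCurve T g) (h : SolvesReducedFlow T g) (h0 : g 0 ∈ metricsNegOne n M)
    {t : ℝ} (ht : t ∈ timeInterval T) (x : M) : scalarCurvature (g t) x = -1 := by
  have hsub : Set.Icc 0 t ×ˢ (Set.univ : Set M) ⊆ timeInterval T ×ˢ Set.univ :=
    Set.prod_mono_left fun s hs => ⟨hs.1, (EReal.coe_le_coe_iff.2 hs.2).trans_lt ht.2⟩
  have hRc : ContinuousOn (fun q : ℝ × M => scalarCurvature (g q.1) q.2)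
      (Set.Icc 0 t ×ˢ Set.univ) :=
    (ContMDiffOn.continuousOn (isSmoothFunctionCurve_scalarCurvature hT hg)).mono hsub
  have hNc : ContinuousOn (fun q : ℝ × M => ricciNormSq (g q.1) q.2)
      (Set.Icc 0 t ×ˢ Set.univ) :=
    (ContMDiffOn.continuousOn (isSmoothFunctionCurve_ricciNormSq hT hg)).mono hsub
  obtain ⟨K, hK⟩ := (isCompact_Icc.prod isCompact_univ).exists_bound_of_continuousOn hNc
  have hφ : ∀ s ∈ Set.Icc 0 t, ∀ y, |conformalOpInv (g s) (ricciNormSq (g s)) y| ≤ K :=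
    fun s hs => abs_le_of_abs_conformalOp_le hn.le (g s)
      (conformalOpInv_mem hn (g s) (ricciNormSq_mem (g s))) fun y => by
        rw [conformalOp_conformalOpInv hn (g s) (ricciNormSq_mem (g s))]
        exact hK (s, y) ⟨hs, Set.mem_univ _⟩
  have hdR : ∀ s ∈ Set.Ioc 0 t, ∀ y, HasDerivAt (fun r => scalarCurvature (g r) y)
      (-laplacian (g s) (scalarCurvature (g s)) y
        + 2 * conformalOpInv (g s) (ricciNormSq (g s)) y * (scalarCurvature (g s) y + 1)) s :=
    fun s hs y => h.hasDerivAt_scalarCurvature hn hg hs.1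
      ((EReal.coe_le_coe_iff.2 hs.2).trans_lt ht.2) y
  have hle : scalarCurvature (g t) x + 1 ≤ 0 := by
    refine nonpos_of_deriv_le_at_max (u := fun s y => scalarCurvature (g s) y + 1) (C := 2 * K)
      (hRc.add continuousOn_const) (fun y => by rw [h0 y]; norm_num) (fun s hs y hmax hpos =>
        ⟨_, (hdR s hs y).add_const 1, ?_⟩) t ⟨ht.1, le_rfl⟩ x
    have h1 := laplacian_nonneg_of_max (g s) (scalarCurvature_mem (g s)) (x := y)
      fun w => by linarith [hmax w]
    have h2 := mul_le_mul_of_nonneg_right (abs_le.1 (hφ s ⟨hs.1.le, hs.2⟩ y)).2 hpos.le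
    linarith
  have hge : -(scalarCurvature (g t) x + 1) ≤ 0 := by
    refine nonpos_of_deriv_le_at_max (u := fun s y => -(scalarCurvature (g s) y + 1)) (C := 2 * K)
      (hRc.add continuousOn_const).neg (fun y => by rw [h0 y]; norm_num) (fun s hs y hmax hpos =>
        ⟨_, ((hdR s hs y).add_const 1).neg, ?_⟩) t ⟨ht.1, le_rfl⟩ x
    have h1 := laplacian_nonneg_of_max (g s)
      (neg_mem_smoothFunctions (scalarCurvature_mem (g s))) (x := y)
      fun w => by linarith [hmax w]
    rw [laplacian_neg (g s) (scalarCurvature_mem (g s))] at h1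
    have h2 := mul_le_mul_of_nonneg_right (abs_le.1 (hφ s ⟨hs.1.le, hs.2⟩ y)).2 hpos.le
    linarith
  linarith

/-- The pressure is smooth since it can be read off from a diagonal component of the evolution
equation. -/
theorem SolvesReducedFlow.isSmoothFunctionCurve_conformalPressure (hn : 0 < n) (hT : 0 < T)
    (hg : IsSmoothMetricCurve T g) (h : SolvesReducedFlow T g) :
    IsSmoothFunctionCurve n T fun t => conformalPressure (g t) := by
  refine isSmoothFunctionCurve_of_charts fun c => ?_
  let i : Fin n := ⟨0, hn⟩
  have hI := uniqueDiffOn_timeInterval hT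
  have hO := isOpen_extChartAt_target (I := 𝓡 n) c
  have hG := slabSmooth_metricCoord hg c
  have hpos : ∀ t ∈ timeInterval T, ∀ z ∈ (extChartAt (𝓡 n) c).target,
      metricCoord (g t) c z i i ≠ 0 := fun t _ z hz => (posDef_metricCoord (g t) hz).diag_pos.ne'
  refine ((((SlabSmooth.const (-1)).mul (((hG i i).derivWithin hI hO).add
    ((SlabSmooth.const 2).mul (slabSmooth_ricciCoord hI hO hG
      (fun t _ z hz => det_metricCoord_ne_zero t z hz) i i)))).mul ((hG i i).inv hpos)).sub
    (SlabSmooth.const (2 / (n : ℝ)))).congr fun t ht z hz => ?_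
  rw [(h.hasDerivWithinAt_metricCoord ht hz i i).derivWithin (hI t ht)]
  have := hpos t ht z hz
  unfold conformalPressure
  field_simp
  ring

/-- For `p = conformalPressure g` the evolution equations agree pointwise, and a solution of the
reduced equation satisfies the constraint and has a smooth pressure. -/
theorem solvesReducedFlow_iff (hn : 1 < n) (hT : 0 < T) (hg : IsSmoothMetricCurve T g)
    (h0 : g 0 ∈ metricsNegOne n M) : SolvesReducedFlow T g ↔
      SolvesConformalRicciFlow T g (fun t => conformalPressure (g t)) := by
  have e : ∀ (t : ℝ) (x : M) (v w : TangentSpace (𝓡 n) x),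
      -2 * (ricci (g t) x v w + 1 / (n : ℝ) * (g t).inner x v w)
        - conformalPressure (g t) x * (g t).inner x v w
      = -2 * ricci (g t) x v w
        - 2 * conformalOpInv (g t) (ricciNormSq (g t)) x * (g t).inner x v w := by
    intro t x v w
    unfold conformalPressure
    ring
  refine ⟨fun h => ⟨h.isSmoothFunctionCurve_conformalPressure (by omega) hT hg,
    fun t ht x v w => ?_, fun t ht x => h.scalarCurvature_eq hn hT hg h0 ht x⟩,
    fun h t ht x v w => ?_⟩
  · exact (h t ht x v w).congr_deriv (e t x v w).symm
  · exact (h.evolution t ht x v w).congr_deriv (e t x v w)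

end Flow

end

end ConformalRicci

end

open ConformalRicci in
theorem mainTheorem4 (n : ℕ) (hn : 3 ≤ n) (M : Type*) [TopologicalSpace M] [T2Space M]
    [CompactSpace M] [ConnectedSpace M] [ChartedSpace (EuclideanSpace ℝ (Fin n)) M]
    [IsManifold (𝓡 n) ∞ M] (T : EReal) (hT : 0 < T) (g : ℝ → ConformalRicci.Metric n M)
    (hg : IsSmoothMetricCurve T g) (hg0 : g 0 ∈ metricsNegOne n M) :
    (∀ t ∈ timeInterval T,
      IsEllipticOrderTwo n (conformalOp (g t)) ∧
      Set.BijOn (conformalOp (g t)) (smoothFunctions n M) (smoothFunctions n M)) ∧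
    (SolvesReducedFlow T g ↔
      SolvesConformalRicciFlow T g (fun t => conformalPressure (g t))) :=
  ⟨fun t _ => ⟨conformalOp_isElliptic (by omega) (g t), conformalOp_bijOn (by omega) (g t)⟩,
    solvesReducedFlow_iff (by omega) hT hg hg0⟩
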